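/- **Setting.** Let $\Omega\subset\mathbb R^3$ and $\mathcal S_0\Subset\Omega$ be bounded domains of class $C^{2+\kappa}$ ($\kappa>0$), $T>0$, $\gamma>\tfrac32$, $\beta\ge\max\{8,\gamma\}$, $\theta=\tfrac23\gamma-1$, $r=\max\{\beta+1,\tfrac{\beta+\theta}{\theta}\}$, and let $\delta\to0^+$ along a sequence. For a body $\mathcal S(t)$ with density $\rho$ write $\chi_{\mathcal S}(t,x)=\mathbf 1_{\mathcal S(t)}(x)$ and, for a velocity field $u$, $$P_{\mathcal S}u(t,x)=\frac1m\int_\Omega\rho\chi_{\mathcal S}u\,dy+\Big(J^{-1}\int_\Omega\rho\chi_{\mathcal S}\,(y-h)\times u\,dy\Big)\times(x-h),$$ $m=\int\rho\chi_{\mathcal S}$, $h=\frac1m\int\rho\chi_{\mathcal S}\,x$, $J=\int\rho\chi_{\mathcal S}\big[|x-h|^2\mathbb I-(x-h)\otimes(x-h)\big]$ (the projection onto rigid fields). Let $(\mathcal S^\delta,\rho^\delta,u^\delta)$ be such that: $\mathcal S^\delta(t)\Subset\Omega$ is a bounded $C^{2+\kappa}$ domain for every $t\in[0,T]$, with $\chi^\delta_{\mathcal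 S}:=\chi_{\mathcal S^\delta}\in C([0,T];L^p)$ for $p<\infty$; $\rho^\delta\ge0$; $u^\delta\in L^2((0,T)\times\Omega)$; and, with $P^\delta_{\mathcal S}u^\delta$ the rigid field formed with $\mathcal S^\delta$ and $\rho^\delta$, $$\partial_t\chi^\delta_{\mathcal S}+\operatorname{div}(\chi^\delta_{\mathcal S}P^\delta_{\mathcal S}u^\delta)=0,\qquad \partial_t(\rho^\delta\chi^\delta_{\mathcal S})+\operatorname{div}(\rho^\delta\chi^\delta_{\mathcal S}P^\delta_{\mathcal S}u^\delta)=0$$ weakly in $(0,T)\times\mathbb R^3$, with initial values $\mathbf 1_{\mathcal S_0}$ and $\rho^\delta_0\mathbf 1_{\mathcal S_0}$, where $\rho_0^\delta\mathbf 1_{\mathcal S_0}\in L^\infty$ and $\rho^\delta_0>0$ a.e. in $\mathcal S_0$. Assume that $u^\delta$ is bounded in $L^2((0,T)\times\Omega)$ and $\rho^\delta\chi^\delta_{\mathcal S}$ in $L^\infty$, and that, along the sequence, $u^\delta\rightharpoonup u$ weakly in $L^2((0,T)\times\Omega)$, $\rho^\delta\rightharpoonup\rho$ weakly in $L^{\gamma+\theta}((0,T)\times\Omega)$,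 $\rho_0^\delta\to\rho_0$ in $L^\gamma(\Omega)$ with $\rho_0>0$ a.e. in $\mathcal S_0$, and $\chi^\delta_{\mathcal S}\rightharpoonup\chi_{\mathcal S}$ weakly-$*$ in $L^\infty((0,T)\times\mathbb R^3)$, where $\mathcal S(t)\Subset\Omega$, $t\in[0,T]$, are bounded $C^{2+\kappa}$ domains with $\chi_{\mathcal S}\in C([0,T];L^p)$ for $p<\infty$. $P_{\mathcal S}u$ is formed with $\mathcal S$ and $\rho$. Let $V_T$ be the set of $\phi\in C([0,T];L^2(\Omega))$ for which there are $\phi_{\mathcal F}\in\mathcal D([0,T);\mathcal D(\overline\Omega))$ and $\phi_{\mathcal S}\in\mathcal D([0,T);\mathcal R)$, $\mathcal R$ the rigid fields $x\mapsto a+b\times x$, with $\phi=\phi_{\mathcal F}$ on $\Omega\setminus\overline{\mathcal S(t)}$, $\phi=\phi_{\mathcal S}$ on $\mathcal S(t)$, $\phi_{\mathcal F}\cdot\nu=\phi_{\mathcal S}\cdot\nu$ on $\partial\mathcal S(t)$ and $\phi_{\mathcal F}\cdot\nu=0$ on $\partial\Omega$ for all $t\in[0,T]$ ($\nu$ the unit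 normal). **Proposition.** Let $\phi\in V_T$, with parts $\phi_{\mathcal F},\phi_{\mathcal S}$, and let $\vartheta>0$. Then there is a sequence $\phi^\delta\in H^1(0,T;L^2(\Omega))\cap L^r(0,T;W^{1,r}(\Omega))$ of the form $$\phi^\delta=(1-\chi^\delta_{\mathcal S})\phi_{\mathcal F}+\chi^\delta_{\mathcal S}\phi^\delta_{\mathcal S},$$ with $\phi^\delta(t,\cdot)$ continuous on $\Omega$ for each $t\in(0,T)$, such that for all $p\in[1,\infty)$, as $\delta\to0$: 1. $\|\chi^\delta_{\mathcal S}(\phi^\delta_{\mathcal S}-\phi_{\mathcal S})\|_{L^p((0,T)\times\Omega)}=O(\delta^{\vartheta/p})$; 2. $\phi^\delta\to\phi$ strongly in $L^p((0,T)\times\Omega)$; 3. $\|\phi^\delta\|_{L^p(0,T;W^{1,p}(\Omega))}=O(\delta^{-\vartheta(1-1/p)})$; 4. $\|\chi^\delta_{\mathcal S}(\partial_t+P^\delta_{\mathcal S}u^\delta\cdot\nabla)(\phi^\delta-\phi_{\mathcal S})\|_{L^2(0,T;L^p(\Omega))}=O(\delta^{\vartheta/p})$; 5. the distribution $(\partial_t+P_{\mathcal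 S}u\cdot\nabla)\phi$ belongs to $L^2(0,T;L^p(\Omega))$, and $(\partial_t+P^\delta_{\mathcal S}u^\delta\cdot\nabla)\phi^\delta\rightharpoonup(\partial_t+P_{\mathcal S}u\cdot\nabla)\phi$ weakly in $L^2(0,T;L^p(\Omega))$. The functions $\phi^\delta$ do not depend on $p$; the constants in $O(\cdot)$ may. -/

import Mathlib

open MeasureTheory Filter Set
open scoped ENNReal NNReal Topology ContDiff

noncomputable section

namespace SlipBody

/-- Physical space. -/
abbrev E3 := EuclideanSpace ℝ (Fin 3)

/-- The vector product of `ℝ³`. -/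
def cross (a b : E3) : E3 := WithLp.toLp 2 (crossProduct (WithLp.ofLp a) (WithLp.ofLp b))

/-! ### Regular domains and normals -/

/-- `ψ` is a `C^{2,κ}` function near `x` with non-vanishing gradient at `x`, and near `x` the set
`U` is the sublevel set `{ψ < 0}`. -/
def IsLocalDefiningFunction (κ : ℝ≥0) (U : Set E3) (x : E3) (ψ : E3 → ℝ) : Prop :=
  ∃ V : Set E3, IsOpen V ∧ x ∈ V ∧ ContDiffOn ℝ 2 ψ V ∧
    (∃ C : ℝ≥0, HolderOnWith C κ (iteratedFDeriv ℝ 2 ψ) V) ∧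
    gradient ψ x ≠ 0 ∧ U ∩ V = {y ∈ V | ψ y < 0}

/-- A bounded domain of class `C^{2+κ}` for some `κ > 0`. -/
def IsRegularDomain (U : Set E3) : Prop :=
  IsOpen U ∧ IsConnected U ∧ Bornology.IsBounded U ∧
    ∃ κ : ℝ≥0, 0 < κ ∧ ∀ x ∈ frontier U, ∃ ψ, IsLocalDefiningFunction κ U x ψ

/-- `ν` is one of the two unit normals to `∂U` at `x`. (All the conditions below in which normals
occur are unchanged if `ν` is replaced by `-ν`.) -/
def IsUnitNormal (U : Set E3) (x ν : E3) : Prop :=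
  ‖ν‖ = 1 ∧ ∃ κ : ℝ≥0, 0 < κ ∧ ∃ ψ, IsLocalDefiningFunction κ U x ψ ∧
    ∃ c : ℝ, ν = c • gradient ψ x

/-! ### The projection onto rigid velocity fields -/

/-- Total mass of the body `S` with density `ρ`. -/
def mass (S : Set E3) (ρ : E3 → ℝ) : ℝ := ∫ x in S, ρ x

/-- Centre of mass. -/
def center (S : Set E3) (ρ : E3 → ℝ) : E3 := (mass S ρ)⁻¹ • ∫ x in S, ρ x • x

/-- Inertia matrix `∫_S ρ (|x - h|² I - (x - h) ⊗ (x - h)) dx`. -/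
def inertia (S : Set E3) (ρ : E3 → ℝ) : Matrix (Fin 3) (Fin 3) ℝ :=
  Matrix.of fun i j => ∫ x in S, ρ x *
    (‖x - center S ρ‖ ^ 2 * (1 : Matrix (Fin 3) (Fin 3) ℝ) i j
      - (x - center S ρ) i * (x - center S ρ) j)

/-- Angular velocity `J⁻¹ ∫_S ρ (y - h) × u dy`. -/
def angularVelocity (S : Set E3) (ρ : E3 → ℝ) (u : E3 → E3) : E3 :=
  WithLp.toLp 2 (Matrix.mulVec (inertia S ρ)⁻¹
    (WithLp.ofLp (∫ y in S, ρ y • cross (y - center S ρ) (u y))))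

/-- The rigid field `m⁻¹ ∫_S ρ u + (J⁻¹ ∫_S ρ (y - h) × u dy) × (x - h)`. -/
def rigidProjection (S : Set E3) (ρ : E3 → ℝ) (u : E3 → E3) (x : E3) : E3 :=
  (mass S ρ)⁻¹ • (∫ y in S, ρ y • u y) + cross (angularVelocity S ρ u) (x - center S ρ)

/-- The field `P_S u (t, x)` for a moving body; here and below, points of `ℝ × E3` are `(t, x)`. -/
def solidVelocity (S : ℝ → Set E3) (ρ : ℝ × E3 → ℝ) (u : ℝ × E3 → E3) (z : ℝ × E3) : E3 :=
  rigidProjection (S z.1) (fun y => ρ (z.1, y)) (fun y => u (z.1, y)) z.2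

/-! ### Space-time sets, weak derivatives, norms, convergence -/

/-- Lebesgue measure on `(0, T) × Ω`. -/
def cyl (T : ℝ) (Ω : Set E3) : Measure (ℝ × E3) := volume.restrict (Ioo 0 T ×ˢ Ω)

/-- The space-time region swept by the moving body; its indicator function is `χ_S`. -/
def swept (S : ℝ → Set E3) : Set (ℝ × E3) := {z | z.2 ∈ S z.1}

/-- `(1 - χ_S) f + χ_S g`. -/
def glue (S : ℝ → Set E3) (f g : ℝ × E3 → E3) (z : ℝ × E3) : E3 :=
  (1 - (swept S).indicator (fun _ => (1 : ℝ)) z) • f z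
    + (swept S).indicator (fun _ => (1 : ℝ)) z • g z

/-- Test functions of class `C_c^∞((0, T) × Ω)`. -/
def IsTest (T : ℝ) (Ω : Set E3) (ψ : ℝ × E3 → ℝ) : Prop :=
  ContDiff ℝ ∞ ψ ∧ HasCompactSupport ψ ∧ tsupport ψ ⊆ Ioo 0 T ×ˢ Ω

/-- `D` is the weak space-time derivative of `f` on `(0, T) × Ω`: `D z (1, 0)` is the time
derivative and `D z (0, e)` the spatial derivative in the direction `e`. -/
def HasWeakFDeriv (T : ℝ) (Ω : Set E3) (f : ℝ × E3 → E3) (D : ℝ × E3 → (ℝ × E3 →L[ℝ] E3)) :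
    Prop :=
  LocallyIntegrableOn f (Ioo 0 T ×ˢ Ω) ∧ LocallyIntegrableOn D (Ioo 0 T ×ˢ Ω) ∧
    ∀ ψ, IsTest T Ω ψ → ∀ d : ℝ × E3,
      ∫ z, fderiv ℝ ψ z d • f z ∂cyl T Ω = - ∫ z, ψ z • D z d ∂cyl T Ω

/-- `(∂_t + v · ∇) f = g` in the sense of distributions on `(0, T) × Ω`, for a field `v` with
`div v = 0` (rigid fields are of this kind). -/
def HasWeakMaterialDeriv (T : ℝ) (Ω : Set E3) (v f g : ℝ × E3 → E3) : Prop :=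
  LocallyIntegrableOn f (Ioo 0 T ×ˢ Ω) ∧
    LocallyIntegrableOn (fun z => ‖v z‖ • f z) (Ioo 0 T ×ˢ Ω) ∧
    LocallyIntegrableOn g (Ioo 0 T ×ˢ Ω) ∧
    ∀ ψ, IsTest T Ω ψ →
      ∫ z, fderiv ℝ ψ z (1, v z) • f z ∂cyl T Ω = - ∫ z, ψ z • g z ∂cyl T Ω

/-- `∂_t f + div (v f) = 0` in `(0, T) × ℝ³`, `f(0) = f₀`, in the weak sense. -/
def IsWeakTransport (T : ℝ) (v : ℝ × E3 → E3) (f : ℝ × E3 → ℝ) (f₀ : E3 → ℝ) : Prop :=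
  Integrable f (cyl T univ) ∧ Integrable (fun z => f z • v z) (cyl T univ) ∧ Integrable f₀ ∧
    ∀ ψ : ℝ × E3 → ℝ, ContDiff ℝ ∞ ψ → HasCompactSupport ψ → tsupport ψ ⊆ Iio T ×ˢ univ →
      ∫ z, f z * fderiv ℝ ψ z (1, v z) ∂cyl T univ + ∫ x, f₀ x * ψ (0, x) = 0

/-- The space `H¹(0, T; L²(Ω)) ∩ Lʳ(0, T; W^{1,r}(Ω))`, for a function `f` with weak space-time
derivative `D`. -/
def MemH1L2W1r (T : ℝ) (Ω : Set E3) (r : ℝ≥0∞) (f : ℝ × E3 → E3)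
    (D : ℝ × E3 → (ℝ × E3 →L[ℝ] E3)) : Prop :=
  HasWeakFDeriv T Ω f D ∧
    MemLp f 2 (cyl T Ω) ∧ MemLp (fun z => D z (1, 0)) 2 (cyl T Ω) ∧
    MemLp f r (cyl T Ω) ∧
    MemLp (fun z => (D z).comp (ContinuousLinearMap.inr ℝ ℝ E3)) r (cyl T Ω)

/-- The norm of `Lᵖ(0, T; W^{1,p}(Ω))`, for a function `f` with weak space-time derivative `D`. -/
def normLpW1p (T : ℝ) (Ω : Set E3) (p : ℝ≥0∞) (f : ℝ × E3 → E3)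
    (D : ℝ × E3 → (ℝ × E3 →L[ℝ] E3)) : ℝ≥0∞ :=
  eLpNorm f p (cyl T Ω) +
    eLpNorm (fun z => (D z).comp (ContinuousLinearMap.inr ℝ ℝ E3)) p (cyl T Ω)

/-- The norm of `L²(0, T; Lᵖ(Ω))`. -/
def normL2Lp (T : ℝ) (Ω : Set E3) (p : ℝ≥0∞) (f : ℝ × E3 → E3) : ℝ≥0∞ :=
  (∫⁻ t in Ioo 0 T, eLpNorm (fun x => f (t, x)) p (volume.restrict Ω) ^ 2) ^ (1 / 2 : ℝ)

/-- Membership in `L²(0, T; Lᵖ(Ω))`. -/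
def MemL2Lp (T : ℝ) (Ω : Set E3) (p : ℝ≥0∞) (f : ℝ × E3 → E3) : Prop :=
  AEStronglyMeasurable f (cyl T Ω) ∧ normL2Lp T Ω p f < ⊤

/-- Weak convergence in `L²(0, T; Lᵖ(Ω))`, `1 ≤ p < ∞`, tested with the dual
`L²(0, T; L^{p'}(Ω))`. -/
def WeakTendstoL2Lp (T : ℝ) (Ω : Set E3) (p : ℝ≥0∞) (f : ℕ → ℝ × E3 → E3) (f' : ℝ × E3 → E3) :
    Prop :=
  (∀ n, MemL2Lp T Ω p (f n)) ∧ MemL2Lp T Ω p f' ∧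
    ∀ g, MemL2Lp T Ω (ENNReal.conjExponent p) g →
      Tendsto (fun n => ∫ z, inner ℝ (f n z) (g z) ∂cyl T Ω) atTop
        (𝓝 (∫ z, inner ℝ (f' z) (g z) ∂cyl T Ω))

/-- Weak convergence in `Lᵖ(μ)`, `1 ≤ p < ∞`, tested with the dual `L^{p'}(μ)`. -/
def WeakTendstoLp {F : Type*} [NormedAddCommGroup F] [InnerProductSpace ℝ F]
    (μ : Measure (ℝ × E3)) (p : ℝ≥0∞) (f : ℕ → ℝ × E3 → F) (f' : ℝ × E3 → F) : Prop :=
  (∀ n, MemLp (f n) p μ) ∧ MemLp f' p μ ∧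
    ∀ g : ℝ × E3 → F, MemLp g (ENNReal.conjExponent p) μ →
      Tendsto (fun n => ∫ z, inner ℝ (f n z) (g z) ∂μ) atTop (𝓝 (∫ z, inner ℝ (f' z) (g z) ∂μ))

/-! ### Moving bodies -/

/-- A moving body inside `Ω`: regular domains `S(t) ⋐ Ω` for `t ∈ [0, T]` such that `χ_S` is
measurable and belongs to `C([0, T]; Lᵖ)` for `p < ∞` (note `‖1_A - 1_B‖_p^p = |A ∆ B|`). -/
structure IsMovingBody (T : ℝ) (Ω : Set E3) (S : ℝ → Set E3) : Prop where
  regular : ∀ t ∈ Icc 0 T, IsRegularDomain (S t)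
  inside : ∀ t ∈ Icc 0 T, closure (S t) ⊆ Ω
  measurable : NullMeasurableSet (swept S) (cyl T univ)
  continuous : ∀ t ∈ Icc 0 T,
    Tendsto (fun s => volume (symmDiff (S s) (S t))) (𝓝[Icc 0 T] t) (𝓝 0)

/-- The part of the approximate problem that concerns the body: the body `S`, the density `ρ` and
the velocity `u` are such that both `χ_S` and `ρ χ_S` are transported, in the weak sense, by the
rigid field `P_S u`, starting from `1_{S₀}` and `ρ₀ 1_{S₀}`. -/
structure IsTransportedBody (T : ℝ) (Ω S₀ : Set E3) (S : ℝ → Set E3) (ρ : ℝ × E3 → ℝ)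
    (u : ℝ × E3 → E3) (ρ₀ : E3 → ℝ) : Prop where
  body : IsMovingBody T Ω S
  density_measurable : AEStronglyMeasurable ρ (cyl T Ω)
  density_nonneg : ∀ᵐ z ∂cyl T Ω, 0 ≤ ρ z
  velocity : MemLp u 2 (cyl T Ω)
  initial_pos : ∀ᵐ x ∂volume.restrict S₀, 0 < ρ₀ x
  initial_bdd : MemLp ρ₀ ⊤ (volume.restrict S₀)
  transport_body : IsWeakTransport T (solidVelocity S ρ u)
    ((swept S).indicator fun _ => 1) (S₀.indicator fun _ => 1)
  transport_density : IsWeakTransport T (solidVelocity S ρ u)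
    ((swept S).indicator ρ) (S₀.indicator ρ₀)

/-- Transported bodies `(Sₙ, ρₙ, uₙ)` (the approximate solutions along a sequence `δₙ → 0`),
bounded as the approximate solutions are, and with limits `(S, ρ, u)`. -/
structure IsApproximation (T : ℝ) (Ω S₀ : Set E3) (γ : ℝ)
    (S : ℕ → ℝ → Set E3) (ρ : ℕ → ℝ × E3 → ℝ) (u : ℕ → ℝ × E3 → E3) (ρ₀ : ℕ → E3 → ℝ)
    (S' : ℝ → Set E3) (ρ' : ℝ × E3 → ℝ) (u' : ℝ × E3 → E3) (ρ₀' : E3 → ℝ) : Prop where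
  transported : ∀ n, IsTransportedBody T Ω S₀ (S n) (ρ n) (u n) (ρ₀ n)
  velocity_bdd : ∃ C : ℝ≥0, ∀ n, eLpNorm (u n) 2 (cyl T Ω) ≤ C
  density_bdd : ∃ M : ℝ, ∀ n, ∀ᵐ z ∂cyl T Ω, z ∈ swept (S n) → ρ n z ≤ M
  velocity_tendsto : WeakTendstoLp (cyl T Ω) 2 u u'
  density_tendsto : WeakTendstoLp (cyl T Ω) (ENNReal.ofReal (γ + (2 / 3 * γ - 1))) ρ ρ'
  initial_mem : ∀ n, MemLp (ρ₀ n) (ENNReal.ofReal γ) (volume.restrict Ω)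
  initial_mem_lim : MemLp ρ₀' (ENNReal.ofReal γ) (volume.restrict Ω)
  initial_tendsto :
    Tendsto (fun n => eLpNorm (ρ₀ n - ρ₀') (ENNReal.ofReal γ) (volume.restrict Ω)) atTop (𝓝 0)
  initial_pos_lim : ∀ᵐ x ∂volume.restrict S₀, 0 < ρ₀' x
  body_lim : IsMovingBody T Ω S'
  /-- Weak-* convergence of `χ_{Sₙ}` to `χ_{S'}` in `L^∞((0, T) × ℝ³)`. -/
  body_tendsto : ∀ g : ℝ × E3 → ℝ, Integrable g (cyl T univ) →
    Tendsto (fun n => ∫ z, (swept (S n)).indicator g z ∂cyl T univ) atTop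
      (𝓝 (∫ z, (swept S').indicator g z ∂cyl T univ))

/-! ### Test functions that may jump tangentially at the interface -/

/-- `φF ∈ 𝒟([0, T); 𝒟(closure Ω))`, given by a function of class `C_c^∞((-∞, T) × ℝ³)`. -/
def IsFluidTest (T : ℝ) (φF : ℝ × E3 → E3) : Prop :=
  ContDiff ℝ ∞ φF ∧ HasCompactSupport φF ∧ tsupport φF ⊆ Iio T ×ˢ univ

/-- `φS ∈ 𝒟([0, T); ℛ)`, with `ℛ` the rigid fields `x ↦ a + b × x`. -/
def IsSolidTest (T : ℝ) (φS : ℝ × E3 → E3) : Prop :=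
  ∃ a b : ℝ → E3, ContDiff ℝ ∞ a ∧ ContDiff ℝ ∞ b ∧ HasCompactSupport a ∧ HasCompactSupport b ∧
    tsupport a ⊆ Iio T ∧ tsupport b ⊆ Iio T ∧ ∀ t x, φS (t, x) = a t + cross (b t) x

/-- `φ` belongs to `V_T`, with fluid part `φF` and solid part `φS`. -/
structure IsSlipTest (T : ℝ) (Ω : Set E3) (S : ℝ → Set E3) (φ φF φS : ℝ × E3 → E3) : Prop where
  memLp : ∀ t ∈ Icc 0 T, MemLp (fun x => φ (t, x)) 2 (volume.restrict Ω)
  continuous : ∀ t ∈ Icc 0 T,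
    Tendsto (fun s => eLpNorm (fun x => φ (s, x) - φ (t, x)) 2 (volume.restrict Ω))
      (𝓝[Icc 0 T] t) (𝓝 0)
  fluid : IsFluidTest T φF
  solid : IsSolidTest T φS
  eq_fluid : ∀ t ∈ Icc 0 T, ∀ x ∈ Ω \ closure (S t), φ (t, x) = φF (t, x)
  eq_solid : ∀ t ∈ Icc 0 T, ∀ x ∈ S t, φ (t, x) = φS (t, x)
  normal_interface : ∀ t ∈ Icc 0 T, ∀ x ∈ frontier (S t), ∀ ν, IsUnitNormal (S t) x ν →
    inner ℝ (φF (t, x)) ν = inner ℝ (φS (t, x)) ν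
  normal_boundary : ∀ t ∈ Icc 0 T, ∀ x ∈ frontier Ω, ∀ ν, IsUnitNormal Ω x ν →
    inner ℝ (φF (t, x)) ν = 0

end SlipBody

end

open SlipBody

noncomputable section

namespace SlipBody

/-! ### The vector product -/

/-! The bodies move rigidly, so everything is pulled back to the fixed domain `S₀`. The rigid field
`a(t) + om(t) × x` of a body has coefficients in `L²(0, T)`; the linear equations for its backward
flow `Y(t)` have an absolutely continuous solution with values in the affine isometries
(`exists_rigidFlow`). Testing the transport equations with functions of `Y(t) x` shows that `χ` and
`ρ χ` are constant along the flow (`IsWeakTransport.ae_eq_comp_flow`), and the regularity of the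
domains turns this into `S(t) = Y(t)⁻¹(S₀)` at every time (`IsMovingBody.eq_preimage`).

On `S₀` one takes a cut-off `ζ` that is `1` off `S₀`, has gradient at most `1/ε` and, inside `S₀`,
is nonzero only on a layer of measure `O(ε)`, where `ε = δ^ϑ` (`IsRegularDomain.exists_cutoff`). The
new solid part is `φS + ζ(Y x) (φF - φS)` (`interp`). It equals `φF` off the body, so gluing
produces no jump. Items 1 and 3 come from the measure of the layer to the power `1/p`, multiplied by
`1/ε` for the gradient. Along the velocity `V` of the body itself `Y(t) x` is constant, so the
material derivative never differentiates `ζ`: it is a uniformly bounded operator applied to `(1, V)`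
(`interpDeriv_apply_velocity`). This gives item 4 without the factor `1/ε`, and the bounds for item
5.

For the limits, a density that is bounded above and whose mass is bounded below cannot concentrate
near an axis, so the inertia matrices are uniformly invertible (`IsDensity.exists_coercive`). Hence
the rigid velocities are controlled in `L²` by `u`, the flows are uniformly Hölder continuous with
exponent `1/2`, and by Arzelà–Ascoli a subsequence converges to a curve of isometries. This curve
carries the limit body; the initial densities composed with the flows converge in `L¹`, and weak
convergence of the densities identifies the limit as `ρ χ` (`IsApproximation.exists_subseq`). Almost
everywhere convergence of the densities makes the adjoint of `u ↦ V`, applied to a test field,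
converge strongly, so it can be paired with the weakly convergent `u` (`tendsto_integral_bodyVel`,
`tendsto_integral_clm`).

In the limit `χ` is transported by the limit rigid velocity. Since rigid fields are divergence free,
this yields the distributional material derivative of `φ` (`IsSlipTest.hasWeakMaterialDeriv`). None
of the limits depends on the subsequence, so the whole sequence converges. -/

lemma cross_coord_zero (a b : E3) : cross a b 0 = a 1 * b 2 - a 2 * b 1 := by
  simp [cross, cross_apply]

lemma cross_coord_one (a b : E3) : cross a b 1 = a 2 * b 0 - a 0 * b 2 := by
  simp [cross, cross_apply]

lemma cross_coord_two (a b : E3) : cross a b 2 = a 0 * b 1 - a 1 * b 0 := by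
  simp [cross, cross_apply]

lemma inner_eq_sum_three (a b : E3) : inner ℝ a b = a 0 * b 0 + a 1 * b 1 + a 2 * b 2 := by
  rw [PiLp.inner_apply, Fin.sum_univ_three]
  simp [mul_comm]

lemma norm_sq_eq_three (a : E3) : ‖a‖ ^ 2 = a 0 ^ 2 + a 1 ^ 2 + a 2 ^ 2 := by
  rw [← real_inner_self_eq_norm_sq, inner_eq_sum_three]; ring

lemma norm_cross_sq (a b : E3) : ‖cross a b‖ ^ 2 = ‖a‖ ^ 2 * ‖b‖ ^ 2 - inner ℝ a b ^ 2 := by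
  simp only [norm_sq_eq_three, inner_eq_sum_three, cross_coord_zero, cross_coord_one,
    cross_coord_two]
  ring

lemma norm_cross_le (a b : E3) : ‖cross a b‖ ≤ ‖a‖ * ‖b‖ := by
  refine abs_le_of_sq_le_sq' ?_ (by positivity) |>.2
  rw [norm_cross_sq, mul_pow]
  nlinarith [sq_nonneg (inner ℝ a b)]

/-- The vector product as a continuous bilinear map. -/
def crossL : E3 →L[ℝ] E3 →L[ℝ] E3 :=
  LinearMap.mkContinuous₂
    (LinearMap.mk₂ ℝ cross (fun a b c => by simp [cross]) (fun c a b => by simp [cross])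
      (fun a b c => by simp [cross]) (fun c a b => by simp [cross])) 1
    (fun a b => by rw [one_mul]; exact norm_cross_le a b)

@[simp] lemma crossL_apply (a b : E3) : crossL a b = cross a b := rfl

lemma norm_crossL_apply_le (a : E3) : ‖crossL a‖ ≤ ‖a‖ :=
  (crossL a).opNorm_le_bound (norm_nonneg _) fun b => norm_cross_le a b

lemma inner_cross_self (a b : E3) : inner ℝ (cross a b) b = 0 := by
  simp only [inner_eq_sum_three, cross_coord_zero, cross_coord_one, cross_coord_two]; ring

lemma inner_cross_left (a b c : E3) : inner ℝ (cross a b) c = inner ℝ a (cross b c) := by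
  simp only [inner_eq_sum_three, cross_coord_zero, cross_coord_one, cross_coord_two]; ring

lemma inner_cross_right (a b c : E3) : inner ℝ (cross a b) c = inner ℝ b (cross c a) := by
  simp only [inner_eq_sum_three, cross_coord_zero, cross_coord_one, cross_coord_two]; ring

@[fun_prop]
lemma continuous_cross {α : Type*} [TopologicalSpace α] {f g : α → E3} (hf : Continuous f)
    (hg : Continuous g) : Continuous fun x => cross (f x) (g x) :=
  crossL.continuous₂.comp (hf.prodMk hg)

/-- For a unit vector `e` there is a unit vector `f` with `|⟪f, z⟫| ≤ ‖e × z‖`. -/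
lemma exists_unit_inner_le_norm_cross (e : E3) (he : ‖e‖ = 1) :
    ∃ f : E3, ‖f‖ = 1 ∧ ∀ z, |inner ℝ f z| ≤ ‖cross e z‖ := by
  -- If the products of `e` with the first two basis vectors both vanished, all coordinates of `e`
  -- would vanish. The wanted `f` is then any unit vector orthogonal to `e`.
  obtain ⟨g, hg⟩ : ∃ g : E3, cross g e ≠ 0 := by
    by_contra! h
    have h0 := h (EuclideanSpace.single 0 1)
    have h1 := h (EuclideanSpace.single 1 1)
    have a2 : cross (EuclideanSpace.single 0 1) e 1 = 0 := by rw [h0]; rfl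
    have a1 : cross (EuclideanSpace.single 0 1) e 2 = 0 := by rw [h0]; rfl
    have a0 : cross (EuclideanSpace.single 1 1) e 2 = 0 := by rw [h1]; rfl
    rw [cross_coord_one] at a2
    rw [cross_coord_two] at a1 a0
    simp at a0 a1 a2
    have := norm_sq_eq_three e
    rw [he, a0, a1, a2] at this
    norm_num at this
  refine ⟨‖cross g e‖⁻¹ • cross g e, ?_, fun z => ?_⟩
  · rw [norm_smul, norm_inv, norm_norm, inv_mul_cancel₀ (norm_ne_zero_iff.2 hg)]
  · set f := ‖cross g e‖⁻¹ • cross g e with hf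
    have hn : ‖f‖ = 1 := by
      rw [hf, norm_smul, norm_inv, norm_norm, inv_mul_cancel₀ (norm_ne_zero_iff.2 hg)]
    have hfe : inner ℝ f e = 0 := by
      rw [hf, real_inner_smul_left, inner_cross_self, mul_zero]
    -- Binet–Cauchy: `(f × e) · (z × e) = (f · z)|e|² - (f · e)(e · z)`, and the last term vanishes.
    have hd : inner ℝ f z = inner ℝ (cross f e) (cross z e) := by
      have : inner ℝ (cross f e) (cross z e) = inner ℝ f z * ‖e‖ ^ 2 - inner ℝ f e * inner ℝ e z := by
        simp only [norm_sq_eq_three, inner_eq_sum_three, cross_coord_zero, cross_coord_one,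
          cross_coord_two]
        ring
      rw [this, hfe, he]; ring
    rw [hd]
    refine (abs_real_inner_le_norm _ _).trans ?_
    have h1 : ‖cross f e‖ ≤ 1 := by simpa [hn, he] using norm_cross_le f e
    have h2 : ‖cross z e‖ = ‖cross e z‖ := by
      have := norm_cross_sq z e
      rw [real_inner_comm, mul_comm, ← norm_cross_sq e z] at this
      exact (sq_eq_sq₀ (norm_nonneg _) (norm_nonneg _)).1 this
    rw [h2]
    exact mul_le_of_le_one_left (norm_nonneg _) h1

/-! ### Sets with many disjoint translates -/

/-- A subset of a ball of radius `R` whose translates by multiples of `s • e` are disjoint has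
measure `O(s)`. -/
lemma volume_le_of_disjoint_translates {A : Set E3} (hA : MeasurableSet A) {c e : E3} {R s : ℝ}
    (hR : 0 < R) (hs : 0 < s) (hAR : A ⊆ Metric.ball c R) (he : ‖e‖ ≤ 1)
    (hdisj : ∀ x ∈ A, ∀ k : ℕ, 0 < k → k * s ≤ R → x + ((k : ℝ) * s) • e ∉ A) :
    volume A ≤ ENNReal.ofReal (s / R) * volume (Metric.ball c (2 * R)) := by
  -- The translates with index `0, …, N` are disjoint and stay in the ball of radius `2R`, because
  -- `N s ≤ R`. Since `(N + 1) s > R`, there are more than `R / s` of them.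
  set N : ℕ := ⌊R / s⌋₊ with hN
  have hNs : N * s ≤ R := by
    have := Nat.floor_le (div_nonneg hR.le hs.le)
    rwa [le_div_iff₀ hs] at this
  have hNs' : R < (N + 1 : ℝ) * s := by
    have := Nat.lt_floor_add_one (R / s)
    rwa [div_lt_iff₀ hs] at this
  let B : ℕ → Set E3 := fun k => (fun x => x + (-(((k : ℝ) * s) • e))) ⁻¹' A
  have hBm : ∀ k, MeasurableSet (B k) := fun k => (measurable_add_const _) hA
  have hBv : ∀ k, volume (B k) = volume A := fun k => measure_preimage_add_right _ _ _
  have hBd : (Finset.range (N + 1) : Set ℕ).PairwiseDisjoint B := by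
    have key : ∀ i j : ℕ, i < j → j < N + 1 → Disjoint (B i) (B j) := by
      intro i j hij hj
      rw [Set.disjoint_left]
      intro x hi hj'
      simp only [B, mem_preimage] at hi hj'
      refine hdisj _ hj' (j - i) (by omega) ?_ ?_
      · rw [Nat.cast_sub hij.le]
        have : ((j : ℝ) - i) ≤ N := by
          have : (j : ℝ) ≤ N := by exact_mod_cast Nat.lt_succ_iff.1 hj
          have := Nat.cast_nonneg (α := ℝ) i
          linarith
        nlinarith
      · convert hi using 1
        rw [Nat.cast_sub hij.le]
        module
    intro i hi j hj hne
    simp only [Finset.coe_range, mem_Iio] at hi hj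
    rcases lt_or_gt_of_ne hne with h | h
    · exact key i j h hj
    · exact (key j i h hi).symm
  have hsub : (⋃ k ∈ Finset.range (N + 1), B k) ⊆ Metric.ball c (2 * R) := by
    intro x hx
    simp only [Finset.mem_range, mem_iUnion, exists_prop] at hx
    obtain ⟨k, hk, hx⟩ := hx
    have h1 := hAR hx
    rw [Metric.mem_ball, dist_eq_norm] at h1 ⊢
    have h2 : ‖((k : ℝ) * s) • e‖ ≤ R := by
      rw [norm_smul, Real.norm_of_nonneg (by positivity)]
      have : (k : ℝ) ≤ N := by exact_mod_cast Nat.lt_succ_iff.1 hk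
      calc (k : ℝ) * s * ‖e‖ ≤ k * s * 1 := by gcongr
        _ ≤ N * s := by rw [mul_one]; gcongr
        _ ≤ R := hNs
    calc ‖x - c‖ = ‖(x + -(((k : ℝ) * s) • e) - c) + ((k : ℝ) * s) • e‖ := by congr 1; abel
      _ ≤ _ := norm_add_le _ _
      _ < 2 * R := by linarith
  have hsum := measure_biUnion_finset (μ := volume) hBd fun k _ => hBm k
  simp only [hBv, Finset.sum_const, Finset.card_range, nsmul_eq_mul] at hsum
  have hle := hsum.symm.le.trans (measure_mono hsub)
  have hfin : (1 : ℝ≥0∞) ≤ ENNReal.ofReal (s / R) * ((N + 1 : ℕ) : ℝ≥0∞) := by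
    rw [← ENNReal.ofReal_natCast, ← ENNReal.ofReal_mul (by positivity), ← ENNReal.ofReal_one]
    apply ENNReal.ofReal_le_ofReal
    push_cast
    rw [div_mul_eq_mul_div, le_div_iff₀ hR]
    linarith
  calc volume A = 1 * volume A := (one_mul _).symm
    _ ≤ ENNReal.ofReal (s / R) * ((N + 1 : ℕ) : ℝ≥0∞) * volume A := by gcongr
    _ = ENNReal.ofReal (s / R) * (((N + 1 : ℕ) : ℝ≥0∞) * volume A) := mul_assoc _ _ _
    _ ≤ _ := by gcongr

/-- The part of a ball in a slab of width `O(ε)` has measure `O(ε)`. -/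
lemma volume_slab_le {f : E3} (hf : ‖f‖ = 1) (c : E3) (a : ℝ) {R ε : ℝ} (hR : 0 < R) (hε : 0 < ε) :
    volume (Metric.ball c R ∩ {x | |inner ℝ f x - a| < ε})
      ≤ ENNReal.ofReal (2 * ε / R) * volume (Metric.ball c (2 * R)) := by
  -- The shift is `2ε`, the width of the slab: every positive multiple of it along `f` leaves the
  -- slab.
  refine volume_le_of_disjoint_translates (e := f) ?_ hR (by positivity) inter_subset_left hf.le ?_
  · refine measurableSet_ball.inter (IsOpen.measurableSet ?_)
    exact isOpen_lt (by fun_prop) continuous_const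
  · rintro x ⟨-, hx⟩ k hk - ⟨-, hx'⟩
    simp only [mem_ofPred_eq, abs_lt, inner_add_right, real_inner_smul_right,
      real_inner_self_eq_norm_sq, hf] at hx hx'
    have : (1 : ℝ) ≤ k := by exact_mod_cast hk
    nlinarith

/-! ### Geometry of regular domains -/

/-- Near a boundary point, a regular domain is the sublevel set of a Lipschitz function which
increases at a definite rate in a fixed direction. -/
lemma IsRegularDomain.exists_chart {U : Set E3} (hU : IsRegularDomain U) {x₀ : E3}
    (hx₀ : x₀ ∈ frontier U) :
    ∃ (ψ : E3 → ℝ) (e : E3) (r c L : ℝ), 0 < r ∧ ‖e‖ = 1 ∧ 0 < c ∧ 0 < L ∧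
      (∀ x ∈ Metric.ball x₀ r, (x ∈ U ↔ ψ x < 0)) ∧
      (∀ x ∈ Metric.ball x₀ r, ∀ y ∈ Metric.ball x₀ r, |ψ x - ψ y| ≤ L * ‖x - y‖) ∧
      ∀ x ∈ Metric.ball x₀ r, ∀ s : ℝ, 0 ≤ s → x + s • e ∈ Metric.ball x₀ r →
        ψ x + c * s ≤ ψ (x + s • e) := by
  obtain ⟨-, -, -, κ, -, h⟩ := hU
  obtain ⟨ψ, V, hVo, hxV, hψ, -, hg, hUV⟩ := h x₀ hx₀
  set g := gradient ψ x₀ with hgdef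
  have hgn : 0 < ‖g‖ := norm_pos_iff.2 hg
  have hstrict : HasStrictFDerivAt ψ (fderiv ℝ ψ x₀) x₀ :=
    (hψ.contDiffAt (hVo.mem_nhds hxV)).hasStrictFDerivAt (by norm_num)
  have hginner : ∀ v, fderiv ℝ ψ x₀ v = inner ℝ g v := by
    intro v
    rw [hgdef, gradient, InnerProductSpace.toDual_symm_apply]
  -- Strict differentiability with relative error `‖g‖ / 2` gives both constants at once: Lipschitz
  -- constant `3‖g‖ / 2`, and slope at least `‖g‖ / 2` in the direction of the gradient.
  have hlo := hstrict.isLittleO.def (half_pos hgn)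
  rw [Metric.eventually_nhds_iff] at hlo
  obtain ⟨r₁, hr₁, hlo⟩ := hlo
  obtain ⟨r₂, hr₂, hV⟩ := Metric.isOpen_iff.1 hVo x₀ hxV
  have key : ∀ x ∈ Metric.ball x₀ (min r₁ r₂), ∀ y ∈ Metric.ball x₀ (min r₁ r₂),
      |ψ x - ψ y - inner ℝ g (x - y)| ≤ ‖g‖ / 2 * ‖x - y‖ := by
    intro x hx y hy
    have := @hlo (x, y) (by
      rw [Prod.dist_eq]
      exact max_lt ((Metric.mem_ball.1 hx).trans_le (min_le_left _ _))
        ((Metric.mem_ball.1 hy).trans_le (min_le_left _ _)))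
    simpa only [hginner, Real.norm_eq_abs] using this
  refine ⟨ψ, ‖g‖⁻¹ • g, min r₁ r₂, ‖g‖ / 2, ‖g‖ + ‖g‖ / 2, lt_min hr₁ hr₂, ?_, by positivity,
    by positivity, ?_, ?_, ?_⟩
  · rw [norm_smul, norm_inv, norm_norm, inv_mul_cancel₀ hgn.ne']
  · intro x hx
    have hxV' : x ∈ V := hV (Metric.ball_subset_ball (min_le_right _ _) hx)
    have := Set.ext_iff.1 hUV x
    simpa [hxV'] using this
  · intro x hx y hy
    have h1 := key x hx y hy
    have h2 := abs_real_inner_le_norm g (x - y)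
    rw [abs_le] at h1 h2 ⊢
    constructor <;> nlinarith
  · intro x hx s hs hxs
    have h1 := key _ hxs x hx
    rw [add_sub_cancel_left, norm_smul, norm_smul, norm_inv, norm_norm, inv_mul_cancel₀ hgn.ne',
      Real.norm_of_nonneg hs, real_inner_smul_right, real_inner_smul_right,
      real_inner_self_eq_norm_sq, abs_le] at h1
    have h3 : s * (‖g‖⁻¹ * ‖g‖ ^ 2) = s * ‖g‖ := by
      field_simp
    rw [h3] at h1
    linarith

/-- Locally, the collar of width `ε` of the boundary has measure `O(ε)`. -/
lemma IsRegularDomain.exists_ball_collar {U : Set E3} (hU : IsRegularDomain U) {x₀ : E3}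
    (hx₀ : x₀ ∈ frontier U) :
    ∃ r : ℝ, 0 < r ∧ ∃ C : ℝ, 0 ≤ C ∧ ∀ ε : ℝ, 0 < ε →
      volume (Metric.ball x₀ r ∩ Metric.thickening ε (frontier U)) ≤ ENNReal.ofReal (C * ε) := by
  obtain ⟨ψ, e, r, c, L, hr, he, hc, hL, hψU, hψL, hψe⟩ := hU.exists_chart hx₀
  have hUo := hU.1
  set v := (volume (Metric.ball x₀ (2 * (r / 2)))).toReal with hv
  have hvt : volume (Metric.ball x₀ (2 * (r / 2))) ≠ ⊤ := measure_ball_lt_top.ne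
  -- On the frontier `ψ ≥ 0` since `U` is open, and `ψ ≤ 0` since points of `U` come arbitrarily
  -- close and `ψ` is Lipschitz.
  have hψF : ∀ z ∈ frontier U, z ∈ Metric.ball x₀ r → ψ z = 0 := by
    intro z hz hzb
    have hzU : z ∉ U := fun h => by
      rw [hUo.frontier_eq] at hz; exact hz.2 h
    have h0 : 0 ≤ ψ z := not_lt.1 fun h => hzU ((hψU z hzb).2 h)
    refine le_antisymm ?_ h0
    by_contra! hpos
    have hcl : z ∈ closure U := frontier_subset_closure hz
    obtain ⟨r', hr', hb⟩ := Metric.isOpen_iff.1 Metric.isOpen_ball z hzb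
    obtain ⟨y, hyU, hy⟩ := Metric.mem_closure_iff.1 hcl (min r' (ψ z / L))
      (lt_min hr' (div_pos hpos hL))
    have hyb : y ∈ Metric.ball x₀ r := hb (by
      rw [Metric.mem_ball, dist_comm]; exact hy.trans_le (min_le_left _ _))
    have h1 := hψL z hzb y hyb
    have h2 := (hψU y hyb).1 hyU
    rw [← dist_eq_norm] at h1
    have h3 : dist z y < ψ z / L := hy.trans_le (min_le_right _ _)
    rw [lt_div_iff₀ hL] at h3
    have := (abs_le.1 h1).2
    linarith
  have hsmall : ∀ ε : ℝ, ε ≤ r / 2 → ∀ x ∈ Metric.ball x₀ (r / 2) ∩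
      Metric.thickening ε (frontier U), |ψ x| ≤ L * ε := by
    rintro ε hε x ⟨hxb, hxt⟩
    obtain ⟨z, hz, hxz⟩ := Metric.mem_thickening_iff.1 hxt
    have hxb' : x ∈ Metric.ball x₀ r := Metric.ball_subset_ball (by linarith) hxb
    have hzb : z ∈ Metric.ball x₀ r := by
      rw [Metric.mem_ball] at hxb ⊢
      have := dist_triangle z x x₀
      rw [dist_comm z x] at this
      linarith
    have h1 := hψL x hxb' z hzb
    rw [hψF z hz hzb, sub_zero, ← dist_eq_norm] at h1
    exact h1.trans (by gcongr)
  refine ⟨r / 2, by positivity, (3 * L / c / (r / 2) + 1 / (r / 2)) * v, by positivity,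
    fun ε hε => ?_⟩
  rcases le_or_gt ε (r / 2) with hεr | hεr
  -- In the collar `|ψ| ≤ Lε`, while a shift by `3Lε / c` along `e` raises `ψ` by at least `3Lε`.
  -- This exceeds the oscillation `2Lε`, so the translates are disjoint.
  · have := volume_le_of_disjoint_translates (A := Metric.ball x₀ (r / 2) ∩
      Metric.thickening ε (frontier U)) (c := x₀) (e := e) (R := r / 2) (s := 3 * L * ε / c)
      (Metric.isOpen_ball.inter Metric.isOpen_thickening).measurableSet (by positivity)
      (by positivity) inter_subset_left he.le ?_
    · refine this.trans ?_
      rw [← ENNReal.ofReal_toReal hvt, ← hv, ← ENNReal.ofReal_mul (by positivity)]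
      apply ENNReal.ofReal_le_ofReal
      have : (3 * L / c / (r / 2) + 1 / (r / 2)) * v * ε
          = 3 * L * ε / c / (r / 2) * v + 1 / (r / 2) * v * ε := by ring
      rw [this]
      have : 0 ≤ 1 / (r / 2) * v * ε := by positivity
      linarith
    · intro x hx k hk _ hx'
      have h1 := hsmall ε hεr x hx
      have h2 := hsmall ε hεr _ hx'
      have hsub : Metric.ball x₀ (r / 2) ⊆ Metric.ball x₀ r := Metric.ball_subset_ball (by linarith)
      have h3 := hψe x (hsub hx.1) _ (by positivity) (hsub hx'.1)
      have hk' : (1 : ℝ) ≤ k := by exact_mod_cast hk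
      have h4 : c * (k * (3 * L * ε / c)) = k * (3 * (L * ε)) := by field_simp
      rw [h4] at h3
      rw [abs_le] at h1 h2
      have : 0 < L * ε := by positivity
      nlinarith
  -- For `ε > r / 2` the measure of a ball is bound enough; the summand `1 / (r / 2)` of the
  -- constant serves this case.
  · refine (measure_mono inter_subset_left).trans ((measure_mono (Metric.ball_subset_ball
      (by linarith : r / 2 ≤ 2 * (r / 2)))).trans ?_)
    rw [← ENNReal.ofReal_toReal hvt, ← hv]
    apply ENNReal.ofReal_le_ofReal
    have h1 : 1 ≤ 1 / (r / 2) * ε := by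
      rw [one_div, inv_mul_eq_div, le_div_iff₀ (by positivity)]; linarith
    have h2 : 0 ≤ v := by positivity
    have h3 : 0 ≤ 3 * L / c / (r / 2) * v * ε := by positivity
    nlinarith

lemma IsRegularDomain.isCompact_frontier {U : Set E3} (hU : IsRegularDomain U) :
    IsCompact (frontier U) :=
  Metric.isCompact_of_isClosed_isBounded isClosed_frontier
    (hU.2.2.1.closure.subset frontier_subset_closure)

lemma IsRegularDomain.volume_frontier {U : Set E3} (hU : IsRegularDomain U) :
    volume (frontier U) = 0 := by
  refine measure_null_of_locally_null _ fun x hx => ?_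
  obtain ⟨r, hr, C, hC, h⟩ := hU.exists_ball_collar hx
  refine ⟨Metric.ball x r ∩ frontier U, ?_, ?_⟩
  · rw [inter_comm]
    exact inter_mem_nhdsWithin _ (Metric.ball_mem_nhds x hr)
  · refine le_antisymm ?_ bot_le
    have h1 : ∀ ε : ℝ, 0 < ε → volume (Metric.ball x r ∩ frontier U) ≤ ENNReal.ofReal (C * ε) :=
      fun ε hε => (measure_mono (inter_subset_inter_right _
        (Metric.self_subset_thickening hε _))).trans (h ε hε)
    have h2 : Tendsto (fun ε : ℝ => ENNReal.ofReal (C * ε)) (𝓝[>] 0) (𝓝 0) := by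
      have : Tendsto (fun ε : ℝ => ENNReal.ofReal (C * ε)) (𝓝 0) (𝓝 (ENNReal.ofReal (C * 0))) :=
        (ENNReal.continuous_ofReal.comp (by fun_prop)).tendsto 0
      rw [mul_zero, ENNReal.ofReal_zero] at this
      exact this.mono_left nhdsWithin_le_nhds
    exact ge_of_tendsto h2 (eventually_mem_nhdsWithin.mono fun ε hε => h1 ε hε)

/-- The inner boundary layer of width `ε` of a regular domain has measure `O(ε)`. -/
lemma IsRegularDomain.exists_volume_layer_le {U : Set E3} (hU : IsRegularDomain U) :
    ∃ C : ℝ, 0 ≤ C ∧ ∀ ε : ℝ, 0 < ε →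
      volume (U ∩ Metric.thickening ε (frontier U)) ≤ ENNReal.ofReal (C * ε) := by
  have hfin : volume U ≠ ⊤ := hU.2.2.1.measure_lt_top.ne
  choose! r hr C hC h using fun x (hx : x ∈ frontier U) => hU.exists_ball_collar hx
  obtain ⟨t, htF, ht⟩ := hU.isCompact_frontier.elim_nhds_subcover (fun x => Metric.ball x (r x))
    fun x hx => Metric.ball_mem_nhds x (hr x hx)
  obtain ⟨ε₀, hε₀, hthick⟩ := hU.isCompact_frontier.exists_thickening_subset_open
    (isOpen_biUnion fun x _ => Metric.isOpen_ball) ht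
  have hCs : 0 ≤ ∑ x ∈ t, C x := Finset.sum_nonneg fun x hx => hC x (htF x hx)
  -- The sum handles widths `ε ≤ ε₀`, for which the collar lies in the finite cover of the frontier;
  -- the second term bounds the whole volume when `ε > ε₀`.
  refine ⟨∑ x ∈ t, C x + (volume U).toReal / ε₀, by positivity, fun ε hε => ?_⟩
  rcases le_or_gt ε ε₀ with hle | hgt
  · calc volume (U ∩ Metric.thickening ε (frontier U))
        ≤ volume (⋃ x ∈ t, Metric.ball x (r x) ∩ Metric.thickening ε (frontier U)) := by
          apply measure_mono
          rintro x ⟨-, hx⟩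
          have := hthick (Metric.thickening_mono hle _ hx)
          simp only [mem_iUnion, exists_prop] at this ⊢
          obtain ⟨i, hi, hx'⟩ := this
          exact ⟨i, hi, hx', hx⟩
      _ ≤ ∑ x ∈ t, volume (Metric.ball x (r x) ∩ Metric.thickening ε (frontier U)) :=
          measure_biUnion_finset_le _ _
      _ ≤ ∑ x ∈ t, ENNReal.ofReal (C x * ε) := Finset.sum_le_sum fun x hx => h x (htF x hx) ε hε
      _ = ENNReal.ofReal ((∑ x ∈ t, C x) * ε) := by
          rw [Finset.sum_mul, ENNReal.ofReal_sum_of_nonneg]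
          intro x hx
          have := hC x (htF x hx)
          positivity
      _ ≤ _ := by
          apply ENNReal.ofReal_le_ofReal
          gcongr
          have : 0 ≤ (volume U).toReal / ε₀ := by positivity
          linarith
  · refine (measure_mono inter_subset_left).trans ?_
    refine (ENNReal.ofReal_toReal hfin).symm.le.trans (ENNReal.ofReal_le_ofReal ?_)
    have h1 : (volume U).toReal ≤ (volume U).toReal / ε₀ * ε := by
      rw [div_mul_eq_mul_div, le_div_iff₀ hε₀]
      gcongr
    have h2 : 0 ≤ (∑ x ∈ t, C x) * ε := by positivity
    linarith

/-- A regular domain lies on one side of its boundary. -/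
lemma IsRegularDomain.interior_closure {U : Set E3} (hU : IsRegularDomain U) :
    interior (closure U) = U := by
  refine subset_antisymm (fun x hx => ?_) (hU.1.subset_interior_iff.2 subset_closure)
  by_contra hxU
  have hxF : x ∈ frontier U := by
    rw [hU.1.frontier_eq]
    exact ⟨interior_subset hx, hxU⟩
  obtain ⟨ψ, e, r, c, L, hr, he, hc, hL, hψU, hψL, hψe⟩ := hU.exists_chart hxF
  obtain ⟨r', hr', hb⟩ := Metric.isOpen_iff.1 isOpen_interior x hx
  set s := min r r' / 2 with hs
  have hspos : 0 < s := by positivity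
  have hsr : s < r := by have := min_le_left r r'; linarith
  have hsr' : s < r' := by have := min_le_right r r'; linarith
  have hd : dist (x + s • e) x = s := by
    rw [dist_eq_norm, add_sub_cancel_left, norm_smul, he, Real.norm_of_nonneg hspos.le, mul_one]
  have hxr : x + s • e ∈ Metric.ball x r := by rw [Metric.mem_ball, hd]; exact hsr
  have hcl : x + s • e ∈ closure U := interior_subset (hb (by rw [Metric.mem_ball, hd]; exact hsr'))
  -- Moving outwards by `s` makes `ψ` at least `c s`, hence positive on the ball of radius `c s /
  -- L`. This ball would have to meet `U`, where `ψ < 0`.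
  have hpos : c * s ≤ ψ (x + s • e) := by
    have := hψe x (Metric.mem_ball_self hr) s hspos.le hxr
    have h0 : 0 ≤ ψ x := not_lt.1 fun h => hxU ((hψU x (Metric.mem_ball_self hr)).2 h)
    linarith
  obtain ⟨r'', hr'', hb''⟩ := Metric.isOpen_iff.1 Metric.isOpen_ball _ hxr
  obtain ⟨y, hyU, hy⟩ := Metric.mem_closure_iff.1 hcl (min r'' (c * s / L)) (by positivity)
  have hyb : y ∈ Metric.ball x r := hb'' (by
    rw [Metric.mem_ball, dist_comm]; exact hy.trans_le (min_le_left _ _))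
  have h1 := (abs_le.1 (hψL _ hxr y hyb)).2
  have h2 := (hψU y hyb).1 hyU
  rw [← dist_eq_norm] at h1
  have h3 := hy.trans_le (min_le_right _ _)
  rw [lt_div_iff₀ hL] at h3
  linarith

/-- A null open set is empty, so inclusion up to a null set already gives `U ⊆ closure V`. This is
what upgrades equality of bodies almost everywhere to equality of sets. -/
lemma subset_of_ae_le_of_interior_closure {U V : Set E3} (hU : IsOpen U)
    (hV : interior (closure V) = V) (h : volume (U \ V) = 0) : U ⊆ V := by
  have h1 : volume (U \ closure V) = 0 :=
    measure_mono_null (sdiff_subset_sdiff_right subset_closure) h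
  have h2 : U \ closure V = ∅ := by
    rw [← (hU.sdiff isClosed_closure).measure_eq_zero_iff volume]; exact h1
  rw [sdiff_eq_empty] at h2
  rw [← hV]
  exact hU.subset_interior_iff.2 h2

lemma IsRegularDomain.volume_pos {U : Set E3} (hU : IsRegularDomain U) : 0 < volume U :=
  hU.1.measure_pos _ hU.2.1.nonempty

/-! ### Smooth boundary layer cut-offs -/

open scoped Convolution in
/-- Smoothing of a bounded Lipschitz function at scale `ε`. -/
lemma exists_smoothing {f : E3 → ℝ} {K : ℝ≥0} (hf : LipschitzWith K f)
    (hf01 : ∀ x, f x ∈ Icc (0 : ℝ) 1) {ε : ℝ} (hε : 0 < ε) :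
    ∃ ζ : E3 → ℝ, ContDiff ℝ ∞ ζ ∧ (∀ x, ζ x ∈ Icc (0 : ℝ) 1) ∧ LipschitzWith K ζ ∧
      ∀ x, (∀ y ∈ Metric.ball x ε, f y = f x) → ζ x = f x := by
  let φ : ContDiffBump (0 : E3) := ⟨ε / 2, ε, by positivity, by linarith⟩
  set w := φ.normed (volume : Measure E3) with hw
  have hwc : HasCompactSupport w := φ.hasCompactSupport_normed
  have hwcont : Continuous w := φ.continuous_normed
  have hwi : Integrable w := φ.integrable_normed
  have hw1 : ∫ x, w x = 1 := φ.integral_normed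
  have hw0 : ∀ x, 0 ≤ w x := φ.nonneg_normed
  have hfi : ∀ x, Integrable fun t => w t * f (x - t) := by
    intro x
    have : Continuous fun t => w t * f (x - t) := by
      have := hf.continuous
      fun_prop
    exact this.integrable_of_hasCompactSupport hwc.mul_right
  -- Averaging against a nonnegative kernel of integral one preserves the range and the Lipschitz
  -- constant, and it changes no value where `f` is constant at the scale of the kernel.
  let ζ : E3 → ℝ := w ⋆[ContinuousLinearMap.lsmul ℝ ℝ, volume] f
  have hζ : ∀ x, ζ x = ∫ t, w t * f (x - t) := fun x => rfl
  refine ⟨ζ, ?_, fun x => ⟨?_, ?_⟩, ?_, fun x hx => ?_⟩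
  · exact hwc.contDiff_convolution_left _ φ.contDiff_normed hf.continuous.locallyIntegrable
  · rw [hζ]
    exact integral_nonneg fun t => mul_nonneg (hw0 t) (hf01 _).1
  · rw [hζ, ← hw1]
    exact integral_mono (hfi x) hwi fun t => mul_le_of_le_one_right (hw0 t) (hf01 _).2
  · refine LipschitzWith.of_dist_le_mul fun x y => ?_
    rw [hζ, hζ, dist_eq_norm, ← integral_sub (hfi x) (hfi y)]
    refine (norm_integral_le_integral_norm _).trans ?_
    have : ∫ t, w t * (K * dist x y) = K * dist x y := by
      rw [integral_mul_const, hw1, one_mul]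
    rw [← this]
    refine integral_mono ((hfi x).sub (hfi y)).norm (hwi.mul_const _) fun t => ?_
    simp only
    rw [← mul_sub, norm_mul, Real.norm_of_nonneg (hw0 t)]
    gcongr
    · exact hw0 t
    · have := hf.dist_le_mul (x - t) (y - t)
      rwa [dist_eq_norm, dist_sub_right] at this
  · exact ContDiffBump.normed_convolution_eq_right (φ := φ) (fun y hy => hx y hy)

/-- Cut-offs equal to `1` off a regular domain, and supported, up to a set of measure `O(ε)`,
outside of it, with gradient bounded by `1 / ε`. -/
lemma IsRegularDomain.exists_cutoff {U : Set E3} (hU : IsRegularDomain U) :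
    ∃ C : ℝ, 0 ≤ C ∧ ∀ ε : ℝ, 0 < ε → ∃ ζ : E3 → ℝ, ContDiff ℝ ∞ ζ ∧
      (∀ x, ζ x ∈ Icc (0 : ℝ) 1) ∧ (∀ x, x ∉ U → ζ x = 1) ∧ (∀ x, ‖fderiv ℝ ζ x‖ ≤ 1 / ε) ∧
      (∀ x, fderiv ℝ ζ x ≠ 0 → x ∈ U ∧ ζ x ≠ 0) ∧
      volume {x ∈ U | ζ x ≠ 0} ≤ ENNReal.ofReal (C * ε) := by
  obtain ⟨C, hC, hlayer⟩ := hU.exists_volume_layer_le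
  have hne : U ≠ univ := fun h => NormedSpace.unbounded_univ ℝ E3 (h ▸ hU.2.2.1)
  -- The profile below is `1` at depth at most `ε` and `0` beyond `2ε`. Smoothing at scale `ε` costs
  -- one more `ε`, so the layer has width `3ε`.
  refine ⟨3 * C, by positivity, fun ε hε => ?_⟩
  set d : E3 → ℝ := fun x => Metric.infDist x Uᶜ with hd
  have hdL : LipschitzWith 1 d := Metric.lipschitz_infDist_pt _
  have hfL : LipschitzWith (Real.toNNReal (1 / ε)) fun x => max 0 (min 1 (2 - d x / ε)) := by
    have h1 : LipschitzWith (Real.toNNReal (1 / ε)) fun x => 2 - d x / ε := by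
      refine LipschitzWith.of_dist_le_mul fun x y => ?_
      have := hdL.dist_le_mul x y
      rw [Real.coe_toNNReal _ (by positivity), Real.dist_eq]
      rw [Real.dist_eq, NNReal.coe_one, one_mul] at this
      have h2 : 2 - d x / ε - (2 - d y / ε) = -((1 / ε) * (d x - d y)) := by ring
      rw [h2, abs_neg, abs_mul, abs_of_pos (by positivity)]
      gcongr
    exact (h1.const_min 1).const_max 0
  obtain ⟨ζ, hζs, hζ01, hζL, hζf⟩ := exists_smoothing hfL
    (fun x => ⟨le_max_left _ _, max_le zero_le_one (min_le_left _ _)⟩) hε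
  have hdist : ∀ x, ∀ y ∈ Metric.ball x ε, |d y - d x| < ε := by
    intro x y hy
    have := hdL.dist_le_mul y x
    rw [Real.dist_eq, NNReal.coe_one, one_mul] at this
    exact this.trans_lt hy
  have hone : ∀ x, x ∉ U → ζ x = 1 := by
    intro x hx
    have hx0 : d x = 0 := Metric.infDist_zero_of_mem hx
    have h1 : ∀ y ∈ Metric.ball x ε, max 0 (min 1 (2 - d y / ε)) = 1 := by
      intro y hy
      have := hdist x y hy
      rw [hx0, sub_zero, abs_lt] at this
      have h2 : d y / ε < 1 := by rw [div_lt_one hε]; exact this.2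
      rw [min_eq_left (by linarith), max_eq_right zero_le_one]
    rw [hζf x fun y hy => (h1 y hy).trans (h1 x (Metric.mem_ball_self hε)).symm]
    exact h1 x (Metric.mem_ball_self hε)
  have hzero : ∀ x, 3 * ε ≤ d x → ζ x = 0 := by
    intro x hx
    have h1 : ∀ y ∈ Metric.ball x ε, max 0 (min 1 (2 - d y / ε)) = 0 := by
      intro y hy
      have := hdist x y hy
      rw [abs_lt] at this
      have h2 : 2 ≤ d y / ε := by rw [le_div_iff₀ hε]; linarith
      rw [min_eq_right (by linarith), max_eq_left (by linarith)]
    rw [hζf x fun y hy => (h1 y hy).trans (h1 x (Metric.mem_ball_self hε)).symm]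
    exact h1 x (Metric.mem_ball_self hε)
  refine ⟨ζ, hζs, hζ01, hone, fun x => ?_, fun x hx => ⟨?_, ?_⟩, ?_⟩
  · have := norm_fderiv_le_of_lipschitz ℝ hζL (x₀ := x)
    rwa [Real.coe_toNNReal _ (by positivity)] at this
  -- The values `0` and `1` are the extrema of `ζ`, so its gradient vanishes wherever they are
  -- attained.
  · by_contra hxU
    refine hx (IsLocalMax.fderiv_eq_zero (Eventually.of_forall fun y => ?_))
    rw [hone x hxU]; exact (hζ01 y).2
  · intro h0
    refine hx (IsLocalMin.fderiv_eq_zero (Eventually.of_forall fun y => ?_))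
    rw [h0]; exact (hζ01 y).1
  · have : {x ∈ U | ζ x ≠ 0} ⊆ U ∩ Metric.thickening (3 * ε) (frontier U) := by
      rintro x ⟨hxU, hx⟩
      refine ⟨hxU, ?_⟩
      obtain ⟨y, hy, hxy⟩ := exists_mem_frontier_infDist_compl_eq_dist hxU hne
      refine Metric.mem_thickening_iff.2 ⟨y, hy, ?_⟩
      rw [← hxy]
      by_contra! h
      exact hx (hzero x h)
    refine (measure_mono this).trans ((hlayer _ (by positivity)).trans_eq ?_)
    congr 1; ring

/-! ### Absolutely continuous curves -/

section Curves

variable {F : Type*} [NormedAddCommGroup F] [NormedSpace ℝ F]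

/-- The absolutely continuous curve with value `y₀` at `0` and derivative `g`. -/
def curve (y₀ : F) (g : ℝ → F) (t : ℝ) : F := y₀ + ∫ s in (0 : ℝ)..t, g s

lemma curve_zero (y₀ : F) (g : ℝ → F) : curve y₀ g 0 = y₀ := by simp [curve]

lemma continuous_curve (y₀ : F) {g : ℝ → F} (hg : Integrable g) : Continuous (curve y₀ g) :=
  continuous_const.add
    (intervalIntegral.continuous_primitive (fun _ _ => hg.intervalIntegrable) 0)

lemma norm_intervalIntegral_le {g : ℝ → F} (hg : Integrable g) (s t : ℝ) :
    ‖∫ r in s..t, g r‖ ≤ ∫ r, ‖g r‖ := by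
  refine (intervalIntegral.norm_integral_le_integral_norm_uIoc).trans ?_
  exact setIntegral_le_integral hg.norm (Eventually.of_forall fun _ => norm_nonneg _)

lemma norm_curve_le (y₀ : F) {g : ℝ → F} (hg : Integrable g) (t : ℝ) :
    ‖curve y₀ g t‖ ≤ ‖y₀‖ + ∫ r, ‖g r‖ :=
  (norm_add_le _ _).trans (by gcongr; exact norm_intervalIntegral_le hg 0 t)

lemma norm_curve_sub_curve_le (y₀ : F) {g h : ℝ → F} (hg : Integrable g) (hh : Integrable h)
    (t : ℝ) : ‖curve y₀ g t - curve y₀ h t‖ ≤ ∫ r, ‖g r - h r‖ := by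
  have : curve y₀ g t - curve y₀ h t = ∫ s in (0 : ℝ)..t, (g s - h s) := by
    rw [intervalIntegral.integral_sub hg.intervalIntegrable hh.intervalIntegrable]
    simp [curve]
  rw [this]
  exact norm_intervalIntegral_le (hg.sub hh) 0 t

lemma hasDerivAt_curve [CompleteSpace F] (y₀ : F) {g : ℝ → F} (hg : Continuous g) (t : ℝ) :
    HasDerivAt (curve y₀ g) (g t) t :=
  (intervalIntegral.integral_hasDerivAt_right (hg.intervalIntegrable _ _)
    hg.aestronglyMeasurable.stronglyMeasurableAtFilter hg.continuousAt).const_add y₀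

lemma contDiff_curve [CompleteSpace F] (y₀ : F) {g : ℝ → F} (hg : ContDiff ℝ ∞ g) :
    ContDiff ℝ ∞ (curve y₀ g) := by
  have hd : deriv (curve y₀ g) = g := funext fun t => (hasDerivAt_curve y₀ hg.continuous t).deriv
  rw [contDiff_infty_iff_deriv, hd]
  exact ⟨fun t => (hasDerivAt_curve y₀ hg.continuous t).differentiableAt, hg⟩

/-- Chain and product rules hold classically for smooth curves; this approximation in `L¹` of the
derivatives passes them to absolutely continuous curves, whose values then converge uniformly. -/
lemma exists_smooth_approx {g : ℝ → F} (hg : Integrable g) :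
    ∃ gk : ℕ → ℝ → F, (∀ k, ContDiff ℝ ∞ (gk k)) ∧ (∀ k, Integrable (gk k)) ∧
      Tendsto (fun k => ∫ t, ‖gk k t - g t‖) atTop (𝓝 0) := by
  have hmem : MemLp g 1 := memLp_one_iff_integrable.2 hg
  choose gk hc hs hle using fun k : ℕ =>
    hmem.exist_eLpNorm_sub_le ENNReal.one_ne_top le_rfl (ε := 1 / ((k : ℝ) + 1)) (by positivity)
  have hint : ∀ k, Integrable (gk k) := fun k =>
    (hs k).continuous.integrable_of_hasCompactSupport (hc k)
  refine ⟨gk, hs, hint, ?_⟩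
  refine squeeze_zero (fun k => integral_nonneg fun _ => norm_nonneg _) (fun k => ?_)
    tendsto_one_div_add_atTop_nhds_zero_nat
  have h1 := hle k
  rw [eLpNorm_one_eq_lintegral_enorm] at h1
  have h2 : ∫ t, ‖gk k t - g t‖ = (∫⁻ t, ‖(g - gk k) t‖ₑ).toReal := by
    rw [← integral_norm_eq_lintegral_enorm (hg.sub (hint k)).aestronglyMeasurable]
    simp [norm_sub_rev]
  rw [h2]
  exact ENNReal.toReal_le_of_le_ofReal (by positivity) h1

/-- The product rule for absolutely continuous curves. -/
lemma curve_bilinear {E G : Type*} [NormedAddCommGroup E] [NormedSpace ℝ E] [CompleteSpace E]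
    [NormedAddCommGroup G] [NormedSpace ℝ G] [CompleteSpace G] [CompleteSpace F]
    (B : E →L[ℝ] F →L[ℝ] G) (x₀ : E) (y₀ : F) {f : ℝ → E} {g : ℝ → F} (hf : Integrable f)
    (hg : Integrable g) (t : ℝ) :
    B (curve x₀ f t) (curve y₀ g t) = B x₀ y₀ +
      ∫ s in (0 : ℝ)..t, (B (f s) (curve y₀ g s) + B (curve x₀ f s) (g s)) := by
  obtain ⟨fk, hfs, hfi, hft⟩ := exists_smooth_approx hf
  obtain ⟨gk, hgs, hgi, hgt⟩ := exists_smooth_approx hg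
  have hXt : ∀ s, Tendsto (fun k => curve x₀ (fk k) s) atTop (𝓝 (curve x₀ f s)) := fun s =>
    tendsto_iff_norm_sub_tendsto_zero.2 (squeeze_zero (fun _ => norm_nonneg _)
      (fun k => norm_curve_sub_curve_le x₀ (hfi k) hf s) hft)
  have hYt : ∀ s, Tendsto (fun k => curve y₀ (gk k) s) atTop (𝓝 (curve y₀ g s)) := fun s =>
    tendsto_iff_norm_sub_tendsto_zero.2 (squeeze_zero (fun _ => norm_nonneg _)
      (fun k => norm_curve_sub_curve_le y₀ (hgi k) hg s) hgt)
  have hint : ∀ {f : ℝ → E} {g : ℝ → F}, Integrable f → Integrable g →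
      Integrable fun s => B (f s) (curve y₀ g s) + B (curve x₀ f s) (g s) := by
    intro f g hf hg
    have hX := continuous_curve x₀ hf
    have hY := continuous_curve y₀ hg
    refine Integrable.add ?_ ?_
    · refine (hf.norm.const_mul (‖B‖ * (‖y₀‖ + ∫ r, ‖g r‖))).mono'
        (B.aestronglyMeasurable_comp₂ hf.aestronglyMeasurable hY.aestronglyMeasurable)
        (Eventually.of_forall fun s => ?_)
      calc ‖B (f s) (curve y₀ g s)‖ ≤ ‖B‖ * ‖f s‖ * ‖curve y₀ g s‖ := B.le_opNorm₂ _ _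
        _ ≤ ‖B‖ * ‖f s‖ * (‖y₀‖ + ∫ r, ‖g r‖) := by gcongr; exact norm_curve_le y₀ hg s
        _ = _ := by ring
    · refine (hg.norm.const_mul (‖B‖ * (‖x₀‖ + ∫ r, ‖f r‖))).mono'
        (B.aestronglyMeasurable_comp₂ hX.aestronglyMeasurable hg.aestronglyMeasurable)
        (Eventually.of_forall fun s => ?_)
      calc ‖B (curve x₀ f s) (g s)‖ ≤ ‖B‖ * ‖curve x₀ f s‖ * ‖g s‖ := B.le_opNorm₂ _ _
        _ ≤ ‖B‖ * (‖x₀‖ + ∫ r, ‖f r‖) * ‖g s‖ := by gcongr; exact norm_curve_le x₀ hf s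
  -- For smooth data this is the fundamental theorem of calculus.
  have hsmooth : ∀ k, B (curve x₀ (fk k) t) (curve y₀ (gk k) t) = B x₀ y₀ +
      ∫ s in (0 : ℝ)..t, (B (fk k s) (curve y₀ (gk k) s) + B (curve x₀ (fk k) s) (gk k s)) := by
    intro k
    rw [intervalIntegral.integral_eq_sub_of_hasDerivAt
      (f := fun s => B (curve x₀ (fk k) s) (curve y₀ (gk k) s))]
    · simp [curve_zero]
    · intro s _
      have := B.hasDerivAt_of_bilinear (fun _ => hasDerivAt_curve x₀ (hfs k).continuous s)
        (fun _ => hasDerivAt_curve y₀ (hgs k).continuous s)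
      rwa [add_comm] at this
    · exact (hint (hfi k) (hgi k)).intervalIntegrable
  have hlim : Tendsto (fun k => ∫ s in (0 : ℝ)..t,
      (B (fk k s) (curve y₀ (gk k) s) + B (curve x₀ (fk k) s) (gk k s))) atTop
      (𝓝 (∫ s in (0 : ℝ)..t, (B (f s) (curve y₀ g s) + B (curve x₀ f s) (g s)))) := by
    rw [tendsto_iff_norm_sub_tendsto_zero]
    -- Each of the four terms of the difference pairs an `L¹` error with an `L¹` norm or with a
    -- uniform bound of a curve, so this explicit majorant tends to `0`.
    have hbound : Tendsto (fun k => ‖B‖ * (∫ r, ‖fk k r - f r‖) *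
          (‖y₀‖ + ((∫ r, ‖gk k r - g r‖) + ∫ r, ‖g r‖)) + ‖B‖ * (∫ r, ‖f r‖) * (∫ r, ‖gk k r - g r‖)
        + (‖B‖ * (‖x₀‖ + ((∫ r, ‖fk k r - f r‖) + ∫ r, ‖f r‖)) * (∫ r, ‖gk k r - g r‖)
          + ‖B‖ * (∫ r, ‖fk k r - f r‖) * (∫ r, ‖g r‖))) atTop (𝓝 0) := by
      have : Tendsto (fun k => ‖B‖ * (∫ r, ‖fk k r - f r‖) *
          (‖y₀‖ + ((∫ r, ‖gk k r - g r‖) + ∫ r, ‖g r‖)) + ‖B‖ * (∫ r, ‖f r‖) * (∫ r, ‖gk k r - g r‖)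
        + (‖B‖ * (‖x₀‖ + ((∫ r, ‖fk k r - f r‖) + ∫ r, ‖f r‖)) * (∫ r, ‖gk k r - g r‖)
          + ‖B‖ * (∫ r, ‖fk k r - f r‖) * (∫ r, ‖g r‖))) atTop
          (𝓝 (‖B‖ * 0 * (‖y₀‖ + (0 + ∫ r, ‖g r‖)) + ‖B‖ * (∫ r, ‖f r‖) * 0
        + (‖B‖ * (‖x₀‖ + (0 + ∫ r, ‖f r‖)) * 0 + ‖B‖ * 0 * (∫ r, ‖g r‖)))) := by
        refine Tendsto.add (Tendsto.add (Tendsto.mul (hft.const_mul _) ?_) (hgt.const_mul _))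
          (Tendsto.add (Tendsto.mul ?_ hgt) ((hft.const_mul _).mul_const _))
        · exact (hgt.add_const _).const_add _
        · exact ((hft.add_const _).const_add _).const_mul _
      simpa using this
    refine squeeze_zero (fun _ => norm_nonneg _) (fun k => ?_) hbound
    rw [← intervalIntegral.integral_sub (hint (hfi k) (hgi k)).intervalIntegrable
      (hint hf hg).intervalIntegrable]
    refine (norm_intervalIntegral_le ((hint (hfi k) (hgi k)).sub (hint hf hg)) _ _).trans ?_
    have hfd : Integrable fun r => fk k r - f r := (hfi k).sub hf
    have hgd : Integrable fun r => gk k r - g r := (hgi k).sub hg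
    have hgk : ∫ r, ‖gk k r‖ ≤ (∫ r, ‖gk k r - g r‖) + ∫ r, ‖g r‖ := by
      rw [← integral_add hgd.norm hg.norm]
      exact integral_mono (hgi k).norm (hgd.norm.add hg.norm) fun r => by
        simpa using norm_add_le (gk k r - g r) (g r)
    have hfk : ∫ r, ‖fk k r‖ ≤ (∫ r, ‖fk k r - f r‖) + ∫ r, ‖f r‖ := by
      rw [← integral_add hfd.norm hf.norm]
      exact integral_mono (hfi k).norm (hfd.norm.add hf.norm) fun r => by
        simpa using norm_add_le (fk k r - f r) (f r)
    set Y := ‖y₀‖ + ((∫ r, ‖gk k r - g r‖) + ∫ r, ‖g r‖)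
    set X := ‖x₀‖ + ((∫ r, ‖fk k r - f r‖) + ∫ r, ‖f r‖)
    set a := ∫ r, ‖fk k r - f r‖
    set b := ∫ r, ‖gk k r - g r‖
    have hYk : ∀ s, ‖curve y₀ (gk k) s‖ ≤ Y := fun s => (norm_curve_le y₀ (hgi k) s).trans
      (by simp only [Y]; gcongr)
    have hXk : ∀ s, ‖curve x₀ (fk k) s‖ ≤ X := fun s => (norm_curve_le x₀ (hfi k) s).trans
      (by simp only [X]; gcongr)
    have hpt : ∀ s, ‖(B (fk k s) (curve y₀ (gk k) s) + B (curve x₀ (fk k) s) (gk k s)) -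
        (B (f s) (curve y₀ g s) + B (curve x₀ f s) (g s))‖ ≤
        (‖B‖ * Y * ‖fk k s - f s‖ + ‖B‖ * b * ‖f s‖) +
          (‖B‖ * X * ‖gk k s - g s‖ + ‖B‖ * a * ‖g s‖) := by
      intro s
      have : (B (fk k s) (curve y₀ (gk k) s) + B (curve x₀ (fk k) s) (gk k s)) -
        (B (f s) (curve y₀ g s) + B (curve x₀ f s) (g s)) =
          (B (fk k s - f s) (curve y₀ (gk k) s) + B (f s) (curve y₀ (gk k) s - curve y₀ g s)) +
          (B (curve x₀ (fk k) s) (gk k s - g s) + B (curve x₀ (fk k) s - curve x₀ f s) (g s)) := by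
        simp only [map_sub, sub_apply]; abel
      rw [this]
      refine (norm_add_le _ _).trans (add_le_add ((norm_add_le _ _).trans (add_le_add ?_ ?_))
        ((norm_add_le _ _).trans (add_le_add ?_ ?_)))
      · refine (B.le_opNorm₂ _ _).trans ?_
        rw [mul_right_comm]; gcongr; exact hYk s
      · refine (B.le_opNorm₂ _ _).trans ?_
        rw [mul_right_comm]; gcongr; exact norm_curve_sub_curve_le y₀ (hgi k) hg s
      · refine (B.le_opNorm₂ _ _).trans ?_
        gcongr; exact hXk s
      · refine (B.le_opNorm₂ _ _).trans ?_
        gcongr; exact norm_curve_sub_curve_le x₀ (hfi k) hf s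
    refine (integral_mono ((hint (hfi k) (hgi k)).sub (hint hf hg)).norm
      (((hfd.norm.const_mul _).add (hf.norm.const_mul _)).add
        ((hgd.norm.const_mul _).add (hg.norm.const_mul _))) hpt).trans_eq ?_
    simp only [Pi.add_apply]
    rw [integral_add, integral_add, integral_add, integral_const_mul, integral_const_mul,
      integral_const_mul, integral_const_mul]
    · ring
    all_goals first
      | exact (hgd.norm.const_mul _)
      | exact (hg.norm.const_mul _)
      | exact (hfd.norm.const_mul _)
      | exact (hf.norm.const_mul _)
      | exact (hfd.norm.const_mul _).add (hf.norm.const_mul _)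
      | exact (hgd.norm.const_mul _).add (hg.norm.const_mul _)
  refine tendsto_nhds_unique (f := fun k => B (curve x₀ (fk k) t) (curve y₀ (gk k) t)) (l := atTop)
    (B.continuous₂.continuousAt.tendsto.comp ((hXt t).prodMk_nhds (hYt t))) ?_
  simp only [hsmooth]
  exact hlim.const_add _

end Curves

/-! ### Functions evaluated along absolutely continuous curves -/

section CurveDerivative

variable {F : Type*} [NormedAddCommGroup F] [NormedSpace ℝ F]
  {G : Type*} [NormedAddCommGroup G] [NormedSpace ℝ G]

lemma fderiv_eq_zero_of_support {H : ℝ × E3 × F → G} {R : ℝ}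
    (hK : ∀ t x y, H (t, x, y) ≠ 0 → ‖x‖ ≤ R) {t : ℝ} {x : E3} (hx : R < ‖x‖) (y : F) :
    fderiv ℝ H (t, x, y) = 0 := by
  have : H =ᶠ[𝓝 (t, x, y)] fun _ => 0 := by
    have ho : IsOpen {p : ℝ × E3 × F | R < ‖p.2.1‖} := isOpen_lt continuous_const (by fun_prop)
    filter_upwards [ho.mem_nhds hx] with p hp
    by_contra h
    exact absurd (hK p.1 p.2.1 p.2.2 h) (not_le.2 hp)
  rw [this.fderiv_eq]
  simp

/-- The support of `H` is bounded in `(t, x)` only, so `y` has to be confined to a ball, as the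
values of a curve are. The indicator keeps the bound integrable in `x` after multiplication by an
integrable function of time. -/
lemma exists_fderiv_bound [ProperSpace F] {H : ℝ × E3 × F → G} (hH : ContDiff ℝ ∞ H) {τ R : ℝ}
    (hK : ∀ t x y, H (t, x, y) ≠ 0 → |t| ≤ τ ∧ ‖x‖ ≤ R) (ρ : ℝ) :
    ∃ B : ℝ, 0 ≤ B ∧ ∀ t x y, ‖y‖ ≤ ρ →
      ‖fderiv ℝ H (t, x, y)‖ ≤ (Metric.closedBall (0 : E3) R).indicator (fun _ => B) x := by
  have hcomp : IsCompact (Metric.closedBall (0 : ℝ) τ ×ˢ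
      (Metric.closedBall (0 : E3) R ×ˢ Metric.closedBall (0 : F) ρ)) :=
    (isCompact_closedBall _ _).prod ((isCompact_closedBall _ _).prod (isCompact_closedBall _ _))
  obtain ⟨B, hB⟩ := hcomp.exists_bound_of_continuousOn
    (hH.continuous_fderiv (by simp)).continuousOn
  refine ⟨max B 0, le_max_right _ _, fun t x y hy => ?_⟩
  rcases le_or_gt ‖x‖ R with hx | hx
  · rw [indicator_of_mem (by simpa using hx)]
    rcases le_or_gt |t| τ with ht | ht
    · exact (hB (t, x, y) (by simpa using ⟨ht, hx, hy⟩)).trans (le_max_left _ _)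
    · have : H =ᶠ[𝓝 (t, x, y)] fun _ => 0 := by
        have ho : IsOpen {p : ℝ × E3 × F | τ < |p.1|} := isOpen_lt continuous_const (by fun_prop)
        filter_upwards [ho.mem_nhds ht] with p hp
        by_contra h
        exact absurd (hK p.1 p.2.1 p.2.2 h).1 (not_le.2 hp)
      rw [this.fderiv_eq]
      simp
  · rw [fderiv_eq_zero_of_support (fun t x y h => (hK t x y h).2) hx, norm_zero]
    exact indicator_nonneg (fun _ _ => le_max_right _ _) _

lemma fderiv_comp_curve [CompleteSpace F] {H : ℝ × E3 × F → G} (hH : ContDiff ℝ ∞ H) (y₀ : F)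
    {g : ℝ → F} (hg : Continuous g) (z d : ℝ × E3) :
    fderiv ℝ (fun z : ℝ × E3 => H (z.1, z.2, curve y₀ g z.1)) z d
      = fderiv ℝ H (z.1, z.2, curve y₀ g z.1) (d.1, d.2, d.1 • g z.1) := by
  have h1 : HasFDerivAt (fun z : ℝ × E3 => curve y₀ g z.1)
      ((ContinuousLinearMap.toSpanSingleton ℝ (g z.1)).comp (ContinuousLinearMap.fst ℝ ℝ E3)) z :=
    (hasDerivAt_curve y₀ hg z.1).hasFDerivAt.comp z hasFDerivAt_fst
  have h2 : HasFDerivAt (fun z : ℝ × E3 => (z.1, z.2, curve y₀ g z.1)) _ z :=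
    hasFDerivAt_fst.prodMk (hasFDerivAt_snd.prodMk h1)
  have h3 := (hH.differentiable (by simp)).differentiableAt.hasFDerivAt.comp z h2
  have h4 := h3.fderiv
  rw [show (fun z : ℝ × E3 => H (z.1, z.2, curve y₀ g z.1))
    = H ∘ fun z : ℝ × E3 => (z.1, z.2, curve y₀ g z.1) from rfl, h4]
  simp

/-- Integrals of `b • ∂ (H(t, x, Y(t)))` for an absolutely continuous curve `Y` are limits of the
same integrals for smooth curves. -/
lemma tendsto_integral_fderiv_curve [ProperSpace F] {H : ℝ × E3 × F → G} (hH : ContDiff ℝ ∞ H) {τ R : ℝ}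
    (hK : ∀ t x y, H (t, x, y) ≠ 0 → |t| ≤ τ ∧ ‖x‖ ≤ R)
    {A : Set (ℝ × E3)} {b : ℝ × E3 → ℝ} {v : ℝ × E3 → E3} {M : ℝ} (hM : 0 ≤ M)
    (hb : Integrable b (volume.restrict A)) (hbM : ∀ᵐ z ∂volume.restrict A, |b z| ≤ M)
    (hbv : Integrable (fun z => b z • v z) (volume.restrict A)) (c : ℝ)
    (y₀ : F) {g : ℝ → F} (hg : Integrable g) {gk : ℕ → ℝ → F}
    (hgs : ∀ k, ContDiff ℝ ∞ (gk k)) (hgi : ∀ k, Integrable (gk k))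
    (hgt : Tendsto (fun k => ∫ t, ‖gk k t - g t‖) atTop (𝓝 0)) :
    Tendsto (fun k => ∫ z, b z •
        fderiv ℝ (fun z : ℝ × E3 => H (z.1, z.2, curve y₀ (gk k) z.1)) z (c, v z)
          ∂volume.restrict A) atTop
      (𝓝 (∫ z, b z • fderiv ℝ H (z.1, z.2, curve y₀ g z.1) (c, v z, c • g z.1)
        ∂volume.restrict A)) := by
  set μ := volume.restrict A with hμ
  obtain ⟨D, hD⟩ : ∃ D, ∀ k, ∫ t, ‖gk k t - g t‖ ≤ D := by
    obtain ⟨D, hD⟩ := hgt.bddAbove_range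
    exact ⟨D, fun k => hD ⟨k, rfl⟩⟩
  -- A common bound for the limit curve and all approximating curves.
  set ρ := ‖y₀‖ + (D + ∫ t, ‖g t‖) with hρ
  have hD0 : 0 ≤ D := (integral_nonneg fun _ => norm_nonneg _).trans (hD 0)
  have hYρ : ∀ t, ‖curve y₀ g t‖ ≤ ρ := fun t => (norm_curve_le y₀ hg t).trans (by
    rw [hρ]; linarith)
  have hYkρ : ∀ k t, ‖curve y₀ (gk k) t‖ ≤ ρ := by
    intro k t
    have h1 := norm_curve_sub_curve_le y₀ (hgi k) hg t
    have h2 := norm_curve_le y₀ hg t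
    have h3 := norm_le_norm_add_norm_sub' (curve y₀ (gk k) t) (curve y₀ g t)
    have h4 := hD k
    rw [hρ]; linarith
  obtain ⟨B, hB0, hB⟩ := exists_fderiv_bound hH hK ρ
  set I : E3 → ℝ := (Metric.closedBall (0 : E3) R).indicator fun _ => 1 with hI
  have hII : ∀ x, (Metric.closedBall (0 : E3) R).indicator (fun _ => B) x = B * I x := by
    intro x; simp [hI, indicator]
  have hI0 : ∀ x, 0 ≤ I x := fun x => indicator_nonneg (fun _ _ => zero_le_one) _
  have hI1 : ∀ x, I x ≤ 1 := fun x => indicator_le_self' (fun _ _ => zero_le_one) _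
  have hIint : Integrable I := by
    rw [hI, integrable_indicator_iff measurableSet_closedBall]
    exact integrableOn_const (measure_closedBall_lt_top).ne
  have hprod : ∀ {f : ℝ → F}, Integrable f →
      Integrable (fun z : ℝ × E3 => ‖f z.1‖ * I z.2) := fun {f} hf => hf.norm.mul_prod hIint
  have hbm := hb.aestronglyMeasurable
  -- the pointwise bound
  have hpt : ∀ (z : ℝ × E3) (y : F), ‖y‖ ≤ ρ → ∀ w : F, |b z| ≤ M →
      ‖b z • fderiv ℝ H (z.1, z.2, y) (c, v z, c • w)‖
        ≤ B * (|c| * |b z|) + B * ‖b z • v z‖ + B * M * |c| * (‖w‖ * I z.2) := by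
    intro z y hy w hM
    have h1 := hB z.1 z.2 y hy
    rw [hII] at h1
    have h2 : ‖(c, v z, c • w)‖ ≤ |c| + ‖v z‖ + |c| * ‖w‖ := by
      rw [Prod.norm_mk, Prod.norm_mk, norm_smul, Real.norm_eq_abs]
      refine max_le ?_ (max_le ?_ ?_) <;> nlinarith [abs_nonneg c, norm_nonneg (v z),
        norm_nonneg w, mul_nonneg (abs_nonneg c) (norm_nonneg w)]
    rw [norm_smul, norm_smul, Real.norm_eq_abs]
    have h3 := (fderiv ℝ H (z.1, z.2, y)).le_opNorm (c, v z, c • w)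
    calc |b z| * ‖fderiv ℝ H (z.1, z.2, y) (c, v z, c • w)‖
        ≤ |b z| * ((B * I z.2) * (|c| + ‖v z‖ + |c| * ‖w‖)) := by
          have := hI0 z.2
          gcongr; exact h3.trans (by gcongr)
      _ = I z.2 * (B * (|c| * |b z|) + B * (|b z| * ‖v z‖)) +
            B * |b z| * |c| * (‖w‖ * I z.2) := by ring
      _ ≤ 1 * (B * (|c| * |b z|) + B * (|b z| * ‖v z‖)) + B * M * |c| * (‖w‖ * I z.2) := by
          have := hI0 z.2
          gcongr
          exact hI1 _
      _ = _ := by ring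
  have hdomint : ∀ {f : ℝ → F}, Integrable f → Integrable (fun z => B * (|c| * |b z|) +
      B * ‖b z • v z‖ + B * M * |c| * (‖f z.1‖ * I z.2)) μ := fun {f} hf =>
    (((hb.norm.const_mul _).const_mul _).add (hbv.norm.const_mul _)).add
      ((hprod hf).restrict.const_mul _)
  have hDHc : ∀ {Y : ℝ → F}, Continuous Y →
      Continuous fun z : ℝ × E3 => fderiv ℝ H (z.1, z.2, Y z.1) := fun hY =>
    (hH.continuous_fderiv (by simp)).comp (by fun_prop)
  have hmeas : ∀ {Y f : ℝ → F}, Continuous Y → Integrable f → AEStronglyMeasurable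
      (fun z => b z • fderiv ℝ H (z.1, z.2, Y z.1) (c, v z, c • f z.1)) μ := by
    intro Y f hY hf
    have hfm : AEStronglyMeasurable (fun z : ℝ × E3 => f z.1) μ :=
      (hf.aestronglyMeasurable.comp_quasiMeasurePreserving
        Measure.quasiMeasurePreserving_fst).restrict
    have h1 : (fun z => b z • fderiv ℝ H (z.1, z.2, Y z.1) (c, v z, c • f z.1)) =
        fun z => fderiv ℝ H (z.1, z.2, Y z.1) (b z * c, b z • v z, b z • (c • f z.1)) := by
      funext z
      rw [← map_smul]
      simp
    rw [h1]
    refine (ContinuousLinearMap.id ℝ (ℝ × E3 × F →L[ℝ] G)).aestronglyMeasurable_comp₂ ?_ ?_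
    · have : SecondCountableTopologyEither (ℝ × E3) (ℝ × E3 × F →L[ℝ] G) :=
        secondCountableTopologyEither_of_left _ _
      exact (hDHc hY).aestronglyMeasurable
    · exact (hbm.mul_const c).prodMk (hbv.aestronglyMeasurable.prodMk (hbm.smul (hfm.const_smul c)))
  have hintg : ∀ {Y f : ℝ → F}, Continuous Y → (∀ t, ‖Y t‖ ≤ ρ) → Integrable f → Integrable
      (fun z => b z • fderiv ℝ H (z.1, z.2, Y z.1) (c, v z, c • f z.1)) μ := by
    intro Y f hY hYb hf
    refine (hdomint hf).mono' (hmeas hY hf) ?_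
    filter_upwards [hbM] with z hz
    exact hpt z _ (hYb _) _ hz
  have hYc := continuous_curve y₀ hg
  have hYkc := fun k => continuous_curve y₀ (hgi k)
  have hYt : ∀ s, Tendsto (fun k => curve y₀ (gk k) s) atTop (𝓝 (curve y₀ g s)) := fun s =>
    tendsto_iff_norm_sub_tendsto_zero.2 (squeeze_zero (fun _ => norm_nonneg _)
      (fun k => norm_curve_sub_curve_le y₀ (hgi k) hg s) hgt)
  -- the main term
  have hmain : Tendsto (fun k => ∫ z, b z •
      fderiv ℝ H (z.1, z.2, curve y₀ (gk k) z.1) (c, v z, c • g z.1) ∂μ) atTop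
      (𝓝 (∫ z, b z • fderiv ℝ H (z.1, z.2, curve y₀ g z.1) (c, v z, c • g z.1) ∂μ)) := by
    refine tendsto_integral_of_dominated_convergence _ (fun k => hmeas (hYkc k) hg) (hdomint hg)
      (fun k => ?_) (Eventually.of_forall fun z => ?_)
    · filter_upwards [hbM] with z hz
      exact hpt z _ (hYkρ k _) _ hz
    · have h1 : Tendsto (fun k => fderiv ℝ H (z.1, z.2, curve y₀ (gk k) z.1)) atTop
          (𝓝 (fderiv ℝ H (z.1, z.2, curve y₀ g z.1))) :=
        (hH.continuous_fderiv (by simp)).continuousAt.tendsto.comp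
          (tendsto_const_nhds.prodMk_nhds (tendsto_const_nhds.prodMk_nhds (hYt z.1)))
      exact (((ContinuousLinearMap.apply ℝ G (c, v z, c • g z.1)).continuous.tendsto _).comp
        h1).const_smul (b z)
  -- the error term
  have herr : Tendsto (fun k => ∫ z, b z •
      fderiv ℝ H (z.1, z.2, curve y₀ (gk k) z.1) (0, 0, c • (gk k z.1 - g z.1)) ∂μ) atTop
      (𝓝 0) := by
    refine squeeze_zero_norm (a := fun k => B * M * |c| * ((∫ t, ‖gk k t - g t‖) * ∫ x, I x))
      (fun k => ?_) ?_
    · have hi : Integrable (fun z : ℝ × E3 => B * M * |c| * (‖gk k z.1 - g z.1‖ * I z.2)) :=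
        (hprod ((hgi k).sub hg)).const_mul _
      refine (norm_integral_le_of_norm_le hi.restrict ?_).trans ?_
      · filter_upwards [hbM] with z hz
        have h1 := hB z.1 z.2 _ (hYkρ k z.1)
        rw [hII] at h1
        rw [norm_smul, Real.norm_eq_abs]
        calc |b z| * _ ≤ M * ((B * I z.2) * ‖((0 : ℝ), (0 : E3), c • (gk k z.1 - g z.1))‖) := by
              gcongr
              exact (ContinuousLinearMap.le_opNorm _ _).trans (by gcongr)
          _ = _ := by
              rw [Prod.norm_mk, Prod.norm_mk, norm_zero, norm_zero, norm_smul, Real.norm_eq_abs,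
                max_eq_right (by positivity), max_eq_right (by positivity)]
              ring
      · refine (setIntegral_le_integral hi (Eventually.of_forall fun z => ?_)).trans_eq ?_
        · have := hI0 z.2
          simp only [Pi.zero_apply]
          positivity
        · rw [integral_const_mul]
          congr 1
          exact integral_prod_mul (fun t => ‖gk k t - g t‖) I
    · have := (hgt.mul_const (∫ x, I x)).const_mul (B * M * |c|)
      simpa using this
  -- The derivative is linear in the velocity of the curve, so `g_k = g + (g_k - g)` splits the
  -- integral along the smooth curve into the two terms treated above.
  have hsum := hmain.add herr
  rw [add_zero] at hsum
  refine hsum.congr fun k => ?_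
  rw [← integral_add (hintg (hYkc k) (hYkρ k) hg)]
  · congr 1
    funext z
    rw [fderiv_comp_curve hH y₀ (hgs k).continuous, ← smul_add, ← map_add]
    congr 2
    ext <;> simp [smul_sub]
  · have := (hintg (hYkc k) (hYkρ k) (hgi k)).sub (hintg (hYkc k) (hYkρ k) hg)
    refine this.congr (Eventually.of_forall fun z => ?_)
    simp only [Pi.sub_apply]
    rw [← smul_sub, ← map_sub]
    congr 2
    ext <;> simp [smul_sub]

end CurveDerivative

/-! ### Linear differential equations with square integrable coefficients -/

section LinearODE

variable {F : Type*} [NormedAddCommGroup F] [NormedSpace ℝ F] [CompleteSpace F]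

/-- Existence for `Y' = L(t) Y`, `Y(0) = y₀`, on `[0, T]`, with `L` square integrable. -/
lemma exists_linear_ode_Icc {T : ℝ} (hT : 0 < T) {L : ℝ → F →L[ℝ] F} (hL : Integrable L)
    (hL2 : Integrable fun t => ‖L t‖ ^ 2) (y₀ : F) :
    ∃ Y : ℝ → F, Continuous Y ∧
      ∀ t ∈ Icc 0 T, Y t = y₀ + ∫ s in (0 : ℝ)..t, L s (Y s) := by
  have : Fact ((0 : ℝ) ≤ T) := ⟨hT.le⟩
  set A := ∫ t, ‖L t‖ ^ 2 with hA
  have hA0 : 0 ≤ A := integral_nonneg fun _ => by positivity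
  -- Constants for a contraction by `1/2`: the weight `exp(-λt)` gives `N / λ = 1/4` for the bounded
  -- part of `‖L‖`, and `A / N ≤ 1/4` for the rest.
  set N := 4 * A + 1 with hN
  have hN0 : 0 < N := by positivity
  set lam := 4 * N with hlam
  have hlam0 : 0 < lam := by positivity
  have hext : ∀ Z : C(Icc 0 T, F), Continuous (IccExtend hT.le Z) := fun Z =>
    Z.continuous.Icc_extend'
  have hbd : ∀ Z : C(Icc 0 T, F), ∀ s, ‖IccExtend hT.le Z s‖ ≤ ‖Z‖ := fun Z s =>
    Z.norm_coe_le_norm _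
  have hint : ∀ (Z : C(Icc 0 T, F)) (a b : ℝ), IntervalIntegrable
      (fun s => Real.exp (lam * s) • L s (IccExtend hT.le Z s)) volume a b := by
    intro Z a b
    have h1 : Integrable fun s => L s (IccExtend hT.le Z s) := by
      refine (hL.norm.mul_const ‖Z‖).mono' ?_ (Eventually.of_forall fun s => ?_)
      · exact (ContinuousLinearMap.id ℝ (F →L[ℝ] F)).aestronglyMeasurable_comp₂
          hL.aestronglyMeasurable (hext Z).aestronglyMeasurable
      · exact ((L s).le_opNorm _).trans (by gcongr; exact hbd Z s)
    exact h1.intervalIntegrable.continuousOn_smul (by fun_prop)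
  -- The Picard map in the unknown `Z = exp(-λt) Y`. The weight makes it a contraction on the whole
  -- of `[0, T]` at once.
  let Φ : C(Icc 0 T, F) → C(Icc 0 T, F) := fun Z =>
    ⟨fun t => Real.exp (-lam * t) • (y₀ + ∫ s in (0 : ℝ)..t,
      Real.exp (lam * s) • L s (IccExtend hT.le Z s)), by
      have : Continuous fun t : ℝ => ∫ s in (0 : ℝ)..t,
          Real.exp (lam * s) • L s (IccExtend hT.le Z s) :=
        intervalIntegral.continuous_primitive (hint Z) 0
      have h2 : Continuous fun t : ℝ => Real.exp (-lam * t) • (y₀ + ∫ s in (0 : ℝ)..t,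
        Real.exp (lam * s) • L s (IccExtend hT.le Z s)) := by fun_prop
      exact h2.comp continuous_subtype_val⟩
  have hΦ : ContractingWith (1 / 2) Φ := by
    refine ⟨by rw [← NNReal.coe_lt_coe]; norm_num, LipschitzWith.of_dist_le_mul fun Z Z' => ?_⟩
    rw [ContinuousMap.dist_le (by positivity)]
    rintro ⟨t, ht0, htT⟩
    have hdiff : Φ Z ⟨t, ht0, htT⟩ - Φ Z' ⟨t, ht0, htT⟩ = Real.exp (-lam * t) •
        ∫ s in (0 : ℝ)..t, Real.exp (lam * s) • L s (IccExtend hT.le Z s - IccExtend hT.le Z' s) := by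
      simp only [Φ, ContinuousMap.coe_mk]
      rw [← smul_sub, add_sub_add_left_eq_sub, ← intervalIntegral.integral_sub (hint Z 0 t)
        (hint Z' 0 t)]
      simp only [map_sub, smul_sub]
    rw [dist_eq_norm, hdiff, norm_smul, Real.norm_of_nonneg (Real.exp_pos _).le]
    set d := dist Z Z' with hd
    have hZ : ∀ s, ‖IccExtend hT.le Z s - IccExtend hT.le Z' s‖ ≤ d := by
      intro s
      rw [← dist_eq_norm]
      exact ContinuousMap.dist_apply_le_dist _
    have hd0 : 0 ≤ d := dist_nonneg
    have hbound : ∀ s ∈ Icc 0 t,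
        ‖Real.exp (lam * s) • L s (IccExtend hT.le Z s - IccExtend hT.le Z' s)‖
          ≤ d * (Real.exp (lam * s) * N + Real.exp (lam * t) * (‖L s‖ ^ 2 / N)) := by
      rintro s ⟨hs0, hst⟩
      rw [norm_smul, Real.norm_of_nonneg (Real.exp_pos _).le]
      -- The part of `‖L‖` exceeding `N` is controlled by the square, whose integral is `A`.
      have h1 : ‖L s‖ ≤ N + ‖L s‖ ^ 2 / N := by
        rcases le_or_gt ‖L s‖ N with h | h
        · have : 0 ≤ ‖L s‖ ^ 2 / N := by positivity
          linarith
        · have : ‖L s‖ ≤ ‖L s‖ ^ 2 / N := by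
            rw [le_div_iff₀ hN0, sq]; gcongr
          linarith
      have h2 : Real.exp (lam * s) ≤ Real.exp (lam * t) := by gcongr
      calc Real.exp (lam * s) * ‖L s (IccExtend hT.le Z s - IccExtend hT.le Z' s)‖
          ≤ Real.exp (lam * s) * ((N + ‖L s‖ ^ 2 / N) * d) := by
            gcongr
            exact ((L s).le_opNorm _).trans (by gcongr; exact hZ s)
        _ = d * (Real.exp (lam * s) * N + Real.exp (lam * s) * (‖L s‖ ^ 2 / N)) := by ring
        _ ≤ _ := by gcongr
    have hi1 : IntervalIntegrable (fun s => Real.exp (lam * s) * N) volume 0 t :=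
      Continuous.intervalIntegrable (by fun_prop) _ _
    have hi2 : IntervalIntegrable (fun s => Real.exp (lam * t) * (‖L s‖ ^ 2 / N)) volume 0 t :=
      ((hL2.div_const N).const_mul _).intervalIntegrable
    have h3 : ‖∫ s in (0 : ℝ)..t,
        Real.exp (lam * s) • L s (IccExtend hT.le Z s - IccExtend hT.le Z' s)‖ ≤
        ∫ s in (0 : ℝ)..t, d * (Real.exp (lam * s) * N + Real.exp (lam * t) * (‖L s‖ ^ 2 / N)) := by
      refine intervalIntegral.norm_integral_le_of_norm_le ht0 (Eventually.of_forall fun s hs => ?_)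
        ((hi1.add hi2).const_mul d)
      exact hbound s (Ioc_subset_Icc_self hs)
    have h4 : ∫ s in (0 : ℝ)..t, d * (Real.exp (lam * s) * N + Real.exp (lam * t) * (‖L s‖ ^ 2 / N))
        ≤ d * (Real.exp (lam * t) / lam * N + Real.exp (lam * t) * (A / N)) := by
      rw [intervalIntegral.integral_const_mul, intervalIntegral.integral_add hi1 hi2,
        intervalIntegral.integral_mul_const, intervalIntegral.integral_const_mul,
        intervalIntegral.integral_div]
      have e1 : ∫ s in (0 : ℝ)..t, Real.exp (lam * s) ≤ Real.exp (lam * t) / lam := by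
        rw [intervalIntegral.integral_comp_mul_left (fun x => Real.exp x) hlam0.ne', integral_exp]
        simp only [mul_zero, Real.exp_zero, smul_eq_mul]
        rw [inv_mul_eq_div]
        gcongr
        linarith
      have e2 : ∫ s in (0 : ℝ)..t, ‖L s‖ ^ 2 ≤ A := by
        rw [intervalIntegral.integral_of_le ht0]
        exact setIntegral_le_integral hL2 (Eventually.of_forall fun _ => by positivity)
      gcongr
    refine (mul_le_mul_of_nonneg_left (h3.trans h4) (Real.exp_pos _).le).trans ?_
    have h5 : Real.exp (-lam * t) * Real.exp (lam * t) = 1 := by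
      rw [← Real.exp_add]; simp
    have h6 : Real.exp (-lam * t) * (d * (Real.exp (lam * t) / lam * N + Real.exp (lam * t) * (A / N)))
        = (Real.exp (-lam * t) * Real.exp (lam * t)) * (d * (N / lam + A / N)) := by ring
    rw [h6, h5, one_mul]
    have h7 : N / lam = 1 / 4 := by rw [hlam]; field_simp
    have h8 : A / N ≤ 1 / 4 := by rw [div_le_iff₀ hN0, hN]; linarith
    have h9 : ((1 / 2 : ℝ≥0) : ℝ) = 1 / 2 := by norm_num
    rw [h7, h9]
    nlinarith
  obtain ⟨Z, hZ⟩ : ∃ Z, Φ Z = Z := ⟨_, hΦ.fixedPoint_isFixedPt⟩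
  refine ⟨fun t => Real.exp (lam * t) • IccExtend hT.le Z t, ?_, fun t ht => ?_⟩
  · have := hext Z
    fun_prop
  · have h1 : Z ⟨t, ht⟩ = Real.exp (-lam * t) • (y₀ + ∫ s in (0 : ℝ)..t,
      Real.exp (lam * s) • L s (IccExtend hT.le Z s)) := by
      conv_lhs => rw [← hZ]
      rfl
    simp only [IccExtend_of_mem hT.le Z ht, h1, smul_smul, map_smul]
    rw [← Real.exp_add]
    simp

/-- Existence for `Y' = L(t) Y`, `Y(0) = y₀`, with `L` square integrable and supported in
`(0, T)`. -/
lemma exists_linear_ode {T : ℝ} (hT : 0 < T) {L : ℝ → F →L[ℝ] F} (hL : Integrable L)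
    (hL2 : Integrable fun t => ‖L t‖ ^ 2) (hLT : ∀ t ∉ Ioo 0 T, L t = 0) (y₀ : F) :
    ∃ Y : ℝ → F, Continuous Y ∧ Integrable (fun s => L s (Y s)) ∧
      Y = curve y₀ fun s => L s (Y s) := by
  obtain ⟨Y, hYc, hY⟩ := exists_linear_ode_Icc hT hL hL2 y₀
  set g : ℝ → F := fun s => L s (Y s) with hg
  have hgi : Integrable g := by
    obtain ⟨B, hB⟩ := isCompact_Icc.exists_bound_of_continuousOn (s := Icc 0 T) hYc.continuousOn
    refine (hL.norm.mul_const B).mono' ?_ (Eventually.of_forall fun s => ?_)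
    · exact (ContinuousLinearMap.id ℝ (F →L[ℝ] F)).aestronglyMeasurable_comp₂
        hL.aestronglyMeasurable hYc.aestronglyMeasurable
    · by_cases hs : s ∈ Ioo 0 T
      · exact ((L s).le_opNorm _).trans (by gcongr; exact hB s (Ioo_subset_Icc_self hs))
      · simp [hg, hLT s hs]
  -- Values of `Y` outside `[0, T]` are irrelevant, as `L` vanishes off `(0, T)`. Replacing `Y` by
  -- the curve yields a solution on all of `ℝ`.
  have heq : (fun s => L s (curve y₀ g s)) = g := by
    funext s
    by_cases hs : s ∈ Ioo 0 T
    · simp only [hg]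
      congr 1
      exact (hY s (Ioo_subset_Icc_self hs)).symm
    · simp [hg, hLT s hs]
  exact ⟨curve y₀ g, continuous_curve y₀ hgi, by rw [heq]; exact hgi, by rw [heq]⟩

end LinearODE

/-- Fundamental solutions of `R' = W R` and `Q' = - Q W`, inverse to each other. -/
lemma exists_fundamental_solutions {A : Type*} [NormedRing A] [NormedAlgebra ℝ A]
    [CompleteSpace A] {T : ℝ} (hT : 0 < T) {W : ℝ → A} (hW : Integrable W)
    (hW2 : Integrable fun t => ‖W t‖ ^ 2) (hWT : ∀ t ∉ Ioo 0 T, W t = 0) :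
    ∃ R Q : ℝ → A, Continuous R ∧ Continuous Q ∧ Integrable (fun s => W s * R s) ∧
      Integrable (fun s => -(Q s * W s)) ∧ R = curve 1 (fun s => W s * R s) ∧
      Q = curve 1 (fun s => -(Q s * W s)) ∧ ∀ t, Q t * R t = 1 := by
  let m := ContinuousLinearMap.mul ℝ A
  have hsq : ∀ {f : ℝ → A →L[ℝ] A}, AEStronglyMeasurable f volume →
      (∀ t, ‖f t‖ ≤ ‖W t‖) → Integrable fun t => ‖f t‖ ^ 2 := by
    intro f hf hfn
    refine hW2.mono' (hf.norm.pow 2) (Eventually.of_forall fun t => ?_)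
    rw [Real.norm_of_nonneg (by positivity)]
    have := hfn t
    gcongr
  have hm : ∀ B, ‖m B‖ ≤ ‖B‖ := fun B =>
    (m B).opNorm_le_bound (norm_nonneg _) fun C => norm_mul_le B C
  have hmf : ∀ B, ‖m.flip B‖ ≤ ‖B‖ := fun B =>
    (m.flip B).opNorm_le_bound (norm_nonneg _) fun C =>
      (norm_mul_le C B).trans_eq (mul_comm _ _)
  obtain ⟨R, hRc, hRi, hR⟩ := exists_linear_ode hT (L := fun t => m (W t))
    (m.integrable_comp hW) (hsq (m.integrable_comp hW).aestronglyMeasurable fun t => hm _)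
    (fun t ht => by simp [hWT t ht]) 1
  obtain ⟨Q, hQc, hQi, hQ⟩ := exists_linear_ode hT (L := fun t => -(m.flip (W t)))
    (m.flip.integrable_comp hW).neg
    (hsq (m.flip.integrable_comp hW).aestronglyMeasurable.neg fun t => by
      rw [norm_neg]; exact hmf _)
    (fun t ht => by simp [hWT t ht]) 1
  have h1 : ∀ s, (-(m.flip (W s))) (Q s) = -(Q s * W s) := fun s => by simp [m]
  have h2 : ∀ s, m (W s) (R s) = W s * R s := fun s => rfl
  simp only [h1] at hQ hQi
  simp only [h2] at hR hRi
  refine ⟨R, Q, hRc, hQc, hRi, hQi, hR, hQ, fun t => ?_⟩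
  -- The derivative of `Q R` is `-Q W R + Q W R = 0`.
  have := curve_bilinear m 1 1 hQi hRi t
  rw [← hQ, ← hR] at this
  have h0 : ∀ s, m (-(Q s * W s)) (R s) + m (Q s) (W s * R s) = 0 := by
    intro s
    simp [m, mul_assoc]
  simp only [h0, intervalIntegral.integral_zero, add_zero] at this
  simpa [m] using this

/-! ### Rigid flows -/

/-- The inner product of `ℝ³` as a continuous bilinear map. -/
def innerL : E3 →L[ℝ] E3 →L[ℝ] ℝ :=
  LinearMap.mkContinuous₂ (innerₗ E3) 1 (fun a b => by
    rw [one_mul]; exact norm_inner_le_norm a b)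

@[simp] lemma innerL_apply (a b : E3) : innerL a b = inner ℝ a b := rfl

/-- The space of (coefficients of) affine maps of `ℝ³`. -/
abbrev Aff := (E3 →L[ℝ] E3) × E3

/-- The backward flow `Y(t, x) = Q(t) x + y(t)` of the rigid field `a(t) + om(t) × x`: a curve of
isometries of `ℝ³`, starting from the identity, along which `Q' = - Q (om ×)` and `y' = - Q a`. -/
structure IsRigidFlow (a om : ℝ → E3) (Y : ℝ → Aff) : Prop where
  isometry : ∀ t x, ‖(Y t).1 x‖ = ‖x‖
  integrable : Integrable fun s => (-((Y s).1.comp (crossL (om s))), -((Y s).1 (a s)))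
  eq_curve : Y = curve (ContinuousLinearMap.id ℝ E3, 0)
    fun s => (-((Y s).1.comp (crossL (om s))), -((Y s).1 (a s)))

lemma integrable_of_memLp_two_of_support {F : Type*} [NormedAddCommGroup F] {T : ℝ} {f : ℝ → F}
    (hf : MemLp f 2 volume) (hfT : ∀ t ∉ Ioo 0 T, f t = 0) : Integrable f := by
  have h1 : MemLp f 2 (volume.restrict (Ioo 0 T)) := hf.restrict _
  have h2 : IntegrableOn f (Ioo 0 T) := h1.integrable (by norm_num)
  rw [← integrable_indicator_iff measurableSet_Ioo] at h2
  refine h2.congr (Eventually.of_forall fun t => ?_)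
  by_cases ht : t ∈ Ioo 0 T
  · simp [ht]
  · simp [ht, hfT t ht]

/-- For `R' = om × R` the norm `|R x|` is conserved, because `(om × R x) · R x = 0`. The equation
`Q' = -Q (om ×)` does not show this directly, so the linear part is obtained as the inverse of `R`;
the translation is then an integral. -/
lemma exists_rigidFlow {T : ℝ} (hT : 0 < T) {a om : ℝ → E3} (ha : MemLp a 2 volume)
    (hom : MemLp om 2 volume) (haT : ∀ t ∉ Ioo 0 T, a t = 0) (homT : ∀ t ∉ Ioo 0 T, om t = 0) :
    ∃ Y : ℝ → Aff, IsRigidFlow a om Y := by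
  have hai := integrable_of_memLp_two_of_support ha haT
  have homi := integrable_of_memLp_two_of_support hom homT
  have homsq : Integrable fun t => ‖om t‖ ^ 2 := hom.integrable_norm_pow (by norm_num)
  let W : ℝ → E3 →L[ℝ] E3 := fun t => crossL (om t)
  have hWi : Integrable W := crossL.integrable_comp homi
  have hWT : ∀ t ∉ Ioo 0 T, W t = 0 := fun t ht => by simp [W, homT t ht]
  have hWn : ∀ t, ‖W t‖ ≤ ‖om t‖ := fun t => norm_crossL_apply_le (om t)
  have hW2 : Integrable fun t => ‖W t‖ ^ 2 := by
    refine homsq.mono' (hWi.aestronglyMeasurable.norm.pow 2) (Eventually.of_forall fun t => ?_)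
    rw [Real.norm_of_nonneg (by positivity)]
    have := hWn t
    gcongr
  obtain ⟨R, Q, hRc, hQc, hRi, hQi, hR, hQ, hQR⟩ := exists_fundamental_solutions hT hWi hW2 hWT
  have hRn : ∀ t x, ‖R t x‖ = ‖x‖ := by
    intro t x
    have hev : ∀ t, R t x = curve x (fun s => cross (om s) (R s x)) t := by
      intro t
      conv_lhs => rw [hR]
      simp only [curve, add_apply, one_apply_eq_self]
      congr 1
      exact (ContinuousLinearMap.intervalIntegral_comp_comm
        (ContinuousLinearMap.apply ℝ E3 x) hRi.intervalIntegrable).symm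
    have hi : Integrable fun s => cross (om s) (R s x) :=
      (ContinuousLinearMap.apply ℝ E3 x).integrable_comp hRi
    have := curve_bilinear innerL x x hi hi t
    rw [← hev t] at this
    simp only [innerL_apply, ← hev] at this
    simp only [inner_cross_self, real_inner_comm (cross _ _) (R _ x), add_zero,
      intervalIntegral.integral_zero, real_inner_self_eq_norm_sq] at this
    exact (sq_eq_sq₀ (norm_nonneg _) (norm_nonneg _)).1 this
  have hQn : ∀ t x, ‖Q t x‖ = ‖x‖ := by
    intro t x
    -- In finite dimension the isometry `R t` is onto, so every vector is some `R t w`, and `Q t`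
    -- maps it back to `w`.
    have hinj : Function.Injective (R t) := by
      intro x y h
      have : ‖R t (x - y)‖ = 0 := by rw [map_sub, h, sub_self, norm_zero]
      rw [hRn, norm_eq_zero, sub_eq_zero] at this
      exact this
    obtain ⟨w, rfl⟩ := (LinearMap.injective_iff_surjective (f := (R t).toLinearMap)).1 hinj x
    have := congrArg (fun B : E3 →L[ℝ] E3 => B w) (hQR t)
    simp only [mul_apply_eq_comp, one_apply_eq_self] at this
    rw [ContinuousLinearMap.coe_coe, this, hRn]
  have hyi : Integrable fun s => -(Q s (a s)) := by
    refine Integrable.neg (hai.norm.mono' ?_ (Eventually.of_forall fun s => (hQn s _).le))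
    exact (ContinuousLinearMap.id ℝ (E3 →L[ℝ] E3)).aestronglyMeasurable_comp₂
        hQc.aestronglyMeasurable hai.aestronglyMeasurable
  refine ⟨fun t => (Q t, curve 0 (fun s => -(Q s (a s))) t), hQn, ?_, ?_⟩
  · exact hQi.prodMk hyi
  · funext t
    have h1 : ∀ s, -(Q s * W s) = -((Q s).comp (crossL (om s))) := fun s => rfl
    simp only [h1] at hQ hQi
    have h2 : (∫ s in (0 : ℝ)..t, (-((Q s).comp (crossL (om s))), -(Q s (a s)))) =
        (∫ s in (0 : ℝ)..t, -((Q s).comp (crossL (om s))), ∫ s in (0 : ℝ)..t, -(Q s (a s))) := by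
      have hp : IntervalIntegrable (fun s => (-((Q s).comp (crossL (om s))), -(Q s (a s))))
        volume 0 t := (hQi.prodMk hyi).intervalIntegrable
      refine Prod.ext ?_ ?_
      · exact (ContinuousLinearMap.intervalIntegral_comp_comm
          (ContinuousLinearMap.fst ℝ (E3 →L[ℝ] E3) E3) hp).symm
      · exact (ContinuousLinearMap.intervalIntegral_comp_comm
          (ContinuousLinearMap.snd ℝ (E3 →L[ℝ] E3) E3) hp).symm
    simp only [curve, h2]
    refine Prod.ext ?_ ?_
    · exact congrFun hQ t
    · simp

/-! ### Curves of isometries -/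

/-- The affine map with coefficients `A`. -/
def act (A : Aff) (x : E3) : E3 := A.1 x + A.2

lemma act_id (x : E3) : act (ContinuousLinearMap.id ℝ E3, 0) x = x := by simp [act]

lemma contDiff_act : ContDiff ℝ ∞ fun p : Aff × E3 => act p.1 p.2 := by
  unfold act
  fun_prop

lemma continuous_act : Continuous fun p : Aff × E3 => act p.1 p.2 := contDiff_act.continuous

/-- A continuous curve of affine isometries of `ℝ³`. -/
structure IsIsometryCurve (Y : ℝ → Aff) : Prop where
  continuous : Continuous Y
  isometry : ∀ t x, ‖(Y t).1 x‖ = ‖x‖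

lemma IsRigidFlow.isIsometryCurve {a om : ℝ → E3} {Y : ℝ → Aff} (h : IsRigidFlow a om Y) :
    IsIsometryCurve Y :=
  ⟨by rw [h.eq_curve]; exact continuous_curve _ h.integrable, h.isometry⟩

namespace IsIsometryCurve

variable {Y : ℝ → Aff}

lemma continuous_act' (hY : IsIsometryCurve Y) : Continuous fun z : ℝ × E3 => act (Y z.1) z.2 :=
  continuous_act.comp ((hY.continuous.comp continuous_fst).prodMk continuous_snd)

lemma adjoint_comp (hY : IsIsometryCurve Y) (t : ℝ) :
    (ContinuousLinearMap.adjoint (Y t).1).comp (Y t).1 = ContinuousLinearMap.id ℝ E3 :=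
  (ContinuousLinearMap.norm_map_iff_adjoint_comp_self (Y t).1).1 (hY.isometry t)

lemma comp_adjoint (hY : IsIsometryCurve Y) (t : ℝ) :
    (Y t).1.comp (ContinuousLinearMap.adjoint (Y t).1) = ContinuousLinearMap.id ℝ E3 := by
  have h := hY.adjoint_comp t
  have h1 : (ContinuousLinearMap.adjoint (Y t).1).toLinearMap * (Y t).1.toLinearMap = 1 := by
    ext x : 1
    exact congrArg (fun B : E3 →L[ℝ] E3 => B x) h
  have h2 := mul_eq_one_comm.1 h1
  ext x : 1
  exact congrArg (fun B : E3 →ₗ[ℝ] E3 => B x) h2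

/-- The homeomorphism `(t, x) ↦ (t, Y(t) x)`. -/
def homeo (hY : IsIsometryCurve Y) : (ℝ × E3) ≃ₜ (ℝ × E3) where
  toFun z := (z.1, act (Y z.1) z.2)
  invFun z := (z.1, ContinuousLinearMap.adjoint (Y z.1).1 (z.2 - (Y z.1).2))
  left_inv z := by
    refine Prod.ext rfl ?_
    have := congrArg (fun B : E3 →L[ℝ] E3 => B z.2) (hY.adjoint_comp z.1)
    simpa [act] using this
  right_inv z := by
    refine Prod.ext rfl ?_
    have := congrArg (fun B : E3 →L[ℝ] E3 => B (z.2 - (Y z.1).2)) (hY.comp_adjoint z.1)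
    simp only [ContinuousLinearMap.comp_apply, ContinuousLinearMap.id_apply] at this
    simp only [act, this]
    abel
  continuous_toFun := continuous_fst.prodMk hY.continuous_act'
  continuous_invFun := by
    have h1 : Continuous fun z : ℝ × E3 => ContinuousLinearMap.adjoint (Y z.1).1 :=
      ContinuousLinearMap.adjoint.continuous.comp
        (continuous_fst.comp (hY.continuous.comp continuous_fst))
    have h2 : Continuous fun z : ℝ × E3 => z.2 - (Y z.1).2 :=
      continuous_snd.sub (continuous_snd.comp (hY.continuous.comp continuous_fst))
    exact continuous_fst.prodMk (h1.clm_apply h2)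

lemma homeo_apply (hY : IsIsometryCurve Y) (z : ℝ × E3) : hY.homeo z = (z.1, act (Y z.1) z.2) := rfl

/-- At a fixed time, the isometry as a homeomorphism. -/
def homeoAt (hY : IsIsometryCurve Y) (t : ℝ) : E3 ≃ₜ E3 where
  toFun x := act (Y t) x
  invFun x := (hY.homeo.symm (t, x)).2
  left_inv x := congrArg Prod.snd (hY.homeo.left_inv (t, x))
  right_inv x := congrArg Prod.snd (hY.homeo.right_inv (t, x))
  continuous_toFun := hY.continuous_act'.comp (continuous_const.prodMk continuous_id)
  continuous_invFun :=
    continuous_snd.comp (hY.homeo.symm.continuous.comp (continuous_const.prodMk continuous_id))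

lemma measurePreserving_act (hY : IsIsometryCurve Y) (t : ℝ) : MeasurePreserving (act (Y t)) volume volume := by
  let e : E3 →ₗᵢ[ℝ] E3 := ⟨(Y t).1.toLinearMap, hY.isometry t⟩
  have h1 : MeasurePreserving (e.toLinearIsometryEquiv rfl) volume volume :=
    LinearIsometryEquiv.measurePreserving _
  exact (measurePreserving_add_right volume (Y t).2).comp h1

lemma measurePreserving_homeo (hY : IsIsometryCurve Y) : MeasurePreserving hY.homeo volume volume :=
  (MeasurePreserving.id volume).skew_product (g := fun t x => act (Y t) x)
    hY.continuous_act'.measurable (Eventually.of_forall fun t => (hY.measurePreserving_act t).map_eq)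

lemma measurePreserving_homeo_cyl (hY : IsIsometryCurve Y) (T : ℝ) :
    MeasurePreserving hY.homeo (cyl T univ) (cyl T univ) := by
  have := hY.measurePreserving_homeo.restrict_preimage
    (measurableSet_Ioo (a := (0 : ℝ)) (b := T) |>.prod (MeasurableSet.univ (α := E3)))
  have h2 : hY.homeo ⁻¹' (Ioo 0 T ×ˢ univ) = Ioo 0 T ×ˢ univ := by
    ext z; simp [hY.homeo_apply]
  rwa [h2] at this

end IsIsometryCurve

/-! ### Testing -/

/-- A function on `(0, T)` whose distributional derivative vanishes, with initial value `c`. -/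
lemma ae_eq_const_of_weak {T c : ℝ} {f : ℝ → ℝ} (hf : IntegrableOn f (Ioo 0 T))
    (h : ∀ η : ℝ → ℝ, ContDiff ℝ ∞ η → HasCompactSupport η → tsupport η ⊆ Iio T →
      (∫ t in Ioo 0 T, f t * deriv η t) + η 0 * c = 0) :
    ∀ᵐ t ∂volume.restrict (Ioo 0 T), f t = c := by
  have hfc : IntegrableOn (fun t => f t - c) (Ioo 0 T) :=
    hf.sub (integrableOn_const (by simp))
  have := isOpen_Ioo.ae_eq_zero_of_integral_contDiff_smul_eq_zero (μ := volume)
    (f := fun t => f t - c) (U := Ioo 0 T) hfc.locallyIntegrableOn ?_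
  · rw [ae_restrict_iff' measurableSet_Ioo]
    filter_upwards [this] with t ht hm
    linarith [ht hm]
  -- Any `θ` supported in `(0, T)` is turned into the derivative on `(0, T)` of an admissible `η`.
  intro θ hθ hθc hθs
  have h0T : ∀ t ∉ Ioo 0 T, θ t = 0 := fun t ht => image_eq_zero_of_notMem_tsupport fun h => ht (hθs h)
  obtain ⟨b, hbT, hb⟩ : ∃ b < T, ∀ t, b < t → θ t = 0 := by
    rcases (tsupport θ).eq_empty_or_nonempty with he | hne
    · exact ⟨T - 1, by linarith, fun t _ => image_eq_zero_of_notMem_tsupport (by simp [he])⟩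
    · obtain ⟨b, hb, hmax⟩ := hθc.isCompact.exists_isMaxOn hne continuous_id.continuousOn
      refine ⟨b, (hθs hb).2, fun t ht => image_eq_zero_of_notMem_tsupport fun h => ?_⟩
      exact absurd (hmax h) (not_le.2 ht)
  have hθi : Integrable θ := hθ.continuous.integrable_of_hasCompactSupport hθc
  set I := ∫ t in (0 : ℝ)..b, θ t with hI
  -- The primitive of `θ` that vanishes after the support of `θ`; its value at `0` is minus the
  -- integral of `θ`, which brings in the initial value `c`.
  set p : ℝ → ℝ := curve (-I) θ with hp
  have hpb : ∀ t, b ≤ t → p t = 0 := by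
    intro t ht
    have h1 : ∫ s in b..t, θ s = 0 := by
      rw [intervalIntegral.integral_of_le ht]
      refine setIntegral_eq_zero_of_forall_eq_zero fun s hs => hb s hs.1
    rw [hp, curve, ← intervalIntegral.integral_add_adjacent_intervals hθi.intervalIntegrable
      hθi.intervalIntegrable (b := b), h1, hI]
    ring
  -- This factor is `1` for `t ≥ -1` and `0` for `t ≤ -2`: it makes the support compact without
  -- affecting `[0, T)`.
  let κ : ℝ → ℝ := fun t => Real.smoothTransition (t + 2)
  have hκ : ContDiff ℝ ∞ κ := Real.smoothTransition.contDiff.comp (by fun_prop)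
  set η : ℝ → ℝ := fun t => κ t * p t with hη
  have hηs : ContDiff ℝ ∞ η := hκ.mul (contDiff_curve _ hθ)
  have hsupp : tsupport η ⊆ Icc (-2) b := by
    refine closure_minimal (fun t ht => ?_) isClosed_Icc
    rw [Function.mem_support] at ht
    constructor
    · by_contra! hlt
      exact ht (by simp [hη, κ, Real.smoothTransition.zero_of_nonpos (by linarith : t + 2 ≤ 0)])
    · by_contra! hlt
      exact ht (by simp [hη, hpb t hlt.le])
  have key := h η hηs (isCompact_Icc.of_isClosed_subset (isClosed_tsupport _) hsupp)
    (hsupp.trans fun t ht => ht.2.trans_lt hbT)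
  have hd : ∀ t ∈ Ioo 0 T, deriv η t = θ t := by
    intro t ht
    have : η =ᶠ[𝓝 t] p := by
      filter_upwards [lt_mem_nhds ht.1] with s hs
      simp [hη, κ, Real.smoothTransition.one_of_one_le (by linarith : 1 ≤ s + 2)]
    rw [this.deriv_eq]
    exact (hasDerivAt_curve _ hθ.continuous t).deriv
  have hη0 : η 0 = -I := by
    simp only [hη, hp, curve_zero, κ]
    rw [Real.smoothTransition.one_of_one_le (by norm_num)]; ring
  have hIθ : I = ∫ t in Ioo 0 T, θ t := by
    have h1 : p T = 0 := hpb T hbT.le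
    rw [hp, curve] at h1
    have h2 : ∫ s in (0 : ℝ)..T, θ s = ∫ t in Ioo 0 T, θ t := by
      rcases le_or_gt 0 T with hT | hT
      · rw [intervalIntegral.integral_of_le hT, integral_Ioc_eq_integral_Ioo]
      · have : θ = 0 := funext fun t => h0T t (by simp [Ioo_eq_empty_of_le hT.le])
        simp [this]
    linarith
  rw [setIntegral_congr_fun measurableSet_Ioo (fun t ht => by rw [hd t ht]), hη0, hIθ] at key
  have hfθ : IntegrableOn (fun t => f t * θ t) (Ioo 0 T) := by
    obtain ⟨C, hC⟩ := hθ.continuous.bounded_above_of_compact_support hθc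
    exact hf.mul_bdd (c := C) hθ.continuous.aestronglyMeasurable (Eventually.of_forall hC)
  have : ∫ t, θ t • (f t - c) = ∫ t in Ioo 0 T, (f t * θ t - θ t * c) := by
    rw [← setIntegral_eq_integral_of_forall_compl_eq_zero (s := Ioo 0 T)]
    · refine setIntegral_congr_fun measurableSet_Ioo fun t _ => ?_
      simp only [smul_eq_mul]; ring
    · intro t ht
      simp [h0T t ht]
  rw [this, integral_sub hfθ (hθi.integrableOn.mul_const c), integral_mul_const]
  linarith

lemma cyl_univ_eq_prod (T : ℝ) :
    cyl T univ = (volume.restrict (Ioo 0 T)).prod (volume : Measure E3) := by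
  rw [cyl, Measure.volume_eq_prod, ← Measure.prod_restrict, Measure.restrict_univ]

lemma cyl_eq_prod (T : ℝ) (Ω : Set E3) :
    cyl T Ω = (volume.restrict (Ioo 0 T)).prod (volume.restrict Ω) := by
  rw [cyl, Measure.volume_eq_prod, ← Measure.prod_restrict]

/-- An integrable function on `(0, T) × ℝ³` which is orthogonal to all test functions at almost
every time vanishes. -/
lemma ae_eq_zero_of_slice_tests {T : ℝ} {g : ℝ × E3 → ℝ} (hg : Integrable g (cyl T univ))
    (h : ∀ ζ : E3 → ℝ, ContDiff ℝ ∞ ζ → HasCompactSupport ζ →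
      ∀ᵐ t ∂volume.restrict (Ioo 0 T), ∫ x, ζ x * g (t, x) = 0) :
    g =ᵐ[cyl T univ] 0 := by
  rw [cyl_univ_eq_prod] at hg ⊢
  set μ := volume.restrict (Ioo (0 : ℝ) T) with hμ
  -- The exceptional set of times depends on `ζ`. Integrating first over a measurable set `A` of
  -- times removes it: the resulting function of `x` is orthogonal to all tests, hence null.
  -- Rectangles then determine `g`.
  have hrect : ∀ A : Set ℝ, MeasurableSet A → ∀ B : Set E3, MeasurableSet B →
      ∫ z in A ×ˢ B, g z ∂μ.prod volume = 0 := by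
    intro A hA B hB
    have hgA : Integrable g ((μ.restrict A).prod volume) := by
      have := hg.restrict (s := A ×ˢ univ)
      rwa [← Measure.prod_restrict, Measure.restrict_univ] at this
    have hz : ∀ᵐ x : E3, ∫ t in A, g (t, x) ∂μ = 0 := by
      refine ae_eq_zero_of_integral_contDiff_smul_eq_zero
        hgA.integral_prod_right.locallyIntegrable fun ζ hζ hζc => ?_
      obtain ⟨C, hC⟩ := hζ.continuous.bounded_above_of_compact_support hζc
      have hi : Integrable (fun z : ℝ × E3 => ζ z.2 * g z) ((μ.restrict A).prod volume) :=
        hgA.bdd_mul (c := C) (hζ.continuous.comp continuous_snd).aestronglyMeasurable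
          (Eventually.of_forall fun z => hC z.2)
      simp only [smul_eq_mul, ← integral_const_mul]
      rw [integral_integral_swap (f := fun x t => ζ x * g (t, x))
        (hi.swap)]
      refine integral_eq_zero_of_ae ?_
      exact ae_restrict_of_ae (h ζ hζ hζc)
    rw [← Measure.prod_restrict]
    have hgAB : Integrable g ((μ.restrict A).prod (volume.restrict B)) := by
      rw [Measure.prod_restrict]; exact hg.restrict
    rw [integral_prod_symm _ hgAB]
    refine integral_eq_zero_of_ae ?_
    exact ae_restrict_of_ae hz
  have htot : ∫ z, g z ∂μ.prod volume = 0 := by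
    have := hrect univ MeasurableSet.univ univ MeasurableSet.univ
    simpa using this
  suffices hall : ∀ s, MeasurableSet s → ∫ z in s, g z ∂μ.prod volume = 0 from
    hg.ae_eq_zero_of_forall_setIntegral_eq_zero fun s hs _ => hall s hs
  intro s hs
  induction s, hs using MeasurableSpace.induction_on_inter generateFrom_prod.symm isPiSystem_prod with
  | empty => simp
  | basic s hs =>
    obtain ⟨A, hA, B, hB, rfl⟩ := hs
    exact hrect A hA B hB
  | compl s hs ih =>
    have := integral_add_compl hs hg
    rw [htot, ih] at this
    linarith
  | iUnion f hd hm ih =>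
    rw [integral_iUnion hm hd hg.integrableOn]
    simp [ih]

/-! ### Transport along rigid flows -/

lemma hasFDerivAt_act_apply (p : ℝ × E3 × Aff) (d : ℝ × E3 × Aff) :
    DifferentiableAt ℝ (fun p : ℝ × E3 × Aff => act p.2.2 p.2.1) p ∧
    fderiv ℝ (fun p : ℝ × E3 × Aff => act p.2.2 p.2.1) p d
      = p.2.2.1 d.2.1 + d.2.2.1 p.2.1 + d.2.2.2 := by
  have hx : HasFDerivAt (fun p : ℝ × E3 × Aff => p.2.1)
      ((ContinuousLinearMap.fst ℝ E3 Aff).comp (ContinuousLinearMap.snd ℝ ℝ (E3 × Aff))) p :=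
    hasFDerivAt_fst.comp p hasFDerivAt_snd
  have hQ : HasFDerivAt (fun p : ℝ × E3 × Aff => p.2.2.1)
      ((ContinuousLinearMap.fst ℝ (E3 →L[ℝ] E3) E3).comp ((ContinuousLinearMap.snd ℝ E3 Aff).comp
        (ContinuousLinearMap.snd ℝ ℝ (E3 × Aff)))) p :=
    hasFDerivAt_fst.comp p (hasFDerivAt_snd.comp p hasFDerivAt_snd)
  have hy : HasFDerivAt (fun p : ℝ × E3 × Aff => p.2.2.2)
      ((ContinuousLinearMap.snd ℝ (E3 →L[ℝ] E3) E3).comp ((ContinuousLinearMap.snd ℝ E3 Aff).comp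
        (ContinuousLinearMap.snd ℝ ℝ (E3 × Aff)))) p :=
    hasFDerivAt_snd.comp p (hasFDerivAt_snd.comp p hasFDerivAt_snd)
  have h := (hQ.clm_apply hx).add hy
  refine ⟨h.differentiableAt, ?_⟩
  have h2 : fderiv ℝ (fun p : ℝ × E3 × Aff => act p.2.2 p.2.1) p = _ := h.fderiv
  rw [h2]
  simp [add_assoc]

/-- Weak transport tested with functions following an absolutely continuous affine motion. -/
lemma IsWeakTransport.integral_curve {T R M : ℝ} {v : ℝ × E3 → E3} {f : ℝ × E3 → ℝ} {f₀ : E3 → ℝ}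
    (h : IsWeakTransport T v f f₀) (hM : 0 ≤ M) (hfM : ∀ᵐ z ∂cyl T univ, |f z| ≤ M)
    (hfR : ∀ᵐ z ∂cyl T univ, f z ≠ 0 → ‖z.2‖ ≤ R) (hf₀R : ∀ᵐ x, f₀ x ≠ 0 → ‖x‖ ≤ R)
    {g : ℝ → Aff} (hg : Integrable g) {ζ : E3 → ℝ} (hζ : ContDiff ℝ ∞ ζ)
    (hζg : ∀ᵐ z ∂cyl T univ, f z ≠ 0 →
      fderiv ℝ ζ (act (curve (ContinuousLinearMap.id ℝ E3, 0) g z.1) z.2)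
        ((curve (ContinuousLinearMap.id ℝ E3, (0 : E3)) g z.1).1 (v z) + (g z.1).1 z.2
          + (g z.1).2) = 0)
    {η : ℝ → ℝ} (hη : ContDiff ℝ ∞ η) (hηc : HasCompactSupport η) (hηT : tsupport η ⊆ Iio T) :
    ∫ z, f z * (deriv η z.1 * ζ (act (curve (ContinuousLinearMap.id ℝ E3, 0) g z.1) z.2))
      ∂cyl T univ + η 0 * ∫ x, f₀ x * ζ x = 0 := by
  obtain ⟨hf, hfv, hf₀, htest⟩ := h
  set R' := max R 0 + 1 with hR'
  have hR'0 : 0 < R' := by positivity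
  have hRR' : R < R' := by have := le_max_left R 0; linarith
  let κ : ContDiffBump (0 : E3) := ⟨R', R' + 1, hR'0, by linarith⟩
  -- The factor `κ` provides compact support in `x` and equals `1` on a neighbourhood of the points
  -- where `f` is nonzero.
  set H : ℝ × E3 × Aff → ℝ := fun p => κ p.2.1 * (η p.1 * ζ (act p.2.2 p.2.1)) with hH
  have hactp : ContDiff ℝ ∞ (fun p : ℝ × E3 × Aff => act p.2.2 p.2.1) :=
    contDiff_act.comp (by fun_prop : ContDiff ℝ ∞ fun p : ℝ × E3 × Aff => (p.2.2, p.2.1))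
  have hHs : ContDiff ℝ ∞ H := by
    refine ContDiff.mul ?_ (ContDiff.mul ?_ ?_)
    · exact κ.contDiff.comp (by fun_prop : ContDiff ℝ ∞ fun p : ℝ × E3 × Aff => p.2.1)
    · exact hη.comp contDiff_fst
    · exact hζ.comp hactp
  obtain ⟨τ, hτ⟩ : ∃ τ, ∀ t, η t ≠ 0 → |t| ≤ τ := by
    obtain ⟨τ, hτ⟩ := hηc.isCompact.isBounded.exists_norm_le
    exact ⟨τ, fun t ht => hτ t (subset_tsupport _ ht)⟩
  have hκ0 : ∀ x : E3, κ x ≠ 0 → ‖x‖ ≤ R' + 1 := by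
    intro x hx
    by_contra! hlt
    exact hx (κ.zero_of_le_dist (by simpa using hlt.le))
  have hK : ∀ t x y, H (t, x, y) ≠ 0 → |t| ≤ τ ∧ ‖x‖ ≤ R' + 1 := by
    intro t x y hne
    exact ⟨hτ t (left_ne_zero_of_mul (right_ne_zero_of_mul hne)), hκ0 x (left_ne_zero_of_mul hne)⟩
  obtain ⟨gk, hgs, hgi, hgt⟩ := exists_smooth_approx hg
  set y₀ : Aff := (ContinuousLinearMap.id ℝ E3, 0) with hy₀
  have hlim := tendsto_integral_fderiv_curve hHs hK hM hf hfM hfv 1 y₀ hg hgs hgi hgt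
  have hfR₀ : ∫ x, f₀ x * H (0, x, y₀) = η 0 * ∫ x, f₀ x * ζ x := by
    rw [← integral_const_mul]
    refine integral_congr_ae ?_
    filter_upwards [hf₀R] with x hx
    by_cases h0 : f₀ x = 0
    · simp [h0]
    · have : κ x = 1 := κ.one_of_mem_closedBall (by simpa using (hx h0).trans hRR'.le)
      simp only [hH, this, hy₀, act_id]
      ring
  -- Along smooth curves the composition is an admissible test function. All these curves start at
  -- the identity, so the initial term is the same for every `k`.
  have hconst : ∀ k, ∫ z, f z • fderiv ℝ (fun z : ℝ × E3 => H (z.1, z.2, curve y₀ (gk k) z.1)) z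
      (1, v z) ∂cyl T univ = -(η 0 * ∫ x, f₀ x * ζ x) := by
    intro k
    have := htest (fun z : ℝ × E3 => H (z.1, z.2, curve y₀ (gk k) z.1)) ?_ ?_ ?_
    · simp only [curve_zero, hfR₀] at this
      simp only [smul_eq_mul]
      linarith
    · refine hHs.comp (contDiff_fst.prodMk (contDiff_snd.prodMk ?_))
      exact (contDiff_curve y₀ (hgs k)).comp contDiff_fst
    · refine HasCompactSupport.of_support_subset_isCompact
        ((isCompact_closedBall (0 : ℝ) τ).prod (isCompact_closedBall (0 : E3) (R' + 1))) ?_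
      rintro ⟨t, x⟩ hne
      have := hK t x _ hne
      simpa using this
    · have hsub : tsupport (fun z : ℝ × E3 => H (z.1, z.2, curve y₀ (gk k) z.1))
          ⊆ tsupport η ×ˢ univ := by
        refine closure_minimal ?_ ((isClosed_tsupport η).prod isClosed_univ)
        rintro ⟨t, x⟩ hne
        exact ⟨subset_tsupport _ (left_ne_zero_of_mul (right_ne_zero_of_mul hne)), mem_univ _⟩
      exact hsub.trans (prod_mono hηT Subset.rfl)
  have heq := tendsto_nhds_unique (hlim.congr hconst) tendsto_const_nhds
  -- Where `f` is nonzero, `hζg` annihilates the derivative of `ζ` of the moved point; only the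
  -- derivative of `η` survives.
  have hident : ∫ z, f z • fderiv ℝ H (z.1, z.2, curve y₀ g z.1) (1, v z, (1 : ℝ) • g z.1)
      ∂cyl T univ = ∫ z, f z * (deriv η z.1 * ζ (act (curve y₀ g z.1) z.2)) ∂cyl T univ := by
    refine integral_congr_ae ?_
    filter_upwards [hfR, hζg] with z hzR hzζ
    by_cases h0 : f z = 0
    · simp [h0]
    simp only [smul_eq_mul]
    congr 1
    set p : ℝ × E3 × Aff := (z.1, z.2, curve y₀ g z.1) with hp
    have hloc : H =ᶠ[𝓝 p] fun p => η p.1 * ζ (act p.2.2 p.2.1) := by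
      have ho : IsOpen {p : ℝ × E3 × Aff | ‖p.2.1‖ < R'} := isOpen_lt (by fun_prop) continuous_const
      filter_upwards [ho.mem_nhds ((hzR h0).trans_lt hRR')] with q hq
      have : κ q.2.1 = 1 := κ.one_of_mem_closedBall (by simpa using (show ‖q.2.1‖ < R' from hq).le)
      simp [hH, this]
    rw [hloc.fderiv_eq]
    have hd1 : HasFDerivAt (fun p : ℝ × E3 × Aff => η p.1)
        ((ContinuousLinearMap.toSpanSingleton ℝ (deriv η z.1)).comp
          (ContinuousLinearMap.fst ℝ ℝ (E3 × Aff))) p :=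
      ((hη.differentiable (by simp)).differentiableAt.hasDerivAt.hasFDerivAt
        : HasFDerivAt η _ p.1).comp p hasFDerivAt_fst
    have hd2 : HasFDerivAt (fun p : ℝ × E3 × Aff => ζ (act p.2.2 p.2.1))
        ((fderiv ℝ ζ (act p.2.2 p.2.1)).comp
          (fderiv ℝ (fun p : ℝ × E3 × Aff => act p.2.2 p.2.1) p)) p :=
      HasFDerivAt.comp p (hζ.differentiable (by simp)).differentiableAt.hasFDerivAt
        (hasFDerivAt_act_apply p 0).1.hasFDerivAt
    have hd3 : fderiv ℝ (fun p : ℝ × E3 × Aff => η p.1 * ζ (act p.2.2 p.2.1)) p = _ :=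
      (hd1.mul hd2).fderiv
    rw [hd3]
    have hz0 := hzζ h0
    simp only [add_apply, smul_apply, ContinuousLinearMap.comp_apply,
      (hasFDerivAt_act_apply p _).2, smul_eq_mul, one_smul]
    simp only [hp]
    rw [hz0]
    simp
    ring
  rw [← hident]
  exact add_eq_zero_iff_eq_neg.2 heq

/-- A bounded transported quantity has constant integrals against functions following the
motion. -/
lemma IsWeakTransport.ae_slice_integral {T R M : ℝ} {v : ℝ × E3 → E3} {f : ℝ × E3 → ℝ}
    {f₀ : E3 → ℝ} (h : IsWeakTransport T v f f₀) (hM : 0 ≤ M)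
    (hfM : ∀ᵐ z ∂cyl T univ, |f z| ≤ M)
    (hfR : ∀ᵐ z ∂cyl T univ, f z ≠ 0 → ‖z.2‖ ≤ R) (hf₀R : ∀ᵐ x, f₀ x ≠ 0 → ‖x‖ ≤ R)
    {g : ℝ → Aff} (hg : Integrable g) {ζ : E3 → ℝ} (hζ : ContDiff ℝ ∞ ζ) {C : ℝ}
    (hζC : ∀ x, ‖ζ x‖ ≤ C)
    (hζg : ∀ᵐ z ∂cyl T univ, f z ≠ 0 →
      fderiv ℝ ζ (act (curve (ContinuousLinearMap.id ℝ E3, 0) g z.1) z.2)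
        ((curve (ContinuousLinearMap.id ℝ E3, (0 : E3)) g z.1).1 (v z) + (g z.1).1 z.2
          + (g z.1).2) = 0) :
    ∀ᵐ t ∂volume.restrict (Ioo 0 T),
      ∫ x, ζ (act (curve (ContinuousLinearMap.id ℝ E3, 0) g t) x) * f (t, x)
        = ∫ x, f₀ x * ζ x := by
  set Y := curve (ContinuousLinearMap.id ℝ E3, (0 : E3)) g with hY
  have hYc : Continuous fun z : ℝ × E3 => ζ (act (Y z.1) z.2) :=
    hζ.continuous.comp (continuous_act.comp
      (((continuous_curve _ hg).comp continuous_fst).prodMk continuous_snd))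
  have hfi : Integrable (fun z => ζ (act (Y z.1) z.2) * f z) (cyl T univ) :=
    h.1.bdd_mul (c := C) hYc.aestronglyMeasurable (Eventually.of_forall fun z => hζC _)
  rw [cyl_univ_eq_prod] at hfi
  -- The time function of the slice integrals has zero weak derivative and initial value `∫ f₀ ζ`.
  refine ae_eq_const_of_weak hfi.integral_prod_left fun η hη hηc hηT => ?_
  have := h.integral_curve hM hfM hfR hf₀R hg hζ hζg hη hηc hηT
  rw [← hY] at this
  obtain ⟨D, hD⟩ := (hη.continuous_deriv (by simp)).bounded_above_of_compact_support hηc.deriv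
  have hi : Integrable (fun z : ℝ × E3 => deriv η z.1 * (ζ (act (Y z.1) z.2) * f z))
      ((volume.restrict (Ioo 0 T)).prod volume) :=
    hfi.bdd_mul (c := D) ((hη.continuous_deriv (by simp)).comp continuous_fst).aestronglyMeasurable
      (Eventually.of_forall fun z => hD _)
  have h3 : ∀ z : ℝ × E3, f z * (deriv η z.1 * ζ (act (Y z.1) z.2))
      = deriv η z.1 * (ζ (act (Y z.1) z.2) * f z) := fun z => by ring
  have h4 : ∫ t in Ioo 0 T, (∫ x, ζ (act (Y t) x) * f (t, x)) * deriv η t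
      = ∫ z, f z * (deriv η z.1 * ζ (act (Y z.1) z.2)) ∂cyl T univ := by
    simp only [h3]
    rw [cyl_univ_eq_prod, integral_prod _ hi]
    refine integral_congr_ae (Eventually.of_forall fun t => ?_)
    change (∫ x, ζ (act (Y t) x) * f (t, x)) * deriv η t
      = ∫ x, deriv η t * (ζ (act (Y t) x) * f (t, x))
    rw [integral_const_mul, mul_comm]
  exact (congrArg (· + η 0 * ∫ x, f₀ x * ζ x) h4).trans this

/-- The total amount of a transported quantity is conserved. -/
lemma IsWeakTransport.ae_integral_eq {T R M : ℝ} {v : ℝ × E3 → E3} {f : ℝ × E3 → ℝ}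
    {f₀ : E3 → ℝ} (h : IsWeakTransport T v f f₀) (hM : 0 ≤ M)
    (hfM : ∀ᵐ z ∂cyl T univ, |f z| ≤ M)
    (hfR : ∀ᵐ z ∂cyl T univ, f z ≠ 0 → ‖z.2‖ ≤ R) (hf₀R : ∀ᵐ x, f₀ x ≠ 0 → ‖x‖ ≤ R) :
    ∀ᵐ t ∂volume.restrict (Ioo 0 T), ∫ x, f (t, x) = ∫ x, f₀ x := by
  have h0i : Integrable (fun _ : ℝ => (0 : Aff)) := integrable_zero ℝ Aff volume
  have hz : ∀ x w : E3, fderiv ℝ (fun _ : E3 => (1 : ℝ)) x w = 0 := fun x w => by simp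
  -- With `ζ = 1` the gradient vanishes, so any curve may be used.
  have := h.ae_slice_integral hM hfM hfR hf₀R (g := fun _ => 0) h0i
    (ζ := fun _ => 1) contDiff_const (C := 1) (by simp)
    (Eventually.of_forall fun z _ => hz _ _)
  simpa using this

/-- A bounded quantity transported by a rigid field is constant along its flow. -/
lemma IsWeakTransport.ae_eq_comp_flow {T R M : ℝ} {v : ℝ × E3 → E3} {f : ℝ × E3 → ℝ}
    {f₀ : E3 → ℝ} (h : IsWeakTransport T v f f₀) (hM : 0 ≤ M)
    (hfM : ∀ᵐ z ∂cyl T univ, |f z| ≤ M)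
    (hfR : ∀ᵐ z ∂cyl T univ, f z ≠ 0 → ‖z.2‖ ≤ R) (hf₀R : ∀ᵐ x, f₀ x ≠ 0 → ‖x‖ ≤ R)
    {a om : ℝ → E3} {Y : ℝ → Aff} (hY : IsRigidFlow a om Y)
    (hv : ∀ z : ℝ × E3, z.1 ∈ Ioo 0 T → v z = a z.1 + cross (om z.1) z.2) :
    f =ᵐ[cyl T univ] fun z => f₀ (act (Y z.1) z.2) := by
  have hI := hY.isIsometryCurve
  have hmp := hI.measurePreserving_homeo_cyl T
  have hmps : MeasurePreserving hI.homeo.symm (cyl T univ) (cyl T univ) :=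
    MeasurePreserving.symm hI.homeo.toMeasurableEquiv hmp
  -- The claim in Lagrangian coordinates: the pulled-back quantity no longer depends on time.
  set G : ℝ × E3 → ℝ := fun z => f (hI.homeo.symm z) - f₀ z.2 with hG
  have hi1 : Integrable (fun z => f (hI.homeo.symm z)) (cyl T univ) :=
    hmps.integrable_comp_of_integrable h.1
  have hi2 : Integrable (fun z : ℝ × E3 => f₀ z.2) (cyl T univ) := by
    rw [cyl_univ_eq_prod]
    exact h.2.2.1.comp_snd _
  have hG0 : G =ᵐ[cyl T univ] 0 := by
    refine ae_eq_zero_of_slice_tests (hi1.sub hi2) fun ζ hζ hζc => ?_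
    obtain ⟨C, hC⟩ := hζ.continuous.bounded_above_of_compact_support hζc
    have hmem : ∀ᵐ z ∂cyl T univ, z.1 ∈ Ioo 0 T := by
      rw [cyl]
      filter_upwards [ae_restrict_mem (measurableSet_Ioo.prod MeasurableSet.univ)] with z hz
      exact hz.1
    -- The hypothesis on `ζ` holds because `Y' = -Y V`: the velocity of the flow cancels the
    -- transport by `v`.
    have hs := h.ae_slice_integral hM hfM hfR hf₀R hY.integrable hζ hC (by
      rw [← hY.eq_curve]
      filter_upwards [hmem] with z hz _
      rw [hv z hz]
      simp)
    rw [← hY.eq_curve] at hs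
    rw [cyl_univ_eq_prod] at hi1
    filter_upwards [hs, hi1.prod_right_ae] with t ht hti
    have hch : ∫ x, ζ x * f (hI.homeo.symm (t, x)) = ∫ x, ζ (act (Y t) x) * f (t, x) := by
      rw [← (hI.measurePreserving_act t).integral_comp
        (hI.homeoAt t).measurableEmbedding (fun x => ζ x * f (hI.homeo.symm (t, x)))]
      refine integral_congr_ae (Eventually.of_forall fun x => ?_)
      simp only
      congr 2
      exact hI.homeo.left_inv (t, x)
    simp only [hG, mul_sub]
    rw [integral_sub, hch, ht]
    · simp [mul_comm]
    · exact hti.bdd_mul (c := C) hζ.continuous.aestronglyMeasurable (Eventually.of_forall hC)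
    · exact h.2.2.1.bdd_mul (c := C) hζ.continuous.aestronglyMeasurable (Eventually.of_forall hC)
  have := hmp.quasiMeasurePreserving.ae hG0
  filter_upwards [this] with z hz
  simp only [hG, Pi.zero_apply, hI.homeo_apply] at hz
  have h2 : hI.homeo.symm (z.1, act (Y z.1) z.2) = z := hI.homeo.left_inv z
  rw [h2] at hz
  linarith

/-! ### Inertia of bounded densities -/

/-- Writing a body `S` of density `ρ` as the single density `1_S ρ` on the whole space lets body and
density be estimated, and pass to the limit, as one function. -/
lemma mass_univ_indicator {S : Set E3} (hS : MeasurableSet S) (ρ : E3 → ℝ) :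
    mass univ (S.indicator ρ) = mass S ρ := by
  simp only [mass, Measure.restrict_univ, integral_indicator hS]

lemma setIntegral_indicator_smul {F : Type*} [NormedAddCommGroup F] [NormedSpace ℝ F]
    {S : Set E3} (hS : MeasurableSet S) (ρ : E3 → ℝ) (f : E3 → F) :
    ∫ x in univ, S.indicator ρ x • f x = ∫ x in S, ρ x • f x := by
  rw [Measure.restrict_univ, ← integral_indicator hS]
  congr 1
  funext x
  exact (indicator_smul_apply_left S ρ f x).symm

lemma center_univ_indicator {S : Set E3} (hS : MeasurableSet S) (ρ : E3 → ℝ) :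
    center univ (S.indicator ρ) = center S ρ := by
  rw [center, center, mass_univ_indicator hS, setIntegral_indicator_smul hS]

lemma inertia_univ_indicator {S : Set E3} (hS : MeasurableSet S) (ρ : E3 → ℝ) :
    inertia univ (S.indicator ρ) = inertia S ρ := by
  ext i j
  simp only [inertia, Matrix.of_apply, center_univ_indicator hS]
  exact setIntegral_indicator_smul hS ρ _

lemma rigidProjection_univ_indicator {S : Set E3} (hS : MeasurableSet S) (ρ : E3 → ℝ)
    (u : E3 → E3) : rigidProjection univ (S.indicator ρ) u = rigidProjection S ρ u := by
  funext x
  simp only [rigidProjection, angularVelocity, mass_univ_indicator hS, center_univ_indicator hS,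
    inertia_univ_indicator hS, setIntegral_indicator_smul hS]

/-- A density between `0` and `M`, carried by `Ω`, of mass at least `m₀`. -/
structure IsDensity (Ω : Set E3) (M m₀ : ℝ) (s : E3 → ℝ) : Prop where
  meas : AEStronglyMeasurable s volume
  bound : ∀ᵐ x, 0 ≤ s x ∧ s x ≤ M ∧ (x ∉ Ω → s x = 0)
  mass_ge : m₀ ≤ ∫ x, s x

namespace IsDensity

variable {Ω : Set E3} {R M m₀ : ℝ} {s : E3 → ℝ}

lemma integrable_smul {F : Type*} [NormedAddCommGroup F] [NormedSpace ℝ F]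
    (h : IsDensity Ω M m₀ s) (hΩ : Ω ⊆ Metric.ball 0 R) {f : E3 → F} (hf : Continuous f) :
    Integrable fun x => s x • f x := by
  have hI : IntegrableOn f (Metric.closedBall (0 : E3) R) :=
    hf.continuousOn.integrableOn_compact (isCompact_closedBall _ _)
  rw [← integrable_indicator_iff measurableSet_closedBall] at hI
  refine (hI.norm.const_mul M).mono' (h.meas.smul hf.aestronglyMeasurable) ?_
  filter_upwards [h.bound] with x hx
  rw [norm_smul, Real.norm_of_nonneg hx.1]
  by_cases hxΩ : x ∈ Ω
  · rw [indicator_of_mem (Metric.ball_subset_closedBall (hΩ hxΩ))]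
    gcongr
    exact hx.2.1
  · rw [hx.2.2 hxΩ, zero_mul]
    exact mul_nonneg (hx.1.trans hx.2.1) (norm_nonneg _)

lemma integrable (h : IsDensity Ω M m₀ s) (hΩ : Ω ⊆ Metric.ball 0 R) : Integrable s := by
  simpa using h.integrable_smul hΩ (f := fun _ => (1 : ℝ)) continuous_const

lemma mass_pos (h : IsDensity Ω M m₀ s) (hm : 0 < m₀) : 0 < mass univ s := by
  rw [mass, Measure.restrict_univ]
  exact hm.trans_le h.mass_ge

lemma norm_center_le (h : IsDensity Ω M m₀ s) (hΩ : Ω ⊆ Metric.ball 0 R) (hm : 0 < m₀) :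
    ‖center univ s‖ ≤ R := by
  have hpos := h.mass_pos hm
  rw [center, norm_smul, norm_inv, Real.norm_of_nonneg hpos.le, inv_mul_le_iff₀ hpos, mass,
    Measure.restrict_univ, ← integral_mul_const]
  refine norm_integral_le_of_norm_le ((h.integrable hΩ).mul_const R) ?_
  filter_upwards [h.bound] with x hx
  rw [norm_smul, Real.norm_of_nonneg hx.1]
  by_cases hxΩ : x ∈ Ω
  · have := hΩ hxΩ
    rw [mem_ball_zero_iff] at this
    exact mul_le_mul_of_nonneg_left this.le hx.1
  · simp [hx.2.2 hxΩ]

/-- The rotational energy is bounded below. -/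
lemma exists_coercive (Ω : Set E3) (hR : 0 < R) (hΩ : Ω ⊆ Metric.ball 0 R) (M : ℝ) (hm : 0 < m₀) :
    ∃ c : ℝ, 0 < c ∧ ∀ s, IsDensity Ω M m₀ s → ∀ e h : E3,
      c * ‖e‖ ^ 2 ≤ ∫ x, s x * ‖cross e (x - h)‖ ^ 2 := by
  set v := (volume (Metric.ball (0 : E3) (2 * R))).toReal with hv
  have hvt : volume (Metric.ball (0 : E3) (2 * R)) ≠ ⊤ := measure_ball_lt_top.ne
  -- Chosen so that a slab of half-width `ε` in the ball, filled with density `M`, weighs at most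
  -- `m₀ / 2`.
  set ε := m₀ * R / (4 * (|M| * v + 1)) with hε
  have hv0 : 0 ≤ v := ENNReal.toReal_nonneg
  have hε0 : 0 < ε := by positivity
  have hεle : |M| * (2 * ε / R * v) ≤ m₀ / 2 := by
    have : |M| * (2 * ε / R * v) = m₀ / 2 * ((|M| * v) / (|M| * v + 1)) := by
      rw [hε]; field_simp; ring
    rw [this]
    have : (|M| * v) / (|M| * v + 1) ≤ 1 := by
      rw [div_le_one (by positivity)]; linarith
    nlinarith
  refine ⟨ε ^ 2 * (m₀ / 2), by positivity, fun s hs e h => ?_⟩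
  have hcont : ∀ e h : E3, Continuous fun x : E3 => ‖cross e (x - h)‖ ^ 2 := by
    intro e h
    have : Continuous fun x : E3 => cross e (x - h) := by fun_prop
    fun_prop
  have hunit : ∀ e : E3, ‖e‖ = 1 → ε ^ 2 * (m₀ / 2) ≤ ∫ x, s x * ‖cross e (x - h)‖ ^ 2 := by
    intro e he
    obtain ⟨f, hf, hfe⟩ := exists_unit_inner_le_norm_cross e he
    set A := Metric.ball (0 : E3) R ∩ {x | |inner ℝ f x - inner ℝ f h| < ε} with hA
    have hAm : MeasurableSet A := measurableSet_ball.inter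
      (isOpen_lt (by fun_prop) continuous_const).measurableSet
    have hAv : (volume A).toReal ≤ 2 * ε / R * v := by
      have := volume_slab_le hf 0 (inner ℝ f h) hR hε0
      refine ENNReal.toReal_le_of_le_ofReal (by positivity) (this.trans_eq ?_)
      rw [ENNReal.ofReal_mul (by positivity), hv, ENNReal.ofReal_toReal hvt]
    have hsi := hs.integrable hΩ
    have hMA : ∫ x in A, s x ≤ m₀ / 2 := by
      have hAt : volume A ≠ ⊤ :=
        ((measure_mono inter_subset_left).trans_lt measure_ball_lt_top).ne
      calc ∫ x in A, s x ≤ ∫ _ in A, |M| := by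
            refine setIntegral_mono_ae hsi.integrableOn (integrableOn_const hAt) ?_
            filter_upwards [hs.bound] with x hx
            exact hx.2.1.trans (le_abs_self M)
        _ = |M| * (volume A).toReal := by
            simp [Measure.real, mul_comm]
        _ ≤ |M| * (2 * ε / R * v) := by gcongr
        _ ≤ m₀ / 2 := hεle
    have hsplit := integral_add_compl hAm hsi
    have hge : m₀ / 2 ≤ ∫ x in Aᶜ, s x := by linarith [hs.mass_ge]
    -- At least half the mass lies outside the slab, where `|e × (x - h)| ≥ |f · (x - h)| ≥ ε`.
    calc ε ^ 2 * (m₀ / 2) ≤ ε ^ 2 * ∫ x in Aᶜ, s x := by gcongr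
      _ = ∫ x in Aᶜ, ε ^ 2 * s x := (integral_const_mul _ _).symm
      _ ≤ ∫ x in Aᶜ, s x * ‖cross e (x - h)‖ ^ 2 := by
          refine setIntegral_mono_ae_restrict (hsi.const_mul _).integrableOn
            (hs.integrable_smul hΩ (hcont e h)).integrableOn ?_
          filter_upwards [ae_restrict_of_ae hs.bound, ae_restrict_mem hAm.compl] with x hx hxA
          by_cases hxΩ : x ∈ Ω
          · have h1 : ε ≤ |inner ℝ f x - inner ℝ f h| := by
              by_contra! hlt
              exact hxA ⟨hΩ hxΩ, hlt⟩
            rw [← inner_sub_right] at h1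
            have h2 := h1.trans (hfe (x - h))
            have := hx.1
            rw [mul_comm]
            gcongr
          · simp [hx.2.2 hxΩ]
      _ ≤ ∫ x, s x * ‖cross e (x - h)‖ ^ 2 := by
          refine setIntegral_le_integral (hs.integrable_smul hΩ (hcont e h)) ?_
          filter_upwards [hs.bound] with x hx
          exact mul_nonneg hx.1 (by positivity)
  rcases eq_or_ne e 0 with rfl | he
  · have : ∀ x : E3, cross 0 x = 0 := fun x => by simp [cross]
    simp [this]
  · have hn : 0 < ‖e‖ := norm_pos_iff.2 he
    have h1 := hunit (‖e‖⁻¹ • e) (by rw [norm_smul, norm_inv, norm_norm, inv_mul_cancel₀ hn.ne'])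
    have h2 : ∀ x : E3, s x * ‖cross (‖e‖⁻¹ • e) (x - h)‖ ^ 2
        = (‖e‖ ^ 2)⁻¹ * (s x * ‖cross e (x - h)‖ ^ 2) := by
      intro x
      have : cross (‖e‖⁻¹ • e) (x - h) = ‖e‖⁻¹ • cross e (x - h) := by
        rw [← crossL_apply, map_smul]; rfl
      rw [this, norm_smul, norm_inv, norm_norm]
      ring
    simp only [h2, integral_const_mul] at h1
    rw [inv_mul_eq_div, le_div_iff₀ (by positivity)] at h1
    exact h1

/-- Lagrange's identity `|e|²|y|² - (e · y)² = |e × y|²` turns the quadratic form of the matrix into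
the rotational energy, to which `exists_coercive` applies. -/
lemma inner_inertia_mulVec (h : IsDensity Ω M m₀ s) (hΩ : Ω ⊆ Metric.ball 0 R) (e : E3) :
    inner ℝ (WithLp.toLp 2 ((inertia univ s).mulVec (WithLp.ofLp e)) : E3) e
      = ∫ x, s x * ‖cross e (x - center univ s)‖ ^ 2 := by
  set c := center univ s
  have hi : ∀ i j : Fin 3, Integrable fun x : E3 => s x *
      (‖x - c‖ ^ 2 * (1 : Matrix (Fin 3) (Fin 3) ℝ) i j - (x - c) i * (x - c) j) := by
    intro i j
    exact h.integrable_smul hΩ (f := fun x : E3 =>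
      ‖x - c‖ ^ 2 * (1 : Matrix (Fin 3) (Fin 3) ℝ) i j - (x - c) i * (x - c) j) (by fun_prop)
  have h1 : ∀ x : E3, s x * ‖cross e (x - c)‖ ^ 2 = ∑ i, ∑ j, (e i * e j) * (s x *
      (‖x - c‖ ^ 2 * (1 : Matrix (Fin 3) (Fin 3) ℝ) i j - (x - c) i * (x - c) j)) := by
    intro x
    rw [norm_cross_sq]
    simp only [Fin.sum_univ_three, norm_sq_eq_three, inner_eq_sum_three]
    simp
    ring
  have h2 : ∫ x, s x * ‖cross e (x - c)‖ ^ 2 = ∑ i, ∑ j, (e i * e j) * inertia univ s i j := by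
    simp only [h1]
    rw [integral_finsetSum _ fun i _ => integrable_finsetSum _ fun j _ => (hi i j).const_mul _]
    refine Finset.sum_congr rfl fun i _ => ?_
    rw [integral_finsetSum _ fun j _ => (hi i j).const_mul _]
    refine Finset.sum_congr rfl fun j _ => ?_
    rw [integral_const_mul, inertia, Matrix.of_apply, Measure.restrict_univ]
  rw [h2, inner_eq_sum_three]
  simp only [Fin.sum_univ_three, Matrix.mulVec, dotProduct]
  ring

/-- The inertia matrix is invertible, with a bounded inverse. -/
lemma inertia_inverse (h : IsDensity Ω M m₀ s) (hΩ : Ω ⊆ Metric.ball 0 R) {c : ℝ} (hc : 0 < c)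
    (hcoer : ∀ e h : E3, c * ‖e‖ ^ 2 ≤ ∫ x, s x * ‖cross e (x - h)‖ ^ 2) :
    IsUnit (inertia univ s).det ∧ ∀ b : E3,
      ‖(WithLp.toLp 2 ((inertia univ s)⁻¹.mulVec (WithLp.ofLp b)) : E3)‖ ≤ c⁻¹ * ‖b‖ := by
  -- Coercivity of the quadratic form and Cauchy–Schwarz, divided by `‖e‖`.
  have hbound : ∀ e : E3, c * ‖e‖ ≤
      ‖(WithLp.toLp 2 ((inertia univ s).mulVec (WithLp.ofLp e)) : E3)‖ := by
    intro e
    have h1 := hcoer e (center univ s)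
    rw [← h.inner_inertia_mulVec hΩ] at h1
    have h2 := h1.trans (real_inner_le_norm _ _)
    rcases eq_or_ne e 0 with rfl | he
    · simp
    · have hn : 0 < ‖e‖ := norm_pos_iff.2 he
      rw [sq, ← mul_assoc] at h2
      exact le_of_mul_le_mul_right h2 hn
  have hunit : IsUnit (inertia univ s) := by
    rw [← Matrix.mulVec_injective_iff_isUnit]
    intro v w hvw
    have h1 := hbound (WithLp.toLp 2 v - WithLp.toLp 2 w)
    have h2 : (inertia univ s).mulVec (WithLp.ofLp (WithLp.toLp 2 v - WithLp.toLp 2 w : E3)) = 0 := by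
      rw [WithLp.ofLp_sub, Matrix.mulVec_sub, sub_eq_zero]
      exact hvw
    rw [h2] at h1
    have h3 : ‖(WithLp.toLp 2 v - WithLp.toLp 2 w : E3)‖ ≤ 0 := by
      have : ‖(WithLp.toLp 2 (0 : Fin 3 → ℝ) : E3)‖ = 0 := by simp
      rw [this] at h1
      nlinarith [norm_nonneg (WithLp.toLp 2 v - WithLp.toLp 2 w : E3)]
    have h4 := norm_le_zero_iff.1 h3
    rw [sub_eq_zero] at h4
    exact congrArg WithLp.ofLp h4
  have hdet : IsUnit (inertia univ s).det := (Matrix.isUnit_iff_isUnit_det _).1 hunit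
  refine ⟨hdet, fun b => ?_⟩
  have h1 := hbound (WithLp.toLp 2 ((inertia univ s)⁻¹.mulVec (WithLp.ofLp b)))
  simp only [Matrix.mulVec_mulVec, Matrix.mul_nonsing_inv _ hdet, Matrix.one_mulVec,
    WithLp.toLp_ofLp] at h1
  rw [inv_mul_eq_div, le_div_iff₀ hc]
  linarith

end IsDensity

/-- Convergence of the inertial quantities of converging densities. -/
lemma tendsto_inertial {Ω : Set E3} {R M m₀ : ℝ} (hΩ : Ω ⊆ Metric.ball 0 R) (hm : 0 < m₀)
    {s : ℕ → E3 → ℝ} {s' : E3 → ℝ} (hs : ∀ n, IsDensity Ω M m₀ (s n)) (hs' : IsDensity Ω M m₀ s')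
    (hlim : ∀ᵐ x, Tendsto (fun n => s n x) atTop (𝓝 (s' x)))
    (hdet : IsUnit (inertia univ s').det) :
    Tendsto (fun n => mass univ (s n)) atTop (𝓝 (mass univ s')) ∧
    Tendsto (fun n => center univ (s n)) atTop (𝓝 (center univ s')) ∧
    Tendsto (fun n => (inertia univ (s n))⁻¹) atTop (𝓝 (inertia univ s')⁻¹) := by
  -- Dominated convergence with a weight that varies with `n`, as needed for the inertia, where the
  -- centre of mass moves too.
  have hdom : ∀ {F : Type} [NormedAddCommGroup F] [NormedSpace ℝ F] {f : ℕ → E3 → F}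
      {f' : E3 → F} {K : ℝ}, (∀ n, Continuous (f n)) →
      (∀ n, ∀ x ∈ Metric.ball (0 : E3) R, ‖f n x‖ ≤ K) →
      (∀ x, Tendsto (fun n => f n x) atTop (𝓝 (f' x))) →
      Tendsto (fun n => ∫ x, s n x • f n x) atTop (𝓝 (∫ x, s' x • f' x)) := by
    intro F _ _ f f' K hf hK hff
    refine tendsto_integral_of_dominated_convergence
      ((Metric.ball (0 : E3) R).indicator fun _ => M * K)
      (fun n => (hs n).meas.smul (hf n).aestronglyMeasurable) ?_ (fun n => ?_) ?_
    · rw [integrable_indicator_iff measurableSet_ball]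
      exact integrableOn_const measure_ball_lt_top.ne
    · filter_upwards [(hs n).bound] with x hx
      by_cases hxΩ : x ∈ Ω
      · rw [indicator_of_mem (hΩ hxΩ), norm_smul, Real.norm_of_nonneg hx.1]
        have := hK n x (hΩ hxΩ)
        exact mul_le_mul hx.2.1 this (norm_nonneg _) (hx.1.trans hx.2.1)
      · rw [hx.2.2 hxΩ, zero_smul, norm_zero]
        by_cases hxb : x ∈ Metric.ball (0 : E3) R
        · rw [indicator_of_mem hxb]
          exact mul_nonneg (hx.1.trans hx.2.1) ((norm_nonneg _).trans (hK n x hxb))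
        · rw [indicator_of_notMem hxb]
    · filter_upwards [hlim] with x hx
      exact hx.smul (hff x)
  have h1 : Tendsto (fun n => mass univ (s n)) atTop (𝓝 (mass univ s')) := by
    have := hdom (f := fun _ _ => (1 : ℝ)) (f' := fun _ => 1) (K := 1) (fun _ => continuous_const)
      (by simp) (fun _ => tendsto_const_nhds)
    simpa [mass] using this
  have h2 : Tendsto (fun n => center univ (s n)) atTop (𝓝 (center univ s')) := by
    have := hdom (f := fun _ x => x) (f' := fun x => x) (K := R) (fun _ => continuous_id)
      (fun _ x hx => (mem_ball_zero_iff.1 hx).le) (fun _ => tendsto_const_nhds)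
    simp only [center, Measure.restrict_univ]
    exact (h1.inv₀ (hs'.mass_pos hm).ne').smul this
  refine ⟨h1, h2, ?_⟩
  have h3 : Tendsto (fun n => inertia univ (s n)) atTop (𝓝 (inertia univ s')) := by
    refine tendsto_pi_nhds.2 fun i => tendsto_pi_nhds.2 fun j => ?_
    simp only [inertia, Matrix.of_apply, Measure.restrict_univ]
    refine hdom (f := fun n x => ‖x - center univ (s n)‖ ^ 2 * (1 : Matrix (Fin 3) (Fin 3) ℝ) i j
      - (x - center univ (s n)) i * (x - center univ (s n)) j) (f' := fun x =>
      ‖x - center univ s'‖ ^ 2 * (1 : Matrix (Fin 3) (Fin 3) ℝ) i j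
      - (x - center univ s') i * (x - center univ s') j) (K := (2 * R) ^ 2 + (2 * R) ^ 2) ?_ ?_ ?_
    · intro n; fun_prop
    · intro n x hx
      have hx' : ‖x - center univ (s n)‖ ≤ 2 * R := by
        have a1 := (mem_ball_zero_iff.1 hx).le
        have a2 := (hs n).norm_center_le hΩ hm
        have := norm_sub_le x (center univ (s n))
        linarith
      have hcoord : ∀ (y : E3) (k : Fin 3), |y k| ≤ ‖y‖ := fun y k => PiLp.norm_apply_le y k
      set y := x - center univ (s n)
      have b1 : |‖y‖ ^ 2 * (1 : Matrix (Fin 3) (Fin 3) ℝ) i j| ≤ (2 * R) ^ 2 := by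
        rw [abs_mul, abs_of_nonneg (by positivity)]
        have : |(1 : Matrix (Fin 3) (Fin 3) ℝ) i j| ≤ 1 := by
          rw [Matrix.one_apply]; split_ifs <;> simp
        calc ‖y‖ ^ 2 * |(1 : Matrix (Fin 3) (Fin 3) ℝ) i j| ≤ (2 * R) ^ 2 * 1 := by gcongr
          _ = _ := mul_one _
      have b2 : |y i * y j| ≤ (2 * R) ^ 2 := by
        rw [abs_mul, sq]
        have := hcoord y i
        have := hcoord y j
        have : (0 : ℝ) ≤ 2 * R := (norm_nonneg y).trans hx'
        gcongr <;> linarith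
      exact (abs_sub _ _).trans (add_le_add b1 b2)
    · intro x
      have h4 : Tendsto (fun n => x - center univ (s n)) atTop (𝓝 (x - center univ s')) :=
        h2.const_sub x
      have h5 : Continuous fun y : E3 => ‖y‖ ^ 2 * (1 : Matrix (Fin 3) (Fin 3) ℝ) i j
        - y i * y j := by fun_prop
      exact (h5.tendsto _).comp h4
  -- Inversion is `det⁻¹` times the adjugate, continuous where the determinant is nonzero.
  have h6 : ContinuousAt (fun A : Matrix (Fin 3) (Fin 3) ℝ => A⁻¹) (inertia univ s') := by
    simp only [Matrix.inv_def]
    have hd : ContinuousAt (fun A : Matrix (Fin 3) (Fin 3) ℝ => Ring.inverse A.det)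
        (inertia univ s') := by
      simp only [Ring.inverse_eq_inv']
      exact (continuous_id.matrix_det.continuousAt).inv₀ hdet.ne_zero
    exact hd.smul (continuous_id.matrix_adjugate.continuousAt)
  exact h6.tendsto.comp h3

/-! ### Rigid velocities of bounded bodies -/

/-- Cauchy–Schwarz on `Ω` after bounding the density by `M`. The factor `L` allows `f` to be either
the velocity or its moment about the centre of mass. -/
lemma enorm_integral_density_smul_le {Ω : Set E3} (hΩm : MeasurableSet Ω) {M m₀ L : ℝ}
    {s : E3 → ℝ} (hs : IsDensity Ω M m₀ s) {w f : E3 → E3} (hL : 0 ≤ L)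
    (hw : AEStronglyMeasurable w (volume.restrict Ω)) (hf : ∀ x ∈ Ω, ‖f x‖ ≤ L * ‖w x‖) :
    ‖∫ x, s x • f x‖ₑ ≤ ENNReal.ofReal (M * L) * volume Ω ^ (1 / 2 : ℝ) *
      eLpNorm w 2 (volume.restrict Ω) := by
  calc ‖∫ x, s x • f x‖ₑ ≤ ∫⁻ x, ‖s x • f x‖ₑ := enorm_integral_le_lintegral_enorm _
    _ ≤ ∫⁻ x, Ω.indicator (fun x => ENNReal.ofReal (M * L) * ‖w x‖ₑ) x := by
        refine lintegral_mono_ae ?_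
        filter_upwards [hs.bound] with x hx
        by_cases hxΩ : x ∈ Ω
        · rw [indicator_of_mem hxΩ, ← ofReal_norm, ← ofReal_norm, ← ENNReal.ofReal_mul
            (mul_nonneg (hx.1.trans hx.2.1) hL)]
          apply ENNReal.ofReal_le_ofReal
          rw [norm_smul, Real.norm_of_nonneg hx.1, mul_assoc]
          exact mul_le_mul hx.2.1 (hf x hxΩ) (norm_nonneg _) (hx.1.trans hx.2.1)
        · simp [hx.2.2 hxΩ]
    _ = ENNReal.ofReal (M * L) * eLpNorm w 1 (volume.restrict Ω) := by
        rw [lintegral_indicator hΩm, lintegral_const_mul' _ _ ENNReal.ofReal_ne_top,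
          eLpNorm_one_eq_lintegral_enorm]
    _ ≤ ENNReal.ofReal (M * L) * (eLpNorm w 2 (volume.restrict Ω) * volume Ω ^ (1 / 2 : ℝ)) := by
        gcongr
        have := eLpNorm_le_eLpNorm_mul_rpow_measure_univ (μ := volume.restrict Ω)
          (p := 1) (q := 2) (by norm_num) hw
        refine this.trans_eq ?_
        rw [Measure.restrict_apply_univ]
        norm_num
    _ = _ := by ring

/-- The inverse of the inertia matrix as an operator. -/
def invInertia (s : E3 → ℝ) : E3 →L[ℝ] E3 :=
  Matrix.toEuclideanCLM (𝕜 := ℝ) (inertia univ s)⁻¹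

lemma invInertia_apply (s : E3 → ℝ) (b : E3) :
    invInertia s b = WithLp.toLp 2 ((inertia univ s)⁻¹.mulVec (WithLp.ofLp b)) :=
  Matrix.toEuclideanCLM_toLp _ _

lemma continuous_toEuclideanCLM :
    Continuous (Matrix.toEuclideanCLM (𝕜 := ℝ) : Matrix (Fin 3) (Fin 3) ℝ → (E3 →L[ℝ] E3)) :=
  LinearMap.continuous_of_finiteDimensional
    ((Matrix.toEuclideanCLM (n := Fin 3) (𝕜 := ℝ)).toAlgEquiv.toLinearMap)

/-- The linear velocity `m⁻¹ ∫ σ u` at time `t`. -/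
def linVel (σ : ℝ × E3 → ℝ) (u : ℝ × E3 → E3) (t : ℝ) : E3 :=
  (mass univ fun y => σ (t, y))⁻¹ • ∫ y, σ (t, y) • u (t, y)

/-- The angular velocity at time `t`. -/
def angVel (σ : ℝ × E3 → ℝ) (u : ℝ × E3 → E3) (t : ℝ) : E3 :=
  invInertia (fun y => σ (t, y))
    (∫ y, σ (t, y) • cross (y - center univ fun y => σ (t, y)) (u (t, y)))

lemma rigidProjection_univ (σ : ℝ × E3 → ℝ) (u : ℝ × E3 → E3) (t : ℝ) (x : E3) :
    rigidProjection univ (fun y => σ (t, y)) (fun y => u (t, y)) x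
      = linVel σ u t + cross (angVel σ u t) (x - center univ fun y => σ (t, y)) := by
  simp only [rigidProjection, angularVelocity, linVel, angVel, invInertia_apply,
    Measure.restrict_univ]

/-- A time dependent density `σ` between `0` and `M`, carried by `Ω`, of mass at least `m₀`, and a
square integrable velocity. -/
structure IsBddBody (T : ℝ) (Ω : Set E3) (M m₀ : ℝ) (σ : ℝ × E3 → ℝ) (u : ℝ × E3 → E3) : Prop where
  meas : AEStronglyMeasurable σ (cyl T univ)
  bound : ∀ᵐ z ∂cyl T univ, 0 ≤ σ z ∧ σ z ≤ M ∧ (z.2 ∉ Ω → σ z = 0)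
  mass_ge : ∀ᵐ t ∂volume.restrict (Ioo 0 T), m₀ ≤ ∫ x, σ (t, x)
  velocity : MemLp u 2 (cyl T Ω)

lemma lintegral_eLpNorm_two_sq {T : ℝ} {Ω : Set E3} {u : ℝ × E3 → E3}
    (hu : AEStronglyMeasurable u (cyl T Ω)) :
    ∫⁻ t in Ioo 0 T, eLpNorm (fun x => u (t, x)) 2 (volume.restrict Ω) ^ 2
      = eLpNorm u 2 (cyl T Ω) ^ 2 := by
  have hsq : ∀ {α : Type} [MeasurableSpace α] (μ : Measure α) (f : α → E3),
      eLpNorm f 2 μ ^ 2 = ∫⁻ x, ‖f x‖ₑ ^ 2 ∂μ := by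
    intro α _ μ f
    have := eLpNorm_nnreal_pow_eq_lintegral (μ := μ) (f := f) (p := 2) (by norm_num)
    simpa using this
  simp only [hsq]
  rw [cyl_eq_prod] at hu ⊢
  rw [lintegral_prod _ (hu.enorm.pow_const 2)]

namespace IsBddBody

variable {T : ℝ} {Ω : Set E3} {R M m₀ : ℝ} {σ : ℝ × E3 → ℝ} {u : ℝ × E3 → E3}

lemma ae_density (h : IsBddBody T Ω M m₀ σ u) :
    ∀ᵐ t ∂volume.restrict (Ioo 0 T), IsDensity Ω M m₀ fun x => σ (t, x) := by
  have h1 := h.meas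
  have h2 := h.bound
  rw [cyl_univ_eq_prod] at h1 h2
  filter_upwards [h1.prodMk_left, Measure.ae_ae_of_ae_prod h2, h.mass_ge] with t a b c
  exact ⟨a, b, c⟩

lemma ae_velocity (h : IsBddBody T Ω M m₀ σ u) :
    ∀ᵐ t ∂volume.restrict (Ioo 0 T), MemLp (fun x => u (t, x)) 2 (volume.restrict Ω) := by
  have h1 := h.velocity.1
  have h2 := lintegral_eLpNorm_two_sq h1
  have h3 : eLpNorm u 2 (cyl T Ω) ^ 2 ≠ ⊤ := ENNReal.pow_ne_top h.velocity.2.ne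
  have hm : AEMeasurable (fun t => eLpNorm (fun x => u (t, x)) 2 (volume.restrict Ω) ^ 2)
      (volume.restrict (Ioo 0 T)) := by
    have hsq : ∀ t, eLpNorm (fun x => u (t, x)) 2 (volume.restrict Ω) ^ 2
        = ∫⁻ x in Ω, ‖u (t, x)‖ₑ ^ 2 := by
      intro t
      have := eLpNorm_nnreal_pow_eq_lintegral (μ := volume.restrict Ω) (f := fun x => u (t, x))
        (p := 2) (by norm_num)
      simpa using this
    simp only [hsq]
    rw [cyl_eq_prod] at h1
    exact (h1.enorm.pow_const 2).lintegral_prod_right'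
  rw [cyl_eq_prod] at h1
  filter_upwards [h1.prodMk_left, ae_lt_top' hm (by rw [h2]; exact h3)] with t a b
  refine ⟨a, ?_⟩
  by_contra hc
  rw [not_lt, top_le_iff] at hc
  simp [hc] at b

lemma meas_inner (h : IsBddBody T Ω M m₀ σ u) : AEStronglyMeasurable σ (cyl T Ω) :=
  h.meas.mono_measure (Measure.restrict_mono (prod_mono Subset.rfl (subset_univ Ω)) le_rfl)

lemma aestronglyMeasurable_mass (h : IsBddBody T Ω M m₀ σ u) :
    AEStronglyMeasurable (fun t => mass univ fun y => σ (t, y)) (volume.restrict (Ioo 0 T)) := by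
  have h1 := h.meas
  rw [cyl_univ_eq_prod] at h1
  simpa [mass] using h1.integral_prod_right'

lemma aestronglyMeasurable_center (h : IsBddBody T Ω M m₀ σ u) :
    AEStronglyMeasurable (fun t => center univ fun y => σ (t, y)) (volume.restrict (Ioo 0 T)) := by
  have h1 := h.meas
  rw [cyl_univ_eq_prod] at h1
  have h2 : AEStronglyMeasurable (fun z : ℝ × E3 => σ z • z.2)
      ((volume.restrict (Ioo 0 T)).prod volume) := h1.smul continuous_snd.aestronglyMeasurable
  simp only [center, Measure.restrict_univ]
  exact (h.aestronglyMeasurable_mass.aemeasurable.inv.aestronglyMeasurable).smul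
    h2.integral_prod_right'

lemma aestronglyMeasurable_sub_center (h : IsBddBody T Ω M m₀ σ u) (ν : Measure E3) [SFinite ν] :
    AEStronglyMeasurable (fun z : ℝ × E3 => z.2 - center univ fun y => σ (z.1, y))
      ((volume.restrict (Ioo 0 T)).prod ν) :=
  continuous_snd.aestronglyMeasurable.sub (h.aestronglyMeasurable_center.comp_fst)

/-- The inverse is the reciprocal determinant times the adjugate, and both are measurable functions
of the entries; no invertibility is required here. -/
lemma aestronglyMeasurable_invInertia (h : IsBddBody T Ω M m₀ σ u) :
    AEStronglyMeasurable (fun t => invInertia fun y => σ (t, y))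
      (volume.restrict (Ioo 0 T)) := by
  have h1 := h.meas
  rw [cyl_univ_eq_prod] at h1
  have hc := h.aestronglyMeasurable_sub_center volume
  have hJ : AEStronglyMeasurable (fun t => inertia univ fun y => σ (t, y))
      (volume.restrict (Ioo 0 T)) := by
    have hij : ∀ i j : Fin 3, AEStronglyMeasurable (fun t => inertia univ (fun y => σ (t, y)) i j)
        (volume.restrict (Ioo 0 T)) := by
      intro i j
      simp only [inertia, Matrix.of_apply, Measure.restrict_univ]
      have hcont : Continuous fun y : E3 => ‖y‖ ^ 2 * (1 : Matrix (Fin 3) (Fin 3) ℝ) i j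
        - y i * y j := by fun_prop
      have := h1.mul (hcont.comp_aestronglyMeasurable hc)
      exact this.integral_prod_right'
    have hsum : (fun t => inertia univ fun y => σ (t, y)) = fun t => ∑ i, ∑ j,
        inertia univ (fun y => σ (t, y)) i j • Matrix.single i j (1 : ℝ) := by
      funext t
      conv_lhs => rw [Matrix.matrix_eq_sum_single (inertia univ fun y => σ (t, y))]
      simp [Matrix.smul_single]
    rw [hsum]
    exact Finset.aestronglyMeasurable_fun_sum _ fun i _ =>
      Finset.aestronglyMeasurable_fun_sum _ fun j _ => (hij i j).smul_const _
  have hd := (continuous_id.matrix_det.comp_aestronglyMeasurable hJ).aemeasurable.inv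
  have ha := (continuous_toEuclideanCLM.comp
    continuous_id.matrix_adjugate).comp_aestronglyMeasurable hJ
  have heq : (fun t => invInertia fun y => σ (t, y)) = fun t =>
      (inertia univ fun y => σ (t, y)).det⁻¹ •
        Matrix.toEuclideanCLM (𝕜 := ℝ) (inertia univ fun y => σ (t, y)).adjugate := by
    funext t
    rw [invInertia, Matrix.inv_def, Ring.inverse_eq_inv', map_smul]
  rw [heq]
  exact hd.aestronglyMeasurable.smul ha

lemma integral_univ_eq {s : E3 → ℝ} (hs : IsDensity Ω M m₀ s)
    {F : Type*} [NormedAddCommGroup F] [NormedSpace ℝ F] (f : E3 → F) :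
    ∫ x, s x • f x = ∫ x in Ω, s x • f x := by
  symm
  refine setIntegral_eq_integral_of_ae_compl_eq_zero ?_
  filter_upwards [hs.bound] with x hx hxΩ
  simp [hx.2.2 hxΩ]

lemma aestronglyMeasurable_linVel (h : IsBddBody T Ω M m₀ σ u) :
    AEStronglyMeasurable (linVel σ u) (volume.restrict (Ioo 0 T)) := by
  have h1 := h.meas_inner.smul h.velocity.1
  rw [cyl_eq_prod] at h1
  have h2 : AEStronglyMeasurable (fun t => ∫ x in Ω, σ (t, x) • u (t, x))
    (volume.restrict (Ioo 0 T)) := h1.integral_prod_right'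
  refine ((h.aestronglyMeasurable_mass.aemeasurable.inv.aestronglyMeasurable).smul h2).congr ?_
  filter_upwards [h.ae_density] with t ht
  rw [linVel, integral_univ_eq ht]
  rfl

lemma aestronglyMeasurable_angVel (h : IsBddBody T Ω M m₀ σ u) :
    AEStronglyMeasurable (angVel σ u) (volume.restrict (Ioo 0 T)) := by
  have hu := h.velocity.1
  have hσ := h.meas_inner
  rw [cyl_eq_prod] at hu hσ
  have h1 := hσ.smul (crossL.aestronglyMeasurable_comp₂
    (h.aestronglyMeasurable_sub_center (volume.restrict Ω)) hu)
  have h2 : AEStronglyMeasurable (fun t => ∫ x in Ω, σ (t, x) •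
      cross (x - center univ fun y => σ (t, y)) (u (t, x))) (volume.restrict (Ioo 0 T)) :=
    h1.integral_prod_right'
  have h3 := (ContinuousLinearMap.id ℝ (E3 →L[ℝ] E3)).aestronglyMeasurable_comp₂
    h.aestronglyMeasurable_invInertia h2
  refine h3.congr ?_
  filter_upwards [h.ae_density] with t ht
  rw [angVel, integral_univ_eq ht]
  rfl

end IsBddBody

/-- Uniform bounds for the rigid velocity of bounded bodies. -/
lemma exists_velocity_bound {Ω : Set E3} {R M m₀ : ℝ} (hΩm : MeasurableSet Ω) (hR : 0 < R)
    (hΩ : Ω ⊆ Metric.ball 0 R) (hm : 0 < m₀) :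
    ∃ (c : ℝ) (K : ℝ≥0), 0 < c ∧
      (∀ s, IsDensity Ω M m₀ s → IsUnit (inertia univ s).det ∧ ‖invInertia s‖ ≤ c⁻¹) ∧
      ∀ (T : ℝ) (σ : ℝ × E3 → ℝ) (u : ℝ × E3 → E3), IsBddBody T Ω M m₀ σ u →
        eLpNorm (linVel σ u) 2 (volume.restrict (Ioo 0 T)) ≤ K * eLpNorm u 2 (cyl T Ω) ∧
        eLpNorm (angVel σ u) 2 (volume.restrict (Ioo 0 T)) ≤ K * eLpNorm u 2 (cyl T Ω) := by
  obtain ⟨c, hc, hcoer⟩ := IsDensity.exists_coercive (R := R) (m₀ := m₀) Ω hR hΩ M hm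
  have hinv : ∀ s, IsDensity Ω M m₀ s → IsUnit (inertia univ s).det ∧ ‖invInertia s‖ ≤ c⁻¹ := by
    intro s hs
    obtain ⟨h1, h2⟩ := hs.inertia_inverse hΩ hc (hcoer s hs)
    refine ⟨h1, ContinuousLinearMap.opNorm_le_bound _ (by positivity) fun b => ?_⟩
    rw [invInertia_apply]
    exact h2 b
  have hΩt : volume Ω ≠ ⊤ := ((measure_mono hΩ).trans_lt measure_ball_lt_top).ne
  set V : ℝ≥0∞ := volume Ω ^ (1 / 2 : ℝ) with hV
  have hVt : V ≠ ⊤ := ENNReal.rpow_ne_top_of_nonneg (by norm_num) hΩt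
  -- `K₁` serves the linear velocity, through the bound `m₀⁻¹` for the inverse mass; `K₂` serves the
  -- angular velocity, through `c⁻¹` for the inverse inertia and `2R` for the distance to the centre
  -- of mass.
  set K₁ : ℝ≥0∞ := ENNReal.ofReal m₀⁻¹ * (ENNReal.ofReal (M * 1) * V) with hK₁
  set K₂ : ℝ≥0∞ := ENNReal.ofReal c⁻¹ * (ENNReal.ofReal (M * (2 * R)) * V) with hK₂
  have hKt : K₁ + K₂ ≠ ⊤ := ENNReal.add_ne_top.2
    ⟨ENNReal.mul_ne_top ENNReal.ofReal_ne_top (ENNReal.mul_ne_top ENNReal.ofReal_ne_top hVt),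
      ENNReal.mul_ne_top ENNReal.ofReal_ne_top (ENNReal.mul_ne_top ENNReal.ofReal_ne_top hVt)⟩
  refine ⟨c, (K₁ + K₂).toNNReal, hc, hinv, fun T σ u hb => ?_⟩
  rw [ENNReal.coe_toNNReal hKt]
  have key : ∀ f : ℝ → E3, (∀ᵐ t ∂volume.restrict (Ioo 0 T), ‖f t‖ₑ ≤
      (K₁ + K₂) * eLpNorm (fun x => u (t, x)) 2 (volume.restrict Ω)) →
      eLpNorm f 2 (volume.restrict (Ioo 0 T)) ≤ (K₁ + K₂) * eLpNorm u 2 (cyl T Ω) := by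
    intro f hf
    have h1 : eLpNorm f 2 (volume.restrict (Ioo 0 T)) ^ 2 ≤
        ((K₁ + K₂) * eLpNorm u 2 (cyl T Ω)) ^ 2 := by
      have h2 := eLpNorm_nnreal_pow_eq_lintegral (μ := volume.restrict (Ioo 0 T)) (f := f)
        (p := 2) (by norm_num)
      have h3 : eLpNorm f 2 (volume.restrict (Ioo 0 T)) ^ 2
          = ∫⁻ t in Ioo 0 T, ‖f t‖ₑ ^ 2 := by simpa using h2
      rw [h3, mul_pow, ← lintegral_eLpNorm_two_sq hb.velocity.1,
        ← lintegral_const_mul' _ _ (ENNReal.pow_ne_top hKt)]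
      refine lintegral_mono_ae ?_
      filter_upwards [hf] with t ht
      rw [← mul_pow]
      gcongr
    exact (ENNReal.pow_le_pow_left_iff (by norm_num)).1 h1
  constructor
  · refine key _ ?_
    filter_upwards [hb.ae_density, hb.ae_velocity] with t hd hv
    rw [linVel, enorm_smul]
    have h1 : ‖(mass univ fun y => σ (t, y))⁻¹‖ₑ ≤ ENNReal.ofReal m₀⁻¹ := by
      have hpos := hd.mass_pos hm
      rw [← ofReal_norm, norm_inv, Real.norm_of_nonneg hpos.le]
      apply ENNReal.ofReal_le_ofReal
      have := hd.mass_ge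
      rw [mass, Measure.restrict_univ]
      gcongr
    have h2 := enorm_integral_density_smul_le hΩm hd (L := 1) zero_le_one hv.1
      (f := fun x => u (t, x)) (fun x _ => by rw [one_mul])
    calc _ ≤ ENNReal.ofReal m₀⁻¹ * (ENNReal.ofReal (M * 1) * V *
          eLpNorm (fun x => u (t, x)) 2 (volume.restrict Ω)) := mul_le_mul' h1 h2
      _ = K₁ * eLpNorm (fun x => u (t, x)) 2 (volume.restrict Ω) := by rw [hK₁]; ring
      _ ≤ _ := by gcongr; exact le_self_add
  · refine key _ ?_
    filter_upwards [hb.ae_density, hb.ae_velocity] with t hd hv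
    have h2 := enorm_integral_density_smul_le hΩm hd (L := 2 * R) (by positivity) hv.1
      (f := fun x => cross (x - center univ fun y => σ (t, y)) (u (t, x))) (fun x hx => by
        refine (norm_cross_le _ _).trans ?_
        gcongr
        have a1 := (mem_ball_zero_iff.1 (hΩ hx)).le
        have a2 := hd.norm_center_le hΩ hm
        have := norm_sub_le x (center univ fun y => σ (t, y))
        linarith)
    have h1 : ‖angVel σ u t‖ₑ ≤ ENNReal.ofReal c⁻¹ *
        ‖∫ y, σ (t, y) • cross (y - center univ fun y => σ (t, y)) (u (t, y))‖ₑ := by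
      rw [← ofReal_norm, ← ofReal_norm, ← ENNReal.ofReal_mul (by positivity)]
      apply ENNReal.ofReal_le_ofReal
      refine (ContinuousLinearMap.le_opNorm _ _).trans ?_
      gcongr
      exact (hinv _ hd).2
    calc _ ≤ ENNReal.ofReal c⁻¹ * (ENNReal.ofReal (M * (2 * R)) * V *
          eLpNorm (fun x => u (t, x)) 2 (volume.restrict Ω)) := h1.trans (by gcongr)
      _ = K₂ * eLpNorm (fun x => u (t, x)) 2 (volume.restrict Ω) := by rw [hK₂]; ring
      _ ≤ _ := by gcongr; exact le_add_self

/-! ### Bodies carried by a flow -/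

lemma ae_cyl_univ_of_ae_cyl {T : ℝ} {Ω : Set E3} (hΩ : MeasurableSet Ω) {P : ℝ × E3 → Prop}
    (h : ∀ᵐ z ∂cyl T Ω, P z) : ∀ᵐ z ∂cyl T univ, z.1 ∈ Ioo 0 T ∧ (z.2 ∈ Ω → P z) := by
  rw [cyl, ae_restrict_iff' (measurableSet_Ioo.prod hΩ)] at h
  rw [cyl, ae_restrict_iff' (measurableSet_Ioo.prod MeasurableSet.univ)]
  filter_upwards [h] with z hz hz1
  exact ⟨hz1.1, fun hz2 => hz ⟨hz1.1, hz2⟩⟩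

lemma ae_cyl_of_ae_cyl_univ {T : ℝ} {Ω : Set E3} {P : ℝ × E3 → Prop}
    (h : ∀ᵐ z ∂cyl T univ, P z) : ∀ᵐ z ∂cyl T Ω, P z :=
  ae_mono (Measure.restrict_mono (prod_mono Subset.rfl (subset_univ Ω)) le_rfl) h

lemma ae_mem_Ioo_cyl (T : ℝ) (Ω : Set E3) (hΩ : MeasurableSet Ω) :
    ∀ᵐ z ∂cyl T Ω, z.1 ∈ Ioo 0 T ∧ z.2 ∈ Ω :=
  ae_restrict_mem (measurableSet_Ioo.prod hΩ)

/-- Preimages of a regular domain under convergent isometries converge pointwise off the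
frontier. -/
lemma eventually_mem_iff_of_tendsto {ι : Type*} {l : Filter ι} {U : Set E3} (hU : IsOpen U)
    {y : ι → E3} {y' : E3} (hy : Tendsto y l (𝓝 y')) (hf : y' ∉ frontier U) :
    ∀ᶠ i in l, (y i ∈ U ↔ y' ∈ U) := by
  by_cases h : y' ∈ U
  · filter_upwards [hy (hU.mem_nhds h)] with i hi
    exact ⟨fun _ => h, fun _ => hi⟩
  · have hc : y' ∈ (closure U)ᶜ := fun hc => hf (by rw [hU.frontier_eq]; exact ⟨hc, h⟩)
    filter_upwards [hy (isClosed_closure.isOpen_compl.mem_nhds hc)] with i hi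
    exact ⟨fun hm => absurd (subset_closure hm) hi, fun hm => absurd hm h⟩

lemma act_le_of_isometry {A : Aff} (hA : ∀ x, ‖A.1 x‖ = ‖x‖) {r : ℝ} {x : E3}
    (hx : ‖act A x‖ ≤ r) : ‖x‖ ≤ r + ‖A.2‖ := by
  have h1 : A.1 x = act A x - A.2 := by simp [act]
  rw [← hA x, h1]
  exact (norm_sub_le _ _).trans (by gcongr)

lemma IsIsometryCurve.volume_preimage_frontier {Y : ℝ → Aff} (hY : IsIsometryCurve Y) {U : Set E3}
    (hU : IsRegularDomain U) (t : ℝ) : volume (act (Y t) ⁻¹' frontier U) = 0 := by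
  rw [(hY.measurePreserving_act t).measure_preimage
    (isClosed_frontier.measurableSet.nullMeasurableSet), hU.volume_frontier]

/-- A moving body whose indicator is carried by a curve of isometries at almost every time is
carried at all times. -/
theorem IsMovingBody.eq_preimage {T : ℝ} (hT : 0 < T) {Ω S₀ : Set E3} {S : ℝ → Set E3}
    (hS : IsMovingBody T Ω S) (hS₀ : IsRegularDomain S₀) {Y : ℝ → Aff} (hY : IsIsometryCurve Y)
    (h : (swept S).indicator (fun _ => (1 : ℝ)) =ᵐ[cyl T univ]
      fun z => S₀.indicator (fun _ => (1 : ℝ)) (act (Y z.1) z.2)) :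
    ∀ t ∈ Icc 0 T, S t = act (Y t) ⁻¹' S₀ := by
  set B : ℝ → Set E3 := fun t => act (Y t) ⁻¹' S₀ with hB
  have hgood : ∀ᵐ t ∂volume.restrict (Ioo 0 T), volume (symmDiff (S t) (B t)) = 0 := by
    have h' : ∀ᵐ z ∂cyl T univ, (swept S).indicator (fun _ => (1 : ℝ)) z
      = S₀.indicator (fun _ => (1 : ℝ)) (act (Y z.1) z.2) := h
    rw [cyl_univ_eq_prod] at h'
    filter_upwards [Measure.ae_ae_of_ae_prod h'] with t ht
    refine measure_mono_null ?_ ht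
    intro x hx
    simp only [mem_compl_iff, mem_ofPred_eq]
    rintro he
    have hiff : x ∈ S t ↔ x ∈ B t := by
      have e1 : (t, x) ∈ swept S ↔ act (Y t) x ∈ S₀ := by
        by_cases h1 : (t, x) ∈ swept S <;> by_cases h2 : act (Y t) x ∈ S₀ <;>
          simp [h1, h2] at he ⊢
      exact e1
    rcases hx with hx | hx
    · exact hx.2 (hiff.1 hx.1)
    · exact hx.2 (hiff.2 hx.1)
  set G : Set ℝ := {t | t ∈ Ioo 0 T ∧ volume (symmDiff (S t) (B t)) = 0} with hG
  -- The good times have full measure in `(0, T)`, so they are dense in `[0, T]`.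
  have hclos : ∀ t ∈ Icc 0 T, t ∈ closure G := by
    intro t ht
    rw [mem_closure_iff]
    intro O hO htO
    have ht' : t ∈ closure (Ioo 0 T) := by rwa [closure_Ioo hT.ne]
    obtain hne := mem_closure_iff.1 ht' O hO htO
    have hpos : 0 < volume (O ∩ Ioo 0 T) := (hO.inter isOpen_Ioo).measure_pos volume hne
    rw [ae_restrict_iff' measurableSet_Ioo] at hgood
    by_contra hemp
    refine hpos.ne' (measure_mono_null ?_ hgood)
    intro s hs
    simp only [mem_compl_iff, mem_ofPred_eq]
    exact fun hc => hemp ⟨s, hs.1, hs.2, hc hs.2⟩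
  intro t ht
  -- The carried sets are continuous in measure: off the null set `Y(t)⁻¹(∂S₀)` membership is
  -- eventually constant, and locally in time all sets lie in one ball.
  have hBt : Tendsto (fun s => volume (symmDiff (B s) (B t))) (𝓝 t) (𝓝 0) := by
    obtain ⟨r, hr⟩ := hS₀.2.2.1.exists_norm_le
    have hloc : ∀ᶠ s in 𝓝 t, ‖(Y s).2‖ < ‖(Y t).2‖ + 1 :=
      (continuous_snd.comp hY.continuous).norm.tendsto t |>.eventually_lt_const (by simp)
    have := tendsto_measure_of_ae_tendsto_indicator (μ := (volume : Measure E3)) (𝓝 t)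
      (A := (∅ : Set E3)) (As := fun s => symmDiff (B s) (B t))
      (B := Metric.closedBall 0 (r + (‖(Y t).2‖ + 1))) MeasurableSet.empty ?_
      measurableSet_closedBall measure_closedBall_lt_top.ne ?_ ?_
    · simpa using this
    · intro s
      have hm : ∀ s, MeasurableSet (B s) := fun s =>
        (hY.measurePreserving_act s).measurable hS₀.1.measurableSet
      exact (hm s).symmDiff (hm t)
    · filter_upwards [hloc] with s hs x hx
      rw [mem_closedBall_zero_iff]
      rcases hx with hx | hx
      · have := act_le_of_isometry (hY.isometry s) (hr _ hx.1)
        linarith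
      · have := act_le_of_isometry (hY.isometry t) (hr _ hx.1)
        linarith
    · have hnull := hY.volume_preimage_frontier hS₀ t
      filter_upwards [measure_eq_zero_iff_ae_notMem.1 hnull] with x hx
      have hc : Tendsto (fun s => act (Y s) x) (𝓝 t) (𝓝 (act (Y t) x)) :=
        (hY.continuous_act'.comp (continuous_id.prodMk continuous_const)).tendsto t
      filter_upwards [eventually_mem_iff_of_tendsto hS₀.1 hc hx] with s hs
      simp only [mem_symmDiff, mem_empty_iff_false, iff_false, hB, mem_preimage]
      tauto
  -- Both families are continuous in measure, so the null symmetric difference extends from the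
  -- dense set of good times to every `t`.
  have hzero : volume (symmDiff (S t) (B t)) = 0 := by
    have hne : (𝓝[G] t).NeBot := mem_closure_iff_nhdsWithin_neBot.1 (hclos t ht)
    have hGI : G ⊆ Icc 0 T := fun s hs => Ioo_subset_Icc_self hs.1
    have h1 := (hS.continuous t ht).mono_left (nhdsWithin_mono t hGI)
    have h2 := hBt.mono_left (nhdsWithin_le_nhds (s := G))
    have h3 := h1.add h2
    rw [add_zero] at h3
    refine le_antisymm (ge_of_tendsto h3 ?_) zero_le
    filter_upwards [self_mem_nhdsWithin] with s hs
    calc volume (symmDiff (S t) (B t))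
        ≤ volume (symmDiff (S s) (S t) ∪ (symmDiff (S s) (B s) ∪ symmDiff (B s) (B t))) := by
          refine measure_mono fun x hx => ?_
          simp only [mem_union, mem_symmDiff] at hx ⊢
          tauto
      _ ≤ volume (symmDiff (S s) (S t)) + (volume (symmDiff (S s) (B s)) +
            volume (symmDiff (B s) (B t))) :=
          (measure_union_le _ _).trans (by gcongr; exact measure_union_le _ _)
      _ = _ := by rw [hs.2, zero_add]
  have hBo : IsOpen (B t) := hS₀.1.preimage (hY.homeoAt t).continuous
  -- A homeomorphism preserves the property of being the interior of the closure, which forces two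
  -- sets with null symmetric difference to coincide.
  have hBi : interior (closure (B t)) = B t := by
    have e : B t = hY.homeoAt t ⁻¹' S₀ := rfl
    rw [e, ← Homeomorph.preimage_closure, ← Homeomorph.preimage_interior, hS₀.interior_closure]
  refine Subset.antisymm ?_ ?_
  · exact subset_of_ae_le_of_interior_closure (hS.regular t ht).1 hBi
      (measure_mono_null (fun x hx => Or.inl hx) hzero)
  · exact subset_of_ae_le_of_interior_closure hBo (hS.regular t ht).interior_closure
      (measure_mono_null (fun x hx => Or.inr hx) hzero)

/-! ### The flow of a transported body -/

/-- The part of a rigid velocity field at the origin, extended by zero outside `(0, T)`. -/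
def transVel (T : ℝ) (σ : ℝ × E3 → ℝ) (u : ℝ × E3 → E3) : ℝ → E3 :=
  (Ioo 0 T).indicator fun t =>
    linVel σ u t - cross (angVel σ u t) (center univ fun y => σ (t, y))

/-- The angular velocity, extended by zero outside `(0, T)`. -/
def rotVel (T : ℝ) (σ : ℝ × E3 → ℝ) (u : ℝ × E3 → E3) : ℝ → E3 := (Ioo 0 T).indicator (angVel σ u)

lemma cross_sub_right (a b c : E3) : cross a (b - c) = cross a b - cross a c := by
  rw [← crossL_apply, ← crossL_apply, ← crossL_apply, map_sub]

/-- The rigid velocity field of a bounded body. -/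
lemma rigidProjection_univ_eq {T t : ℝ} (σ : ℝ × E3 → ℝ) (u : ℝ × E3 → E3) (ht : t ∈ Ioo 0 T)
    (x : E3) : rigidProjection univ (fun y => σ (t, y)) (fun y => u (t, y)) x
      = transVel T σ u t + cross (rotVel T σ u t) x := by
  rw [rigidProjection_univ, transVel, rotVel, indicator_of_mem ht, indicator_of_mem ht,
    cross_sub_right]
  abel

/-- Rigid flows are driven by fields `a(t) + om(t) × x` about the fixed origin, so the field is
expanded about the origin instead of the centre of mass. -/
lemma solidVelocity_eq {T : ℝ} {S : ℝ → Set E3} {ρ : ℝ × E3 → ℝ} {u : ℝ × E3 → E3}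
    (hS : ∀ t ∈ Icc 0 T, IsOpen (S t)) {z : ℝ × E3} (hz : z.1 ∈ Ioo 0 T) :
    solidVelocity S ρ u z = transVel T ((swept S).indicator ρ) u z.1
      + cross (rotVel T ((swept S).indicator ρ) u z.1) z.2 := by
  rw [← rigidProjection_univ_eq _ _ hz, solidVelocity]
  have : (fun y => (swept S).indicator ρ (z.1, y)) = (S z.1).indicator fun y => ρ (z.1, y) := by
    funext y
    by_cases hy : y ∈ S z.1
    · rw [indicator_of_mem hy, indicator_of_mem (show (z.1, y) ∈ swept S from hy)]
    · rw [indicator_of_notMem hy, indicator_of_notMem (show (z.1, y) ∉ swept S from hy)]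
  rw [this, rigidProjection_univ_indicator (hS z.1 (Ioo_subset_Icc_self hz)).measurableSet]

/-- Uniform bounds for the velocities of bounded bodies, in the form used for flows. -/
lemma exists_flow_bound {Ω : Set E3} {R M m₀ : ℝ} (hΩm : MeasurableSet Ω) (hR : 0 < R)
    (hΩ : Ω ⊆ Metric.ball 0 R) (hm : 0 < m₀) :
    ∃ K : ℝ≥0, ∀ (T : ℝ) (σ : ℝ × E3 → ℝ) (u : ℝ × E3 → E3), IsBddBody T Ω M m₀ σ u →
      (MemLp (transVel T σ u) 2 ∧ eLpNorm (transVel T σ u) 2 volume ≤ K * eLpNorm u 2 (cyl T Ω)) ∧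
      (MemLp (rotVel T σ u) 2 ∧ eLpNorm (rotVel T σ u) 2 volume ≤ K * eLpNorm u 2 (cyl T Ω)) := by
  obtain ⟨c, K, hc, -, hK⟩ := exists_velocity_bound (M := M) hΩm hR hΩ hm
  -- The second summand pays for `om × h`, with `|h| ≤ R`, when the field is evaluated at the
  -- origin.
  refine ⟨K + R.toNNReal * K, fun T σ u hb => ?_⟩
  obtain ⟨hl, ha⟩ := hK T σ u hb
  have hKu : (K : ℝ≥0∞) * eLpNorm u 2 (cyl T Ω) < ⊤ :=
    ENNReal.mul_lt_top ENNReal.coe_lt_top hb.velocity.2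
  have hcen : ∀ᵐ t ∂volume.restrict (Ioo 0 T),
      ‖cross (angVel σ u t) (center univ fun y => σ (t, y))‖ ≤ R.toNNReal * ‖angVel σ u t‖ := by
    filter_upwards [hb.ae_density] with t ht
    refine (norm_cross_le _ _).trans ?_
    rw [mul_comm, Real.coe_toNNReal _ hR.le]
    gcongr
    exact ht.norm_center_le hΩ hm
  have hcm : AEStronglyMeasurable (fun t => cross (angVel σ u t) (center univ fun y => σ (t, y)))
      (volume.restrict (Ioo 0 T)) :=
    crossL.aestronglyMeasurable_comp₂ hb.aestronglyMeasurable_angVel hb.aestronglyMeasurable_center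
  have hcn : eLpNorm (fun t => cross (angVel σ u t) (center univ fun y => σ (t, y))) 2
      (volume.restrict (Ioo 0 T)) ≤ R.toNNReal * (K * eLpNorm u 2 (cyl T Ω)) := by
    refine (eLpNorm_le_nnreal_smul_eLpNorm_of_ae_le_mul hcen 2).trans ?_
    rw [ENNReal.smul_def, smul_eq_mul]
    gcongr
  have h1 : eLpNorm (transVel T σ u) 2 volume ≤
      ((K + R.toNNReal * K : ℝ≥0) : ℝ≥0∞) * eLpNorm u 2 (cyl T Ω) := by
    rw [transVel, eLpNorm_indicator_eq_eLpNorm_restrict measurableSet_Ioo]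
    refine (eLpNorm_sub_le hb.aestronglyMeasurable_linVel hcm (by norm_num)).trans ?_
    push_cast
    rw [add_mul, mul_assoc]
    gcongr
  have h2 : eLpNorm (rotVel T σ u) 2 volume ≤
      ((K + R.toNNReal * K : ℝ≥0) : ℝ≥0∞) * eLpNorm u 2 (cyl T Ω) := by
    rw [rotVel, eLpNorm_indicator_eq_eLpNorm_restrict measurableSet_Ioo]
    refine ha.trans ?_
    gcongr
    simp
  have hfin : ((K + R.toNNReal * K : ℝ≥0) : ℝ≥0∞) * eLpNorm u 2 (cyl T Ω) < ⊤ :=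
    ENNReal.mul_lt_top ENNReal.coe_lt_top hb.velocity.2
  refine ⟨⟨⟨?_, h1.trans_lt hfin⟩, h1⟩, ⟨⟨?_, h2.trans_lt hfin⟩, h2⟩⟩
  · exact (aestronglyMeasurable_indicator_iff measurableSet_Ioo).2
      (hb.aestronglyMeasurable_linVel.sub hcm)
  · exact (aestronglyMeasurable_indicator_iff measurableSet_Ioo).2 hb.aestronglyMeasurable_angVel

namespace IsTransportedBody

variable {T : ℝ} {Ω S₀ : Set E3} {S : ℝ → Set E3} {ρ : ℝ × E3 → ℝ} {u : ℝ × E3 → E3}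
  {ρ₀ : E3 → ℝ} {R M m₀ : ℝ}

lemma isOpen (h : IsTransportedBody T Ω S₀ S ρ u ρ₀) : ∀ t ∈ Icc 0 T, IsOpen (S t) :=
  fun t ht => (h.body.regular t ht).1

lemma ae_bound (h : IsTransportedBody T Ω S₀ S ρ u ρ₀) (hΩ : MeasurableSet Ω) (hM : 0 ≤ M)
    (hρM : ∀ᵐ z ∂cyl T Ω, z ∈ swept S → ρ z ≤ M) :
    ∀ᵐ z ∂cyl T univ, 0 ≤ (swept S).indicator ρ z ∧ (swept S).indicator ρ z ≤ M ∧
      (z.2 ∉ Ω → (swept S).indicator ρ z = 0) := by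
  filter_upwards [ae_cyl_univ_of_ae_cyl hΩ (h.density_nonneg.and hρM)] with z hz
  by_cases hzS : z ∈ swept S
  · have hzΩ : z.2 ∈ Ω :=
      h.body.inside z.1 (Ioo_subset_Icc_self hz.1) (subset_closure hzS)
    obtain ⟨h1, h2⟩ := hz.2 hzΩ
    rw [indicator_of_mem hzS]
    exact ⟨h1, h2 hzS, fun hn => absurd hzΩ hn⟩
  · rw [indicator_of_notMem hzS]
    exact ⟨le_rfl, hM, fun _ => rfl⟩

lemma ae_norm_le (h : IsTransportedBody T Ω S₀ S ρ u ρ₀) (hΩ : Ω ⊆ Metric.ball 0 R)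
    (f : ℝ × E3 → ℝ) : ∀ᵐ z ∂cyl T univ, (swept S).indicator f z ≠ 0 → ‖z.2‖ ≤ R := by
  filter_upwards [ae_mem_Ioo_cyl T univ MeasurableSet.univ] with z hz hne
  have hzS : z ∈ swept S := by
    by_contra hc
    exact hne (indicator_of_notMem hc _)
  have hzΩ : z.2 ∈ Ω := h.body.inside z.1 (Ioo_subset_Icc_self hz.1) (subset_closure hzS)
  exact (mem_ball_zero_iff.1 (hΩ hzΩ)).le

lemma indicator_norm_le (hS₀ : S₀ ⊆ Metric.ball 0 R) (f : E3 → ℝ) :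
    ∀ᵐ x, S₀.indicator f x ≠ 0 → ‖x‖ ≤ R := by
  refine Eventually.of_forall fun x hne => ?_
  have hx : x ∈ S₀ := by
    by_contra hc
    exact hne (indicator_of_notMem hc _)
  exact (mem_ball_zero_iff.1 (hS₀ hx)).le

/-- Mass is conserved by transport, so a lower bound for the initial mass persists at almost every
time. -/
lemma isBddBody (h : IsTransportedBody T Ω S₀ S ρ u ρ₀) (hΩm : MeasurableSet Ω)
    (hΩ : Ω ⊆ Metric.ball 0 R) (hS₀ : S₀ ⊆ Ω) (hM : 0 ≤ M)
    (hρM : ∀ᵐ z ∂cyl T Ω, z ∈ swept S → ρ z ≤ M) (hm : m₀ ≤ ∫ x, S₀.indicator ρ₀ x) :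
    IsBddBody T Ω M m₀ ((swept S).indicator ρ) u := by
  have hb := h.ae_bound hΩm hM hρM
  refine ⟨h.transport_density.1.1, hb, ?_, h.velocity⟩
  filter_upwards [h.transport_density.ae_integral_eq hM
    (by filter_upwards [hb] with z hz; rw [abs_of_nonneg hz.1]; exact hz.2.1)
    (h.ae_norm_le hΩ ρ) (indicator_norm_le (hS₀.trans hΩ) ρ₀)] with t ht
  rwa [ht]

/-- A transported body is carried by the flow of its rigid velocity field. -/
lemma eq_preimage (h : IsTransportedBody T Ω S₀ S ρ u ρ₀) (hT : 0 < T) 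
    (hS₀ : IsRegularDomain S₀) (hΩ : Ω ⊆ Metric.ball 0 R) (hS₀Ω : S₀ ⊆ Ω) {Y : ℝ → Aff}
    (hY : IsRigidFlow (transVel T ((swept S).indicator ρ) u)
      (rotVel T ((swept S).indicator ρ) u) Y) :
    ∀ t ∈ Icc 0 T, S t = act (Y t) ⁻¹' S₀ := by
  refine h.body.eq_preimage hT hS₀ hY.isIsometryCurve ?_
  exact h.transport_body.ae_eq_comp_flow zero_le_one
    (Eventually.of_forall fun z => by
      by_cases hz : z ∈ swept S <;> simp [hz])
    (h.ae_norm_le hΩ _) (indicator_norm_le (hS₀Ω.trans hΩ) _) hY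
    (fun z hz => solidVelocity_eq h.isOpen hz)

lemma density_ae_eq (h : IsTransportedBody T Ω S₀ S ρ u ρ₀) (hΩm : MeasurableSet Ω)
    (hΩ : Ω ⊆ Metric.ball 0 R) (hS₀Ω : S₀ ⊆ Ω) (hM : 0 ≤ M)
    (hρM : ∀ᵐ z ∂cyl T Ω, z ∈ swept S → ρ z ≤ M) {Y : ℝ → Aff}
    (hY : IsRigidFlow (transVel T ((swept S).indicator ρ) u)
      (rotVel T ((swept S).indicator ρ) u) Y) :
    (swept S).indicator ρ =ᵐ[cyl T univ] fun z => S₀.indicator ρ₀ (act (Y z.1) z.2) := by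
  refine h.transport_density.ae_eq_comp_flow hM ?_ (h.ae_norm_le hΩ _)
    (indicator_norm_le (hS₀Ω.trans hΩ) _) hY (fun z hz => solidVelocity_eq h.isOpen hz)
  filter_upwards [h.ae_bound hΩm hM hρM] with z hz
  rw [abs_of_nonneg hz.1]
  exact hz.2.1

end IsTransportedBody

/-- Curves of isometries driven by square integrable velocities are Hölder continuous. -/
lemma IsRigidFlow.norm_sub_le {a om : ℝ → E3} {Y : ℝ → Aff} (hY : IsRigidFlow a om Y)
    (ha : MemLp a 2) (hom : MemLp om 2) {K : ℝ≥0} (haK : eLpNorm a 2 volume ≤ K)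
    (homK : eLpNorm om 2 volume ≤ K) {s t : ℝ} (hst : s ≤ t) :
    ‖Y t - Y s‖ ≤ 2 * K * Real.sqrt (t - s) := by
  set g : ℝ → Aff := fun s => (-((Y s).1.comp (crossL (om s))), -((Y s).1 (a s))) with hg
  have hgi : Integrable g := hY.integrable
  have hgn : ∀ r, ‖g r‖ ≤ ‖om r‖ + ‖a r‖ := by
    intro r
    have h1 : ‖(g r).1‖ ≤ ‖om r‖ := by
      rw [hg]
      simp only [norm_neg]
      refine ContinuousLinearMap.opNorm_le_bound _ (norm_nonneg _) fun x => ?_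
      rw [ContinuousLinearMap.comp_apply, hY.isometry, crossL_apply]
      exact norm_cross_le _ _
    have h2 : ‖(g r).2‖ = ‖a r‖ := by
      rw [hg]
      simp only [norm_neg, hY.isometry]
    rw [Prod.norm_def, h2]
    exact max_le (by linarith [norm_nonneg (a r)]) (by linarith [norm_nonneg (om r)])
  have hdiff : Y t - Y s = ∫ r in Ioc s t, g r := by
    have h1 : ∀ r, Y r = curve (ContinuousLinearMap.id ℝ E3, 0) g r := fun r => congrFun hY.eq_curve r
    rw [h1 t, h1 s, curve, curve, add_sub_add_left_eq_sub,
      intervalIntegral.integral_interval_sub_left hgi.intervalIntegrable hgi.intervalIntegrable,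
      intervalIntegral.integral_of_le hst]
  -- Cauchy–Schwarz on `(s, t)`: this is where the exponent `1/2` comes from.
  have hone : ∀ f : ℝ → E3, MemLp f 2 → eLpNorm f 2 volume ≤ K →
      ∫⁻ r in Ioc s t, ‖f r‖ₑ ≤ ENNReal.ofReal (K * Real.sqrt (t - s)) := by
    intro f hf hfK
    have h1 := eLpNorm_le_eLpNorm_mul_rpow_measure_univ (μ := volume.restrict (Ioc s t))
      (p := 1) (q := 2) (by norm_num) (hf.1.restrict (s := Ioc s t))
    rw [eLpNorm_one_eq_lintegral_enorm, Measure.restrict_apply_univ, Real.volume_Ioc] at h1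
    refine h1.trans ?_
    rw [ENNReal.ofReal_mul K.coe_nonneg, ENNReal.ofReal_coe_nnreal, Real.sqrt_eq_rpow,
      ← ENNReal.ofReal_rpow_of_nonneg (by linarith) (by norm_num)]
    have h2 : eLpNorm f 2 (volume.restrict (Ioc s t)) ≤ K := (eLpNorm_restrict_le f 2 _ _).trans hfK
    have h3 : (1 / (1 : ℝ≥0∞).toReal - 1 / (2 : ℝ≥0∞).toReal) = (1 / 2 : ℝ) := by norm_num
    rw [h3]
    gcongr
  have hfin : ‖Y t - Y s‖ₑ ≤ ENNReal.ofReal (2 * K * Real.sqrt (t - s)) := by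
    rw [hdiff]
    calc ‖∫ r in Ioc s t, g r‖ₑ ≤ ∫⁻ r in Ioc s t, ‖g r‖ₑ := enorm_integral_le_lintegral_enorm _
      _ ≤ ∫⁻ r in Ioc s t, (‖om r‖ₑ + ‖a r‖ₑ) := by
          refine lintegral_mono fun r => ?_
          rw [← ofReal_norm, ← ofReal_norm, ← ofReal_norm,
            ← ENNReal.ofReal_add (norm_nonneg _) (norm_nonneg _)]
          exact ENNReal.ofReal_le_ofReal (hgn r)
      _ = (∫⁻ r in Ioc s t, ‖om r‖ₑ) + ∫⁻ r in Ioc s t, ‖a r‖ₑ :=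
          lintegral_add_left' hom.1.restrict.enorm _
      _ ≤ ENNReal.ofReal (K * Real.sqrt (t - s)) + ENNReal.ofReal (K * Real.sqrt (t - s)) :=
          add_le_add (hone om hom homK) (hone a ha haK)
      _ = _ := by
          rw [← ENNReal.ofReal_add (by positivity) (by positivity)]
          congr 1
          ring
  rw [← ofReal_norm] at hfin
  exact (ENNReal.ofReal_le_ofReal_iff (by positivity)).1 hfin

/-- Curves of isometries with a common Hölder bound are precompact. -/
lemma exists_tendsto_isometryCurve {T L : ℝ} (hT : 0 ≤ T) {Y : ℕ → ℝ → Aff}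
    (hY : ∀ n, IsIsometryCurve (Y n)) (h0 : ∀ n, Y n 0 = (ContinuousLinearMap.id ℝ E3, 0))
    (hL : ∀ n s t, s ≤ t → ‖Y n t - Y n s‖ ≤ L * Real.sqrt (t - s)) :
    ∃ (k : ℕ → ℕ) (Y' : ℝ → Aff), StrictMono k ∧ IsIsometryCurve Y' ∧
      ∀ t ∈ Icc 0 T, Tendsto (fun n => Y (k n) t) atTop (𝓝 (Y' t)) := by
  have hL0 : 0 ≤ L := by
    have := (norm_nonneg _).trans (hL 0 0 1 zero_le_one)
    simpa using this
  let F : ℕ → BoundedContinuousFunction (Icc (0 : ℝ) T) Aff := fun n =>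
    BoundedContinuousFunction.mkOfCompact ⟨fun t => Y n t, (hY n).continuous.comp continuous_subtype_val⟩
  have hFv : ∀ n t, F n t = Y n t := fun n t => rfl
  set B := ‖((ContinuousLinearMap.id ℝ E3, 0) : Aff)‖ + L * Real.sqrt T with hB
  -- Arzelà–Ascoli: the common starting point gives boundedness, the square root modulus gives
  -- equicontinuity.
  have hcomp : IsCompact (closure (range F)) := by
    refine BoundedContinuousFunction.arzela_ascoli (Metric.closedBall 0 B)
      (isCompact_closedBall _ _) (range F) ?_ ?_
    · rintro f t ⟨n, rfl⟩
      rw [mem_closedBall_zero_iff, hFv]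
      have h1 := hL n 0 t t.2.1
      rw [h0, sub_zero] at h1
      have h2 : L * Real.sqrt t ≤ L * Real.sqrt T := by
        gcongr
        exact t.2.2
      have h3 := norm_add_le (Y n t - (ContinuousLinearMap.id ℝ E3, 0))
        ((ContinuousLinearMap.id ℝ E3, 0) : Aff)
      rw [sub_add_cancel] at h3
      linarith
    · refine Metric.equicontinuous_of_continuity_modulus (fun d => L * Real.sqrt d) ?_ _ ?_
      · have : Continuous fun d : ℝ => L * Real.sqrt d := by fun_prop
        simpa using this.tendsto 0
      · rintro s t ⟨f, n, rfl⟩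
        change dist (Y n s) (Y n t) ≤ L * Real.sqrt (dist s t)
        rcases le_total (s : ℝ) t with hst | hst
        · rw [dist_comm, dist_eq_norm, Subtype.dist_eq, dist_comm, Real.dist_eq,
            abs_of_nonneg (by linarith)]
          exact hL n s t hst
        · rw [dist_eq_norm, Subtype.dist_eq, Real.dist_eq, abs_of_nonneg (by linarith)]
          exact hL n t s hst
  have hfc : FirstCountableTopology (BoundedContinuousFunction (Icc (0 : ℝ) T) Aff) :=
    UniformSpace.firstCountableTopology _
  obtain ⟨G, -, k, hk, hkG⟩ := hcomp.tendsto_subseq (x := F) fun n =>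
    subset_closure (mem_range_self n)
  have hpt : ∀ t : Icc (0 : ℝ) T, Tendsto (fun n => Y (k n) t) atTop (𝓝 (G t)) := fun t =>
    ((continuous_eval_const t).tendsto G).comp hkG
  -- Outside `[0, T]` the limit curve is extended by its end values.
  refine ⟨k, IccExtend hT G, hk, ⟨G.continuous.Icc_extend', fun t x => ?_⟩, fun t ht => ?_⟩
  · have h1 := hpt (projIcc 0 T hT t)
    have h2 : Tendsto (fun n => ‖(Y (k n) (projIcc 0 T hT t)).1 x‖) atTop
        (𝓝 ‖(G (projIcc 0 T hT t)).1 x‖) := by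
      have hc : Continuous fun A : Aff => ‖A.1 x‖ := by fun_prop
      exact (hc.tendsto _).comp h1
    simp only [(hY _).isometry] at h2
    exact tendsto_nhds_unique h2 tendsto_const_nhds
  · rw [IccExtend_of_mem hT _ ht]
    exact hpt ⟨t, ht⟩

/-! ### Convergence along convergent flows -/

lemma tendsto_act {ι : Type*} {l : Filter ι} {A : ι → Aff} {A' : Aff} (h : Tendsto A l (𝓝 A'))
    (x : E3) : Tendsto (fun i => act (A i) x) l (𝓝 (act A' x)) := by
  have hc : Continuous fun B : Aff => act B x := by unfold act; fun_prop
  exact (hc.tendsto A').comp h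

/-- Isometries preserve volume, so the `L¹` norm of the composition does not see the curve.
Approximation errors are therefore uniform in the flow. -/
lemma IsIsometryCurve.lintegral_act {Y : ℝ → Aff} (hY : IsIsometryCurve Y) (T : ℝ) {f : E3 → ℝ}
    (hf : AEStronglyMeasurable f volume) :
    ∫⁻ z, ‖f (act (Y z.1) z.2)‖ₑ ∂cyl T univ = ENNReal.ofReal T * eLpNorm f 1 volume := by
  have h1 := (hY.measurePreserving_homeo_cyl T).lintegral_comp_emb
    hY.homeo.measurableEmbedding (fun z => ‖f z.2‖ₑ)
  simp only [hY.homeo_apply] at h1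
  rw [h1, cyl_univ_eq_prod, lintegral_prod _ (by exact hf.enorm.comp_snd),
    eLpNorm_one_eq_lintegral_enorm]
  simp [mul_comm]

lemma IsIsometryCurve.aestronglyMeasurable_comp {Y : ℝ → Aff} (hY : IsIsometryCurve Y) (T : ℝ)
    {f : E3 → ℝ} (hf : AEStronglyMeasurable f volume) :
    AEStronglyMeasurable (fun z : ℝ × E3 => f (act (Y z.1) z.2)) (cyl T univ) := by
  have h1 : AEStronglyMeasurable (fun z : ℝ × E3 => f z.2) (cyl T univ) := by
    rw [cyl_univ_eq_prod]; exact hf.comp_snd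
  exact h1.comp_measurePreserving (hY.measurePreserving_homeo_cyl T)

/-- Compositions of `L¹` convergent functions with convergent isometries converge in `L¹`. -/
lemma tendsto_lintegral_comp_flow {T B : ℝ} {f : ℕ → E3 → ℝ} {f' : E3 → ℝ}
    (hf : ∀ n, Integrable (f n)) (hf' : Integrable f')
    (hlim : Tendsto (fun n => eLpNorm (f n - f') 1 volume) atTop (𝓝 0))
    {Y : ℕ → ℝ → Aff} {Y' : ℝ → Aff} (hY : ∀ n, IsIsometryCurve (Y n)) (hY' : IsIsometryCurve Y')
    (hB : ∀ n, ∀ t ∈ Ioo 0 T, ‖(Y n t).2‖ ≤ B)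
    (hYlim : ∀ t ∈ Ioo 0 T, Tendsto (fun n => Y n t) atTop (𝓝 (Y' t))) :
    Tendsto (fun n => eLpNorm ((fun z : ℝ × E3 => f n (act (Y n z.1) z.2))
      - fun z => f' (act (Y' z.1) z.2)) 1 (cyl T univ)) atTop (𝓝 0) := by
  rw [ENNReal.tendsto_nhds_zero]
  intro ε hε
  -- The error has four parts: `f n - f'` and `f' - g` along `Y n`, the displacement of `g`, and `g
  -- - f'` along `Y'`.
  obtain ⟨η, hη0, hη⟩ : ∃ η : ℝ≥0∞, η ≠ 0 ∧
      ENNReal.ofReal T * η + (ENNReal.ofReal T * η + (η + ENNReal.ofReal T * η)) ≤ ε := by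
    rcases eq_or_ne ε ⊤ with rfl | hεt
    · exact ⟨1, one_ne_zero, le_top⟩
    refine ⟨ε / (ENNReal.ofReal T + (ENNReal.ofReal T + (1 + ENNReal.ofReal T))), ?_, ?_⟩
    · rw [Ne, ENNReal.div_eq_zero_iff]
      push Not
      exact ⟨hε.ne', by finiteness⟩
    · set w := ENNReal.ofReal T + (ENNReal.ofReal T + (1 + ENNReal.ofReal T)) with hw
      have : ENNReal.ofReal T * (ε / w) + (ENNReal.ofReal T * (ε / w) +
          (ε / w + ENNReal.ofReal T * (ε / w))) = w * (ε / w) := by rw [hw]; ring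
      rw [this]
      exact ENNReal.mul_div_le
  obtain ⟨g, hgc, hgε, hgcont, hgm⟩ := (memLp_one_iff_integrable.2 hf').exists_hasCompactSupport_eLpNorm_sub_le
    ENNReal.one_ne_top hη0
  have hgi : Integrable g := memLp_one_iff_integrable.1 hgm
  -- For the continuous, compactly supported `g` the flows may be compared pointwise; the bound `B`
  -- on the translations keeps all supports in one ball.
  have hdom : Tendsto (fun n => ∫⁻ z, ‖g (act (Y n z.1) z.2) - g (act (Y' z.1) z.2)‖ₑ ∂cyl T univ)
      atTop (𝓝 0) := by
    obtain ⟨C, hC⟩ := hgcont.bounded_above_of_compact_support hgc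
    obtain ⟨r, hr⟩ := hgc.isCompact.isBounded.exists_norm_le
    have hbd := tendsto_lintegral_of_dominated_convergence' (μ := cyl T univ)
      (F := fun n z => ‖g (act (Y n z.1) z.2) - g (act (Y' z.1) z.2)‖ₑ) (f := fun _ => 0)
      ((Ioo 0 T ×ˢ Metric.closedBall (0 : E3) (r + B)).indicator fun _ => ENNReal.ofReal (2 * C))
      ?_ ?_ ?_ ?_
    · simpa using hbd
    · intro n
      exact (((hY n).aestronglyMeasurable_comp T hgcont.aestronglyMeasurable).sub
        (hY'.aestronglyMeasurable_comp T hgcont.aestronglyMeasurable)).enorm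
    · intro n
      filter_upwards [ae_mem_Ioo_cyl T univ MeasurableSet.univ] with z hz
      have hB' : ‖(Y' z.1).2‖ ≤ B := le_of_tendsto
        ((continuous_snd.norm.tendsto _).comp (hYlim z.1 hz.1))
        (Eventually.of_forall fun n => hB n z.1 hz.1)
      by_cases hzb : z.2 ∈ Metric.closedBall (0 : E3) (r + B)
      · rw [indicator_of_mem (show z ∈ Ioo 0 T ×ˢ Metric.closedBall (0 : E3) (r + B) from ⟨hz.1, hzb⟩),
          ← ofReal_norm]
        apply ENNReal.ofReal_le_ofReal
        refine (norm_sub_le _ _).trans ?_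
        linarith [hC (act (Y n z.1) z.2), hC (act (Y' z.1) z.2)]
      · have key : ∀ A : Aff, (∀ x, ‖A.1 x‖ = ‖x‖) → ‖A.2‖ ≤ B → g (act A z.2) = 0 := by
          intro A hA hAB
          by_contra hne
          have := act_le_of_isometry hA (hr _ (subset_tsupport _ hne))
          exact hzb (mem_closedBall_zero_iff.2 (by linarith))
        rw [key _ ((hY n).isometry z.1) (hB n z.1 hz.1), key _ (hY'.isometry z.1) hB']
        simp
    · rw [lintegral_indicator (measurableSet_Ioo.prod measurableSet_closedBall),
        lintegral_const, cyl, Measure.restrict_restrict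
          (measurableSet_Ioo.prod measurableSet_closedBall), Measure.restrict_apply_univ]
      refine ENNReal.mul_ne_top ENNReal.ofReal_ne_top ?_
      refine ((measure_mono inter_subset_left).trans_lt ?_).ne
      rw [Measure.volume_eq_prod, Measure.prod_prod]
      exact ENNReal.mul_lt_top (by simp) measure_closedBall_lt_top
    · filter_upwards [ae_mem_Ioo_cyl T univ MeasurableSet.univ] with z hz
      have h1 := tendsto_act (hYlim z.1 hz.1) z.2
      have h2 := ((hgcont.tendsto _).comp h1).sub_const (g (act (Y' z.1) z.2))
      rw [sub_self] at h2
      have h3 := h2.enorm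
      simpa using h3
  have hgf : eLpNorm (g - f') 1 volume ≤ η := by rwa [eLpNorm_sub_comm]
  filter_upwards [(ENNReal.tendsto_nhds_zero.1 hlim) η (pos_iff_ne_zero.2 hη0),
    (ENNReal.tendsto_nhds_zero.1 hdom) η (pos_iff_ne_zero.2 hη0)] with n hn1 hn2
  rw [eLpNorm_one_eq_lintegral_enorm]
  have m1 : ∀ {h : E3 → ℝ}, Integrable h → ∀ {W}, IsIsometryCurve W →
      AEMeasurable (fun z : ℝ × E3 => ‖h (act (W z.1) z.2)‖ₑ) (cyl T univ) :=
    fun hh _ hW => (hW.aestronglyMeasurable_comp T hh.1).enorm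
  calc ∫⁻ z, ‖((fun z : ℝ × E3 => f n (act (Y n z.1) z.2)) - fun z : ℝ × E3 => f' (act (Y' z.1) z.2)) z‖ₑ
        ∂cyl T univ
      ≤ ∫⁻ z, (‖(f n - f') (act (Y n z.1) z.2)‖ₑ + (‖(f' - g) (act (Y n z.1) z.2)‖ₑ +
          (‖g (act (Y n z.1) z.2) - g (act (Y' z.1) z.2)‖ₑ + ‖(g - f') (act (Y' z.1) z.2)‖ₑ)))
          ∂cyl T univ := by
        refine lintegral_mono fun z => ?_
        have : ((fun z : ℝ × E3 => f n (act (Y n z.1) z.2)) - fun z : ℝ × E3 => f' (act (Y' z.1) z.2)) z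
            = (f n - f') (act (Y n z.1) z.2) + ((f' - g) (act (Y n z.1) z.2) +
            ((g (act (Y n z.1) z.2) - g (act (Y' z.1) z.2)) + (g - f') (act (Y' z.1) z.2))) := by
          simp only [Pi.sub_apply]; ring
        rw [this]
        refine (enorm_add_le _ _).trans ?_
        gcongr
        refine (enorm_add_le _ _).trans ?_
        gcongr
        exact enorm_add_le _ _
    _ = ENNReal.ofReal T * eLpNorm (f n - f') 1 volume + (ENNReal.ofReal T * eLpNorm (f' - g) 1 volume
          + ((∫⁻ z, ‖g (act (Y n z.1) z.2) - g (act (Y' z.1) z.2)‖ₑ ∂cyl T univ)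
          + ENNReal.ofReal T * eLpNorm (g - f') 1 volume)) := by
        rw [lintegral_add_left' (m1 ((hf n).sub hf') (hY n)),
          lintegral_add_left' (m1 (hf'.sub hgi) (hY n)),
          lintegral_add_right' _ (m1 (hgi.sub hf') hY'),
          (hY n).lintegral_act T ((hf n).sub hf').1, (hY n).lintegral_act T (hf'.sub hgi).1,
          hY'.lintegral_act T (hgi.sub hf').1]
    _ ≤ ENNReal.ofReal T * η + (ENNReal.ofReal T * η + (η + ENNReal.ofReal T * η)) := by gcongr
    _ ≤ ε := hη

lemma IsIsometryCurve.ae_notMem_frontier {Y : ℝ → Aff} (hY : IsIsometryCurve Y) (T : ℝ)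
    {U : Set E3} (hU : IsRegularDomain U) : ∀ᵐ z ∂cyl T univ, act (Y z.1) z.2 ∉ frontier U := by
  rw [cyl_univ_eq_prod]
  have hm : MeasurableSet {z : ℝ × E3 | act (Y z.1) z.2 ∉ frontier U} :=
    (isClosed_frontier.measurableSet.preimage hY.continuous_act'.measurable).compl
  rw [Measure.ae_prod_iff_ae_ae hm]
  exact Eventually.of_forall fun t =>
    measure_eq_zero_iff_ae_notMem.1 (hY.volume_preimage_frontier hU t)

/-! ### Approximations and their flows -/

/-- `Y` is the flow of the transported body `(S, ρ, u)`, with bounds. -/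
structure IsFlowOf (T : ℝ) (Ω S₀ : Set E3) (M m₀ : ℝ) (K : ℝ≥0) (S : ℝ → Set E3) (ρ : ℝ × E3 → ℝ)
    (u : ℝ × E3 → E3) (ρ₀ : E3 → ℝ) (Y : ℝ → Aff) : Prop where
  flow : IsRigidFlow (transVel T ((swept S).indicator ρ) u) (rotVel T ((swept S).indicator ρ) u) Y
  bddBody : IsBddBody T Ω M m₀ ((swept S).indicator ρ) u
  memLp_trans : MemLp (transVel T ((swept S).indicator ρ) u) 2
  memLp_rot : MemLp (rotVel T ((swept S).indicator ρ) u) 2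
  trans_le : eLpNorm (transVel T ((swept S).indicator ρ) u) 2 volume ≤ K
  rot_le : eLpNorm (rotVel T ((swept S).indicator ρ) u) 2 volume ≤ K
  eq_preimage : ∀ t ∈ Icc 0 T, S t = act (Y t) ⁻¹' S₀
  density : (swept S).indicator ρ =ᵐ[cyl T univ] fun z => S₀.indicator ρ₀ (act (Y z.1) z.2)

/-- The hypotheses pass to subsequences, which is what allows every convergence to be proved by
extracting further subsequences. -/
lemma IsApproximation.comp {T : ℝ} {Ω S₀ : Set E3} {γ : ℝ}
    {S : ℕ → ℝ → Set E3} {ρ : ℕ → ℝ × E3 → ℝ} {u : ℕ → ℝ × E3 → E3} {ρ₀ : ℕ → E3 → ℝ}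
    {S' : ℝ → Set E3} {ρ' : ℝ × E3 → ℝ} {u' : ℝ × E3 → E3} {ρ₀' : E3 → ℝ}
    (h : IsApproximation T Ω S₀ γ S ρ u ρ₀ S' ρ' u' ρ₀') {k : ℕ → ℕ} (hk : Tendsto k atTop atTop) :
    IsApproximation T Ω S₀ γ (fun n => S (k n)) (fun n => ρ (k n)) (fun n => u (k n))
      (fun n => ρ₀ (k n)) S' ρ' u' ρ₀' where
  transported n := h.transported (k n)
  velocity_bdd := by
    obtain ⟨C, hC⟩ := h.velocity_bdd
    exact ⟨C, fun n => hC (k n)⟩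
  density_bdd := by
    obtain ⟨C, hC⟩ := h.density_bdd
    exact ⟨C, fun n => hC (k n)⟩
  velocity_tendsto := ⟨fun n => h.velocity_tendsto.1 (k n), h.velocity_tendsto.2.1,
    fun g hg => (h.velocity_tendsto.2.2 g hg).comp hk⟩
  density_tendsto := ⟨fun n => h.density_tendsto.1 (k n), h.density_tendsto.2.1,
    fun g hg => (h.density_tendsto.2.2 g hg).comp hk⟩
  initial_mem n := h.initial_mem (k n)
  initial_mem_lim := h.initial_mem_lim
  initial_tendsto := h.initial_tendsto.comp hk
  initial_pos_lim := h.initial_pos_lim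
  body_lim := h.body_lim
  body_tendsto g hg := (h.body_tendsto g hg).comp hk

lemma integral_indicator_pos {S₀ : Set E3} (hS₀ : IsRegularDomain S₀) {f : E3 → ℝ}
    (hpos : ∀ᵐ x ∂volume.restrict S₀, 0 < f x) (hi : Integrable (S₀.indicator f)) :
    0 < ∫ x, S₀.indicator f x := by
  rw [integrable_indicator_iff hS₀.1.measurableSet] at hi
  rw [integral_indicator hS₀.1.measurableSet]
  have hvol : volume.restrict S₀ ≠ 0 := by
    rw [Ne, Measure.restrict_eq_zero]
    exact hS₀.volume_pos.ne'
  rw [integral_pos_iff_support_of_nonneg_ae (hpos.mono fun x hx => hx.le) hi]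
  rw [pos_iff_ne_zero]
  intro h0
  have : ∀ᵐ x ∂volume.restrict S₀, False := by
    filter_upwards [hpos, measure_eq_zero_iff_ae_notMem.1 h0] with x h1 h2
    exact h2 h1.ne'
  exact hvol (by simpa using this)

section

variable {T : ℝ} {Ω S₀ : Set E3} {γ : ℝ}
  {S : ℕ → ℝ → Set E3} {ρ : ℕ → ℝ × E3 → ℝ} {u : ℕ → ℝ × E3 → E3} {ρ₀ : ℕ → E3 → ℝ}
  {S' : ℝ → Set E3} {ρ' : ℝ × E3 → ℝ} {u' : ℝ × E3 → E3} {ρ₀' : E3 → ℝ}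

lemma IsApproximation.integrable_initial (h : IsApproximation T Ω S₀ γ S ρ u ρ₀ S' ρ' u' ρ₀')
    (hΩb : volume Ω ≠ ⊤) (hS₀ : IsRegularDomain S₀) (hS₀Ω : S₀ ⊆ Ω) (hγ : 1 ≤ γ) :
    Integrable (S₀.indicator ρ₀') := by
  have hfm : IsFiniteMeasure (volume.restrict Ω) := ⟨by simpa using hΩb.lt_top⟩
  have h1 : Integrable ρ₀' (volume.restrict Ω) := h.initial_mem_lim.integrable (by simpa using hγ)
  rw [integrable_indicator_iff hS₀.1.measurableSet]
  exact h1.mono_measure (Measure.restrict_mono hS₀Ω le_rfl)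

/-- Hölder's inequality on the bounded `Ω` lowers the exponent from `γ` to `1`, where composition
with isometries is easily controlled. -/
lemma IsApproximation.tendsto_initial (h : IsApproximation T Ω S₀ γ S ρ u ρ₀ S' ρ' u' ρ₀')
    (hΩb : volume Ω ≠ ⊤) (hS₀ : IsRegularDomain S₀) (hS₀Ω : S₀ ⊆ Ω) (hγ : 1 ≤ γ) :
    Tendsto (fun n => eLpNorm (S₀.indicator (ρ₀ n) - S₀.indicator ρ₀') 1 volume) atTop (𝓝 0) := by
  have hle : ∀ n, eLpNorm (S₀.indicator (ρ₀ n) - S₀.indicator ρ₀') 1 volume ≤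
      eLpNorm (ρ₀ n - ρ₀') (ENNReal.ofReal γ) (volume.restrict Ω) *
        volume Ω ^ (1 / (1 : ℝ≥0∞).toReal - 1 / (ENNReal.ofReal γ).toReal) := by
    intro n
    have e : S₀.indicator (ρ₀ n) - S₀.indicator ρ₀' = S₀.indicator (ρ₀ n - ρ₀') := by
      rw [indicator_sub']
    rw [e, eLpNorm_indicator_eq_eLpNorm_restrict hS₀.1.measurableSet]
    refine (eLpNorm_mono_measure _ (Measure.restrict_mono hS₀Ω le_rfl)).trans ?_
    have := eLpNorm_le_eLpNorm_mul_rpow_measure_univ (μ := volume.restrict Ω) (p := 1)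
      (q := ENNReal.ofReal γ) (by simpa using hγ)
      ((h.initial_mem n).1.sub h.initial_mem_lim.1)
    rwa [Measure.restrict_apply_univ] at this
  have hexp : volume Ω ^ (1 / (1 : ℝ≥0∞).toReal - 1 / (ENNReal.ofReal γ).toReal) ≠ ⊤ := by
    refine ENNReal.rpow_ne_top_of_nonneg ?_ hΩb
    rw [ENNReal.toReal_ofReal (by linarith), ENNReal.toReal_one, div_one, sub_nonneg]
    exact (div_le_one (by linarith)).2 hγ
  have hz := ENNReal.Tendsto.mul_const h.initial_tendsto (Or.inr hexp)
  rw [zero_mul] at hz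
  exact tendsto_of_tendsto_of_tendsto_of_le_of_le tendsto_const_nhds hz (fun _ => zero_le) hle

/-- The flows of approximations, with uniform bounds. -/
lemma IsApproximation.exists_flows (h : IsApproximation T Ω S₀ γ S ρ u ρ₀ S' ρ' u' ρ₀')
    (hT : 0 < T) (hΩ : IsRegularDomain Ω) (hS₀ : IsRegularDomain S₀) (hS₀Ω : S₀ ⊆ Ω)
    (hγ : 1 ≤ γ) :
    ∃ (R M m₀ : ℝ) (K : ℝ≥0) (Y : ℕ → ℝ → Aff), 0 < R ∧ Ω ⊆ Metric.ball 0 R ∧ 0 ≤ M ∧ 0 < m₀ ∧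
      m₀ ≤ ∫ x, S₀.indicator ρ₀' x ∧
      ∀ n, IsFlowOf T Ω S₀ M m₀ K (S n) (ρ n) (u n) (ρ₀ n) (Y n) := by
  obtain ⟨R, hR, hΩR⟩ : ∃ R, 0 < R ∧ Ω ⊆ Metric.ball 0 R := hΩ.2.2.1.subset_ball_lt 0 0
  have hΩb : volume Ω ≠ ⊤ := ((measure_mono hΩR).trans_lt measure_ball_lt_top).ne
  have hΩm := hΩ.1.measurableSet
  obtain ⟨M', hM'⟩ := h.density_bdd
  set M := max M' 0
  have hM : 0 ≤ M := le_max_right _ _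
  have hρM : ∀ n, ∀ᵐ z ∂cyl T Ω, z ∈ swept (S n) → ρ n z ≤ M := fun n => by
    filter_upwards [hM' n] with z hz hzS
    exact (hz hzS).trans (le_max_left _ _)
  have hi' := h.integrable_initial hΩb hS₀ hS₀Ω hγ
  have hin : ∀ n, Integrable (S₀.indicator (ρ₀ n)) := fun n =>
    (h.transported n).transport_density.2.2.1
  have hconv : Tendsto (fun n => ∫ x, S₀.indicator (ρ₀ n) x) atTop
      (𝓝 (∫ x, S₀.indicator ρ₀' x)) := by
    refine tendsto_integral_of_L1 _ hi'.1 (Eventually.of_forall hin) ?_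
    have := h.tendsto_initial hΩb hS₀ hS₀Ω hγ
    simpa only [eLpNorm_one_eq_lintegral_enorm, Pi.sub_apply] using this
  -- A convergent sequence together with its limit is compact, so the infimum of the initial masses
  -- is attained, by a positive number.
  obtain ⟨m₀, hm, hm', hmn⟩ : ∃ m₀ : ℝ, 0 < m₀ ∧ m₀ ≤ ∫ x, S₀.indicator ρ₀' x ∧
      ∀ n, m₀ ≤ ∫ x, S₀.indicator (ρ₀ n) x := by
    obtain ⟨m₀, hmem, hmin⟩ := hconv.isCompact_insert_range.exists_isLeast (insert_nonempty _ _)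
    refine ⟨m₀, ?_, hmin (mem_insert _ _), fun n => hmin (mem_insert_of_mem _ ⟨n, rfl⟩)⟩
    rcases hmem with rfl | ⟨n, rfl⟩
    · exact integral_indicator_pos hS₀ h.initial_pos_lim hi'
    · exact integral_indicator_pos hS₀ (h.transported n).initial_pos (hin n)
  obtain ⟨K, hK⟩ := exists_flow_bound (M := M) hΩm hR hΩR hm
  obtain ⟨C, hC⟩ := h.velocity_bdd
  have hbody : ∀ n, IsBddBody T Ω M m₀ ((swept (S n)).indicator (ρ n)) (u n) := fun n =>
    (h.transported n).isBddBody hΩm hΩR hS₀Ω hM (hρM n) (hmn n)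
  have hflow : ∀ n, ∃ Y, IsRigidFlow (transVel T ((swept (S n)).indicator (ρ n)) (u n))
      (rotVel T ((swept (S n)).indicator (ρ n)) (u n)) Y := fun n =>
    exists_rigidFlow hT (hK T _ _ (hbody n)).1.1 (hK T _ _ (hbody n)).2.1
      (fun t ht => indicator_of_notMem ht _) (fun t ht => indicator_of_notMem ht _)
  choose Y hY using hflow
  refine ⟨R, M, m₀, K * C, Y, hR, hΩR, hM, hm, hm', fun n => ?_⟩
  obtain ⟨⟨h1, h2⟩, ⟨h3, h4⟩⟩ := hK T _ _ (hbody n)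
  have hKC : (K : ℝ≥0∞) * eLpNorm (u n) 2 (cyl T Ω) ≤ ((K * C : ℝ≥0) : ℝ≥0∞) := by
    push_cast
    gcongr
    exact hC n
  exact ⟨hY n, hbody n, h1, h3, h2.trans hKC, h4.trans hKC,
    (h.transported n).eq_preimage hT hS₀ hΩR hS₀Ω (hY n),
    (h.transported n).density_ae_eq hΩm hΩR hS₀Ω hM (hρM n) (hY n)⟩

end

/-! ### Strong convergence of the densities -/

section

variable {T : ℝ} {Ω S₀ : Set E3} {γ : ℝ}
  {S : ℕ → ℝ → Set E3} {ρ : ℕ → ℝ × E3 → ℝ} {u : ℕ → ℝ × E3 → E3} {ρ₀ : ℕ → E3 → ℝ}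
  {S' : ℝ → Set E3} {ρ' : ℝ × E3 → ℝ} {u' : ℝ × E3 → E3} {ρ₀' : E3 → ℝ}
  {R M m₀ : ℝ} {K : ℝ≥0} {Y : ℕ → ℝ → Aff} {Y' : ℝ → Aff}

lemma IsFlowOf.norm_sub_le {S : ℝ → Set E3} {ρ : ℝ × E3 → ℝ} {u : ℝ × E3 → E3} {ρ₀ : E3 → ℝ}
    {Y : ℝ → Aff} (h : IsFlowOf T Ω S₀ M m₀ K S ρ u ρ₀ Y) {s t : ℝ} (hst : s ≤ t) :
    ‖Y t - Y s‖ ≤ 2 * K * Real.sqrt (t - s) :=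
  h.flow.norm_sub_le h.memLp_trans h.memLp_rot h.trans_le h.rot_le hst

lemma IsRigidFlow.zero {a om : ℝ → E3} {Y : ℝ → Aff} (hY : IsRigidFlow a om Y) :
    Y 0 = (ContinuousLinearMap.id ℝ E3, 0) := by
  rw [hY.eq_curve, curve_zero]

lemma IsFlowOf.norm_snd_le {S : ℝ → Set E3} {ρ : ℝ × E3 → ℝ} {u : ℝ × E3 → E3} {ρ₀ : E3 → ℝ}
    {Y : ℝ → Aff} (h : IsFlowOf T Ω S₀ M m₀ K S ρ u ρ₀ Y) {t : ℝ} (ht : t ∈ Icc 0 T) :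
    ‖(Y t).2‖ ≤ 2 * K * Real.sqrt T := by
  have h1 := h.norm_sub_le ht.1
  rw [h.flow.zero, sub_zero] at h1
  have h2 : ‖(Y t).2‖ ≤ ‖Y t - (ContinuousLinearMap.id ℝ E3, 0)‖ := by
    have := _root_.norm_snd_le (Y t - (ContinuousLinearMap.id ℝ E3, 0))
    simpa using this
  refine h2.trans (h1.trans ?_)
  gcongr
  exact ht.2

lemma volume_cyl_lt_top (T : ℝ) {Ω : Set E3} (hΩ : volume Ω ≠ ⊤) :
    (volume : Measure (ℝ × E3)) (Ioo 0 T ×ˢ Ω) < ⊤ := by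
  rw [Measure.volume_eq_prod, Measure.prod_prod]
  exact ENNReal.mul_lt_top (by simp) hΩ.lt_top

lemma IsMovingBody.cyl_swept_ne_top (hS : IsMovingBody T Ω S') (hΩ : volume Ω ≠ ⊤) :
    cyl T univ (swept S') ≠ ⊤ := by
  have h1 : swept S' ≤ᵐ[cyl T univ] Ioo 0 T ×ˢ Ω := by
    filter_upwards [ae_mem_Ioo_cyl T univ MeasurableSet.univ] with z hz hzS
    exact ⟨hz.1, hS.inside z.1 (Ioo_subset_Icc_self hz.1) (subset_closure hzS)⟩
  refine ((measure_mono_ae h1).trans_lt ?_).ne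
  exact (Measure.restrict_apply_le _ _).trans_lt (volume_cyl_lt_top T hΩ)

/-- The moving bodies converge almost everywhere along convergent flows. -/
lemma ae_eventually_mem_iff (hS₀ : IsRegularDomain S₀)
    (hY : ∀ n, ∀ t ∈ Icc 0 T, S n t = act (Y n t) ⁻¹' S₀) (hY' : IsIsometryCurve Y')
    (hlim : ∀ t ∈ Icc 0 T, Tendsto (fun n => Y n t) atTop (𝓝 (Y' t))) :
    ∀ᵐ z ∂cyl T univ, ∀ᶠ n in atTop, (z ∈ swept (S n) ↔ act (Y' z.1) z.2 ∈ S₀) := by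
  filter_upwards [hY'.ae_notMem_frontier T hS₀, ae_mem_Ioo_cyl T univ MeasurableSet.univ]
    with z hz hzT
  have hzI := Ioo_subset_Icc_self hzT.1
  filter_upwards [eventually_mem_iff_of_tendsto hS₀.1 (tendsto_act (hlim z.1 hzI) z.2) hz] with n hn
  rw [← hn]
  change z.2 ∈ S n z.1 ↔ _
  rw [hY n z.1 hzI]
  rfl

lemma ae_eventually_mem_swept_iff (hS₀ : IsRegularDomain S₀)
    (hY : ∀ n, ∀ t ∈ Icc 0 T, S n t = act (Y n t) ⁻¹' S₀) (hY' : IsIsometryCurve Y')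
    (hS' : ∀ t ∈ Icc 0 T, S' t = act (Y' t) ⁻¹' S₀)
    (hlim : ∀ t ∈ Icc 0 T, Tendsto (fun n => Y n t) atTop (𝓝 (Y' t))) :
    ∀ᵐ z ∂cyl T univ, ∀ᶠ n in atTop, (z ∈ swept (S n) ↔ z ∈ swept S') := by
  filter_upwards [ae_eventually_mem_iff hS₀ hY hY' hlim,
    ae_mem_Ioo_cyl T univ MeasurableSet.univ] with z hz hzT
  have : z ∈ swept S' ↔ act (Y' z.1) z.2 ∈ S₀ := by
    change z.2 ∈ S' z.1 ↔ _
    rw [hS' z.1 (Ioo_subset_Icc_self hzT.1)]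
    rfl
  simpa only [this] using hz

/-- The limit body is carried by the limit flow. -/
lemma IsApproximation.eq_preimage_lim (h : IsApproximation T Ω S₀ γ S ρ u ρ₀ S' ρ' u' ρ₀')
    (hT : 0 < T) (hΩ : volume Ω ≠ ⊤) (hS₀ : IsRegularDomain S₀)
    (hY : ∀ n, ∀ t ∈ Icc 0 T, S n t = act (Y n t) ⁻¹' S₀) (hY' : IsIsometryCurve Y')
    (hlim : ∀ t ∈ Icc 0 T, Tendsto (fun n => Y n t) atTop (𝓝 (Y' t))) :
    ∀ t ∈ Icc 0 T, S' t = act (Y' t) ⁻¹' S₀ := by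
  set B : Set (ℝ × E3) := {z | act (Y' z.1) z.2 ∈ S₀} with hB
  have hBm : MeasurableSet B := hS₀.1.measurableSet.preimage hY'.continuous_act'.measurable
  have hA := h.body_lim.measurable
  -- The weak-* limit is `χ` by assumption, while pointwise convergence along the flows gives the
  -- indicator of `B`; both have the same integrals against `g`.
  have hconv : ∀ g : ℝ × E3 → ℝ, Integrable g (cyl T univ) →
      ∫ z, (swept S').indicator g z ∂cyl T univ = ∫ z, B.indicator g z ∂cyl T univ := by
    intro g hg
    refine tendsto_nhds_unique (h.body_tendsto g hg) ?_
    refine tendsto_integral_of_dominated_convergence (fun z => ‖g z‖)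
      (fun n => hg.1.indicator₀ (h.transported n).body.measurable) hg.norm
      (fun n => Eventually.of_forall fun z => norm_indicator_le_norm_self _ _) ?_
    filter_upwards [ae_eventually_mem_iff hS₀ hY hY' hlim] with z hz
    refine tendsto_const_nhds.congr' ?_
    filter_upwards [hz] with n hn
    by_cases hzB : z ∈ B
    · rw [indicator_of_mem hzB, indicator_of_mem (hn.2 hzB)]
    · rw [indicator_of_notMem hzB, indicator_of_notMem fun hc => hzB (hn.1 hc)]
  have hAfin := h.body_lim.cyl_swept_ne_top hΩ
  have hBfin : cyl T univ B ≠ ⊤ := by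
    have h1 := (hY'.measurePreserving_homeo_cyl T).measure_preimage
      (MeasurableSet.univ.prod hS₀.1.measurableSet (α := ℝ)).nullMeasurableSet
    have h2 : hY'.homeo ⁻¹' (univ ×ˢ S₀) = B := by
      ext z; simp [hB, hY'.homeo_apply]
    rw [h2, cyl_univ_eq_prod, Measure.prod_prod] at h1
    rw [cyl_univ_eq_prod, h1]
    exact ENNReal.mul_ne_top (by simp) (hS₀.2.2.1.measure_lt_top).ne
  -- Testing with the indicator of the difference set shows that it is null.
  have hAB : cyl T univ (swept S' \ B) = 0 := by
    have hm : NullMeasurableSet (swept S' \ B) (cyl T univ) := hA.diff hBm.nullMeasurableSet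
    have hf : cyl T univ (swept S' \ B) ≠ ⊤ := measure_ne_top_of_subset sdiff_subset hAfin
    have h1 := hconv ((swept S' \ B).indicator fun _ => 1)
      ((integrableOn_const hf).integrable_indicator₀ hm)
    rw [indicator_indicator, indicator_indicator, inter_eq_right.2 sdiff_subset,
      inter_sdiff_self, indicator_empty, integral_zero, integral_indicator₀ hm] at h1
    simpa [measureReal_def, ENNReal.toReal_eq_zero_iff, hf] using h1
  have hBA : cyl T univ (B \ swept S') = 0 := by
    have hm : NullMeasurableSet (B \ swept S') (cyl T univ) := hBm.nullMeasurableSet.diff hA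
    have hf : cyl T univ (B \ swept S') ≠ ⊤ := measure_ne_top_of_subset sdiff_subset hBfin
    have h1 := hconv ((B \ swept S').indicator fun _ => 1)
      ((integrableOn_const hf).integrable_indicator₀ hm)
    rw [indicator_indicator, indicator_indicator, inter_eq_right.2 sdiff_subset,
      inter_sdiff_self, indicator_empty, integral_zero, integral_indicator₀ hm] at h1
    symm at h1
    simpa [measureReal_def, ENNReal.toReal_eq_zero_iff, hf] using h1
  refine h.body_lim.eq_preimage hT hS₀ hY' ?_
  filter_upwards [measure_eq_zero_iff_ae_notMem.1 hAB, measure_eq_zero_iff_ae_notMem.1 hBA]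
    with z h1 h2
  by_cases hz : z ∈ swept S'
  · have hzB : act (Y' z.1) z.2 ∈ S₀ := by
      by_contra hc
      exact h1 ⟨hz, hc⟩
    simp [hz, hzB]
  · have hzB : act (Y' z.1) z.2 ∉ S₀ := fun hc => h2 ⟨hc, hz⟩
    simp [hz, hzB]

/-- The strong limit of `ρₙ χₙ` is `ρ χ`. -/
lemma IsApproximation.density_lim_eq (h : IsApproximation T Ω S₀ γ S ρ u ρ₀ S' ρ' u' ρ₀')
    (hΩm : MeasurableSet Ω) (hΩ : volume Ω ≠ ⊤) (hγ : 3 / 2 ≤ γ)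
    (hset : ∀ᵐ z ∂cyl T univ, ∀ᶠ n in atTop, (z ∈ swept (S n) ↔ z ∈ swept S'))
    (hσm : ∀ n, Integrable ((swept (S n)).indicator (ρ n)) (cyl T univ))
    {s : ℝ × E3 → ℝ} (hs : Integrable s (cyl T univ))
    (hlim : Tendsto (fun n => eLpNorm ((swept (S n)).indicator (ρ n) - s) 1 (cyl T univ)) atTop
      (𝓝 0)) (hs0 : ∀ᵐ z ∂cyl T univ, z.2 ∉ Ω → s z = 0) :
    (swept S').indicator ρ' =ᵐ[cyl T univ] s := by
  have hle : cyl T Ω ≤ cyl T univ :=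
    Measure.restrict_mono (prod_mono Subset.rfl (subset_univ Ω)) le_rfl
  have hfm : IsFiniteMeasure (cyl T Ω) := ⟨by
    rw [cyl, Measure.restrict_apply_univ]; exact volume_cyl_lt_top T hΩ⟩
  have hA : ∀ n, NullMeasurableSet (swept (S n)) (cyl T Ω) := fun n =>
    (h.transported n).body.measurable.mono_ac (Measure.absolutelyContinuous_of_le hle)
  have hA' : NullMeasurableSet (swept S') (cyl T Ω) :=
    h.body_lim.measurable.mono_ac (Measure.absolutelyContinuous_of_le hle)
  -- For `γ ≥ 3/2` the exponent `γ + θ` is at least `3/2`.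
  have hq : (1 : ℝ≥0∞) ≤ ENNReal.ofReal (γ + (2 / 3 * γ - 1)) := by
    rw [ENNReal.one_le_ofReal]
    linarith
  have hρ'i : Integrable ρ' (cyl T Ω) := h.density_tendsto.2.1.integrable hq
  -- On `N j` the indicators agree with the limit from index `j` on. There the product of weakly
  -- convergent densities with varying indicators has a fixed second factor. The sets `N j` exhaust
  -- almost all of the cylinder.
  let N : ℕ → Set (ℝ × E3) := fun j => ⋂ n, ⋂ (_ : j ≤ n), {z | z ∈ swept (S n) ↔ z ∈ swept S'}
  have hN : ∀ j, NullMeasurableSet (N j) (cyl T Ω) := by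
    intro j
    refine NullMeasurableSet.iInter fun n => NullMeasurableSet.iInter fun _ => ?_
    have e : {z | z ∈ swept (S n) ↔ z ∈ swept S'}
        = (swept (S n) ∩ swept S') ∪ ((swept (S n))ᶜ ∩ (swept S')ᶜ) := by
      ext z
      simp only [mem_ofPred_eq, mem_union, mem_inter_iff, mem_compl_iff]
      tauto
    rw [e]
    exact ((hA n).inter hA').union ((hA n).compl.inter hA'.compl)
  have hint : ∀ j, (swept S').indicator ρ' =ᵐ[(cyl T Ω).restrict (N j)] s := by
    intro j
    refine Integrable.ae_eq_of_forall_setIntegral_eq _ _ (hρ'i.indicator₀ hA').restrict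
      (hs.mono_measure hle).restrict fun E hE _ => ?_
    rw [Measure.restrict_restrict hE]
    have hEN : NullMeasurableSet (E ∩ N j) (cyl T Ω) := hE.nullMeasurableSet.inter (hN j)
    -- A bounded test function independent of `n`, so admissible in the weak convergence of the
    -- densities.
    set g : ℝ × E3 → ℝ := (E ∩ N j).indicator ((swept S').indicator fun _ => 1) with hg
    have hgm : MemLp g (ENNReal.conjExponent (ENNReal.ofReal (γ + (2 / 3 * γ - 1)))) (cyl T Ω) := by
      refine MemLp.of_bound (((aestronglyMeasurable_const).indicator₀ hA').indicator₀ hEN) 1 ?_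
      refine Eventually.of_forall fun z => ?_
      refine (norm_indicator_le_norm_self _ _).trans ((norm_indicator_le_norm_self _ _).trans ?_)
      simp
    have hpair : ∀ f : ℝ × E3 → ℝ, ∀ A : Set (ℝ × E3), (∀ z ∈ N j, z ∈ A ↔ z ∈ swept S') →
        ∫ z, inner ℝ (f z) (g z) ∂cyl T Ω = ∫ z in E ∩ N j, A.indicator f z ∂cyl T Ω := by
      intro f A hAj
      rw [← integral_indicator₀ hEN]
      refine integral_congr_ae (Eventually.of_forall fun z => ?_)
      by_cases hz : z ∈ E ∩ N j
      · have hiff := hAj z hz.2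
        by_cases hzA : z ∈ swept S'
        · simp [hg, hz, hzA, hiff.2 hzA]
        · simp [hg, hz, hzA, mt hiff.1 hzA]
      · simp only [hg, indicator_of_notMem hz, inner_zero_right]
    have h1 := h.density_tendsto.2.2 g hgm
    rw [hpair ρ' (swept S') fun _ _ => Iff.rfl] at h1
    have h2 : Tendsto (fun n => ∫ z in E ∩ N j, (swept (S n)).indicator (ρ n) z ∂cyl T Ω) atTop
        (𝓝 (∫ z in E ∩ N j, s z ∂cyl T Ω)) := by
      refine tendsto_setIntegral_of_L1' _ (hs.mono_measure hle).1
        (Eventually.of_forall fun n => (hσm n).mono_measure hle) ?_ _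
      exact tendsto_of_tendsto_of_tendsto_of_le_of_le tendsto_const_nhds hlim
        (fun _ => zero_le) fun n => eLpNorm_mono_measure _ hle
    refine tendsto_nhds_unique (h1.congr' ?_) h2
    filter_upwards [eventually_ge_atTop j] with n hn
    refine hpair (ρ n) (swept (S n)) fun z hz => ?_
    exact mem_iInter.1 (mem_iInter.1 hz n) hn
  have hall : ∀ᵐ z ∂cyl T Ω, ∀ j, z ∈ N j → (swept S').indicator ρ' z = s z := by
    rw [ae_all_iff]
    intro j
    exact (ae_restrict_iff'₀ (hN j)).1 (hint j)
  filter_upwards [ae_cyl_univ_of_ae_cyl hΩm hall, hset, hs0] with z hz hzs hz0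
  by_cases hzΩ : z.2 ∈ Ω
  · obtain ⟨j, hj⟩ := eventually_atTop.1 hzs
    exact hz.2 hzΩ j (mem_iInter.2 fun n => mem_iInter.2 fun hn => hj n hn)
  · rw [hz0 hzΩ, indicator_of_notMem]
    exact fun hc => hzΩ (h.body_lim.inside z.1 (Ioo_subset_Icc_self hz.1) (subset_closure hc))

/-- Along a subsequence, flows, bodies and densities converge. -/
theorem IsApproximation.exists_subseq (h : IsApproximation T Ω S₀ γ S ρ u ρ₀ S' ρ' u' ρ₀')
    (hT : 0 < T) (hΩm : MeasurableSet Ω) (hΩ : volume Ω ≠ ⊤) (hS₀ : IsRegularDomain S₀)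
    (hS₀Ω : S₀ ⊆ Ω) (hγ : 3 / 2 ≤ γ) (hm' : m₀ ≤ ∫ x, S₀.indicator ρ₀' x)
    (hY : ∀ n, IsFlowOf T Ω S₀ M m₀ K (S n) (ρ n) (u n) (ρ₀ n) (Y n)) :
    ∃ (k : ℕ → ℕ) (Y' : ℝ → Aff), StrictMono k ∧ IsIsometryCurve Y' ∧
      (∀ t ∈ Icc 0 T, S' t = act (Y' t) ⁻¹' S₀) ∧
      (∀ t ∈ Icc 0 T, Tendsto (fun n => Y (k n) t) atTop (𝓝 (Y' t))) ∧
      (∀ᵐ z ∂cyl T univ, Tendsto (fun n => (swept (S (k n))).indicator (ρ (k n)) z) atTop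
        (𝓝 ((swept S').indicator ρ' z))) ∧
      IsBddBody T Ω M m₀ ((swept S').indicator ρ') u' := by
  obtain ⟨k, Y', hk, hI', hlim⟩ := exists_tendsto_isometryCurve hT.le
    (fun n => (hY n).flow.isIsometryCurve) (fun n => (hY n).flow.zero)
    (fun n s t hst => (hY n).norm_sub_le hst)
  have hc := h.comp hk.tendsto_atTop
  have hpre := hc.eq_preimage_lim hT hΩ hS₀ (fun n => (hY (k n)).eq_preimage) hI' hlim
  have hset := ae_eventually_mem_swept_iff hS₀ (fun n => (hY (k n)).eq_preimage) hI' hpre hlim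
  have hi' := h.integrable_initial hΩ hS₀ hS₀Ω (by linarith)
  have hσi : ∀ n, Integrable ((swept (S n)).indicator (ρ n)) (cyl T univ) := fun n =>
    (h.transported n).transport_density.1
  -- The candidate for the strong limit: the limit initial density carried by the limit flow.
  set s : ℝ × E3 → ℝ := fun z => S₀.indicator ρ₀' (act (Y' z.1) z.2) with hs
  have hsi : Integrable s (cyl T univ) := by
    refine ⟨hI'.aestronglyMeasurable_comp T hi'.1, ?_⟩
    rw [HasFiniteIntegral, hI'.lintegral_act T hi'.1]
    exact ENNReal.mul_lt_top ENNReal.ofReal_lt_top (memLp_one_iff_integrable.2 hi').2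
  have hL1 : Tendsto (fun n => eLpNorm ((swept (S (k n))).indicator (ρ (k n)) - s) 1 (cyl T univ))
      atTop (𝓝 0) := by
    have := tendsto_lintegral_comp_flow (T := T) (B := 2 * K * Real.sqrt T)
      (f := fun n => S₀.indicator (ρ₀ (k n))) (f' := S₀.indicator ρ₀')
      (fun n => (h.transported (k n)).transport_density.2.2.1) hi'
      (hc.tendsto_initial hΩ hS₀ hS₀Ω (by linarith))
      (fun n => (hY (k n)).flow.isIsometryCurve) hI'
      (fun n t ht => (hY (k n)).norm_snd_le (Ioo_subset_Icc_self ht))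
      (fun t ht => hlim t (Ioo_subset_Icc_self ht))
    refine this.congr fun n => eLpNorm_congr_ae ?_
    filter_upwards [(hY (k n)).density] with z hz
    simp only [Pi.sub_apply, hz, hs]
  have hs0 : ∀ᵐ z ∂cyl T univ, z.2 ∉ Ω → s z = 0 := by
    filter_upwards [ae_mem_Ioo_cyl T univ MeasurableSet.univ] with z hz hzΩ
    have hzI := Ioo_subset_Icc_self hz.1
    refine indicator_of_notMem (fun hc => hzΩ ?_) _
    have : z.2 ∈ S' z.1 := by rw [hpre z.1 hzI]; exact hc
    exact h.body_lim.inside z.1 hzI (subset_closure this)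
  have hσ' := hc.density_lim_eq hΩm hΩ hγ hset (fun n => hσi (k n)) hsi hL1 hs0
  -- `L¹` convergence gives convergence almost everywhere only along a further subsequence. The
  -- bounds on the density then pass to the limit pointwise.
  obtain ⟨l, hl, hlae⟩ := (tendstoInMeasure_of_tendsto_eLpNorm one_ne_zero
    (fun n => (hσi (k n)).1) hsi.1 hL1).exists_seq_tendsto_ae
  have hσconv : ∀ᵐ z ∂cyl T univ, Tendsto (fun n => (swept (S (k (l n)))).indicator
      (ρ (k (l n))) z) atTop (𝓝 ((swept S').indicator ρ' z)) := by
    filter_upwards [hlae, hσ'] with z hz hz'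
    rwa [hz']
  refine ⟨k ∘ l, Y', hk.comp hl, hI', hpre, fun t ht => (hlim t ht).comp hl.tendsto_atTop,
    hσconv, ⟨(hsi.congr hσ'.symm).1, ?_, ?_, h.velocity_tendsto.2.1⟩⟩
  · filter_upwards [hσconv, ae_all_iff.2 fun n => (hY (k (l n))).bddBody.bound] with z hz hb
    refine ⟨ge_of_tendsto' hz fun n => (hb n).1, le_of_tendsto' hz fun n => (hb n).2.1,
      fun hzΩ => tendsto_nhds_unique hz ?_⟩
    simp only [(hb _).2.2 hzΩ]
    exact tendsto_const_nhds
  -- The isometries preserve volume, so the limit body has the mass of its initial density at almost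
  -- every time.
  · have h1 : ∀ᵐ z ∂cyl T univ, (swept S').indicator ρ' z = s z := hσ'
    rw [cyl_univ_eq_prod] at h1
    filter_upwards [Measure.ae_ae_of_ae_prod h1] with t ht
    rw [integral_congr_ae ht]
    have := (hI'.measurePreserving_act t).integral_comp
      (hI'.homeoAt t).measurableEmbedding (S₀.indicator ρ₀')
    exact hm'.trans_eq this.symm

end

/-! ### Weak convergence of the rigid velocities -/

lemma tendsto_eLpNorm_of_dominated {α F : Type*} [MeasurableSpace α] [NormedAddCommGroup F]
    {μ : Measure α} {p : ℝ≥0∞} (hp0 : p ≠ 0) (hpt : p ≠ ⊤) {f : ℕ → α → F} {k : α → ℝ}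
    (hf : ∀ n, AEStronglyMeasurable (f n) μ) (hk : MemLp k p μ)
    (hfk : ∀ n, ∀ᵐ x ∂μ, ‖f n x‖ ≤ k x)
    (hlim : ∀ᵐ x ∂μ, Tendsto (fun n => f n x) atTop (𝓝 0)) :
    Tendsto (fun n => eLpNorm (f n) p μ) atTop (𝓝 0) := by
  have hpr : 0 < p.toReal := ENNReal.toReal_pos hp0 hpt
  simp only [eLpNorm_eq_lintegral_rpow_enorm_toReal hp0 hpt]
  have h1 : Tendsto (fun n => ∫⁻ x, ‖f n x‖ₑ ^ p.toReal ∂μ) atTop (𝓝 (∫⁻ _, 0 ∂μ)) := by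
    refine tendsto_lintegral_of_dominated_convergence' (fun x => ‖k x‖ₑ ^ p.toReal)
      (fun n => (hf n).enorm.pow_const _) (fun n => ?_) ?_ ?_
    · filter_upwards [hfk n] with x hx
      gcongr
      rw [← ofReal_norm, ← ofReal_norm]
      exact ENNReal.ofReal_le_ofReal (hx.trans (le_abs_self _))
    · exact (lintegral_rpow_enorm_lt_top_of_eLpNorm_lt_top hp0 hpt hk.2).ne
    · filter_upwards [hlim] with x hx
      have h2 := (ENNReal.continuous_rpow_const (y := p.toReal)).tendsto _ |>.comp hx.enorm
      simpa [hpr, Function.comp_def] using h2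
  rw [lintegral_zero] at h1
  have h3 := (ENNReal.continuous_rpow_const (y := 1 / p.toReal)).tendsto _ |>.comp h1
  simpa [hpr, Function.comp_def] using h3

lemma integrable_inner_of_memLp_two {α : Type*} [MeasurableSpace α] {μ : Measure α} {f g : α → E3}
    (hf : MemLp f 2 μ) (hg : MemLp g 2 μ) : Integrable (fun x => inner ℝ (f x) (g x)) μ :=
  (hf.norm.integrable_mul hg.norm).mono' (hf.1.inner hg.1)
    (Eventually.of_forall fun _ => norm_inner_le_norm _ _)

/-- The pairing of a weakly convergent sequence with a strongly convergent one. -/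
lemma tendsto_integral_inner_of_weak {μ : Measure (ℝ × E3)} {f : ℕ → ℝ × E3 → E3}
    {f' : ℝ × E3 → E3} (hw : WeakTendstoLp μ 2 f f') {C : ℝ≥0} (hC : ∀ n, eLpNorm (f n) 2 μ ≤ C)
    {g : ℕ → ℝ × E3 → E3} {g' : ℝ × E3 → E3} {k : ℝ × E3 → ℝ}
    (hg : ∀ n, AEStronglyMeasurable (g n) μ) (hg' : AEStronglyMeasurable g' μ) (hk : MemLp k 2 μ)
    (hgk : ∀ n, ∀ᵐ z ∂μ, ‖g n z‖ ≤ k z)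
    (hlim : ∀ᵐ z ∂μ, Tendsto (fun n => g n z) atTop (𝓝 (g' z))) :
    Tendsto (fun n => ∫ z, inner ℝ (f n z) (g n z) ∂μ) atTop
      (𝓝 (∫ z, inner ℝ (f' z) (g' z) ∂μ)) := by
  have hg'k : ∀ᵐ z ∂μ, ‖g' z‖ ≤ k z := by
    filter_upwards [hlim, ae_all_iff.2 hgk] with z h1 h2
    exact le_of_tendsto' h1.norm h2
  have hg'm : MemLp g' 2 μ := hk.mono hg' (by
    filter_upwards [hg'k] with z hz using hz.trans (le_abs_self _))
  have hgm : ∀ n, MemLp (g n) 2 μ := fun n => hk.mono (hg n) (by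
    filter_upwards [hgk n] with z hz using hz.trans (le_abs_self _))
  have h0 : Tendsto (fun n => eLpNorm (g n - g') 2 μ) atTop (𝓝 0) := by
    refine tendsto_eLpNorm_of_dominated (k := fun z => 2 * k z) (by norm_num) (by norm_num)
      (fun n => (hg n).sub hg') (hk.const_mul 2) (fun n => ?_) ?_
    · filter_upwards [hgk n, hg'k] with z h1 h2
      refine (norm_sub_le _ _).trans ?_
      linarith
    · filter_upwards [hlim] with z hz
      have := hz.sub_const (g' z)
      simpa using this
  have h2 : ENNReal.conjExponent 2 = 2 := ENNReal.HolderConjugate.conjExponent_eq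
  have h1 := hw.2.2 g' (by rwa [h2])
  -- The `L²` bound on `f n` multiplies the strongly vanishing error of `g n`; the remaining term is
  -- weak convergence against the fixed `g'`.
  have h3 : Tendsto (fun n => ∫ z, inner ℝ (f n z) ((g n - g') z) ∂μ) atTop (𝓝 0) := by
    rw [tendsto_zero_iff_enorm_tendsto_zero]
    have hb : ∀ n, ‖∫ z, inner ℝ (f n z) ((g n - g') z) ∂μ‖ₑ ≤ C * eLpNorm (g n - g') 2 μ := by
      intro n
      refine (enorm_integral_le_lintegral_enorm _).trans ?_
      rw [← eLpNorm_one_eq_lintegral_enorm]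
      refine (eLpNorm_le_eLpNorm_mul_eLpNorm'_of_norm (p := 2) (q := 2) (hw.1 n).1
        ((hg n).sub hg') (fun x y => inner ℝ x y) 1 (Eventually.of_forall fun z => ?_)).trans ?_
      · simpa using norm_inner_le_norm (𝕜 := ℝ) (f n z) ((g n - g') z)
      · rw [ENNReal.coe_one, one_mul]
        gcongr
        exact hC n
    have h4 := ENNReal.Tendsto.const_mul h0 (Or.inr (ENNReal.coe_ne_top (r := C)))
    rw [mul_zero] at h4
    exact tendsto_of_tendsto_of_tendsto_of_le_of_le tendsto_const_nhds h4 (fun _ => zero_le) hb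
  have h5 := h1.add h3
  rw [add_zero] at h5
  refine h5.congr fun n => ?_
  rw [← integral_add (integrable_inner_of_memLp_two (hw.1 n) hg'm)
    (integrable_inner_of_memLp_two (hw.1 n) ((hgm n).sub hg'm))]
  refine integral_congr_ae (Eventually.of_forall fun z => ?_)
  simp [inner_sub_right]

lemma tendsto_clm_apply {ι E F : Type*} [NormedAddCommGroup E] [NormedSpace ℝ E]
    [NormedAddCommGroup F] [NormedSpace ℝ F] {l : Filter ι} {L : ι → E →L[ℝ] F} {L' : E →L[ℝ] F}
    {x : ι → E} {x' : E} (hL : Tendsto L l (𝓝 L')) (hx : Tendsto x l (𝓝 x')) :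
    Tendsto (fun i => L i (x i)) l (𝓝 (L' x')) :=
  (isBoundedBilinearMap_apply.continuous.tendsto (L', x')).comp (hL.prodMk_nhds hx)

lemma tendsto_cross {ι : Type*} {l : Filter ι} {f g : ι → E3} {a b : E3} (hf : Tendsto f l (𝓝 a))
    (hg : Tendsto g l (𝓝 b)) : Tendsto (fun i => cross (f i) (g i)) l (𝓝 (cross a b)) :=
  tendsto_clm_apply ((crossL.continuous.tendsto a).comp hf) hg

/-- A function in `L²(0, T; L¹(Ω))`, used to dominate. -/
structure IsWeight (T : ℝ) (Ω : Set E3) (k : ℝ × E3 → ℝ) : Prop where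
  nonneg : ∀ z, 0 ≤ k z
  meas : AEStronglyMeasurable k (cyl T Ω)
  integrable : ∀ᵐ t ∂volume.restrict (Ioo 0 T), Integrable (fun x => k (t, x)) (volume.restrict Ω)
  memLp : MemLp (fun t => ∫ x in Ω, k (t, x)) 2 (volume.restrict (Ioo 0 T))

/-- Fubini, then Cauchy–Schwarz in time: `v` and the spatial integral of `k` both lie in `L²(0, T)`.
The velocities have exactly the integrability of `v`. -/
lemma IsWeight.integrable_of_le {T : ℝ} {Ω : Set E3} {k : ℝ × E3 → ℝ} (hk : IsWeight T Ω k)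
    {v : ℝ → ℝ} (hv : MemLp v 2 (volume.restrict (Ioo 0 T))) {F : Type*} [NormedAddCommGroup F]
    {f : ℝ × E3 → F} (hf : AEStronglyMeasurable f (cyl T Ω))
    (hfk : ∀ᵐ z ∂cyl T Ω, ‖f z‖ ≤ v z.1 * k z) : Integrable f (cyl T Ω) := by
  refine Integrable.mono' (g := fun z => v z.1 * k z) ?_ hf hfk
  have hm := hk.meas
  rw [cyl_eq_prod] at hm ⊢
  rw [integrable_prod_iff (by exact hv.1.comp_fst.mul hm)]
  refine ⟨?_, ?_⟩
  · filter_upwards [hk.integrable] with t ht using ht.const_mul _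
  · have : (fun t => ∫ x in Ω, ‖v t * k (t, x)‖) = fun t => ‖v t‖ * ∫ x in Ω, k (t, x) := by
      funext t
      rw [← integral_const_mul]
      congr 1
      funext x
      rw [norm_mul, Real.norm_of_nonneg (hk.nonneg _)]
    simp only [this]
    exact hv.norm.integrable_mul hk.memLp

/-- The rigid velocity of a body, which vanishes for `t ∉ (0, T)`. -/
def bodyVel (T : ℝ) (σ : ℝ × E3 → ℝ) (u : ℝ × E3 → E3) (z : ℝ × E3) : E3 :=
  transVel T σ u z.1 + cross (rotVel T σ u z.1) z.2

lemma bodyVel_eq {T : ℝ} (σ : ℝ × E3 → ℝ) (u : ℝ × E3 → E3) {z : ℝ × E3} (hz : z.1 ∈ Ioo 0 T) :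
    bodyVel T σ u z = linVel σ u z.1
      + cross (angVel σ u z.1) (z.2 - center univ fun y => σ (z.1, y)) := by
  rw [bodyVel, ← rigidProjection_univ_eq σ u hz, rigidProjection_univ]

/-- `∫_Ω G(t, x) dx`. -/
def force (Ω : Set E3) (G : ℝ × E3 → E3) (t : ℝ) : E3 := ∫ x in Ω, G (t, x)

/-- `∫_Ω (x - h(t)) × G(t, x) dx`, with `h` the centre of mass. -/
def torque (Ω : Set E3) (σ : ℝ × E3 → ℝ) (G : ℝ × E3 → E3) (t : ℝ) : E3 :=
  ∫ x in Ω, cross (x - center univ fun y => σ (t, y)) (G (t, x))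

/-- The adjoint of `u ↦ bodyVel T σ u`. -/
def dualVel (Ω : Set E3) (σ : ℝ × E3 → ℝ) (G : ℝ × E3 → E3) (z : ℝ × E3) : E3 :=
  σ z • ((mass univ fun y => σ (z.1, y))⁻¹ • force Ω G z.1
    + cross (ContinuousLinearMap.adjoint (invInertia fun y => σ (z.1, y)) (torque Ω σ G z.1))
      (z.2 - center univ fun y => σ (z.1, y)))

section

variable {T : ℝ} {Ω : Set E3} {R M m₀ : ℝ} {σ : ℝ × E3 → ℝ} {u : ℝ × E3 → E3}
  {G : ℝ × E3 → E3} {k : ℝ × E3 → ℝ}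

lemma IsBddBody.aestronglyMeasurable_bodyVel (hb : IsBddBody T Ω M m₀ σ u) :
    AEStronglyMeasurable (bodyVel T σ u) (cyl T Ω) := by
  have hm : AEStronglyMeasurable (fun t => cross (angVel σ u t) (center univ fun y => σ (t, y)))
      (volume.restrict (Ioo 0 T)) :=
    crossL.aestronglyMeasurable_comp₂ hb.aestronglyMeasurable_angVel hb.aestronglyMeasurable_center
  have h1 : AEStronglyMeasurable (transVel T σ u) (volume.restrict (Ioo 0 T)) :=
    ((aestronglyMeasurable_indicator_iff measurableSet_Ioo).2
      (hb.aestronglyMeasurable_linVel.sub hm)).restrict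
  have h2 : AEStronglyMeasurable (rotVel T σ u) (volume.restrict (Ioo 0 T)) :=
    ((aestronglyMeasurable_indicator_iff measurableSet_Ioo).2
      hb.aestronglyMeasurable_angVel).restrict
  rw [cyl_eq_prod]
  exact h1.comp_fst.add
    (crossL.aestronglyMeasurable_comp₂ h2.comp_fst continuous_snd.aestronglyMeasurable)

lemma IsBddBody.aestronglyMeasurable_dualVel (hb : IsBddBody T Ω M m₀ σ u)
    (hG : AEStronglyMeasurable G (cyl T Ω)) : AEStronglyMeasurable (dualVel Ω σ G) (cyl T Ω) := by
  have hσ := hb.meas_inner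
  rw [cyl_eq_prod] at hG hσ ⊢
  have h1 : AEStronglyMeasurable (force Ω G) (volume.restrict (Ioo 0 T)) :=
    hG.integral_prod_right'
  have h2 : AEStronglyMeasurable (torque Ω σ G) (volume.restrict (Ioo 0 T)) :=
    (crossL.aestronglyMeasurable_comp₂
      (hb.aestronglyMeasurable_sub_center (volume.restrict Ω)) hG).integral_prod_right'
  have h3 : AEStronglyMeasurable
      (fun t => ContinuousLinearMap.adjoint (invInertia fun y => σ (t, y)))
      (volume.restrict (Ioo 0 T)) :=
    ContinuousLinearMap.adjoint.continuous.comp_aestronglyMeasurable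
      hb.aestronglyMeasurable_invInertia
  have h4 := (ContinuousLinearMap.id ℝ (E3 →L[ℝ] E3)).aestronglyMeasurable_comp₂ h3 h2
  have h5 := (hb.aestronglyMeasurable_mass.aemeasurable.inv.aestronglyMeasurable).smul h1
  exact hσ.smul (h5.comp_fst.add (crossL.aestronglyMeasurable_comp₂ h4.comp_fst
    (hb.aestronglyMeasurable_sub_center (volume.restrict Ω))))

lemma norm_force_le {t : ℝ} (hk : Integrable (fun x => k (t, x)) (volume.restrict Ω))
    (hGk : ∀ᵐ x ∂volume.restrict Ω, ‖G (t, x)‖ ≤ k (t, x)) :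
    ‖force Ω G t‖ ≤ ∫ x in Ω, k (t, x) := norm_integral_le_of_norm_le hk hGk

lemma norm_torque_le (hΩm : MeasurableSet Ω) (hR : 0 < R) (hΩ : Ω ⊆ Metric.ball 0 R) (hm : 0 < m₀)
    {t : ℝ} (hd : IsDensity Ω M m₀ fun x => σ (t, x))
    (hk : Integrable (fun x => k (t, x)) (volume.restrict Ω))
    (hGk : ∀ᵐ x ∂volume.restrict Ω, ‖G (t, x)‖ ≤ k (t, x)) :
    (∀ᵐ x ∂volume.restrict Ω,
      ‖cross (x - center univ fun y => σ (t, y)) (G (t, x))‖ ≤ 2 * R * k (t, x)) ∧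
    ‖torque Ω σ G t‖ ≤ 2 * R * ∫ x in Ω, k (t, x) := by
  have h1 : ∀ᵐ x ∂volume.restrict Ω,
      ‖cross (x - center univ fun y => σ (t, y)) (G (t, x))‖ ≤ 2 * R * k (t, x) := by
    filter_upwards [hGk, ae_restrict_mem hΩm] with x hx hxΩ
    refine (norm_cross_le _ _).trans ?_
    have a1 := (mem_ball_zero_iff.1 (hΩ hxΩ)).le
    have a2 := hd.norm_center_le hΩ hm
    have a3 := norm_sub_le x (center univ fun y => σ (t, y))
    exact mul_le_mul (by linarith) hx (norm_nonneg _) (by positivity)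
  refine ⟨h1, ?_⟩
  rw [← integral_const_mul]
  exact norm_integral_le_of_norm_le (hk.const_mul _) h1

/-- The bound for `dualVel`. -/
lemma IsBddBody.norm_dualVel_le (hb : IsBddBody T Ω M m₀ σ u) (hΩm : MeasurableSet Ω) (hR : 0 < R)
    (hΩ : Ω ⊆ Metric.ball 0 R) (hm : 0 < m₀) {c : ℝ} (hc : 0 < c)
    (hcs : ∀ s, IsDensity Ω M m₀ s → ‖invInertia s‖ ≤ c⁻¹) (hk : IsWeight T Ω k)
    (hGk : ∀ᵐ z ∂cyl T Ω, ‖G z‖ ≤ k z) :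
    ∀ᵐ z ∂cyl T Ω, ‖dualVel Ω σ G z‖ ≤
      M * (m₀⁻¹ + c⁻¹ * (2 * R) * (2 * R)) * ∫ x in Ω, k (z.1, x) := by
  have h1 := hGk
  rw [cyl_eq_prod] at h1
  have h2 : ∀ᵐ t ∂volume.restrict (Ioo 0 T), IsDensity Ω M m₀ (fun x => σ (t, x)) ∧
      ‖force Ω G t‖ ≤ (∫ x in Ω, k (t, x)) ∧ ‖torque Ω σ G t‖ ≤ 2 * R * ∫ x in Ω, k (t, x) := by
    filter_upwards [hb.ae_density, hk.integrable, Measure.ae_ae_of_ae_prod h1] with t a b d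
    exact ⟨a, norm_force_le b d, (norm_torque_le hΩm hR hΩ hm a b d).2⟩
  have h3 : ∀ᵐ z ∂cyl T Ω, IsDensity Ω M m₀ (fun x => σ (z.1, x)) ∧
      ‖force Ω G z.1‖ ≤ (∫ x in Ω, k (z.1, x)) ∧
      ‖torque Ω σ G z.1‖ ≤ 2 * R * ∫ x in Ω, k (z.1, x) := by
    rw [cyl_eq_prod]
    exact Measure.quasiMeasurePreserving_fst.ae h2
  filter_upwards [h3, ae_cyl_of_ae_cyl_univ hb.bound, ae_mem_Ioo_cyl T Ω hΩm] with z hz hσ hzΩ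
  obtain ⟨hd, hP, hW⟩ := hz
  have hκ : 0 ≤ ∫ x in Ω, k (z.1, x) := integral_nonneg fun x => hk.nonneg _
  have hM : 0 ≤ M := hσ.1.trans hσ.2.1
  rw [dualVel, norm_smul, Real.norm_of_nonneg hσ.1, mul_assoc]
  refine mul_le_mul hσ.2.1 ?_ (norm_nonneg _) hM
  refine (norm_add_le _ _).trans ?_
  rw [add_mul]
  have hmass := hd.mass_pos hm
  refine add_le_add ?_ ?_
  · rw [norm_smul, norm_inv, Real.norm_of_nonneg hmass.le]
    have : (mass univ fun y => σ (z.1, y))⁻¹ ≤ m₀⁻¹ := by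
      have := hd.mass_ge
      rw [mass, Measure.restrict_univ]
      gcongr
    exact mul_le_mul this hP (norm_nonneg _) (by positivity)
  · refine (norm_cross_le _ _).trans ?_
    have a1 := (mem_ball_zero_iff.1 (hΩ hzΩ.2)).le
    have a2 := hd.norm_center_le hΩ hm
    have a3 := norm_sub_le z.2 (center univ fun y => σ (z.1, y))
    have a4 : ‖ContinuousLinearMap.adjoint (invInertia fun y => σ (z.1, y)) (torque Ω σ G z.1)‖
        ≤ c⁻¹ * (2 * R * ∫ x in Ω, k (z.1, x)) := by
      refine (ContinuousLinearMap.le_opNorm _ _).trans ?_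
      rw [LinearIsometryEquiv.norm_map]
      exact mul_le_mul (hcs _ hd) hW (norm_nonneg _) (by positivity)
    calc _ ≤ c⁻¹ * (2 * R * ∫ x in Ω, k (z.1, x)) * (2 * R) :=
          mul_le_mul a4 (by linarith) (norm_nonneg _) (by positivity)
      _ = _ := by ring

/-- Duality between `bodyVel` and `dualVel`. -/
lemma IsBddBody.integral_bodyVel (hb : IsBddBody T Ω M m₀ σ u) (hΩm : MeasurableSet Ω) (hR : 0 < R)
    (hΩ : Ω ⊆ Metric.ball 0 R) (hm : 0 < m₀) (hk : IsWeight T Ω k)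
    (hG : AEStronglyMeasurable G (cyl T Ω)) (hGk : ∀ᵐ z ∂cyl T Ω, ‖G z‖ ≤ k z) :
    ∫ z, inner ℝ (bodyVel T σ u z) (G z) ∂cyl T Ω
      = ∫ z, inner ℝ (u z) (dualVel Ω σ G z) ∂cyl T Ω := by
  obtain ⟨c, K, hc, hcs, hK⟩ := exists_velocity_bound (M := M) hΩm hR hΩ hm
  obtain ⟨hl, ha⟩ := hK T σ u hb
  have hKu : (K : ℝ≥0∞) * eLpNorm u 2 (cyl T Ω) < ⊤ :=
    ENNReal.mul_lt_top ENNReal.coe_lt_top hb.velocity.2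
  have hlm : MemLp (linVel σ u) 2 (volume.restrict (Ioo 0 T)) :=
    ⟨hb.aestronglyMeasurable_linVel, hl.trans_lt hKu⟩
  have ham : MemLp (angVel σ u) 2 (volume.restrict (Ioo 0 T)) :=
    ⟨hb.aestronglyMeasurable_angVel, ha.trans_lt hKu⟩
  have hdens : ∀ᵐ z ∂cyl T Ω, IsDensity Ω M m₀ (fun x => σ (z.1, x)) := by
    rw [cyl_eq_prod]
    exact Measure.quasiMeasurePreserving_fst.ae hb.ae_density
  have hi1 : Integrable (fun z => inner ℝ (bodyVel T σ u z) (G z)) (cyl T Ω) := by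
    refine hk.integrable_of_le (hlm.norm.add (ham.norm.const_mul (2 * R)))
      (hb.aestronglyMeasurable_bodyVel.inner hG) ?_
    filter_upwards [hdens, hGk, ae_mem_Ioo_cyl T Ω hΩm] with z hd hz hzT
    refine (norm_inner_le_norm _ _).trans ?_
    refine mul_le_mul ?_ hz (norm_nonneg _) (by simp only [Pi.add_apply]; positivity)
    rw [bodyVel_eq σ u hzT.1]
    refine (norm_add_le _ _).trans ?_
    simp only [Pi.add_apply]
    refine add_le_add le_rfl ((norm_cross_le _ _).trans ?_)
    rw [mul_comm]
    have a1 := (mem_ball_zero_iff.1 (hΩ hzT.2)).le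
    have a2 := hd.norm_center_le hΩ hm
    have a3 := norm_sub_le z.2 (center univ fun y => σ (z.1, y))
    gcongr
    linarith
  have hΩt : volume Ω ≠ ⊤ := ((measure_mono hΩ).trans_lt measure_ball_lt_top).ne
  have hfin : IsFiniteMeasure (volume.restrict Ω) := ⟨by simpa using hΩt.lt_top⟩
  have hdm : MemLp (dualVel Ω σ G) 2 (cyl T Ω) := by
    have hκ : MemLp (fun z : ℝ × E3 => ∫ x in Ω, k (z.1, x)) 2 (cyl T Ω) := by
      rw [cyl_eq_prod]; exact hk.memLp.comp_fst _
    refine (hκ.const_mul (M * (m₀⁻¹ + c⁻¹ * (2 * R) * (2 * R)))).mono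
      (hb.aestronglyMeasurable_dualVel hG) ?_
    filter_upwards [hb.norm_dualVel_le hΩm hR hΩ hm hc (fun s hs => (hcs s hs).2) hk hGk] with z hz
    exact hz.trans (le_abs_self _)
  have hi2 := integrable_inner_of_memLp_two hb.velocity hdm
  have hGs := hG
  have hGks := hGk
  rw [cyl_eq_prod] at hi1 hi2 hGs hGks ⊢
  rw [integral_prod _ hi1, integral_prod _ hi2]
  refine integral_congr_ae ?_
  filter_upwards [hb.ae_density, hb.ae_velocity, hk.integrable, hGs.prodMk_left,
    Measure.ae_ae_of_ae_prod hGks, ae_restrict_mem measurableSet_Ioo] with t hd hv hkt hGm hGkt ht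
  have hGi : Integrable (fun x => G (t, x)) (volume.restrict Ω) := hkt.mono' hGm hGkt
  have hdm' : AEStronglyMeasurable (fun x => σ (t, x)) (volume.restrict Ω) := hd.meas.restrict
  have hdb : ∀ᵐ x ∂volume.restrict Ω, ‖σ (t, x)‖ ≤ M := by
    filter_upwards [ae_restrict_of_ae hd.bound] with x hx
    rw [Real.norm_of_nonneg hx.1]; exact hx.2.1
  have hvi : Integrable (fun x => u (t, x)) (volume.restrict Ω) := hv.integrable (by norm_num)
  set h := center univ fun y => σ (t, y) with hh
  have hcm : AEStronglyMeasurable (fun x : E3 => x - h) (volume.restrict Ω) := by fun_prop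
  have hWi : Integrable (fun x => cross (x - h) (G (t, x))) (volume.restrict Ω) :=
    (hkt.const_mul (2 * R)).mono' (crossL.aestronglyMeasurable_comp₂ hcm hGm)
      (norm_torque_le hΩm hR hΩ hm hd hkt hGkt).1
  have hcu : Integrable (fun x => cross (x - h) (u (t, x))) (volume.restrict Ω) :=
    (hvi.norm.const_mul (2 * R)).mono' (crossL.aestronglyMeasurable_comp₂ hcm hv.1)
      (norm_torque_le (G := u) (k := fun z => ‖u z‖) hΩm hR hΩ hm hd hvi.norm
        (Eventually.of_forall fun _ => le_rfl)).1
  have hσu : Integrable (fun x => σ (t, x) • u (t, x)) (volume.restrict Ω) :=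
    hvi.bdd_smul M hdm' hdb
  have hσc : Integrable (fun x => σ (t, x) • cross (x - h) (u (t, x))) (volume.restrict Ω) :=
    hcu.bdd_smul M hdm' hdb
  -- At a fixed time the pairing reduces to force and torque. The scalar `m⁻¹` and the adjoint of
  -- the inverse inertia are moved onto them, and the cyclic symmetry of the triple product isolates
  -- `u` again.
  set Q := ContinuousLinearMap.adjoint (invInertia fun y => σ (t, y)) (torque Ω σ G t) with hQ
  calc ∫ x in Ω, inner ℝ (bodyVel T σ u (t, x)) (G (t, x))
      = ∫ x in Ω, (inner ℝ (linVel σ u t) (G (t, x))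
          + inner ℝ (angVel σ u t) (cross (x - h) (G (t, x)))) := by
        congr 1
        funext x
        rw [bodyVel_eq σ u (z := (t, x)) ht, inner_add_left, inner_cross_left]
    _ = inner ℝ (linVel σ u t) (force Ω G t) + inner ℝ (angVel σ u t) (torque Ω σ G t) := by
        rw [integral_add (hGi.const_inner _) (hWi.const_inner _), integral_inner hGi,
          integral_inner hWi]
        rfl
    _ = inner ℝ (∫ x in Ω, σ (t, x) • u (t, x))
          ((mass univ fun y => σ (t, y))⁻¹ • force Ω G t)
        + inner ℝ (∫ x in Ω, σ (t, x) • cross (x - h) (u (t, x))) Q := by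
        rw [linVel, angVel, IsBddBody.integral_univ_eq hd, IsBddBody.integral_univ_eq hd,
          real_inner_smul_left, real_inner_smul_right, hQ,
          ContinuousLinearMap.adjoint_inner_right]
    _ = ∫ x in Ω, (inner ℝ ((mass univ fun y => σ (t, y))⁻¹ • force Ω G t) (σ (t, x) • u (t, x))
          + inner ℝ Q (σ (t, x) • cross (x - h) (u (t, x)))) := by
        rw [integral_add (hσu.const_inner _) (hσc.const_inner _), integral_inner hσu,
          integral_inner hσc, real_inner_comm, real_inner_comm Q]
    _ = _ := by
        congr 1
        funext x
        rw [dualVel, real_inner_smul_right, real_inner_smul_right, real_inner_smul_right,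
          inner_add_right, real_inner_comm, real_inner_comm _ Q, inner_cross_right]
        ring

/-- Convergence of pairings with the rigid velocities. -/
theorem tendsto_integral_bodyVel {σ : ℕ → ℝ × E3 → ℝ} {σ' : ℝ × E3 → ℝ} {u : ℕ → ℝ × E3 → E3}
    {u' : ℝ × E3 → E3} (hΩm : MeasurableSet Ω) (hR : 0 < R) (hΩ : Ω ⊆ Metric.ball 0 R)
    (hm : 0 < m₀) (hb : ∀ n, IsBddBody T Ω M m₀ (σ n) (u n)) (hb' : IsBddBody T Ω M m₀ σ' u')
    (hσ : ∀ᵐ z ∂cyl T univ, Tendsto (fun n => σ n z) atTop (𝓝 (σ' z)))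
    (hu : WeakTendstoLp (cyl T Ω) 2 u u') {C : ℝ≥0} (hC : ∀ n, eLpNorm (u n) 2 (cyl T Ω) ≤ C)
    (hk : IsWeight T Ω k) {G : ℕ → ℝ × E3 → E3} {G' : ℝ × E3 → E3}
    (hG : ∀ n, AEStronglyMeasurable (G n) (cyl T Ω)) (hG' : AEStronglyMeasurable G' (cyl T Ω))
    (hGk : ∀ n, ∀ᵐ z ∂cyl T Ω, ‖G n z‖ ≤ k z)
    (hlim : ∀ᵐ z ∂cyl T Ω, Tendsto (fun n => G n z) atTop (𝓝 (G' z))) :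
    Tendsto (fun n => ∫ z, inner ℝ (bodyVel T (σ n) (u n) z) (G n z) ∂cyl T Ω) atTop
      (𝓝 (∫ z, inner ℝ (bodyVel T σ' u' z) (G' z) ∂cyl T Ω)) := by
  have hG'k : ∀ᵐ z ∂cyl T Ω, ‖G' z‖ ≤ k z := by
    filter_upwards [hlim, ae_all_iff.2 hGk] with z h1 h2
    exact le_of_tendsto' h1.norm h2
  -- By duality the nonlinear dependence on the density is carried entirely by the dual field, which
  -- converges strongly, while `u n` only has to converge weakly.
  simp only [fun n => (hb n).integral_bodyVel hΩm hR hΩ hm hk (hG n) (hGk n),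
    hb'.integral_bodyVel hΩm hR hΩ hm hk hG' hG'k]
  obtain ⟨c, -, hc, hcs, -⟩ := exists_velocity_bound (M := M) hΩm hR hΩ hm
  have hΩt : volume Ω ≠ ⊤ := ((measure_mono hΩ).trans_lt measure_ball_lt_top).ne
  have hfin : IsFiniteMeasure (volume.restrict Ω) := ⟨by simpa using hΩt.lt_top⟩
  have hκ : MemLp (fun z : ℝ × E3 => ∫ x in Ω, k (z.1, x)) 2 (cyl T Ω) := by
    rw [cyl_eq_prod]; exact hk.memLp.comp_fst _
  refine tendsto_integral_inner_of_weak hu hC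
    (fun n => (hb n).aestronglyMeasurable_dualVel (hG n)) (hb'.aestronglyMeasurable_dualVel hG')
    (hκ.const_mul (M * (m₀⁻¹ + c⁻¹ * (2 * R) * (2 * R))))
    (fun n => (hb n).norm_dualVel_le hΩm hR hΩ hm hc (fun s hs => (hcs s hs).2) hk (hGk n)) ?_
  -- At almost every time the densities converge almost everywhere in space, hence so do mass,
  -- centre and inverse inertia, and by domination force and torque.
  have htime : ∀ᵐ t ∂volume.restrict (Ioo 0 T),
      Tendsto (fun n => (mass univ fun y => σ n (t, y))⁻¹ • force Ω (G n) t) atTop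
        (𝓝 ((mass univ fun y => σ' (t, y))⁻¹ • force Ω G' t)) ∧
      Tendsto (fun n => center univ fun y => σ n (t, y)) atTop
        (𝓝 (center univ fun y => σ' (t, y))) ∧
      Tendsto (fun n => ContinuousLinearMap.adjoint (invInertia fun y => σ n (t, y))
        (torque Ω (σ n) (G n) t)) atTop (𝓝 (ContinuousLinearMap.adjoint
          (invInertia fun y => σ' (t, y)) (torque Ω σ' G' t))) := by
    have hσs := hσ
    have hlims := hlim
    have hGks := ae_all_iff.2 hGk
    have hGm : ∀ᵐ t ∂volume.restrict (Ioo 0 T), ∀ n,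
        AEStronglyMeasurable (fun x => G n (t, x)) (volume.restrict Ω) := by
      rw [ae_all_iff]
      intro n
      have := hG n
      rw [cyl_eq_prod] at this
      exact this.prodMk_left
    rw [cyl_univ_eq_prod] at hσs
    rw [cyl_eq_prod] at hlims hGks
    filter_upwards [ae_all_iff.2 fun n => (hb n).ae_density, hb'.ae_density,
      Measure.ae_ae_of_ae_prod hσs, Measure.ae_ae_of_ae_prod hlims,
      Measure.ae_ae_of_ae_prod hGks, hGm, hk.integrable] with t hd hd' hσt hlt hGkt hGmt hkt
    obtain ⟨t1, t2, t3⟩ := tendsto_inertial hΩ hm hd hd' hσt (hcs _ hd').1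
    have hF : Tendsto (fun n => force Ω (G n) t) atTop (𝓝 (force Ω G' t)) := by
      refine tendsto_integral_of_dominated_convergence (fun x => k (t, x)) hGmt hkt (fun n => ?_) hlt
      filter_upwards [hGkt] with x hx using hx n
    have hW : Tendsto (fun n => torque Ω (σ n) (G n) t) atTop (𝓝 (torque Ω σ' G' t)) := by
      refine tendsto_integral_of_dominated_convergence (fun x => 2 * R * k (t, x)) (fun n => ?_)
        (hkt.const_mul _) (fun n => ?_) ?_
      · have hcm : AEStronglyMeasurable (fun x : E3 => x - center univ fun y => σ n (t, y))
          (volume.restrict Ω) := by fun_prop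
        exact crossL.aestronglyMeasurable_comp₂ hcm (hGmt n)
      · exact (norm_torque_le hΩm hR hΩ hm (hd n) hkt (by
          filter_upwards [hGkt] with x hx using hx n)).1
      · filter_upwards [hlt] with x hx
        exact tendsto_cross (tendsto_const_nhds.sub t2) hx
    refine ⟨(t1.inv₀ (hd'.mass_pos hm).ne').smul hF, t2, ?_⟩
    have hadj : Tendsto (fun n => ContinuousLinearMap.adjoint (invInertia fun y => σ n (t, y)))
        atTop (𝓝 (ContinuousLinearMap.adjoint (invInertia fun y => σ' (t, y)))) :=
      (ContinuousLinearMap.adjoint.continuous.tendsto _).comp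
        ((continuous_toEuclideanCLM.tendsto _).comp t3)
    exact tendsto_clm_apply hadj hW
  have htime' := (Measure.quasiMeasurePreserving_fst (μ := volume.restrict (Ioo 0 T))
    (ν := volume.restrict Ω)).ae htime
  rw [← cyl_eq_prod] at htime'
  filter_upwards [htime', ae_cyl_of_ae_cyl_univ hσ] with z hz hσz
  obtain ⟨h1, h2, h3⟩ := hz
  exact hσz.smul (h1.add (tendsto_cross h3 (tendsto_const_nhds.sub h2)))

end

/-! ### Rigid fields are divergence free -/

section

variable {G : Type*} [NormedAddCommGroup G] [NormedSpace ℝ G]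

lemma integral_fderiv_eq_zero {E : Type*} [NormedAddCommGroup E] [NormedSpace ℝ E]
    [FiniteDimensional ℝ E] [MeasurableSpace E] [BorelSpace E] (μ : Measure E)
    [μ.IsAddHaarMeasure] {g : E → G} (hg : ContDiff ℝ ∞ g) (hgc : HasCompactSupport g) (v : E) :
    ∫ x, fderiv ℝ g x v ∂μ = 0 := by
  have hd : Integrable (fun x => fderiv ℝ g x v) μ :=
    ((hg.continuous_fderiv (by simp)).clm_apply continuous_const).integrable_of_hasCompactSupport
      (hgc.fderiv_apply (𝕜 := ℝ) v)
  have := integral_smul_fderiv_eq_neg_fderiv_smul_of_integrable (𝕜 := ℝ) (μ := μ)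
    (f := fun _ => (1 : ℝ)) (g := g) (v := v) (by simp) (by simpa using hd)
    (by simpa using hg.continuous.integrable_of_hasCompactSupport hgc)
    (fun x _ => differentiableAt_const _)
    (fun x _ => (hg.differentiable (by simp)).differentiableAt)
  simpa using this

/-- The `i`-th component of `a + w × x` does not depend on `x_i`, since `(w × e_i) · e_i = 0`.
Integration by parts in each coordinate therefore leaves nothing. -/
lemma integral_fderiv_rigid_slice {g : E3 → G} (hg : ContDiff ℝ ∞ g) (hgc : HasCompactSupport g)
    (a w : E3) : ∫ x, fderiv ℝ g x (a + cross w x) = 0 := by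
  let e : Fin 3 → E3 := fun i => EuclideanSpace.single i (1 : ℝ)
  let f : Fin 3 → E3 → ℝ := fun i x => EuclideanSpace.proj (𝕜 := ℝ) i (a + crossL w x)
  have hf : ∀ i x, HasFDerivAt (f i) ((EuclideanSpace.proj (𝕜 := ℝ) i).comp (crossL w)) x :=
    fun i x => (EuclideanSpace.proj (𝕜 := ℝ) i).hasFDerivAt.comp x
      ((crossL w).hasFDerivAt.const_add a)
  have hfc : ∀ i, Continuous (f i) := fun i =>
    continuous_iff_continuousAt.2 fun x => (hf i x).continuousAt
  have hgd : ∀ v : E3, Continuous fun x => fderiv ℝ g x v := fun v =>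
    (hg.continuous_fderiv (by simp)).clm_apply continuous_const
  have hi : ∀ i, Integrable fun x => f i x • fderiv ℝ g x (e i) := fun i =>
    ((hfc i).smul (hgd _)).integrable_of_hasCompactSupport
      ((hgc.fderiv_apply (𝕜 := ℝ) (e i)).smul_left)
  have hz : ∀ i, ∫ x, f i x • fderiv ℝ g x (e i) = 0 := by
    intro i
    have hdiv : ∀ x, fderiv ℝ (f i) x (e i) = 0 := by
      intro x
      rw [(hf i x).fderiv]
      have h1 := inner_cross_self w (e i)
      rw [EuclideanSpace.inner_single_right] at h1
      simpa [crossL_apply] using h1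
    rw [integral_smul_fderiv_eq_neg_fderiv_smul_of_integrable (𝕜 := ℝ) (by simp [hdiv]) (hi i)
      (((hfc i).smul hg.continuous).integrable_of_hasCompactSupport hgc.smul_left)
      (fun x _ => (hf i x).differentiableAt)
      (fun x _ => (hg.differentiable (by simp)).differentiableAt)]
    simp [hdiv]
  have hsum : ∀ x, fderiv ℝ g x (a + cross w x) = ∑ i, f i x • fderiv ℝ g x (e i) := by
    intro x
    have : a + cross w x = ∑ i, f i x • e i := by
      ext j
      fin_cases j <;> simp [f, e, Fin.sum_univ_three, crossL_apply]
    conv_lhs => rw [this]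
    simp
  simp only [hsum]
  rw [integral_finsetSum _ fun i _ => hi i]
  simp [hz]

/-- Integrability of a bounded field of operators applied to a rigid velocity. -/
lemma integrable_clm_rigid {L : ℝ × E3 → (ℝ × E3 →L[ℝ] G)} (hL : AEStronglyMeasurable L volume)
    {C R : ℝ} (hLC : ∀ z, ‖L z‖ ≤ C) (hLR : ∀ z, L z ≠ 0 → ‖z.2‖ ≤ R)
    {a om : ℝ → E3} (ha : Integrable a) (hom : Integrable om) :
    Integrable fun z : ℝ × E3 => L z (0, a z.1 + cross (om z.1) z.2) := by
  have hm : AEStronglyMeasurable (fun z : ℝ × E3 => ((0 : ℝ), a z.1 + cross (om z.1) z.2))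
      volume := by
    rw [Measure.volume_eq_prod]
    exact aestronglyMeasurable_const.prodMk (ha.1.comp_fst.add
      (crossL.aestronglyMeasurable_comp₂ hom.1.comp_fst continuous_snd.aestronglyMeasurable))
  have hi : Integrable (fun z : ℝ × E3 => (C * (‖a z.1‖ + R * ‖om z.1‖)) *
      (Metric.closedBall (0 : E3) R).indicator (fun _ => (1 : ℝ)) z.2) := by
    rw [Measure.volume_eq_prod]
    refine Integrable.mul_prod (f := fun t => C * (‖a t‖ + R * ‖om t‖))
      (g := (Metric.closedBall (0 : E3) R).indicator fun _ => (1 : ℝ))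
      ((ha.norm.add (hom.norm.const_mul R)).const_mul C) ?_
    exact (integrable_indicator_iff measurableSet_closedBall).2
      (integrableOn_const measure_closedBall_lt_top.ne)
  refine hi.mono' ((ContinuousLinearMap.id ℝ (ℝ × E3 →L[ℝ] G)).aestronglyMeasurable_comp₂ hL hm)
    (Eventually.of_forall fun z => ?_)
  by_cases hz : L z = 0
  · have hC : 0 ≤ C := (norm_nonneg _).trans (hLC z)
    rw [hz]
    by_cases hzb : z.2 ∈ Metric.closedBall (0 : E3) R
    · have : 0 ≤ R := (norm_nonneg _).trans (mem_closedBall_zero_iff.1 hzb)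
      simp only [zero_apply, norm_zero, indicator_of_mem hzb]
      positivity
    · simp [hzb]
  · have hzR := hLR z hz
    rw [indicator_of_mem (mem_closedBall_zero_iff.2 hzR), mul_one]
    refine (ContinuousLinearMap.le_opNorm _ _).trans ?_
    refine mul_le_mul (hLC z) ?_ (norm_nonneg _) ((norm_nonneg _).trans (hLC z))
    rw [Prod.norm_def, norm_zero, max_eq_right (norm_nonneg _)]
    refine (norm_add_le _ _).trans (add_le_add le_rfl ((norm_cross_le _ _).trans ?_))
    rw [mul_comm]
    gcongr

lemma integral_cyl_eq {T : ℝ} {Ω : Set E3} {f : ℝ × E3 → G}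
    (hf : ∀ z, f z ≠ 0 → z ∈ Ioo 0 T ×ˢ Ω) : ∫ z, f z ∂cyl T Ω = ∫ z, f z := by
  refine setIntegral_eq_integral_of_forall_compl_eq_zero fun z hz => ?_
  by_contra hc
  exact hz (hf z hc)

/-- The integral of a material derivative along a rigid field vanishes. -/
lemma integral_fderiv_rigid {T : ℝ} {Ω : Set E3} {Ψ : ℝ × E3 → G} (hΨ : ContDiff ℝ ∞ Ψ)
    (hΨc : HasCompactSupport Ψ) (hΨs : tsupport Ψ ⊆ Ioo 0 T ×ˢ Ω) {a om : ℝ → E3}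
    (ha : Integrable a) (hom : Integrable om) :
    ∫ z, fderiv ℝ Ψ z (1, a z.1 + cross (om z.1) z.2) ∂cyl T Ω = 0 := by
  have hsupp : ∀ z, fderiv ℝ Ψ z ≠ 0 → z ∈ tsupport Ψ := fun z hz =>
    support_fderiv_subset ℝ hz
  rw [integral_cyl_eq]
  swap
  · intro z hz
    refine hΨs (hsupp z fun h0 => hz ?_)
    simp [h0]
  have hcont := hΨ.continuous_fderiv (n := ∞) (by simp)
  obtain ⟨C, hC⟩ := hcont.bounded_above_of_compact_support (hΨc.fderiv (𝕜 := ℝ))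
  obtain ⟨R, hR⟩ := hΨc.isCompact.isBounded.exists_norm_le
  have h1 : Integrable fun z => fderiv ℝ Ψ z (1, 0) :=
    (hcont.clm_apply continuous_const).integrable_of_hasCompactSupport
      (hΨc.fderiv_apply (𝕜 := ℝ) (1, 0))
  have h2 := integrable_clm_rigid hcont.aestronglyMeasurable hC
    (fun z hz => (norm_snd_le z).trans (hR z (hsupp z hz))) ha hom
  -- The time derivative integrates to zero over space-time. The spatial part does so on each slice,
  -- so the coefficients need only be integrable in time.
  have hsplit : ∀ z : ℝ × E3, fderiv ℝ Ψ z (1, a z.1 + cross (om z.1) z.2)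
      = fderiv ℝ Ψ z (1, 0) + fderiv ℝ Ψ z (0, a z.1 + cross (om z.1) z.2) := by
    intro z
    rw [← map_add]
    simp
  simp only [hsplit]
  rw [integral_add h1 h2]
  have e1 : ∫ z, fderiv ℝ Ψ z (1, 0) = 0 := by
    rw [Measure.volume_eq_prod]
    exact integral_fderiv_eq_zero _ hΨ hΨc _
  rw [e1, zero_add]
  rw [Measure.volume_eq_prod] at h2 ⊢
  rw [integral_prod _ h2]
  refine integral_eq_zero_of_ae (Eventually.of_forall fun t => ?_)
  have hslice : ∀ x v, fderiv ℝ Ψ (t, x) (0, v) = fderiv ℝ (fun x => Ψ (t, x)) x v := by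
    intro x v
    have hd : HasFDerivAt (fun x : E3 => Ψ (t, x))
        ((fderiv ℝ Ψ (t, x)).comp (ContinuousLinearMap.inr ℝ ℝ E3)) x :=
      HasFDerivAt.comp x (hΨ.differentiable (by simp)).differentiableAt.hasFDerivAt
        (hasFDerivAt_prodMk_right t x)
    rw [hd.fderiv]
    simp
  simp only [hslice]
  refine integral_fderiv_rigid_slice (hΨ.comp (contDiff_const.prodMk contDiff_id)) ?_ _ _
  refine HasCompactSupport.of_support_subset_isCompact (isCompact_closedBall (0 : E3) R) ?_
  intro x hx
  have := (norm_snd_le _).trans (hR (t, x) (subset_tsupport _ hx))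
  simpa using this

end

/-! ### Bounds for rigid velocities on bounded cylinders -/

/-- A bound for `bodyVel` on the ball of radius `R`. -/
def velBound (T R : ℝ) (σ : ℝ × E3 → ℝ) (u : ℝ × E3 → E3) (t : ℝ) : ℝ :=
  ‖transVel T σ u t‖ + R * ‖rotVel T σ u t‖

lemma norm_bodyVel_le {T R : ℝ} (σ : ℝ × E3 → ℝ) (u : ℝ × E3 → E3) {z : ℝ × E3}
    (hz : ‖z.2‖ ≤ R) : ‖bodyVel T σ u z‖ ≤ velBound T R σ u z.1 := by
  refine (norm_add_le _ _).trans (add_le_add le_rfl ((norm_cross_le _ _).trans ?_))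
  rw [mul_comm]
  gcongr

lemma velBound_nonneg {T R : ℝ} (hR : 0 ≤ R) (σ : ℝ × E3 → ℝ) (u : ℝ × E3 → E3) (t : ℝ) :
    0 ≤ velBound T R σ u t := by
  unfold velBound
  positivity

lemma memLp_velBound {T R : ℝ} {σ : ℝ × E3 → ℝ} {u : ℝ × E3 → E3} (ha : MemLp (transVel T σ u) 2)
    (hom : MemLp (rotVel T σ u) 2) : MemLp (velBound T R σ u) 2 :=
  ha.norm.add (hom.norm.const_mul R)

lemma eLpNorm_velBound_le {T R : ℝ} (hR : 0 ≤ R) {σ : ℝ × E3 → ℝ} {u : ℝ × E3 → E3} {K : ℝ≥0}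
    (ha : MemLp (transVel T σ u) 2) (hom : MemLp (rotVel T σ u) 2)
    (haK : eLpNorm (transVel T σ u) 2 volume ≤ K) (homK : eLpNorm (rotVel T σ u) 2 volume ≤ K) :
    eLpNorm (velBound T R σ u) 2 volume ≤ ((K + R.toNNReal * K : ℝ≥0) : ℝ≥0∞) := by
  have h1 := eLpNorm_add_le (μ := volume) (p := 2) ha.norm.1 (hom.norm.const_mul R).1 (by norm_num)
  refine h1.trans ?_
  rw [eLpNorm_norm]
  have h2 : eLpNorm (fun t => R * ‖rotVel T σ u t‖) 2 volume ≤ R.toNNReal * K := by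
    have := eLpNorm_le_nnreal_smul_eLpNorm_of_ae_le_mul (μ := volume)
      (f := fun t => R * ‖rotVel T σ u t‖) (g := rotVel T σ u) (c := R.toNNReal)
      (Eventually.of_forall fun t => by
        rw [← NNReal.coe_le_coe, NNReal.coe_mul, coe_nnnorm, coe_nnnorm, norm_mul, norm_norm,
          Real.norm_of_nonneg hR, Real.coe_toNNReal _ hR]) 2
    refine this.trans ?_
    rw [ENNReal.smul_def, smul_eq_mul]
    gcongr
  push_cast
  exact add_le_add haK h2

lemma isWeight_const {T : ℝ} {Ω : Set E3} (hΩ : volume Ω ≠ ⊤) {c : ℝ} (hc : 0 ≤ c) :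
    IsWeight T Ω fun _ => c where
  nonneg _ := hc
  meas := aestronglyMeasurable_const
  integrable := Eventually.of_forall fun _ => integrableOn_const hΩ
  memLp := memLp_const _

lemma integrable_transVel {T : ℝ} {σ : ℝ × E3 → ℝ} {u : ℝ × E3 → E3}
    (ha : MemLp (transVel T σ u) 2) : Integrable (transVel T σ u) :=
  integrable_of_memLp_two_of_support ha fun _ ht => indicator_of_notMem ht _

lemma integrable_rotVel {T : ℝ} {σ : ℝ × E3 → ℝ} {u : ℝ × E3 → E3}
    (ha : MemLp (rotVel T σ u) 2) : Integrable (rotVel T σ u) :=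
  integrable_of_memLp_two_of_support ha fun _ ht => indicator_of_notMem ht _

section

variable {T : ℝ} {Ω : Set E3} {R M m₀ : ℝ} {σ : ℝ × E3 → ℝ} {u : ℝ × E3 → E3}
  {G : Type*} [NormedAddCommGroup G] [NormedSpace ℝ G]

/-- The velocity is unbounded only in time, where it is square integrable; on the bounded `Ω` it is
dominated by `velBound`. -/
lemma IsBddBody.integrable_clm (hb : IsBddBody T Ω M m₀ σ u) (hΩm : MeasurableSet Ω) (hR : 0 < R)
    (hΩ : Ω ⊆ Metric.ball 0 R) (hm : 0 < m₀) {L : ℝ × E3 → (ℝ × E3 →L[ℝ] G)}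
    (hL : AEStronglyMeasurable L (cyl T Ω)) {C : ℝ} (hC : 0 ≤ C)
    (hLC : ∀ᵐ z ∂cyl T Ω, ‖L z‖ ≤ C) (c : ℝ) :
    Integrable (fun z => L z (c, bodyVel T σ u z)) (cyl T Ω) := by
  obtain ⟨K, hK⟩ := exists_flow_bound (M := M) hΩm hR hΩ hm
  obtain ⟨⟨ha, -⟩, ⟨hom, -⟩⟩ := hK T σ u hb
  have hΩt : volume Ω ≠ ⊤ := ((measure_mono hΩ).trans_lt measure_ball_lt_top).ne
  have hv : MemLp (fun t => C * (|c| + velBound T R σ u t)) 2 (volume.restrict (Ioo 0 T)) :=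
    ((memLp_const |c|).add ((memLp_velBound ha hom).restrict _)).const_mul C
  refine (isWeight_const (T := T) hΩt zero_le_one).integrable_of_le hv
    ((ContinuousLinearMap.id ℝ (ℝ × E3 →L[ℝ] G)).aestronglyMeasurable_comp₂ hL
      (aestronglyMeasurable_const.prodMk hb.aestronglyMeasurable_bodyVel)) ?_
  filter_upwards [hLC, ae_mem_Ioo_cyl T Ω hΩm] with z hz hzT
  rw [mul_one]
  refine (ContinuousLinearMap.le_opNorm _ _).trans ?_
  refine mul_le_mul hz ?_ (norm_nonneg _) hC
  have h1 := norm_bodyVel_le (T := T) σ u (mem_ball_zero_iff.1 (hΩ hzT.2)).le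
  rw [Prod.norm_def]
  exact max_le (le_add_of_nonneg_right (velBound_nonneg hR.le _ _ _))
    (h1.trans (le_add_of_nonneg_left (abs_nonneg c)))

lemma exists_bound_on_cyl (T : ℝ) (hΩ : Ω ⊆ Metric.ball 0 R) {F : Type*} [NormedAddCommGroup F]
    {f : ℝ × E3 → F} (hf : Continuous f) :
    ∃ C : ℝ, 0 ≤ C ∧ ∀ z : ℝ × E3, z.1 ∈ Ioo 0 T → z.2 ∈ Ω → ‖f z‖ ≤ C := by
  obtain ⟨C, hC⟩ := ((isCompact_Icc (a := (0 : ℝ)) (b := T)).prod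
    (isCompact_closedBall (0 : E3) R)).exists_bound_of_continuousOn hf.continuousOn
  refine ⟨max C 0, le_max_right _ _, fun z h1 h2 => (hC z ⟨Ioo_subset_Icc_self h1, ?_⟩).trans
    (le_max_left _ _)⟩
  exact Metric.ball_subset_closedBall (hΩ h2)

lemma integrable_cyl_of_bound (hΩm : MeasurableSet Ω) (hΩ : volume Ω ≠ ⊤)
    {F : Type*} [NormedAddCommGroup F] {f : ℝ × E3 → F} (hf : AEStronglyMeasurable f (cyl T Ω))
    {C : ℝ} (hC : ∀ z : ℝ × E3, z.1 ∈ Ioo 0 T → z.2 ∈ Ω → ‖f z‖ ≤ C) : Integrable f (cyl T Ω) := by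
  have hfin : IsFiniteMeasure (cyl T Ω) := ⟨by
    rw [cyl, Measure.restrict_apply_univ]; exact volume_cyl_lt_top T hΩ⟩
  refine Integrable.of_bound hf C ?_
  filter_upwards [ae_mem_Ioo_cyl T Ω hΩm] with z hz using hC z hz.1 hz.2

end

/-! ### Transport of the limit body -/

section

variable {T : ℝ} {Ω S₀ : Set E3} {γ : ℝ}
  {S : ℕ → ℝ → Set E3} {ρ : ℕ → ℝ × E3 → ℝ} {u : ℕ → ℝ × E3 → E3} {ρ₀ : ℕ → E3 → ℝ}
  {S' : ℝ → Set E3} {ρ' : ℝ × E3 → ℝ} {u' : ℝ × E3 → E3} {ρ₀' : E3 → ℝ}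
  {R M m₀ : ℝ}

/-- A test function supported in the open cylinder vanishes at time `0`, so the initial datum drops
out of the weak equation. -/
lemma IsTransportedBody.integral_fderiv {S : ℝ → Set E3} {ρ : ℝ × E3 → ℝ} {u : ℝ × E3 → E3}
    {ρ₀ : E3 → ℝ} (h : IsTransportedBody T Ω S₀ S ρ u ρ₀) {η : ℝ × E3 → ℝ} (hη : IsTest T Ω η) :
    ∫ z, (swept S).indicator (fun _ => (1 : ℝ)) z *
      fderiv ℝ η z (1, bodyVel T ((swept S).indicator ρ) u z) ∂cyl T Ω = 0 := by
  have h1 := h.transport_body.2.2.2 η hη.1 hη.2.1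
    (hη.2.2.trans (prod_mono (fun t ht => ht.2) (subset_univ _)))
  have h0 : ∀ x, η (0, x) = 0 := fun x => image_eq_zero_of_notMem_tsupport fun hc =>
    lt_irrefl _ (hη.2.2 hc).1.1
  simp only [h0, mul_zero, integral_zero, add_zero] at h1
  have hsup : ∀ z, (swept S).indicator (fun _ => (1 : ℝ)) z *
      fderiv ℝ η z (1, bodyVel T ((swept S).indicator ρ) u z) ≠ 0 → z ∈ Ioo 0 T ×ˢ Ω := by
    intro z hz
    refine hη.2.2 (support_fderiv_subset ℝ fun hc => hz ?_)
    rw [hc]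
    simp
  rw [integral_cyl_eq hsup, ← integral_cyl_eq (T := T) (Ω := univ)
    fun z hz => ⟨(hsup z hz).1, mem_univ _⟩, ← h1]
  refine integral_congr_ae ?_
  filter_upwards [ae_mem_Ioo_cyl T univ MeasurableSet.univ] with z hz
  rw [solidVelocity_eq h.isOpen hz.1]
  rfl

/-- The limit body is transported by its rigid velocity. -/
lemma IsApproximation.integral_fderiv_lim (h : IsApproximation T Ω S₀ γ S ρ u ρ₀ S' ρ' u' ρ₀')
    (hΩm : MeasurableSet Ω) (hR : 0 < R) (hΩ : Ω ⊆ Metric.ball 0 R) (hm : 0 < m₀)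
    (hb : ∀ n, IsBddBody T Ω M m₀ ((swept (S n)).indicator (ρ n)) (u n))
    (hb' : IsBddBody T Ω M m₀ ((swept S').indicator ρ') u')
    (hset : ∀ᵐ z ∂cyl T univ, ∀ᶠ n in atTop, (z ∈ swept (S n) ↔ z ∈ swept S'))
    (hσ : ∀ᵐ z ∂cyl T univ, Tendsto (fun n => (swept (S n)).indicator (ρ n) z) atTop
      (𝓝 ((swept S').indicator ρ' z))) {η : ℝ × E3 → ℝ} (hη : IsTest T Ω η) :
    ∫ z, (swept S').indicator (fun _ => (1 : ℝ)) z *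
      fderiv ℝ η z (1, bodyVel T ((swept S').indicator ρ') u' z) ∂cyl T Ω = 0 := by
  have hΩt : volume Ω ≠ ⊤ := ((measure_mono hΩ).trans_lt measure_ball_lt_top).ne
  have hle : cyl T Ω ≤ cyl T univ :=
    Measure.restrict_mono (prod_mono Subset.rfl (subset_univ Ω)) le_rfl
  have hcont := hη.1.continuous_fderiv (n := ∞) (by simp)
  obtain ⟨C, hC0, hC⟩ := exists_bound_on_cyl T hΩ hcont
  -- The spatial gradient of `η` as a vector, so that the term with the velocity becomes a pairing
  -- covered by `tendsto_integral_bodyVel`.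
  set D : ℝ × E3 → E3 := fun z => (InnerProductSpace.toDual ℝ E3).symm
    ((fderiv ℝ η z).comp (ContinuousLinearMap.inr ℝ ℝ E3)) with hD
  have hDc : Continuous D := (InnerProductSpace.toDual ℝ E3).symm.continuous.comp
    (hcont.clm_comp continuous_const)
  obtain ⟨C', hC'0, hC'⟩ := exists_bound_on_cyl T hΩ hDc
  have hDV : ∀ z v, fderiv ℝ η z (1, v) = fderiv ℝ η z (1, 0) + inner ℝ v (D z) := by
    intro z v
    rw [real_inner_comm, hD, InnerProductSpace.toDual_symm_apply]
    simp only [ContinuousLinearMap.comp_apply, ContinuousLinearMap.inr_apply]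
    rw [← map_add]
    simp
  have hχm : ∀ {A : ℝ → Set E3}, NullMeasurableSet (swept A) (cyl T univ) →
      AEStronglyMeasurable ((swept A).indicator fun _ => (1 : ℝ)) (cyl T Ω) := fun hA =>
    aestronglyMeasurable_const.indicator₀
      (hA.mono_ac (Measure.absolutelyContinuous_of_le hle))
  have hχ1 : ∀ (A : ℝ → Set E3) z, ‖(swept A).indicator (fun _ => (1 : ℝ)) z‖ ≤ 1 := fun A z =>
    (norm_indicator_le_norm_self _ _).trans (by simp)
  have hi1 : ∀ {A : ℝ → Set E3}, NullMeasurableSet (swept A) (cyl T univ) →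
      Integrable (fun z => (swept A).indicator (fun _ => (1 : ℝ)) z * fderiv ℝ η z (1, 0))
        (cyl T Ω) := by
    intro A hA
    refine integrable_cyl_of_bound hΩm hΩt ((hχm hA).mul
      (hcont.clm_apply continuous_const).aestronglyMeasurable) (C := 1 * (C * ‖((1 : ℝ), (0 : E3))‖))
      fun z hz1 hz2 => ?_
    rw [norm_mul]
    refine mul_le_mul (hχ1 A z) ?_ (norm_nonneg _) zero_le_one
    exact (ContinuousLinearMap.le_opNorm _ _).trans (by gcongr; exact hC z hz1 hz2)
  have hi2 : ∀ {A : ℝ → Set E3} {r v}, NullMeasurableSet (swept A) (cyl T univ) →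
      IsBddBody T Ω M m₀ r v → Integrable (fun z => inner ℝ (bodyVel T r v z)
        ((swept A).indicator (fun _ => (1 : ℝ)) z • D z)) (cyl T Ω) := by
    intro A r v hA hbr
    have := hbr.integrable_clm hΩm hR hΩ hm (L := fun z =>
      (swept A).indicator (fun _ => (1 : ℝ)) z • fderiv ℝ η z)
      ((hχm hA).smul hcont.aestronglyMeasurable) hC0 (by
        filter_upwards [ae_mem_Ioo_cyl T Ω hΩm] with z hz
        rw [norm_smul, ← one_mul C]
        exact mul_le_mul (hχ1 A z) (hC z hz.1 hz.2) (norm_nonneg _) zero_le_one) 0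
    refine this.congr (Eventually.of_forall fun z => ?_)
    simp only [smul_apply, smul_eq_mul, real_inner_smul_right]
    rw [real_inner_comm, hD, InnerProductSpace.toDual_symm_apply]
    simp
  have hsplit : ∀ {A : ℝ → Set E3} {r v}, NullMeasurableSet (swept A) (cyl T univ) →
      IsBddBody T Ω M m₀ r v → ∫ z, (swept A).indicator (fun _ => (1 : ℝ)) z *
        fderiv ℝ η z (1, bodyVel T r v z) ∂cyl T Ω
      = ∫ z, (swept A).indicator (fun _ => (1 : ℝ)) z * fderiv ℝ η z (1, 0) ∂cyl T Ω
        + ∫ z, inner ℝ (bodyVel T r v z)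
          ((swept A).indicator (fun _ => (1 : ℝ)) z • D z) ∂cyl T Ω := by
    intro A r v hA hbr
    rw [← integral_add (hi1 hA) (hi2 hA hbr)]
    refine integral_congr_ae (Eventually.of_forall fun z => ?_)
    simp only [hDV z (bodyVel T r v z), real_inner_smul_right]
    ring
  have hAm : ∀ n, NullMeasurableSet (swept (S n)) (cyl T univ) := fun n =>
    (h.transported n).body.measurable
  have hχlim : ∀ᵐ z ∂cyl T Ω, Tendsto (fun n => (swept (S n)).indicator (fun _ => (1 : ℝ)) z) atTop
      (𝓝 ((swept S').indicator (fun _ => (1 : ℝ)) z)) := by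
    filter_upwards [ae_cyl_of_ae_cyl_univ hset] with z hz
    refine tendsto_const_nhds.congr' ?_
    filter_upwards [hz] with n hn
    by_cases hzS : z ∈ swept S'
    · rw [indicator_of_mem hzS, indicator_of_mem (hn.2 hzS)]
    · rw [indicator_of_notMem hzS, indicator_of_notMem fun hc => hzS (hn.1 hc)]
  have hfin : IsFiniteMeasure (cyl T Ω) := ⟨by
    rw [cyl, Measure.restrict_apply_univ]; exact volume_cyl_lt_top T hΩt⟩
  have hl1 : Tendsto (fun n => ∫ z, (swept (S n)).indicator (fun _ => (1 : ℝ)) z *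
      fderiv ℝ η z (1, 0) ∂cyl T Ω) atTop
      (𝓝 (∫ z, (swept S').indicator (fun _ => (1 : ℝ)) z * fderiv ℝ η z (1, 0) ∂cyl T Ω)) := by
    refine tendsto_integral_of_dominated_convergence (fun z => ‖fderiv ℝ η z (1, 0)‖)
      (fun n => (hi1 (hAm n)).1) ?_ (fun n => Eventually.of_forall fun z => ?_) ?_
    · refine (integrable_cyl_of_bound hΩm hΩt
        (hcont.clm_apply continuous_const).aestronglyMeasurable (C := C * ‖((1 : ℝ), (0 : E3))‖)
        fun z hz1 hz2 => ?_).norm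
      exact (ContinuousLinearMap.le_opNorm _ _).trans (by gcongr; exact hC z hz1 hz2)
    · rw [norm_mul]
      exact mul_le_of_le_one_left (norm_nonneg _) (hχ1 _ z)
    · filter_upwards [hχlim] with z hz using hz.mul_const _
  obtain ⟨Cu, hCu⟩ := h.velocity_bdd
  have hl2 := tendsto_integral_bodyVel hΩm hR hΩ hm hb hb' hσ h.velocity_tendsto hCu
    (isWeight_const (T := T) hΩt hC'0)
    (G := fun n z => (swept (S n)).indicator (fun _ => (1 : ℝ)) z • D z)
    (G' := fun z => (swept S').indicator (fun _ => (1 : ℝ)) z • D z)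
    (fun n => (hχm (hAm n)).smul hDc.aestronglyMeasurable)
    ((hχm h.body_lim.measurable).smul hDc.aestronglyMeasurable)
    (fun n => by
      filter_upwards [ae_mem_Ioo_cyl T Ω hΩm] with z hz
      rw [norm_smul, ← one_mul C']
      exact mul_le_mul (hχ1 _ z) (hC' z hz.1 hz.2) (norm_nonneg _) zero_le_one)
    (by filter_upwards [hχlim] with z hz using hz.smul_const _)
  rw [hsplit h.body_lim.measurable hb']
  -- Every approximate integral is zero, so the limit is.
  refine tendsto_nhds_unique ((hl1.add hl2).congr fun n => ?_) tendsto_const_nhds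
  rw [← hsplit (hAm n) (hb n)]
  exact (h.transported n).integral_fderiv hη

end

/-! ### The material derivative of the limit test function -/

/-- The material derivative `(1 - χ) (∂_t + v · ∇) φF + χ (∂_t + v · ∇) φS`. -/
def glueDeriv (S : ℝ → Set E3) (v φF φS : ℝ × E3 → E3) (z : ℝ × E3) : E3 :=
  fderiv ℝ φF z (1, v z)
    + (swept S).indicator (fun _ => (1 : ℝ)) z • (fderiv ℝ φS z - fderiv ℝ φF z) (1, v z)

section

variable {T : ℝ} {Ω S₀ : Set E3} {S : ℝ → Set E3} {φ φF φS : ℝ × E3 → E3} {Y : ℝ → Aff}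
  {R M m₀ : ℝ} {σ : ℝ × E3 → ℝ} {u : ℝ × E3 → E3}

lemma IsSolidTest.contDiff (h : IsSolidTest T φS) : ContDiff ℝ ∞ φS := by
  obtain ⟨a, b, ha, hb, -, -, -, -, he⟩ := h
  have : φS = fun z => a z.1 + crossL (b z.1) z.2 := by
    funext z
    exact he z.1 z.2
  rw [this]
  exact (ha.comp contDiff_fst).add
    ((crossL.contDiff.comp (hb.comp contDiff_fst)).clm_apply contDiff_snd)

/-- Almost everywhere, `φ` is glued from its fluid and solid parts. -/
lemma IsSlipTest.ae_eq (hφ : IsSlipTest T Ω S φ φF φS) (hΩm : MeasurableSet Ω)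
    (hS₀ : IsRegularDomain S₀) (hY : IsIsometryCurve Y)
    (hS : ∀ t ∈ Icc 0 T, S t = act (Y t) ⁻¹' S₀) :
    φ =ᵐ[cyl T Ω] fun z => φF z + (swept S).indicator (fun _ => (1 : ℝ)) z • (φS z - φF z) := by
  -- The frontier of the moving body is the only place where neither part prescribes `φ`, and it is
  -- null along the isometries.
  filter_upwards [ae_cyl_of_ae_cyl_univ (hY.ae_notMem_frontier T hS₀), ae_mem_Ioo_cyl T Ω hΩm]
    with z hz hzT
  have hzI := Ioo_subset_Icc_self hzT.1
  have hSz := hS z.1 hzI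
  by_cases hzS : z ∈ swept S
  · rw [indicator_of_mem hzS]
    have : φ (z.1, z.2) = φS (z.1, z.2) := hφ.eq_solid z.1 hzI z.2 hzS
    simpa using this
  · have hcl : z.2 ∉ closure (S z.1) := by
      intro hc
      rw [hSz, show act (Y z.1) ⁻¹' S₀ = hY.homeoAt z.1 ⁻¹' S₀ from rfl,
        ← Homeomorph.preimage_closure] at hc
      have hn : act (Y z.1) z.2 ∉ S₀ := by
        intro hc'
        refine hzS ?_
        change z.2 ∈ S z.1
        rw [hSz]
        exact hc'
      exact hz (by rw [hS₀.1.frontier_eq]; exact ⟨hc, hn⟩)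
    rw [indicator_of_notMem hzS]
    have : φ (z.1, z.2) = φF (z.1, z.2) := hφ.eq_fluid z.1 hzI z.2 ⟨hzT.2, hcl⟩
    simpa using this

lemma fderiv_smul_apply {ψ : ℝ × E3 → ℝ} {Φ : ℝ × E3 → E3} (hψ : ContDiff ℝ ∞ ψ)
    (hΦ : ContDiff ℝ ∞ Φ) (z d : ℝ × E3) :
    fderiv ℝ (fun z => ψ z • Φ z) z d = fderiv ℝ ψ z d • Φ z + ψ z • fderiv ℝ Φ z d := by
  rw [fderiv_fun_smul (hψ.differentiable (by simp)).differentiableAt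
    (hΦ.differentiable (by simp)).differentiableAt]
  simp [add_comm]

/-- The weak material derivative of a slip test function. -/
theorem IsSlipTest.hasWeakMaterialDeriv (hφ : IsSlipTest T Ω S φ φF φS) (hΩm : MeasurableSet Ω)
    (hR : 0 < R) (hΩ : Ω ⊆ Metric.ball 0 R) (hm : 0 < m₀) (hS₀ : IsRegularDomain S₀)
    (hY : IsIsometryCurve Y) (hS : ∀ t ∈ Icc 0 T, S t = act (Y t) ⁻¹' S₀)
    (hSm : NullMeasurableSet (swept S) (cyl T univ)) (hb : IsBddBody T Ω M m₀ σ u)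
    (hχ : ∀ η, IsTest T Ω η → ∫ z, (swept S).indicator (fun _ => (1 : ℝ)) z *
      fderiv ℝ η z (1, bodyVel T σ u z) ∂cyl T Ω = 0)
    {v : ℝ × E3 → E3} (hv : ∀ z : ℝ × E3, z.1 ∈ Ioo 0 T → v z = bodyVel T σ u z) :
    HasWeakMaterialDeriv T Ω v φ (glueDeriv S (bodyVel T σ u) φF φS) := by
  have hΩt : volume Ω ≠ ⊤ := ((measure_mono hΩ).trans_lt measure_ball_lt_top).ne
  have hle : cyl T Ω ≤ cyl T univ :=
    Measure.restrict_mono (prod_mono Subset.rfl (subset_univ Ω)) le_rfl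
  have hF := hφ.fluid.1
  have hS' := hφ.solid.contDiff
  have hcF := hF.continuous_fderiv (n := ∞) (by simp)
  have hcS := hS'.continuous_fderiv (n := ∞) (by simp)
  set χ : ℝ × E3 → ℝ := (swept S).indicator fun _ => (1 : ℝ) with hχdef
  have hχm : AEStronglyMeasurable χ (cyl T Ω) := aestronglyMeasurable_const.indicator₀
    (hSm.mono_ac (Measure.absolutelyContinuous_of_le hle))
  have hχ1 : ∀ z, ‖χ z‖ ≤ 1 := fun z => (norm_indicator_le_norm_self _ _).trans (by simp)
  obtain ⟨C₁, hC₁0, hC₁⟩ := exists_bound_on_cyl T hΩ hF.continuous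
  obtain ⟨C₂, hC₂0, hC₂⟩ := exists_bound_on_cyl T hΩ hS'.continuous
  obtain ⟨C₃, hC₃0, hC₃⟩ := exists_bound_on_cyl T hΩ hcF
  obtain ⟨C₄, hC₄0, hC₄⟩ := exists_bound_on_cyl T hΩ (hcS.sub hcF)
  have hae := hφ.ae_eq hΩm hS₀ hY hS
  have hgm : AEStronglyMeasurable (fun z => φF z + χ z • (φS z - φF z)) (cyl T Ω) :=
    hF.continuous.aestronglyMeasurable.add
      (hχm.smul (hS'.continuous.sub hF.continuous).aestronglyMeasurable)
  have hgb : ∀ z : ℝ × E3, z.1 ∈ Ioo 0 T → z.2 ∈ Ω →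
      ‖φF z + χ z • (φS z - φF z)‖ ≤ C₁ + (C₂ + C₁) := by
    intro z h1 h2
    refine (norm_add_le _ _).trans (add_le_add (hC₁ z h1 h2) ?_)
    rw [norm_smul]
    refine (mul_le_of_le_one_left (norm_nonneg _) (hχ1 z)).trans ((norm_sub_le _ _).trans ?_)
    exact add_le_add (hC₂ z h1 h2) (hC₁ z h1 h2)
  have hφi : Integrable φ (cyl T Ω) := (integrable_cyl_of_bound hΩm hΩt hgm hgb).congr hae.symm
  have hVi : Integrable (bodyVel T σ u) (cyl T Ω) := by
    have := hb.integrable_clm hΩm hR hΩ hm (L := fun _ => ContinuousLinearMap.snd ℝ ℝ E3)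
      aestronglyMeasurable_const zero_le_one
      (Eventually.of_forall fun _ => ContinuousLinearMap.norm_snd_le ℝ ℝ E3) 1
    simpa using this
  have hVφ : Integrable (fun z => ‖v z‖ • φ z) (cyl T Ω) := by
    have h1 : Integrable (fun z => ‖bodyVel T σ u z‖ • (φF z + χ z • (φS z - φF z))) (cyl T Ω) := by
      refine (hVi.norm.mul_const (C₁ + (C₂ + C₁))).mono' (hVi.norm.1.smul hgm) ?_
      filter_upwards [ae_mem_Ioo_cyl T Ω hΩm] with z hz
      rw [norm_smul, norm_norm]
      gcongr
      exact hgb z hz.1 hz.2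
    refine h1.congr ?_
    filter_upwards [hae, ae_mem_Ioo_cyl T Ω hΩm] with z h1 h2
    rw [h1, hv z h2.1]
  have hdF : Integrable (fun z => fderiv ℝ φF z (1, bodyVel T σ u z)) (cyl T Ω) :=
    hb.integrable_clm hΩm hR hΩ hm hcF.aestronglyMeasurable hC₃0 (by
      filter_upwards [ae_mem_Ioo_cyl T Ω hΩm] with z hz using hC₃ z hz.1 hz.2) 1
  have hdS : Integrable (fun z => χ z • (fderiv ℝ φS z - fderiv ℝ φF z) (1, bodyVel T σ u z))
      (cyl T Ω) := by
    refine hb.integrable_clm hΩm hR hΩ hm (L := fun z => χ z • (fderiv ℝ φS z - fderiv ℝ φF z))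
      (hχm.smul (hcS.sub hcF).aestronglyMeasurable) hC₄0 ?_ 1
    filter_upwards [ae_mem_Ioo_cyl T Ω hΩm] with z hz
    rw [norm_smul]
    exact (mul_le_of_le_one_left (norm_nonneg _) (hχ1 z)).trans (hC₄ z hz.1 hz.2)
  refine ⟨IntegrableOn.locallyIntegrableOn hφi, IntegrableOn.locallyIntegrableOn hVφ,
    IntegrableOn.locallyIntegrableOn (hdF.add hdS), fun ψ hψ => ?_⟩
  have hcψ := hψ.1.continuous_fderiv (n := ∞) (by simp)
  obtain ⟨K, hK⟩ := exists_flow_bound (M := M) hΩm hR hΩ hm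
  obtain ⟨⟨ha, -⟩, ⟨hom, -⟩⟩ := hK T σ u hb
  have hsupp : ∀ {Φ : ℝ × E3 → E3}, tsupport (fun z => ψ z • Φ z) ⊆ Ioo 0 T ×ˢ Ω := fun {Φ} =>
    (closure_mono (Function.support_smul_subset_left ψ Φ)).trans hψ.2.2
  have hcs : ∀ {Φ : ℝ × E3 → E3}, HasCompactSupport fun z => ψ z • Φ z := fun {Φ} =>
    hψ.2.1.smul_right
  have hΦi : ∀ {Φ : ℝ × E3 → E3}, ContDiff ℝ ∞ Φ → ∀ {θ : ℝ × E3 → ℝ},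
      AEStronglyMeasurable θ (cyl T Ω) → (∀ z, ‖θ z‖ ≤ 1) → Integrable (fun z => θ z •
        fderiv ℝ (fun z => ψ z • Φ z) z (1, bodyVel T σ u z)) (cyl T Ω) := by
    intro Φ hΦ θ hθ hθ1
    have hc : Continuous (fderiv ℝ fun z => ψ z • Φ z) :=
      (hψ.1.smul hΦ).continuous_fderiv (n := ∞) (by simp)
    obtain ⟨C, hC0, hC⟩ := exists_bound_on_cyl T hΩ hc
    refine hb.integrable_clm hΩm hR hΩ hm (L := fun z => θ z • fderiv ℝ (fun z => ψ z • Φ z) z)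
      (hθ.smul hc.aestronglyMeasurable) hC0 ?_ 1
    filter_upwards [ae_mem_Ioo_cyl T Ω hΩm] with z hz
    rw [norm_smul]
    exact (mul_le_of_le_one_left (norm_nonneg _) (hθ1 z)).trans (hC z hz.1 hz.2)
  -- Since `ψ φ = ψ φF + χ ψ (φS - φF)`, two integrals have to vanish: the first because rigid
  -- fields are divergence free, the second (`e2`) because `χ` is transported.
  have e1 : ∫ z, fderiv ℝ (fun z => ψ z • φF z) z (1, bodyVel T σ u z) ∂cyl T Ω = 0 :=
    integral_fderiv_rigid (hψ.1.smul hF) hcs hsupp (integrable_transVel ha) (integrable_rotVel hom)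
  have e2 : ∫ z, χ z • fderiv ℝ (fun z => ψ z • (φS z - φF z)) z (1, bodyVel T σ u z) ∂cyl T Ω
      = 0 := by
    -- The transport identity is scalar, so it is applied to the component in an arbitrary direction
    -- `c`.
    refine ext_inner_left ℝ fun c => ?_
    rw [← integral_inner (hΦi (hS'.sub hF) hχm hχ1), inner_zero_right,
      ← hχ (fun z => inner ℝ c (ψ z • (φS z - φF z))) ⟨?_, ?_, ?_⟩]
    · refine integral_congr_ae (Eventually.of_forall fun z => ?_)
      have hd : HasFDerivAt (fun z => inner ℝ c (ψ z • (φS z - φF z)))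
          ((innerSL ℝ c).comp (fderiv ℝ (fun z => ψ z • (φS z - φF z)) z)) z :=
        (innerSL ℝ c).hasFDerivAt.comp z
          ((hψ.1.smul (hS'.sub hF)).differentiable (by simp)).differentiableAt.hasFDerivAt
      simp only [hd.fderiv]
      rw [real_inner_smul_right]
      rfl
    · exact contDiff_const.inner ℝ (hψ.1.smul (hS'.sub hF))
    · exact (hcs (Φ := fun z => φS z - φF z)).comp_left (g := fun w => inner ℝ c w) (by simp)
    · refine (closure_mono ?_).trans (hsupp (Φ := fun z => φS z - φF z))
      intro z hz hc
      refine hz ?_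
      simp only at hc
      simp only [hc, inner_zero_right]
  have hψφ : ∫ z, fderiv ℝ ψ z (1, v z) • φ z ∂cyl T Ω =
      ∫ z, (fderiv ℝ (fun z => ψ z • φF z) z (1, bodyVel T σ u z)
        + χ z • fderiv ℝ (fun z => ψ z • (φS z - φF z)) z (1, bodyVel T σ u z)
        - ψ z • glueDeriv S (bodyVel T σ u) φF φS z) ∂cyl T Ω := by
    refine integral_congr_ae ?_
    filter_upwards [hae, ae_mem_Ioo_cyl T Ω hΩm] with z h1 h2
    rw [h1, hv z h2.1, fderiv_smul_apply hψ.1 hF, fderiv_smul_apply hψ.1 (hS'.sub hF), glueDeriv,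
      fderiv_fun_sub (hS'.differentiable (by simp)).differentiableAt
        (hF.differentiable (by simp)).differentiableAt]
    simp only [← hχdef]
    module
  have i1 : Integrable (fun z => fderiv ℝ (fun z => ψ z • φF z) z (1, bodyVel T σ u z))
      (cyl T Ω) := by
    have := hΦi hF (θ := fun _ => 1) aestronglyMeasurable_const (by simp)
    simpa using this
  have i3 : Integrable (fun z => ψ z • glueDeriv S (bodyVel T σ u) φF φS z) (cyl T Ω) := by
    obtain ⟨C, hC⟩ := hψ.1.continuous.bounded_above_of_compact_support hψ.2.1
    exact (hdF.add hdS).bdd_smul C hψ.1.continuous.aestronglyMeasurable (Eventually.of_forall hC)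
  have i2 := hΦi (hS'.sub hF) hχm hχ1
  rw [hψφ, integral_sub (by exact i1.add i2) i3, integral_add i1 i2, e1, e2, add_zero, zero_sub]

end

/-! ### Interpolation between the solid and the fluid test function along a flow -/

/-- `φS + ζ(Y(t) x) (φF - φS)`. -/
def interp (ζ : E3 → ℝ) (Y : ℝ → Aff) (φF φS : ℝ × E3 → E3) (z : ℝ × E3) : E3 :=
  φS z + ζ (act (Y z.1) z.2) • (φF z - φS z)

/-- The space-time derivative of `interp ζ Y φF φS`, if `Y` is the backward flow of `V`. -/
def interpDeriv (ζ : E3 → ℝ) (Y : ℝ → Aff) (V φF φS : ℝ × E3 → E3) (z : ℝ × E3) :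
    ℝ × E3 →L[ℝ] E3 :=
  fderiv ℝ φS z + ζ (act (Y z.1) z.2) • (fderiv ℝ φF z - fderiv ℝ φS z)
    + ((fderiv ℝ ζ (act (Y z.1) z.2)).comp ((Y z.1).1.comp (ContinuousLinearMap.snd ℝ ℝ E3
      - (ContinuousLinearMap.fst ℝ ℝ E3).smulRight (V z)))).smulRight (φF z - φS z)

lemma interpDeriv_apply (ζ : E3 → ℝ) (Y : ℝ → Aff) (V φF φS : ℝ × E3 → E3) (z d : ℝ × E3) :
    interpDeriv ζ Y V φF φS z d = fderiv ℝ φS z d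
      + ζ (act (Y z.1) z.2) • (fderiv ℝ φF z - fderiv ℝ φS z) d
      + fderiv ℝ ζ (act (Y z.1) z.2) ((Y z.1).1 (d.2 - d.1 • V z)) • (φF z - φS z) := by
  simp [interpDeriv]

/-- The material derivative along `V` does not see the cut-off. -/
lemma interpDeriv_apply_velocity (ζ : E3 → ℝ) (Y : ℝ → Aff) (V φF φS : ℝ × E3 → E3) (z : ℝ × E3) :
    interpDeriv ζ Y V φF φS z (1, V z) = fderiv ℝ φS z (1, V z)
      + ζ (act (Y z.1) z.2) • (fderiv ℝ φF z - fderiv ℝ φS z) (1, V z) := by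
  simp [interpDeriv_apply]

section

variable {T : ℝ} {Ω : Set E3} {R M m₀ : ℝ} {σ : ℝ × E3 → ℝ} {u : ℝ × E3 → E3}
  {ζ : E3 → ℝ} {Y : ℝ → Aff} {φF φS : ℝ × E3 → E3}

lemma continuous_interp (hζ : ContDiff ℝ ∞ ζ) (hY : IsIsometryCurve Y) (hF : ContDiff ℝ ∞ φF)
    (hS : ContDiff ℝ ∞ φS) : Continuous (interp ζ Y φF φS) :=
  hS.continuous.add ((hζ.continuous.comp hY.continuous_act').smul
    (hF.continuous.sub hS.continuous))

lemma aestronglyMeasurable_interpDeriv {μ : Measure (ℝ × E3)} {V : ℝ × E3 → E3}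
    (hV : AEStronglyMeasurable V μ) (hζ : ContDiff ℝ ∞ ζ) (hY : IsIsometryCurve Y)
    (hF : ContDiff ℝ ∞ φF) (hS : ContDiff ℝ ∞ φS) :
    AEStronglyMeasurable (interpDeriv ζ Y V φF φS) μ := by
  have hcF := hF.continuous_fderiv (n := ∞) (by simp)
  have hcS := hS.continuous_fderiv (n := ∞) (by simp)
  have hcζ := hζ.continuous_fderiv (n := ∞) (by simp)
  have h1 : Continuous fun z : ℝ × E3 => fderiv ℝ φS z
      + ζ (act (Y z.1) z.2) • (fderiv ℝ φF z - fderiv ℝ φS z) :=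
    hcS.add ((hζ.continuous.comp hY.continuous_act').smul (hcF.sub hcS))
  have h2 : Continuous fun z : ℝ × E3 => (fderiv ℝ ζ (act (Y z.1) z.2)).comp (Y z.1).1 :=
    (hcζ.comp hY.continuous_act').clm_comp
      (continuous_fst.comp (hY.continuous.comp continuous_fst))
  have h3 : AEStronglyMeasurable (fun z => ContinuousLinearMap.snd ℝ ℝ E3
      - (ContinuousLinearMap.fst ℝ ℝ E3).smulRight (V z)) μ :=
    aestronglyMeasurable_const.sub
      (((ContinuousLinearMap.smulRightL ℝ (ℝ × E3) E3
        (ContinuousLinearMap.fst ℝ ℝ E3)).continuous).comp_aestronglyMeasurable hV)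
  have h4 := (ContinuousLinearMap.compL ℝ (ℝ × E3) E3 ℝ).aestronglyMeasurable_comp₂
    h2.aestronglyMeasurable h3
  have h5 := (ContinuousLinearMap.smulRightL ℝ (ℝ × E3) E3).aestronglyMeasurable_comp₂ h4
    (hF.continuous.sub hS.continuous).aestronglyMeasurable
  exact h1.aestronglyMeasurable.add h5

/-- Bounds for the derivative of the interpolation. -/
lemma norm_interpDeriv_apply_le {V : ℝ × E3 → E3} (hY : IsIsometryCurve Y)
    (hζ01 : ∀ x, ζ x ∈ Icc (0 : ℝ) 1) {C : ℝ} {z : ℝ × E3} (h1 : ‖fderiv ℝ φS z‖ ≤ C)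
    (h2 : ‖fderiv ℝ φF z - fderiv ℝ φS z‖ ≤ C) (h3 : ‖φF z - φS z‖ ≤ C) (d : ℝ × E3) :
    ‖interpDeriv ζ Y V φF φS z d‖ ≤ 2 * C * ‖d‖
      + ‖fderiv ℝ ζ (act (Y z.1) z.2)‖ * ‖d.2 - d.1 • V z‖ * C := by
  rw [interpDeriv_apply]
  have hζn : ‖ζ (act (Y z.1) z.2)‖ ≤ 1 := by
    rw [Real.norm_of_nonneg (hζ01 _).1]
    exact (hζ01 _).2
  refine (norm_add_le _ _).trans (add_le_add ((norm_add_le _ _).trans ?_) ?_)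
  · have a1 : ‖fderiv ℝ φS z d‖ ≤ C * ‖d‖ :=
      (ContinuousLinearMap.le_opNorm _ _).trans (by gcongr)
    have a2 : ‖ζ (act (Y z.1) z.2) • (fderiv ℝ φF z - fderiv ℝ φS z) d‖ ≤ C * ‖d‖ := by
      rw [norm_smul]
      refine (mul_le_of_le_one_left (norm_nonneg _) hζn).trans ?_
      exact (ContinuousLinearMap.le_opNorm _ _).trans (by gcongr)
    linarith
  · rw [norm_smul]
    refine mul_le_mul ?_ h3 (norm_nonneg _) (by positivity)
    refine (ContinuousLinearMap.le_opNorm _ _).trans ?_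
    rw [hY.isometry]

/-- The interpolation has the expected weak derivative. -/
theorem hasWeakFDeriv_interp (hΩm : MeasurableSet Ω) (hR : 0 < R) (hΩ : Ω ⊆ Metric.ball 0 R)
    (hm : 0 < m₀) (hb : IsBddBody T Ω M m₀ σ u)
    (hY : IsRigidFlow (transVel T σ u) (rotVel T σ u) Y)
    (hζ : ContDiff ℝ ∞ ζ) (hζ01 : ∀ x, ζ x ∈ Icc (0 : ℝ) 1) {B : ℝ}
    (hζB : ∀ x, ‖fderiv ℝ ζ x‖ ≤ B) (hF : ContDiff ℝ ∞ φF) (hS : ContDiff ℝ ∞ φS) :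
    HasWeakFDeriv T Ω (interp ζ Y φF φS) (interpDeriv ζ Y (bodyVel T σ u) φF φS) := by
  have hI := hY.isIsometryCurve
  have hΩt : volume Ω ≠ ⊤ := ((measure_mono hΩ).trans_lt measure_ball_lt_top).ne
  have hcF := hF.continuous_fderiv (n := ∞) (by simp)
  have hcS := hS.continuous_fderiv (n := ∞) (by simp)
  have hci := continuous_interp hζ hI hF hS
  obtain ⟨Ci, -, hCi⟩ := exists_bound_on_cyl T hΩ hci
  have hii : Integrable (interp ζ Y φF φS) (cyl T Ω) :=
    integrable_cyl_of_bound hΩm hΩt hci.aestronglyMeasurable hCi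
  obtain ⟨C₁, hC₁0, hC₁⟩ := exists_bound_on_cyl T hΩ hcS
  obtain ⟨C₂, hC₂0, hC₂⟩ := exists_bound_on_cyl T hΩ (f := fun z => fderiv ℝ φF z - fderiv ℝ φS z)
    (hcF.sub hcS)
  obtain ⟨C₃, hC₃0, hC₃⟩ := exists_bound_on_cyl T hΩ (f := fun z => φF z - φS z)
    (hF.continuous.sub hS.continuous)
  set C := C₁ + C₂ + C₃ with hC
  have hB0 : 0 ≤ B := (norm_nonneg _).trans (hζB 0)
  have hVi : Integrable (bodyVel T σ u) (cyl T Ω) := by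
    have := hb.integrable_clm hΩm hR hΩ hm (L := fun _ => ContinuousLinearMap.snd ℝ ℝ E3)
      aestronglyMeasurable_const zero_le_one
      (Eventually.of_forall fun _ => ContinuousLinearMap.norm_snd_le ℝ ℝ E3) 1
    simpa using this
  have hDm := aestronglyMeasurable_interpDeriv hVi.1 hζ hI hF hS
  have hfin : IsFiniteMeasure (cyl T Ω) := ⟨by
    rw [cyl, Measure.restrict_apply_univ]; exact volume_cyl_lt_top T hΩt⟩
  -- With a gradient bound `B` for the cut-off, the full derivative is dominated by a constant plus
  -- a multiple of `1 + |V|`.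
  have hDi : Integrable (interpDeriv ζ Y (bodyVel T σ u) φF φS) (cyl T Ω) := by
    refine (((integrable_const (2 * C)).add (((integrable_const (1 : ℝ)).add hVi.norm).const_mul
      (B * C)))).mono' hDm ?_
    filter_upwards [ae_mem_Ioo_cyl T Ω hΩm] with z hz
    refine ContinuousLinearMap.opNorm_le_bound _ (by simp only [Pi.add_apply]; positivity) fun d => ?_
    refine (norm_interpDeriv_apply_le hI hζ01 (C := C) (by have := hC₁ z hz.1 hz.2; linarith)
      (by have := hC₂ z hz.1 hz.2; linarith) (by have := hC₃ z hz.1 hz.2; linarith) d).trans ?_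
    have hd : ‖d.2 - d.1 • bodyVel T σ u z‖ ≤ (1 + ‖bodyVel T σ u z‖) * ‖d‖ := by
      refine (norm_sub_le _ _).trans ?_
      rw [norm_smul, add_mul, one_mul]
      have b1 := norm_snd_le d
      have b2 : ‖d.1‖ * ‖bodyVel T σ u z‖ ≤ ‖bodyVel T σ u z‖ * ‖d‖ := by
        rw [mul_comm]
        gcongr
        exact norm_fst_le d
      exact add_le_add b1 b2
    have := mul_le_mul (hζB (act (Y z.1) z.2)) hd (norm_nonneg _) hB0
    have h2 := mul_le_mul_of_nonneg_right this (by positivity : 0 ≤ C)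
    simp only [Pi.add_apply]
    calc _ ≤ 2 * C * ‖d‖ + B * ((1 + ‖bodyVel T σ u z‖) * ‖d‖) * C := by linarith
      _ = _ := by ring
  refine ⟨IntegrableOn.locallyIntegrableOn hii, IntegrableOn.locallyIntegrableOn hDi,
    fun ψ hψ d => ?_⟩
  -- The test function times the interpolation, smooth in the coefficients of the affine map;
  -- composition with `Y` is only absolutely continuous in time.
  set H : ℝ × E3 × Aff → E3 := fun p => ψ (p.1, p.2.1) •
    (φS (p.1, p.2.1) + ζ (act p.2.2 p.2.1) • (φF (p.1, p.2.1) - φS (p.1, p.2.1))) with hH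
  have hpr : ContDiff ℝ ∞ fun p : ℝ × E3 × Aff => (p.1, p.2.1) := by fun_prop
  have hact : ContDiff ℝ ∞ fun p : ℝ × E3 × Aff => act p.2.2 p.2.1 :=
    contDiff_act.comp (by fun_prop : ContDiff ℝ ∞ fun p : ℝ × E3 × Aff => (p.2.2, p.2.1))
  have hHs : ContDiff ℝ ∞ H := (hψ.1.comp hpr).smul ((hS.comp hpr).add
    ((hζ.comp hact).smul ((hF.comp hpr).sub (hS.comp hpr))))
  obtain ⟨r, hr⟩ := hψ.2.1.isCompact.isBounded.exists_norm_le
  have hK : ∀ t x y, H (t, x, y) ≠ 0 → |t| ≤ r ∧ ‖x‖ ≤ r := by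
    intro t x y hne
    have hmem : (t, x) ∈ tsupport ψ := subset_tsupport _ (left_ne_zero_of_smul hne)
    exact ⟨(norm_fst_le (t, x)).trans (hr _ hmem), (norm_snd_le (t, x)).trans (hr _ hmem)⟩
  set y₀ : Aff := (ContinuousLinearMap.id ℝ E3, 0) with hy₀
  set g : ℝ → Aff := fun s => (-((Y s).1.comp (crossL (rotVel T σ u s))),
    -((Y s).1 (transVel T σ u s))) with hg
  have hgI : Integrable g := hY.integrable
  obtain ⟨gk, hgs, hgi, hgt⟩ := exists_smooth_approx hgI
  have hlim := tendsto_integral_fderiv_curve hHs hK (A := Ioo 0 T ×ˢ Ω) (b := fun _ => 1)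
    (v := fun _ => d.2) zero_le_one (integrableOn_const (volume_cyl_lt_top T hΩt).ne) (by simp)
    (by
      simp only [one_smul]
      exact integrableOn_const (volume_cyl_lt_top T hΩt).ne) d.1 y₀ hgI
    hgs hgi hgt
  -- Along smooth curves the integrand is a derivative of a compactly supported smooth function. In
  -- the limit this becomes the integration by parts formula.
  have hzero : ∀ k, ∫ z, (1 : ℝ) • fderiv ℝ (fun z : ℝ × E3 => H (z.1, z.2, curve y₀ (gk k) z.1)) z
      (d.1, d.2) ∂volume.restrict (Ioo 0 T ×ˢ Ω) = 0 := by
    intro k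
    have hs : ContDiff ℝ ∞ fun z : ℝ × E3 => H (z.1, z.2, curve y₀ (gk k) z.1) := by
      refine hHs.comp (contDiff_fst.prodMk (contDiff_snd.prodMk ?_))
      exact (contDiff_curve y₀ (hgs k)).comp contDiff_fst
    have hsub : tsupport (fun z : ℝ × E3 => H (z.1, z.2, curve y₀ (gk k) z.1)) ⊆ tsupport ψ := by
      refine closure_mono ?_
      rintro ⟨t, x⟩ hne
      exact left_ne_zero_of_smul hne
    have hc : HasCompactSupport fun z : ℝ × E3 => H (z.1, z.2, curve y₀ (gk k) z.1) :=
      hψ.2.1.isCompact.of_isClosed_subset (isClosed_tsupport _) hsub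
    simp only [one_smul]
    rw [← cyl, integral_cyl_eq, Measure.volume_eq_prod]
    · exact integral_fderiv_eq_zero _ hs hc _
    · intro z hz
      refine hψ.2.2 (hsub (support_fderiv_subset ℝ fun h0 => hz ?_))
      rw [h0]
      simp
  have heq := tendsto_nhds_unique (hlim.congr hzero) tendsto_const_nhds
  have hYc : ∀ t, curve y₀ g t = Y t := fun t => (congrFun hY.eq_curve t).symm
  have hpt : ∀ z : ℝ × E3, (1 : ℝ) • fderiv ℝ H (z.1, z.2, curve y₀ g z.1) (d.1, d.2, d.1 • g z.1)
      = fderiv ℝ ψ z d • interp ζ Y φF φS z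
        + ψ z • interpDeriv ζ Y (bodyVel T σ u) φF φS z d := by
    intro z
    rw [hYc, one_smul]
    set p : ℝ × E3 × Aff := (z.1, z.2, Y z.1) with hp
    have hπ : HasFDerivAt (fun p : ℝ × E3 × Aff => (p.1, p.2.1))
        ((ContinuousLinearMap.fst ℝ ℝ (E3 × Aff)).prod ((ContinuousLinearMap.fst ℝ E3 Aff).comp
          (ContinuousLinearMap.snd ℝ ℝ (E3 × Aff)))) p :=
      hasFDerivAt_fst.prodMk (hasFDerivAt_fst.comp p hasFDerivAt_snd)
    have dψ := HasFDerivAt.comp (g := ψ) p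
      (hψ.1.differentiable (by simp)).differentiableAt.hasFDerivAt hπ
    have dF := HasFDerivAt.comp (g := φF) p
      (hF.differentiable (by simp)).differentiableAt.hasFDerivAt hπ
    have dS := HasFDerivAt.comp (g := φS) p
      (hS.differentiable (by simp)).differentiableAt.hasFDerivAt hπ
    have dζ := HasFDerivAt.comp (g := ζ) p
      (hζ.differentiable (by simp)).differentiableAt.hasFDerivAt
      (hasFDerivAt_act_apply p 0).1.hasFDerivAt
    have dH : HasFDerivAt H _ p := dψ.smul (dS.add (dζ.smul (dF.sub dS)))
    rw [dH.fderiv]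
    simp only [add_apply, smul_apply, sub_apply, ContinuousLinearMap.comp_apply,
      (hasFDerivAt_act_apply p _).2, Function.comp_apply, ContinuousLinearMap.smulRight_apply,
      ContinuousLinearMap.prod_apply, ContinuousLinearMap.coe_fst',
      ContinuousLinearMap.coe_snd', interpDeriv_apply, interp]
    -- From `Q' = -Q (om ×)` and `y' = -Q a`, the derivative of `Y(t) x` in direction `d` is `Q (d₂
    -- - d₁ V)`; it vanishes for `d = (1, V)`.
    have hvel : p.2.2.1 d.2 + (d.1 • g z.1).1 p.2.1 + (d.1 • g z.1).2
        = (Y z.1).1 (d.2 - d.1 • bodyVel T σ u z) := by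
      simp only [hp, hg, bodyVel, Prod.smul_fst, Prod.smul_snd, smul_apply,
        neg_apply, ContinuousLinearMap.comp_apply, crossL_apply, map_sub, map_smul, map_add]
      module
    rw [hvel]
    simp only [hp, Prod.mk.eta]
    module
  have hcψ := hψ.1.continuous_fderiv (n := ∞) (by simp)
  obtain ⟨Cψ, hCψ⟩ := hψ.1.continuous.bounded_above_of_compact_support hψ.2.1
  have i1 : Integrable (fun z => fderiv ℝ ψ z d • interp ζ Y φF φS z) (cyl T Ω) := by
    have hc : Continuous fun z => fderiv ℝ ψ z d • interp ζ Y φF φS z :=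
      (hcψ.clm_apply continuous_const).smul hci
    obtain ⟨Cc, -, hCc⟩ := exists_bound_on_cyl T hΩ hc
    exact integrable_cyl_of_bound hΩm hΩt hc.aestronglyMeasurable hCc
  have i2 : Integrable (fun z => ψ z • interpDeriv ζ Y (bodyVel T σ u) φF φS z d) (cyl T Ω) :=
    (hDi.apply_continuousLinearMap d).bdd_smul Cψ hψ.1.continuous.aestronglyMeasurable
      (Eventually.of_forall hCψ)
  simp only [hpt] at heq
  rw [← cyl, integral_add i1 i2] at heq
  exact eq_neg_of_add_eq_zero_left heq

end

/-! ### Estimates for the interpolation -/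

/-- A cut-off function of `S₀`: equal to `1` outside `S₀`, with gradient at most `1 / ε` and with
support in `S₀` of measure at most `c ε`. -/
structure IsCutoff (S₀ : Set E3) (c ε : ℝ) (ζ : E3 → ℝ) : Prop where
  contDiff : ContDiff ℝ ∞ ζ
  mem_Icc : ∀ x, ζ x ∈ Icc (0 : ℝ) 1
  eq_one : ∀ x ∉ S₀, ζ x = 1
  norm_fderiv_le : ∀ x, ‖fderiv ℝ ζ x‖ ≤ 1 / ε
  fderiv_ne_zero : ∀ x, fderiv ℝ ζ x ≠ 0 → x ∈ S₀ ∧ ζ x ≠ 0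
  volume_le : volume {x ∈ S₀ | ζ x ≠ 0} ≤ ENNReal.ofReal (c * ε)

/-- A bound for the test functions and their derivatives on a cylinder. -/
structure IsTestBound (T : ℝ) (Ω : Set E3) (φF φS : ℝ × E3 → E3) (C : ℝ) : Prop where
  nonneg : 0 ≤ C
  solid : ∀ z : ℝ × E3, z.1 ∈ Ioo 0 T → z.2 ∈ Ω → ‖φS z‖ ≤ C
  diff : ∀ z : ℝ × E3, z.1 ∈ Ioo 0 T → z.2 ∈ Ω → ‖φF z - φS z‖ ≤ C
  fderiv_solid : ∀ z : ℝ × E3, z.1 ∈ Ioo 0 T → z.2 ∈ Ω → ‖fderiv ℝ φS z‖ ≤ C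
  fderiv_diff : ∀ z : ℝ × E3, z.1 ∈ Ioo 0 T → z.2 ∈ Ω → ‖fderiv ℝ φF z - fderiv ℝ φS z‖ ≤ C

lemma exists_isTestBound (T : ℝ) {Ω : Set E3} {R : ℝ} (hΩ : Ω ⊆ Metric.ball 0 R)
    {φF φS : ℝ × E3 → E3} (hF : ContDiff ℝ ∞ φF) (hS : ContDiff ℝ ∞ φS) :
    ∃ C, IsTestBound T Ω φF φS C := by
  have hcF := hF.continuous_fderiv (n := ∞) (by simp)
  have hcS := hS.continuous_fderiv (n := ∞) (by simp)
  obtain ⟨C₀, hC₀0, hC₀⟩ := exists_bound_on_cyl T hΩ hS.continuous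
  obtain ⟨C₁, hC₁0, hC₁⟩ := exists_bound_on_cyl T hΩ hcS
  obtain ⟨C₂, hC₂0, hC₂⟩ := exists_bound_on_cyl T hΩ (f := fun z => fderiv ℝ φF z - fderiv ℝ φS z)
    (hcF.sub hcS)
  obtain ⟨C₃, hC₃0, hC₃⟩ := exists_bound_on_cyl T hΩ (f := fun z => φF z - φS z)
    (hF.continuous.sub hS.continuous)
  refine ⟨C₀ + C₁ + C₂ + C₃, by positivity, fun z h1 h2 => ?_, fun z h1 h2 => ?_,
    fun z h1 h2 => ?_, fun z h1 h2 => ?_⟩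
  · linarith [hC₀ z h1 h2]
  · linarith [hC₃ z h1 h2]
  · linarith [hC₁ z h1 h2]
  · linarith [hC₂ z h1 h2]

lemma eLpNorm_le_of_le_indicator {α F : Type*} [MeasurableSpace α] [NormedAddCommGroup F]
    {μ : Measure α} {f : α → F} {L : Set α} {C p : ℝ} (hp : 0 < p)
    (hf : ∀ᵐ x ∂μ, ‖f x‖ ≤ L.indicator (fun _ => C) x) :
    eLpNorm f (ENNReal.ofReal p) μ ≤ ENNReal.ofReal C * μ L ^ (1 / p) := by
  have h1 : eLpNorm f (ENNReal.ofReal p) μ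
      ≤ eLpNorm (L.indicator fun _ => C) (ENNReal.ofReal p) μ := by
    refine eLpNorm_mono_ae ?_
    filter_upwards [hf] with x hx using hx.trans (le_abs_self _)
  by_cases hC : 0 ≤ C
  · refine h1.trans ((eLpNorm_indicator_const_le C (ENNReal.ofReal p)).trans ?_)
    rw [ENNReal.toReal_ofReal hp.le, ← ofReal_norm, Real.norm_of_nonneg hC]
  -- A negative constant forces `f = 0` almost everywhere, so no sign condition on `C` is needed.
  · have h0 : f =ᵐ[μ] 0 := by
      filter_upwards [hf] with x hx
      have : L.indicator (fun _ => C) x ≤ 0 := indicator_nonpos (fun _ _ => (not_le.1 hC).le) x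
      exact norm_le_zero_iff.1 (hx.trans this)
    rw [eLpNorm_congr_ae h0]
    simp

lemma normL2Lp_le {T : ℝ} {Ω : Set E3} {p A : ℝ≥0∞} (hA : A ≠ ⊤) {f : ℝ × E3 → E3} {w : ℝ → ℝ}
    (h : ∀ t ∈ Ioo 0 T, eLpNorm (fun x => f (t, x)) p (volume.restrict Ω) ≤ A * ‖w t‖ₑ) :
    normL2Lp T Ω p f ≤ A * eLpNorm w 2 (volume.restrict (Ioo 0 T)) := by
  have h2 := eLpNorm_nnreal_pow_eq_lintegral (μ := volume.restrict (Ioo 0 T)) (f := w)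
    (p := 2) (by norm_num)
  have h3 : eLpNorm w 2 (volume.restrict (Ioo 0 T)) ^ 2 = ∫⁻ t in Ioo 0 T, ‖w t‖ₑ ^ 2 := by
    simpa using h2
  have h4 : ∫⁻ t in Ioo 0 T, eLpNorm (fun x => f (t, x)) p (volume.restrict Ω) ^ 2
      ≤ (A * eLpNorm w 2 (volume.restrict (Ioo 0 T))) ^ 2 := by
    rw [mul_pow, h3, ← lintegral_const_mul' _ _ (ENNReal.pow_ne_top hA)]
    refine setLIntegral_mono' measurableSet_Ioo fun t ht => ?_
    rw [← mul_pow]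
    gcongr
    exact h t ht
  rw [normL2Lp]
  calc _ ≤ ((A * eLpNorm w 2 (volume.restrict (Ioo 0 T))) ^ 2) ^ (1 / 2 : ℝ) := by gcongr
    _ = _ := by
      rw [← ENNReal.rpow_natCast, ← ENNReal.rpow_mul]
      norm_num

section

variable {T : ℝ} {Ω S₀ : Set E3} {R M m₀ : ℝ} {K : ℝ≥0} {S : ℝ → Set E3} {ρ : ℝ × E3 → ℝ}
  {u : ℝ × E3 → E3} {ρ₀ : E3 → ℝ} {ζ : E3 → ℝ} {Y : ℝ → Aff} {φF φS : ℝ × E3 → E3} {c ε C : ℝ}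

lemma IsFlowOf.mem_swept_iff (h : IsFlowOf T Ω S₀ M m₀ K S ρ u ρ₀ Y) {z : ℝ × E3}
    (hz : z.1 ∈ Icc 0 T) : z ∈ swept S ↔ act (Y z.1) z.2 ∈ S₀ := by
  change z.2 ∈ S z.1 ↔ _
  rw [h.eq_preimage z.1 hz]
  rfl

/-- Outside the body the interpolation is the fluid part. -/
lemma IsFlowOf.glue_eq_interp (h : IsFlowOf T Ω S₀ M m₀ K S ρ u ρ₀ Y) (hζ : IsCutoff S₀ c ε ζ)
    {z : ℝ × E3} (hz : z.1 ∈ Icc 0 T) : glue S φF (interp ζ Y φF φS) z = interp ζ Y φF φS z := by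
  by_cases hzS : z ∈ swept S
  · simp [glue, hzS]
  · have h1 := hζ.eq_one _ (mt (h.mem_swept_iff hz).2 hzS)
    simp [glue, hzS, interp, h1]

/-- The space-time layer where the cut-off is active. -/
def layer (S₀ : Set E3) (ζ : E3 → ℝ) (Y : ℝ → Aff) : Set (ℝ × E3) :=
  {z | act (Y z.1) z.2 ∈ S₀ ∧ ζ (act (Y z.1) z.2) ≠ 0}

lemma measurableSet_cutoff_support (hS₀ : IsOpen S₀) (hζ : IsCutoff S₀ c ε ζ) :
    MeasurableSet {x ∈ S₀ | ζ x ≠ 0} :=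
  hS₀.measurableSet.inter
    (isOpen_ne_fun hζ.contDiff.continuous continuous_const).measurableSet

lemma volume_layer_slice_le (hS₀ : IsOpen S₀) (hζ : IsCutoff S₀ c ε ζ) (hY : IsIsometryCurve Y)
    (t : ℝ) : volume {x | (t, x) ∈ layer S₀ ζ Y} ≤ ENNReal.ofReal (c * ε) := by
  have h1 := (hY.measurePreserving_act t).measure_preimage
    (measurableSet_cutoff_support hS₀ hζ).nullMeasurableSet
  refine le_trans (le_of_eq ?_) hζ.volume_le
  exact h1

lemma cyl_layer_le (hS₀ : IsOpen S₀) (hζ : IsCutoff S₀ c ε ζ) (hY : IsIsometryCurve Y) :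
    cyl T univ (layer S₀ ζ Y) ≤ ENNReal.ofReal T * ENNReal.ofReal (c * ε) := by
  have h1 := (hY.measurePreserving_homeo_cyl T).measure_preimage
    (MeasurableSet.univ.prod (measurableSet_cutoff_support hS₀ hζ) (α := ℝ)).nullMeasurableSet
  have h2 : hY.homeo ⁻¹' (univ ×ˢ {x ∈ S₀ | ζ x ≠ 0}) = layer S₀ ζ Y := by
    ext z; simp [layer, hY.homeo_apply]
  rw [h2] at h1
  rw [h1, cyl_univ_eq_prod, Measure.prod_prod, Measure.restrict_apply_univ, Real.volume_Ioo,
    sub_zero]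
  gcongr
  exact hζ.volume_le

lemma cyl_layer_le' (hS₀ : IsOpen S₀) (hζ : IsCutoff S₀ c ε ζ) (hY : IsIsometryCurve Y) :
    cyl T Ω (layer S₀ ζ Y) ≤ ENNReal.ofReal T * ENNReal.ofReal (c * ε) :=
  (Measure.restrict_mono (prod_mono Subset.rfl (subset_univ Ω)) le_rfl _).trans
    (cyl_layer_le hS₀ hζ hY)

lemma norm_interp_le (hζ : IsCutoff S₀ c ε ζ) (hC : IsTestBound T Ω φF φS C) {z : ℝ × E3}
    (h1 : z.1 ∈ Ioo 0 T) (h2 : z.2 ∈ Ω) : ‖interp ζ Y φF φS z‖ ≤ 2 * C := by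
  refine (norm_add_le _ _).trans ?_
  rw [norm_smul, Real.norm_of_nonneg (hζ.mem_Icc _).1]
  have a1 := hC.solid z h1 h2
  have a2 := mul_le_mul (hζ.mem_Icc (act (Y z.1) z.2)).2 (hC.diff z h1 h2) (norm_nonneg _)
    zero_le_one
  linarith

lemma norm_fderiv_cutoff_le (hε : 0 < ε) (hζ : IsCutoff S₀ c ε ζ) (z : ℝ × E3) :
    ‖fderiv ℝ ζ (act (Y z.1) z.2)‖ ≤ (layer S₀ ζ Y).indicator (fun _ => 1 / ε) z := by
  by_cases h0 : fderiv ℝ ζ (act (Y z.1) z.2) = 0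
  · rw [h0, norm_zero]
    exact indicator_nonneg (fun _ _ => by positivity) _
  · rw [indicator_of_mem (show z ∈ layer S₀ ζ Y from hζ.fderiv_ne_zero _ h0)]
    exact hζ.norm_fderiv_le _

lemma norm_interpDeriv_inr_le {V : ℝ × E3 → E3} (hε : 0 < ε) (hY : IsIsometryCurve Y)
    (hζ : IsCutoff S₀ c ε ζ) (hC : IsTestBound T Ω φF φS C) {z : ℝ × E3} (h1 : z.1 ∈ Ioo 0 T)
    (h2 : z.2 ∈ Ω) :
    ‖(interpDeriv ζ Y V φF φS z).comp (ContinuousLinearMap.inr ℝ ℝ E3)‖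
      ≤ 2 * C + (layer S₀ ζ Y).indicator (fun _ => C / ε) z := by
  have hC0 := hC.nonneg
  have hi : 0 ≤ (layer S₀ ζ Y).indicator (fun _ => C / ε) z :=
    indicator_nonneg (fun _ _ => by positivity) _
  refine ContinuousLinearMap.opNorm_le_bound _ (by positivity) fun v => ?_
  rw [ContinuousLinearMap.comp_apply, ContinuousLinearMap.inr_apply]
  refine (norm_interpDeriv_apply_le hY hζ.mem_Icc (hC.fderiv_solid z h1 h2)
    (hC.fderiv_diff z h1 h2) (hC.diff z h1 h2) _).trans ?_
  rw [zero_smul, sub_zero, Prod.norm_def, norm_zero, max_eq_right (norm_nonneg v), add_mul]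
  have h3 := norm_fderiv_cutoff_le (Y := Y) hε hζ z
  have h4 : (layer S₀ ζ Y).indicator (fun _ => C / ε) z
      = (layer S₀ ζ Y).indicator (fun _ => 1 / ε) z * C := by
    by_cases hz : z ∈ layer S₀ ζ Y
    · simp only [indicator_of_mem hz]; ring
    · simp [hz]
  rw [h4]
  have h5 := mul_le_mul_of_nonneg_right h3 (by positivity : 0 ≤ ‖v‖ * C)
  linarith

/-- Regularity of the glued test functions. -/
theorem IsFlowOf.memH1L2W1r (h : IsFlowOf T Ω S₀ M m₀ K S ρ u ρ₀ Y) (hΩm : MeasurableSet Ω)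
    (hR : 0 < R) (hΩ : Ω ⊆ Metric.ball 0 R) (hm : 0 < m₀) (hε : 0 < ε)
    (hζ : IsCutoff S₀ c ε ζ) (hF : ContDiff ℝ ∞ φF) (hS : ContDiff ℝ ∞ φS)
    (hC : IsTestBound T Ω φF φS C) (r : ℝ≥0∞) :
    MemH1L2W1r T Ω r (glue S φF (interp ζ Y φF φS))
      (interpDeriv ζ Y (bodyVel T ((swept S).indicator ρ) u) φF φS) := by
  have hI := h.flow.isIsometryCurve
  have hΩt : volume Ω ≠ ⊤ := ((measure_mono hΩ).trans_lt measure_ball_lt_top).ne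
  have hfin : IsFiniteMeasure (cyl T Ω) := ⟨by
    rw [cyl, Measure.restrict_apply_univ]; exact volume_cyl_lt_top T hΩt⟩
  have hfin2 : IsFiniteMeasure (volume.restrict Ω) := ⟨by simpa using hΩt.lt_top⟩
  have hae : glue S φF (interp ζ Y φF φS) =ᵐ[cyl T Ω] interp ζ Y φF φS := by
    filter_upwards [ae_mem_Ioo_cyl T Ω hΩm] with z hz
    exact h.glue_eq_interp hζ (Ioo_subset_Icc_self hz.1)
  have hC0 := hC.nonneg
  have hci := continuous_interp (Y := Y) hζ.contDiff hI hF hS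
  have hw := hasWeakFDeriv_interp hΩm hR hΩ hm h.bddBody h.flow hζ.contDiff hζ.mem_Icc
    hζ.norm_fderiv_le hF hS
  have hVm := h.bddBody.aestronglyMeasurable_bodyVel
  have hDm := aestronglyMeasurable_interpDeriv hVm hζ.contDiff hI hF hS
  have hlp : ∀ q : ℝ≥0∞, MemLp (glue S φF (interp ζ Y φF φS)) q (cyl T Ω) := by
    intro q
    rw [memLp_congr_ae hae]
    refine MemLp.of_bound hci.aestronglyMeasurable (2 * C) ?_
    filter_upwards [ae_mem_Ioo_cyl T Ω hΩm] with z hz using norm_interp_le hζ hC hz.1 hz.2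
  have hii : Integrable (interp ζ Y φF φS) (cyl T Ω) := by
    have := hlp 1
    rw [memLp_congr_ae hae] at this
    exact memLp_one_iff_integrable.1 this
  refine ⟨⟨IntegrableOn.locallyIntegrableOn (hii.congr hae.symm), hw.2.1, fun ψ hψ d => ?_⟩,
    hlp 2, ?_, hlp r, ?_⟩
  · rw [← hw.2.2 ψ hψ d]
    refine integral_congr_ae ?_
    filter_upwards [hae] with z hz
    rw [hz]
  -- The time derivative contains `V`, hence is only square integrable in time. All other quantities
  -- are bounded for fixed `ε`, so the exponent `r` is arbitrary.
  · have hv : MemLp (fun z : ℝ × E3 => velBound T R ((swept S).indicator ρ) u z.1) 2 (cyl T Ω) := by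
      rw [cyl_eq_prod]
      exact ((memLp_velBound h.memLp_trans h.memLp_rot).restrict _).comp_fst _
    refine ((memLp_const (2 * C)).add (hv.const_mul (1 / ε * C))).mono
      (hDm.apply_continuousLinearMap _) ?_
    filter_upwards [ae_mem_Ioo_cyl T Ω hΩm] with z hz
    refine le_trans ?_ (le_abs_self _)
    refine (norm_interpDeriv_apply_le hI hζ.mem_Icc (hC.fderiv_solid z hz.1 hz.2)
      (hC.fderiv_diff z hz.1 hz.2) (hC.diff z hz.1 hz.2) _).trans ?_
    have hV := norm_bodyVel_le (T := T) ((swept S).indicator ρ) u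
      (mem_ball_zero_iff.1 (hΩ hz.2)).le
    have h1 := mul_le_mul (hζ.norm_fderiv_le (act (Y z.1) z.2)) hV (norm_nonneg _) (by positivity)
    have h2 := mul_le_mul_of_nonneg_right h1 hC0
    simp only [Pi.add_apply, Prod.norm_def, one_smul, zero_sub, norm_neg, norm_one, norm_zero]
    rw [max_eq_left zero_le_one]
    linarith
  · refine MemLp.of_bound ?_ (2 * C + C / ε) ?_
    · exact ((ContinuousLinearMap.compL ℝ E3 (ℝ × E3) E3).flip
        (ContinuousLinearMap.inr ℝ ℝ E3)).continuous.comp_aestronglyMeasurable hDm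
    · filter_upwards [ae_mem_Ioo_cyl T Ω hΩm] with z hz
      refine (norm_interpDeriv_inr_le hε hI hζ hC hz.1 hz.2).trans ?_
      gcongr
      exact indicator_le_self' (fun _ _ => by positivity) z

end

/-! ### Rates -/

/-- At each time the spatial layer contributes its measure to the power `1/p`; as the measure bound
is uniform in time, only `w` is left to be integrated. -/
lemma normL2Lp_le_of_le_indicator {T : ℝ} {Ω : Set E3} (hΩm : MeasurableSet Ω) {p C : ℝ}
    (hp : 0 < p) {a : ℝ≥0∞} (ha : a ≠ ⊤) {f : ℝ × E3 → E3} {w : ℝ → ℝ} (hw : ∀ t, 0 ≤ w t)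
    {A : ℝ → Set E3} (hA : ∀ t, volume.restrict Ω (A t) ≤ a)
    (hf : ∀ t ∈ Ioo 0 T, ∀ x ∈ Ω, ‖f (t, x)‖ ≤ (A t).indicator (fun _ => C * w t) x) :
    normL2Lp T Ω (ENNReal.ofReal p) f
      ≤ ENNReal.ofReal C * a ^ (1 / p) * eLpNorm w 2 (volume.restrict (Ioo 0 T)) := by
  refine normL2Lp_le (ENNReal.mul_ne_top ENNReal.ofReal_ne_top
    (ENNReal.rpow_ne_top_of_nonneg (by positivity) ha)) fun t ht => ?_
  have h1 := eLpNorm_le_of_le_indicator (μ := volume.restrict Ω) (f := fun x => f (t, x))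
    (L := A t) (C := C * w t) hp (by
      filter_upwards [ae_restrict_mem hΩm] with x hx using hf t ht x hx)
  refine h1.trans ?_
  rw [ENNReal.ofReal_mul' (hw t), ← ofReal_norm, Real.norm_of_nonneg (hw t)]
  calc _ ≤ ENNReal.ofReal C * ENNReal.ofReal (w t) * a ^ (1 / p) := by gcongr; exact hA t
    _ = _ := by ring

/-- The source of the exponent `ϑ / p`: a layer of measure proportional to `δ^ϑ`, raised to the
power `1/p`. -/
lemma ofReal_mul_rpow_layer {C c T δ ϑ p : ℝ} (hT : 0 ≤ T) (hc : 0 ≤ c) (hδ : 0 < δ) (hp : 0 < p) :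
    ENNReal.ofReal C * (ENNReal.ofReal T * ENNReal.ofReal (c * δ ^ ϑ)) ^ (1 / p)
      = ENNReal.ofReal (C * (T * c) ^ (1 / p) * δ ^ (ϑ / p)) := by
  have hδϑ : 0 ≤ δ ^ ϑ := Real.rpow_nonneg hδ.le _
  have h1 : (δ ^ ϑ) ^ (1 / p) = δ ^ (ϑ / p) := by
    rw [← Real.rpow_mul hδ.le]
    congr 1
    ring
  have hexp : 0 ≤ 1 / p := by positivity
  rw [← ENNReal.ofReal_mul hT, ENNReal.ofReal_rpow_of_nonneg (by positivity) hexp, ← mul_assoc T,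
    Real.mul_rpow (by positivity) hδϑ, h1, mul_assoc C,
    ENNReal.ofReal_mul' (p := C) (by positivity)]

section

variable {T : ℝ} {Ω S₀ : Set E3} {R M m₀ : ℝ} {K : ℝ≥0} {S : ℝ → Set E3} {ρ : ℝ × E3 → ℝ}
  {u : ℝ × E3 → E3} {ρ₀ : E3 → ℝ} {ζ : E3 → ℝ} {Y : ℝ → Aff} {φF φS : ℝ × E3 → E3} {c ε C : ℝ}

/-- On the body the difference is `ζ(Y x) (φF - φS)`, which is bounded and lives on the layer. -/
lemma IsFlowOf.eLpNorm_diff_le (h : IsFlowOf T Ω S₀ M m₀ K S ρ u ρ₀ Y) (hΩm : MeasurableSet Ω)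
    (hS₀ : IsOpen S₀) (hζ : IsCutoff S₀ c ε ζ) (hC : IsTestBound T Ω φF φS C) {p : ℝ}
    (hp : 0 < p) :
    eLpNorm ((swept S).indicator (interp ζ Y φF φS - φS)) (ENNReal.ofReal p) (cyl T Ω)
      ≤ ENNReal.ofReal C * (ENNReal.ofReal T * ENNReal.ofReal (c * ε)) ^ (1 / p) := by
  refine (eLpNorm_le_of_le_indicator (L := layer S₀ ζ Y) (C := C) hp ?_).trans ?_
  · filter_upwards [ae_mem_Ioo_cyl T Ω hΩm] with z hz
    by_cases hzS : z ∈ swept S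
    · rw [indicator_of_mem hzS]
      have e : (interp ζ Y φF φS - φS) z = ζ (act (Y z.1) z.2) • (φF z - φS z) := by
        simp [interp]
      rw [e, norm_smul]
      by_cases hz0 : ζ (act (Y z.1) z.2) = 0
      · rw [hz0, norm_zero, zero_mul]
        exact indicator_nonneg (fun _ _ => hC.nonneg) _
      · rw [indicator_of_mem (show z ∈ layer S₀ ζ Y from
          ⟨(h.mem_swept_iff (Ioo_subset_Icc_self hz.1)).1 hzS, hz0⟩),
          Real.norm_of_nonneg (hζ.mem_Icc _).1]
        exact (mul_le_of_le_one_left (norm_nonneg _) (hζ.mem_Icc _).2).trans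
          (hC.diff z hz.1 hz.2)
    · rw [indicator_of_notMem hzS, norm_zero]
      exact indicator_nonneg (fun _ _ => hC.nonneg) _
  · gcongr
    exact cyl_layer_le' hS₀ hζ h.flow.isIsometryCurve

/-- The factor `1 / ε` occurs only on a layer of measure `O(ε)`, so the gradient grows like `ε^(1/p
- 1)`. The function and the rest of its gradient contribute `2C` each. -/
lemma IsFlowOf.normLpW1p_le (h : IsFlowOf T Ω S₀ M m₀ K S ρ u ρ₀ Y) (hΩm : MeasurableSet Ω)
    (hS₀ : IsOpen S₀) (hε : 0 < ε) (hζ : IsCutoff S₀ c ε ζ) (hC : IsTestBound T Ω φF φS C)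
    {p : ℝ} (hp : 1 ≤ p) (V : ℝ × E3 → E3) :
    normLpW1p T Ω (ENNReal.ofReal p) (glue S φF (interp ζ Y φF φS)) (interpDeriv ζ Y V φF φS)
      ≤ ENNReal.ofReal (4 * C) * cyl T Ω univ ^ (1 / p)
        + ENNReal.ofReal (C / ε) * (ENNReal.ofReal T * ENNReal.ofReal (c * ε)) ^ (1 / p) := by
  have hp0 : 0 < p := by linarith
  have hC0 := hC.nonneg
  have hI := h.flow.isIsometryCurve
  have h1 : eLpNorm (glue S φF (interp ζ Y φF φS)) (ENNReal.ofReal p) (cyl T Ω)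
      ≤ ENNReal.ofReal (2 * C) * cyl T Ω univ ^ (1 / p) := by
    refine eLpNorm_le_of_le_indicator hp0 ?_
    filter_upwards [ae_mem_Ioo_cyl T Ω hΩm] with z hz
    rw [h.glue_eq_interp hζ (Ioo_subset_Icc_self hz.1), indicator_univ]
    exact norm_interp_le hζ hC hz.1 hz.2
  have h2 : eLpNorm (fun z => (interpDeriv ζ Y V φF φS z).comp (ContinuousLinearMap.inr ℝ ℝ E3))
      (ENNReal.ofReal p) (cyl T Ω) ≤ ENNReal.ofReal (2 * C) * cyl T Ω univ ^ (1 / p)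
        + ENNReal.ofReal (C / ε) * (ENNReal.ofReal T * ENNReal.ofReal (c * ε)) ^ (1 / p) := by
    have hL : MeasurableSet (layer S₀ ζ Y) := by
      exact (measurableSet_cutoff_support hS₀ hζ).preimage hI.continuous_act'.measurable
    have a1 : eLpNorm (fun z => (interpDeriv ζ Y V φF φS z).comp (ContinuousLinearMap.inr ℝ ℝ E3))
        (ENNReal.ofReal p) (cyl T Ω) ≤ eLpNorm ((fun _ => 2 * C) +
          (layer S₀ ζ Y).indicator fun _ => C / ε) (ENNReal.ofReal p) (cyl T Ω) := by
      refine eLpNorm_mono_ae ?_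
      filter_upwards [ae_mem_Ioo_cyl T Ω hΩm] with z hz
      exact (norm_interpDeriv_inr_le hε hI hζ hC hz.1 hz.2).trans (le_abs_self _)
    refine a1.trans ((eLpNorm_add_le aestronglyMeasurable_const
      (aestronglyMeasurable_const.indicator hL) (by simpa using hp)).trans (add_le_add ?_ ?_))
    · refine eLpNorm_le_of_le_indicator hp0 (Eventually.of_forall fun z => ?_)
      rw [indicator_univ, Real.norm_of_nonneg (by positivity)]
    · refine (eLpNorm_le_of_le_indicator (L := layer S₀ ζ Y) (C := C / ε) hp0
        (Eventually.of_forall fun z => ?_)).trans ?_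
      · rw [Real.norm_of_nonneg (indicator_nonneg (fun _ _ => by positivity) _)]
      · gcongr
        exact cyl_layer_le' hS₀ hζ hI
  refine (add_le_add h1 h2).trans (le_of_eq ?_)
  rw [← add_assoc, ← add_mul, ← ENNReal.ofReal_add (by positivity) (by positivity)]
  ring_nf

/-- The weight `1 + |V|` in time. -/
lemma IsFlowOf.eLpNorm_one_add_velBound_le (h : IsFlowOf T Ω S₀ M m₀ K S ρ u ρ₀ Y) (hR : 0 ≤ R) :
    eLpNorm (fun t => 1 + velBound T R ((swept S).indicator ρ) u t) 2 (volume.restrict (Ioo 0 T))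
      ≤ eLpNorm (fun _ : ℝ => (1 : ℝ)) 2 (volume.restrict (Ioo 0 T))
        + ((K + R.toNNReal * K : ℝ≥0) : ℝ≥0∞) := by
  refine (eLpNorm_add_le aestronglyMeasurable_const
    (memLp_velBound h.memLp_trans h.memLp_rot).1.restrict (by norm_num)).trans ?_
  gcongr
  exact (eLpNorm_restrict_le _ _ _ _).trans
    (eLpNorm_velBound_le hR h.memLp_trans h.memLp_rot h.trans_le h.rot_le)

lemma norm_one_velocity_le (hR : 0 ≤ R) (σ : ℝ × E3 → ℝ) {z : ℝ × E3} (hz : ‖z.2‖ ≤ R) :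
    ‖((1 : ℝ), bodyVel T σ u z)‖ ≤ 1 + velBound T R σ u z.1 := by
  rw [Prod.norm_def, norm_one]
  have := norm_bodyVel_le (T := T) σ u hz
  have h0 := velBound_nonneg (T := T) hR σ u z.1
  exact max_le (by linarith) (by simp only; linarith)

/-- Along the velocity of the body the cut-off is not differentiated. The difference is `ζ(Y x)`
times a bounded operator applied to `(1, V)`, so there is no factor `1 / ε`. -/
lemma IsFlowOf.normL2Lp_layer_le (h : IsFlowOf T Ω S₀ M m₀ K S ρ u ρ₀ Y) (hΩm : MeasurableSet Ω)
    (hR : 0 < R) (hΩ : Ω ⊆ Metric.ball 0 R) (hS₀ : IsOpen S₀)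
    (hζ : IsCutoff S₀ c ε ζ) (hC : IsTestBound T Ω φF φS C) {p : ℝ} (hp : 0 < p) :
    normL2Lp T Ω (ENNReal.ofReal p) ((swept S).indicator fun z =>
        (interpDeriv ζ Y (bodyVel T ((swept S).indicator ρ) u) φF φS z - fderiv ℝ φS z)
          (1, bodyVel T ((swept S).indicator ρ) u z))
      ≤ ENNReal.ofReal C * ENNReal.ofReal (c * ε) ^ (1 / p) *
        eLpNorm (fun t => 1 + velBound T R ((swept S).indicator ρ) u t) 2
          (volume.restrict (Ioo 0 T)) := by
  refine normL2Lp_le_of_le_indicator hΩm hp ENNReal.ofReal_ne_top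
    (fun t => by have := velBound_nonneg (T := T) hR.le ((swept S).indicator ρ) u t; linarith)
    (A := fun t => {x | (t, x) ∈ layer S₀ ζ Y})
    (fun t => (Measure.restrict_apply_le _ _).trans
      (volume_layer_slice_le hS₀ hζ h.flow.isIsometryCurve t)) fun t ht x hx => ?_
  have hv := velBound_nonneg (T := T) hR.le ((swept S).indicator ρ) u t
  have hC0 := hC.nonneg
  by_cases hzS : (t, x) ∈ swept S
  · rw [indicator_of_mem hzS, sub_apply, interpDeriv_apply_velocity,
      add_sub_cancel_left, norm_smul]
    by_cases hz0 : ζ (act (Y t) x) = 0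
    · simp only [hz0, norm_zero, zero_mul]
      exact indicator_nonneg (fun _ _ => by positivity) _
    · rw [indicator_of_mem (show x ∈ {x | (t, x) ∈ layer S₀ ζ Y} from
        ⟨(h.mem_swept_iff (Ioo_subset_Icc_self ht)).1 hzS, hz0⟩),
        Real.norm_of_nonneg (hζ.mem_Icc _).1]
      refine (mul_le_of_le_one_left (norm_nonneg _) (hζ.mem_Icc _).2).trans ?_
      refine (ContinuousLinearMap.le_opNorm _ _).trans ?_
      exact mul_le_mul (hC.fderiv_diff (t, x) ht hx)
        (norm_one_velocity_le hR.le _ (mem_ball_zero_iff.1 (hΩ hx)).le) (norm_nonneg _) hC0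
  · rw [indicator_of_notMem hzS, norm_zero]
    exact indicator_nonneg (fun _ _ => by positivity) _

/-- A bounded field of operators applied to `(1, V)` belongs to `L²(0, T; Lᵖ(Ω))`. -/
lemma memL2Lp_clm {σ : ℝ × E3 → ℝ} (hb : IsBddBody T Ω M m₀ σ u) (hΩm : MeasurableSet Ω)
    (hR : 0 < R) (hΩ : Ω ⊆ Metric.ball 0 R) (hm : 0 < m₀) {L : ℝ × E3 → (ℝ × E3 →L[ℝ] E3)}
    (hL : AEStronglyMeasurable L (cyl T Ω)) (hC : 0 ≤ C)
    (hLC : ∀ z : ℝ × E3, z.1 ∈ Ioo 0 T → z.2 ∈ Ω → ‖L z‖ ≤ C) {p : ℝ} (hp : 0 < p) :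
    MemL2Lp T Ω (ENNReal.ofReal p) fun z => L z (1, bodyVel T σ u z) := by
  have hΩt : volume Ω ≠ ⊤ := ((measure_mono hΩ).trans_lt measure_ball_lt_top).ne
  obtain ⟨K, hK⟩ := exists_flow_bound (M := M) hΩm hR hΩ hm
  obtain ⟨⟨ha, -⟩, ⟨hom, -⟩⟩ := hK T σ u hb
  have hw : MemLp (fun t => 1 + velBound T R σ u t) 2 (volume.restrict (Ioo 0 T)) :=
    (memLp_const (1 : ℝ)).add ((memLp_velBound ha hom).restrict _)
  have hle : ∀ t ∈ Ioo 0 T, ∀ x ∈ Ω, ‖L (t, x) (1, bodyVel T σ u (t, x))‖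
      ≤ (univ : Set E3).indicator (fun _ => C * (1 + velBound T R σ u t)) x := by
    intro t ht x hx
    rw [indicator_univ]
    exact (ContinuousLinearMap.le_opNorm _ _).trans (mul_le_mul (hLC (t, x) ht hx)
      (norm_one_velocity_le hR.le σ (mem_ball_zero_iff.1 (hΩ hx)).le) (norm_nonneg _) hC)
  have hfin : ENNReal.ofReal C * volume Ω ^ (1 / p) *
      eLpNorm (fun t => 1 + velBound T R σ u t) 2 (volume.restrict (Ioo 0 T)) < ⊤ :=
    ENNReal.mul_lt_top (ENNReal.mul_lt_top ENNReal.ofReal_lt_top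
      (ENNReal.rpow_lt_top_of_nonneg (by positivity) hΩt)) hw.2
  have hbd := normL2Lp_le_of_le_indicator (f := fun z => L z (1, bodyVel T σ u z)) (C := C)
    hΩm hp hΩt (w := fun t => 1 + velBound T R σ u t)
    (fun t => by have := velBound_nonneg (T := T) hR.le σ u t; linarith)
    (A := fun _ => univ) (fun t => by simp) hle
  refine ⟨(hb.integrable_clm hΩm hR hΩ hm hL hC ?_ 1).1, hbd.trans_lt hfin⟩
  filter_upwards [ae_mem_Ioo_cyl T Ω hΩm] with z hz using hLC z hz.1 hz.2

end

/-! ### Weights given by test functions of the dual space -/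

/-- On the bounded `Ω`, Hölder's inequality embeds `L^q` into `L¹` at each time, so every element of
a dual space can serve to dominate. -/
lemma MemL2Lp.isWeight {T : ℝ} {Ω : Set E3} {q : ℝ≥0∞} {g : ℝ × E3 → E3} (hg : MemL2Lp T Ω q g)
    (hq : 1 ≤ q) (hΩ : volume Ω ≠ ⊤) {c : ℝ} (hc : 0 ≤ c) :
    IsWeight T Ω fun z => c * ‖g z‖ := by
  obtain ⟨hgm, hgn⟩ := hg
  have hgm' := hgm
  rw [cyl_eq_prod] at hgm'
  have hslice : ∀ᵐ t ∂volume.restrict (Ioo 0 T),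
      AEStronglyMeasurable (fun x => g (t, x)) (volume.restrict Ω) := hgm'.prodMk_left
  set e : ℝ := 1 / (1 : ℝ≥0∞).toReal - 1 / q.toReal with he
  have he0 : 0 ≤ e := by
    rw [he, ENNReal.toReal_one, div_one, sub_nonneg]
    -- For `q = ∞` the conventions `toReal ∞ = 0` and `1 / 0 = 0` give the exponent `1`, as they
    -- should.
    rcases eq_or_ne q ⊤ with rfl | hqt
    · simp
    · rw [one_div]
      exact inv_le_one_of_one_le₀ (by
        simpa using (ENNReal.toReal_le_toReal ENNReal.one_ne_top hqt).2 hq)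
  set A : ℝ≥0∞ := volume Ω ^ e with hA
  have hAt : A ≠ ⊤ := ENNReal.rpow_ne_top_of_nonneg he0 hΩ
  have hle : ∀ᵐ t ∂volume.restrict (Ioo 0 T), ∫⁻ x in Ω, ‖g (t, x)‖ₑ
      ≤ eLpNorm (fun x => g (t, x)) q (volume.restrict Ω) * A := by
    filter_upwards [hslice] with t ht
    have := eLpNorm_le_eLpNorm_mul_rpow_measure_univ hq ht
    rwa [eLpNorm_one_eq_lintegral_enorm, Measure.restrict_apply_univ] at this
  have hN : AEMeasurable (fun t => ∫⁻ x in Ω, ‖g (t, x)‖ₑ) (volume.restrict (Ioo 0 T)) :=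
    hgm'.enorm.lintegral_prod_right'
  have hn2 : ∫⁻ t in Ioo 0 T, eLpNorm (fun x => g (t, x)) q (volume.restrict Ω) ^ 2 < ⊤ := by
    rw [normL2Lp] at hgn
    by_contra! h
    rw [top_le_iff.1 h, ENNReal.top_rpow_of_pos (by norm_num)] at hgn
    exact lt_irrefl _ hgn
  have hN2 : ∫⁻ t in Ioo 0 T, (∫⁻ x in Ω, ‖g (t, x)‖ₑ) ^ 2 < ⊤ := by
    calc _ ≤ ∫⁻ t in Ioo 0 T, A ^ 2 * eLpNorm (fun x => g (t, x)) q (volume.restrict Ω) ^ 2 := by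
          refine lintegral_mono_ae ?_
          filter_upwards [hle] with t ht
          rw [mul_comm, ← mul_pow]
          gcongr
      _ = A ^ 2 * ∫⁻ t in Ioo 0 T, eLpNorm (fun x => g (t, x)) q (volume.restrict Ω) ^ 2 :=
          lintegral_const_mul' _ _ (ENNReal.pow_ne_top hAt)
      _ < ⊤ := ENNReal.mul_lt_top (ENNReal.pow_lt_top hAt.lt_top) hn2
  have hfin : ∀ᵐ t ∂volume.restrict (Ioo 0 T), ∫⁻ x in Ω, ‖g (t, x)‖ₑ < ⊤ := by
    filter_upwards [ae_lt_top' (hN.pow_const 2) hN2.ne] with t ht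
    by_contra! h
    rw [top_le_iff.1 h] at ht
    simp at ht
  have hk : AEStronglyMeasurable (fun z => c * ‖g z‖) (cyl T Ω) := hgm.norm.const_mul c
  refine ⟨fun z => by positivity, hk, ?_, ?_, ?_⟩
  · filter_upwards [hslice, hfin] with t h1 h2
    exact (Integrable.norm ⟨h1, h2⟩).const_mul c
  · rw [cyl_eq_prod] at hk
    exact hk.integral_prod_right'
  · rw [eLpNorm_lt_top_iff_lintegral_rpow_enorm_lt_top two_ne_zero ENNReal.ofNat_ne_top]
    have hb : ∀ t, ‖∫ x in Ω, c * ‖g (t, x)‖‖ₑ ^ (2 : ℝ)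
        ≤ ENNReal.ofReal c ^ 2 * (∫⁻ x in Ω, ‖g (t, x)‖ₑ) ^ 2 := by
      intro t
      rw [ENNReal.rpow_ofNat, ← mul_pow, integral_const_mul, enorm_mul, Real.enorm_of_nonneg hc]
      gcongr
      refine (enorm_integral_le_lintegral_enorm _).trans_eq ?_
      simp
    refine (lintegral_mono fun t => by simpa using hb t).trans_lt ?_
    rw [lintegral_const_mul' _ _ (ENNReal.pow_ne_top ENNReal.ofReal_ne_top)]
    exact ENNReal.mul_lt_top (ENNReal.pow_lt_top ENNReal.ofReal_lt_top) hN2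

/-! ### Convergence along subsequences -/

section

variable {T : ℝ} {Ω S₀ : Set E3} {γ : ℝ} {S : ℕ → ℝ → Set E3} {ρ : ℕ → ℝ × E3 → ℝ}
  {u : ℕ → ℝ × E3 → E3} {ρ₀ : ℕ → E3 → ℝ} {S' : ℝ → Set E3} {ρ' : ℝ × E3 → ℝ}
  {u' : ℝ × E3 → E3} {ρ₀' : E3 → ℝ} {R M m₀ : ℝ} {K : ℝ≥0} {Y : ℕ → ℝ → Aff}
  {φ φF φS : ℝ × E3 → E3} {ζ : ℕ → E3 → ℝ} {c C : ℝ} {ε : ℕ → ℝ}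

/-- The cut-offs, transported with the bodies, converge to `1 - χ` along a subsequence. -/
lemma IsApproximation.exists_subseq_cutoff (h : IsApproximation T Ω S₀ γ S ρ u ρ₀ S' ρ' u' ρ₀')
    (hT : 0 < T) (hΩm : MeasurableSet Ω) (hΩ : volume Ω ≠ ⊤) (hS₀ : IsRegularDomain S₀)
    (hS₀Ω : S₀ ⊆ Ω) (hγ : 3 / 2 ≤ γ) (hm' : m₀ ≤ ∫ x, S₀.indicator ρ₀' x)
    (hY : ∀ n, IsFlowOf T Ω S₀ M m₀ K (S n) (ρ n) (u n) (ρ₀ n) (Y n))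
    (hζ : ∀ n, IsCutoff S₀ c (ε n) (ζ n)) (hε : Tendsto ε atTop (𝓝 0)) :
    ∃ k : ℕ → ℕ, StrictMono k ∧
      (∀ᵐ z ∂cyl T univ, Tendsto (fun n => (swept (S (k n))).indicator (ρ (k n)) z) atTop
        (𝓝 ((swept S').indicator ρ' z))) ∧
      ∀ᵐ z ∂cyl T univ, Tendsto (fun n => ζ (k n) (act (Y (k n) z.1) z.2)) atTop
        (𝓝 (1 - (swept S').indicator (fun _ => (1 : ℝ)) z)) := by
  obtain ⟨k, Y', hk, hI', hpre, hlim, hσ, -⟩ :=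
    h.exists_subseq hT hΩm hΩ hS₀ hS₀Ω hγ hm' hY
  have hset := ae_eventually_mem_swept_iff hS₀ (fun n => (hY (k n)).eq_preimage) hI' hpre hlim
  set f : ℕ → ℝ × E3 → ℝ := fun n =>
    (layer S₀ (ζ (k n)) (Y (k n))).indicator fun _ => (1 : ℝ) with hf
  -- The measures of the layers tend to zero, so their indicators vanish in measure, and almost
  -- everywhere along a further subsequence.
  have hmeas : TendstoInMeasure (cyl T univ) f atTop fun _ => 0 := by
    rw [tendstoInMeasure_iff_norm]
    intro e he
    have hup : Tendsto (fun n => ENNReal.ofReal T * ENNReal.ofReal (c * ε (k n))) atTop (𝓝 0) := by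
      have h1 : Tendsto (fun n => c * ε (k n)) atTop (𝓝 0) := by
        simpa using (hε.comp hk.tendsto_atTop).const_mul c
      have h2 := ENNReal.Tendsto.const_mul (a := ENNReal.ofReal T)
        (ENNReal.tendsto_ofReal h1) (Or.inr ENNReal.ofReal_ne_top)
      simpa using h2
    refine tendsto_of_tendsto_of_tendsto_of_le_of_le tendsto_const_nhds hup
      (fun _ => zero_le) fun n => ?_
    refine (measure_mono fun z hz => ?_).trans
      (cyl_layer_le hS₀.1 (hζ (k n)) (hY (k n)).flow.isIsometryCurve)
    by_contra hzl
    rw [mem_ofPred_eq, hf] at hz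
    simp only [indicator_of_notMem hzl, sub_zero, norm_zero] at hz
    linarith
  obtain ⟨l, hl, hfl⟩ := hmeas.exists_seq_tendsto_ae
  refine ⟨k ∘ l, hk.comp hl, ?_, ?_⟩
  · filter_upwards [hσ] with z hz using hz.comp hl.tendsto_atTop
  · filter_upwards [hset, hfl, ae_mem_Ioo_cyl T univ MeasurableSet.univ] with z hz hz0 hzT
    -- Off the layer the transported cut-off is exactly `1 - χ` of the approximate body; on the
    -- layer they differ by at most `1`.
    have h1 : Tendsto (fun n => ζ (k (l n)) (act (Y (k (l n)) z.1) z.2)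
        - (1 - (swept (S (k (l n)))).indicator (fun _ => (1 : ℝ)) z)) atTop (𝓝 0) := by
      refine squeeze_zero_norm (fun n => ?_) hz0
      have hmem := (hY (k (l n))).mem_swept_iff (Ioo_subset_Icc_self hzT.1) (z := z)
      have hI := (hζ (k (l n))).mem_Icc (act (Y (k (l n)) z.1) z.2)
      by_cases hzS : z ∈ swept (S (k (l n)))
      · rw [indicator_of_mem hzS, sub_self, sub_zero, Real.norm_of_nonneg hI.1]
        by_cases h0 : ζ (k (l n)) (act (Y (k (l n)) z.1) z.2) = 0
        · rw [h0]
          exact indicator_nonneg (fun _ _ => zero_le_one) _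
        · rw [hf]
          simp only
          rw [indicator_of_mem (show z ∈ layer S₀ (ζ (k (l n))) (Y (k (l n))) from
            ⟨hmem.1 hzS, h0⟩)]
          exact hI.2
      · rw [indicator_of_notMem hzS, (hζ (k (l n))).eq_one _ (mt hmem.2 hzS), sub_zero, sub_self,
          norm_zero]
        exact indicator_nonneg (fun _ _ => zero_le_one) _
    have h2 : Tendsto (fun n => 1 - (swept (S (k (l n)))).indicator (fun _ => (1 : ℝ)) z) atTop
        (𝓝 (1 - (swept S').indicator (fun _ => (1 : ℝ)) z)) := by
      refine tendsto_const_nhds.congr' ?_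
      filter_upwards [hl.tendsto_atTop.eventually hz] with n hn
      by_cases hzS : z ∈ swept S'
      · rw [indicator_of_mem hzS, indicator_of_mem (hn.2 hzS)]
      · rw [indicator_of_notMem hzS, indicator_of_notMem (mt hn.1 hzS)]
    simpa using h1.add h2

/-- Strong convergence of the interpolations, if the cut-offs converge almost everywhere. -/
lemma tendsto_eLpNorm_glue_sub (hΩm : MeasurableSet Ω) (hΩ : volume Ω ≠ ⊤)
    (hY : ∀ n, IsFlowOf T Ω S₀ M m₀ K (S n) (ρ n) (u n) (ρ₀ n) (Y n))
    (hζ : ∀ n, IsCutoff S₀ c (ε n) (ζ n)) (hF : ContDiff ℝ ∞ φF) (hS : ContDiff ℝ ∞ φS)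
    (hC : IsTestBound T Ω φF φS C) (hSm : NullMeasurableSet (swept S') (cyl T univ))
    (hφ : φ =ᵐ[cyl T Ω] fun z =>
      φF z + (swept S').indicator (fun _ => (1 : ℝ)) z • (φS z - φF z))
    (hlim : ∀ᵐ z ∂cyl T univ, Tendsto (fun n => ζ n (act (Y n z.1) z.2)) atTop
      (𝓝 (1 - (swept S').indicator (fun _ => (1 : ℝ)) z))) {p : ℝ} (hp : 0 < p) :
    Tendsto (fun n => eLpNorm (glue (S n) φF (interp (ζ n) (Y n) φF φS) - φ) (ENNReal.ofReal p)
      (cyl T Ω)) atTop (𝓝 0) := by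
  have hfin : IsFiniteMeasure (cyl T Ω) := ⟨by
    rw [cyl, Measure.restrict_apply_univ]; exact volume_cyl_lt_top T hΩ⟩
  have hle : cyl T Ω ≤ cyl T univ :=
    Measure.restrict_mono (prod_mono Subset.rfl (subset_univ Ω)) le_rfl
  have hχ : AEStronglyMeasurable ((swept S').indicator fun _ => (1 : ℝ)) (cyl T Ω) :=
    aestronglyMeasurable_const.indicator₀ (hSm.mono_ac hle.absolutelyContinuous)
  -- The error is the bounded field `φF - φS` times the error of the cut-off.
  have heq : ∀ n, glue (S n) φF (interp (ζ n) (Y n) φF φS) - φ =ᵐ[cyl T Ω] fun z =>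
      (ζ n (act (Y n z.1) z.2) - (1 - (swept S').indicator (fun _ => (1 : ℝ)) z)) •
        (φF z - φS z) := by
    intro n
    filter_upwards [hφ, ae_mem_Ioo_cyl T Ω hΩm] with z hz hzT
    rw [Pi.sub_apply, (hY n).glue_eq_interp (hζ n) (Ioo_subset_Icc_self hzT.1), hz, interp]
    module
  simp only [fun n => eLpNorm_congr_ae (p := ENNReal.ofReal p) (heq n)]
  refine tendsto_eLpNorm_of_dominated (k := fun _ => C) (by simpa using hp)
    ENNReal.ofReal_ne_top (fun n => ?_) (memLp_const _) (fun n => ?_) ?_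
  · exact ((((hζ n).contDiff.continuous.comp
      (hY n).flow.isIsometryCurve.continuous_act').aestronglyMeasurable.sub
      (aestronglyMeasurable_const.sub hχ))).smul (hF.continuous.sub hS.continuous).aestronglyMeasurable
  · filter_upwards [ae_mem_Ioo_cyl T Ω hΩm] with z hzT
    have hI := (hζ n).mem_Icc (act (Y n z.1) z.2)
    have h1 : ‖ζ n (act (Y n z.1) z.2) - (1 - (swept S').indicator (fun _ => (1 : ℝ)) z)‖ ≤ 1 := by
      rw [Real.norm_eq_abs, abs_le]
      by_cases hzS : z ∈ swept S'
      · simp only [indicator_of_mem hzS]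
        constructor <;> linarith [hI.1, hI.2]
      · simp only [indicator_of_notMem hzS]
        constructor <;> linarith [hI.1, hI.2]
    rw [norm_smul]
    exact (mul_le_of_le_one_left (norm_nonneg _) h1).trans (hC.diff z hzT.1 hzT.2)
  · filter_upwards [ae_cyl_of_ae_cyl_univ hlim] with z hz
    have h1 := (hz.sub_const (1 - (swept S').indicator (fun _ => (1 : ℝ)) z)).smul_const
      (φF z - φS z)
    simpa using h1

end

/-! ### Weak convergence of the material derivatives -/

/-- The transpose of the spatial part of an operator. -/
def spatialAdjoint (L : ℝ × E3 →L[ℝ] E3) : E3 →L[ℝ] E3 :=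
  ContinuousLinearMap.adjoint (L.comp (ContinuousLinearMap.inr ℝ ℝ E3))

lemma continuous_spatialAdjoint : Continuous spatialAdjoint :=
  ContinuousLinearMap.adjoint.continuous.comp (continuous_id.clm_comp continuous_const)

lemma norm_spatialAdjoint_le (L : ℝ × E3 →L[ℝ] E3) : ‖spatialAdjoint L‖ ≤ ‖L‖ := by
  rw [spatialAdjoint, LinearIsometryEquiv.norm_map]
  exact (ContinuousLinearMap.opNorm_comp_le _ _).trans
    (mul_le_of_le_one_right (norm_nonneg _) (ContinuousLinearMap.norm_inr_le_one ℝ ℝ E3))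

/-- Moving the operator onto the test field isolates the velocity, the form required by
`tendsto_integral_bodyVel`. -/
lemma inner_clm_apply_eq (L : ℝ × E3 →L[ℝ] E3) (v g : E3) :
    inner ℝ (L (1, v)) g = inner ℝ (L (1, 0)) g + inner ℝ v (spatialAdjoint L g) := by
  have h1 : ((1 : ℝ), v) = (1, 0) + (0, v) := by simp
  rw [spatialAdjoint, ContinuousLinearMap.adjoint_inner_right, h1, map_add, inner_add_left]
  simp

section

variable {T : ℝ} {Ω : Set E3} {R M m₀ : ℝ}

lemma norm_clm_one_zero_le (L : ℝ × E3 →L[ℝ] E3) : ‖L (1, 0)‖ ≤ ‖L‖ := by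
  have := L.le_opNorm ((1 : ℝ), (0 : E3))
  simpa [Prod.norm_def] using this

/-- Convergence of `∫ L(1, V) · g` for bounded, almost everywhere convergent operators `L`. -/
theorem tendsto_integral_clm {σ : ℕ → ℝ × E3 → ℝ} {σ' : ℝ × E3 → ℝ} {u : ℕ → ℝ × E3 → E3}
    {u' : ℝ × E3 → E3} (hΩm : MeasurableSet Ω) (hR : 0 < R) (hΩ : Ω ⊆ Metric.ball 0 R)
    (hm : 0 < m₀) (hb : ∀ n, IsBddBody T Ω M m₀ (σ n) (u n)) (hb' : IsBddBody T Ω M m₀ σ' u')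
    (hσ : ∀ᵐ z ∂cyl T univ, Tendsto (fun n => σ n z) atTop (𝓝 (σ' z)))
    (hu : WeakTendstoLp (cyl T Ω) 2 u u') {B : ℝ≥0} (hB : ∀ n, eLpNorm (u n) 2 (cyl T Ω) ≤ B)
    {L : ℕ → ℝ × E3 → (ℝ × E3 →L[ℝ] E3)} {L' : ℝ × E3 → (ℝ × E3 →L[ℝ] E3)}
    (hL : ∀ n, AEStronglyMeasurable (L n) (cyl T Ω)) (hL' : AEStronglyMeasurable L' (cyl T Ω))
    {C : ℝ} (hC : 0 ≤ C) (hLC : ∀ n, ∀ᵐ z ∂cyl T Ω, ‖L n z‖ ≤ C)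
    (hlim : ∀ᵐ z ∂cyl T Ω, Tendsto (fun n => L n z) atTop (𝓝 (L' z)))
    {q : ℝ≥0∞} (hq : 1 ≤ q) {g : ℝ × E3 → E3} (hg : MemL2Lp T Ω q g) :
    Tendsto (fun n => ∫ z, inner ℝ (L n z (1, bodyVel T (σ n) (u n) z)) (g z) ∂cyl T Ω) atTop
      (𝓝 (∫ z, inner ℝ (L' z (1, bodyVel T σ' u' z)) (g z) ∂cyl T Ω)) := by
  have hΩt : volume Ω ≠ ⊤ := ((measure_mono hΩ).trans_lt measure_ball_lt_top).ne
  have hL'C : ∀ᵐ z ∂cyl T Ω, ‖L' z‖ ≤ C := by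
    filter_upwards [hlim, ae_all_iff.2 hLC] with z h1 h2
    exact le_of_tendsto' h1.norm h2
  have hk := hg.isWeight hq hΩt hC
  have hki : Integrable (fun z => C * ‖g z‖) (cyl T Ω) :=
    hk.integrable_of_le (v := fun _ => 1) (memLp_const (1 : ℝ)) hk.meas (by
      refine Eventually.of_forall fun z => ?_
      rw [one_mul, Real.norm_of_nonneg (hk.nonneg z)])
  have hGm : ∀ {A : ℝ × E3 → (ℝ × E3 →L[ℝ] E3)}, AEStronglyMeasurable A (cyl T Ω) →
      AEStronglyMeasurable (fun z => spatialAdjoint (A z) (g z)) (cyl T Ω) := fun hA =>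
    (ContinuousLinearMap.id ℝ (E3 →L[ℝ] E3)).aestronglyMeasurable_comp₂
      (continuous_spatialAdjoint.comp_aestronglyMeasurable hA) hg.1
  have hGle : ∀ {A : ℝ × E3 → (ℝ × E3 →L[ℝ] E3)}, (∀ᵐ z ∂cyl T Ω, ‖A z‖ ≤ C) →
      ∀ᵐ z ∂cyl T Ω, ‖spatialAdjoint (A z) (g z)‖ ≤ C * ‖g z‖ := fun hA => by
    filter_upwards [hA] with z hz
    refine (ContinuousLinearMap.le_opNorm _ _).trans ?_
    gcongr
    exact (norm_spatialAdjoint_le _).trans hz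
  have hFm : ∀ {A : ℝ × E3 → (ℝ × E3 →L[ℝ] E3)}, AEStronglyMeasurable A (cyl T Ω) →
      AEStronglyMeasurable (fun z => inner ℝ (A z (1, 0)) (g z)) (cyl T Ω) := fun hA =>
    AEStronglyMeasurable.inner (𝕜 := ℝ) ((ContinuousLinearMap.id ℝ (ℝ × E3 →L[ℝ] E3)).aestronglyMeasurable_comp₂ hA
      aestronglyMeasurable_const) hg.1
  have hFle : ∀ {A : ℝ × E3 → (ℝ × E3 →L[ℝ] E3)}, (∀ᵐ z ∂cyl T Ω, ‖A z‖ ≤ C) →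
      ∀ᵐ z ∂cyl T Ω, ‖inner ℝ (A z (1, 0)) (g z)‖ ≤ C * ‖g z‖ := fun hA => by
    filter_upwards [hA] with z hz
    refine (norm_inner_le_norm _ _).trans ?_
    gcongr
    exact (norm_clm_one_zero_le _).trans hz
  have hsplit : ∀ {s v} {A : ℝ × E3 → (ℝ × E3 →L[ℝ] E3)}, IsBddBody T Ω M m₀ s v →
      AEStronglyMeasurable A (cyl T Ω) → (∀ᵐ z ∂cyl T Ω, ‖A z‖ ≤ C) →
      ∫ z, inner ℝ (A z (1, bodyVel T s v z)) (g z) ∂cyl T Ω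
        = ∫ z, inner ℝ (A z (1, 0)) (g z) ∂cyl T Ω
          + ∫ z, inner ℝ (bodyVel T s v z) (spatialAdjoint (A z) (g z)) ∂cyl T Ω := by
    intro s v A hs hA hAC
    obtain ⟨K, hK⟩ := exists_flow_bound (M := M) hΩm hR hΩ hm
    obtain ⟨⟨ha, -⟩, ⟨hom, -⟩⟩ := hK T s v hs
    have hi : Integrable (fun z => inner ℝ (bodyVel T s v z) (spatialAdjoint (A z) (g z)))
        (cyl T Ω) := by
      refine hk.integrable_of_le (v := velBound T R s v) ((memLp_velBound ha hom).restrict _)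
        (AEStronglyMeasurable.inner (𝕜 := ℝ) hs.aestronglyMeasurable_bodyVel (hGm hA)) ?_
      filter_upwards [hGle hAC, ae_mem_Ioo_cyl T Ω hΩm] with z h1 h2
      exact (norm_inner_le_norm _ _).trans (mul_le_mul
        (norm_bodyVel_le s v (mem_ball_zero_iff.1 (hΩ h2.2)).le) h1 (norm_nonneg _)
        (velBound_nonneg hR.le _ _ _))
    rw [← integral_add (hki.mono' (hFm hA) (hFle hAC)) hi]
    exact integral_congr_ae (Eventually.of_forall fun z => inner_clm_apply_eq _ _ _)
  simp only [fun n => hsplit (hb n) (hL n) (hLC n)]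
  rw [hsplit hb' hL' hL'C]
  -- The part without velocity converges by domination; the part with velocity pairs it with a
  -- dominated, almost everywhere convergent field.
  refine Tendsto.add ?_ ?_
  · refine tendsto_integral_of_dominated_convergence (fun z => C * ‖g z‖)
      (fun n => hFm (hL n)) hki (fun n => hFle (hLC n)) ?_
    filter_upwards [hlim] with z hz
    exact (tendsto_clm_apply hz tendsto_const_nhds).inner tendsto_const_nhds
  · refine tendsto_integral_bodyVel hΩm hR hΩ hm hb hb' hσ hu hB hk (fun n => hGm (hL n)) (hGm hL')
      (fun n => hGle (hLC n)) ?_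
    filter_upwards [hlim] with z hz
    exact tendsto_clm_apply ((continuous_spatialAdjoint.tendsto _).comp hz) tendsto_const_nhds

end

/-- The operator `DφS + w (DφF - DφS)`. -/
def blend (w : ℝ × E3 → ℝ) (φF φS : ℝ × E3 → E3) (z : ℝ × E3) : ℝ × E3 →L[ℝ] E3 :=
  fderiv ℝ φS z + w z • (fderiv ℝ φF z - fderiv ℝ φS z)

/-- Along `V` the full derivative, whose norm grows like `1 / ε`, may be replaced by an operator
that is bounded uniformly in `n` and converges almost everywhere along subsequences. -/
lemma interpDeriv_apply_velocity' (ζ : E3 → ℝ) (Y : ℝ → Aff) (V φF φS : ℝ × E3 → E3)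
    (z : ℝ × E3) : interpDeriv ζ Y V φF φS z (1, V z)
      = blend (fun z => ζ (act (Y z.1) z.2)) φF φS z (1, V z) := by
  rw [interpDeriv_apply_velocity]
  simp [blend]

lemma glueDeriv_eq (S : ℝ → Set E3) (v φF φS : ℝ × E3 → E3) (z : ℝ × E3) :
    glueDeriv S v φF φS z
      = blend (fun z => 1 - (swept S).indicator (fun _ => (1 : ℝ)) z) φF φS z (1, v z) := by
  simp only [glueDeriv, blend, add_apply, sub_apply, smul_apply]
  module

lemma norm_blend_le {T C : ℝ} {Ω : Set E3} {w : ℝ × E3 → ℝ} {φF φS : ℝ × E3 → E3}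
    (hC : IsTestBound T Ω φF φS C) (hw : ∀ z, w z ∈ Icc (0 : ℝ) 1) {z : ℝ × E3}
    (h1 : z.1 ∈ Ioo 0 T) (h2 : z.2 ∈ Ω) : ‖blend w φF φS z‖ ≤ 2 * C := by
  refine (norm_add_le _ _).trans ?_
  rw [norm_smul, Real.norm_of_nonneg (hw z).1]
  have a1 := hC.fderiv_solid z h1 h2
  have a2 := mul_le_mul (hw z).2 (hC.fderiv_diff z h1 h2) (norm_nonneg _) zero_le_one
  linarith

lemma aestronglyMeasurable_blend {μ : Measure (ℝ × E3)} {w : ℝ × E3 → ℝ} {φF φS : ℝ × E3 → E3}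
    (hw : AEStronglyMeasurable w μ) (hF : ContDiff ℝ ∞ φF) (hS : ContDiff ℝ ∞ φS) :
    AEStronglyMeasurable (blend w φF φS) μ := by
  have hcF := hF.continuous_fderiv (n := ∞) (by simp)
  have hcS := hS.continuous_fderiv (n := ∞) (by simp)
  exact hcS.aestronglyMeasurable.add (hw.smul (hcF.sub hcS).aestronglyMeasurable)

lemma normL2Lp_congr {T : ℝ} {Ω : Set E3} {p : ℝ≥0∞} {f g : ℝ × E3 → E3}
    (h : ∀ z : ℝ × E3, z.1 ∈ Ioo 0 T → f z = g z) : normL2Lp T Ω p f = normL2Lp T Ω p g := by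
  rw [normL2Lp, normL2Lp]
  congr 1
  refine setLIntegral_congr_fun measurableSet_Ioo fun t ht => ?_
  exact congrArg (fun f => eLpNorm f p (volume.restrict Ω) ^ 2) (funext fun x => h (t, x) ht)

lemma MemL2Lp.congr {T : ℝ} {Ω : Set E3} {p : ℝ≥0∞} {f g : ℝ × E3 → E3} (hf : MemL2Lp T Ω p f)
    (hΩm : MeasurableSet Ω) (h : ∀ z : ℝ × E3, z.1 ∈ Ioo 0 T → f z = g z) : MemL2Lp T Ω p g := by
  refine ⟨hf.1.congr ?_, (normL2Lp_congr h).symm.trans_lt hf.2⟩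
  filter_upwards [ae_mem_Ioo_cyl T Ω hΩm] with z hz using h z hz.1

section

variable {T : ℝ} {Ω S₀ : Set E3} {γ : ℝ} {S : ℕ → ℝ → Set E3} {ρ : ℕ → ℝ × E3 → ℝ}
  {u : ℕ → ℝ × E3 → E3} {ρ₀ : ℕ → E3 → ℝ} {S' : ℝ → Set E3} {ρ' : ℝ × E3 → ℝ}
  {u' : ℝ × E3 → E3} {ρ₀' : E3 → ℝ} {R M m₀ : ℝ} {K : ℝ≥0} {Y : ℕ → ℝ → Aff}
  {φ φF φS : ℝ × E3 → E3} {ζ : ℕ → E3 → ℝ} {c C : ℝ} {ε : ℕ → ℝ}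

/-- The limit body is transported by the limit velocity. -/
lemma IsApproximation.exists_limit_flow (h : IsApproximation T Ω S₀ γ S ρ u ρ₀ S' ρ' u' ρ₀')
    (hT : 0 < T) (hΩm : MeasurableSet Ω) (hR : 0 < R) (hΩ : Ω ⊆ Metric.ball 0 R) (hm : 0 < m₀)
    (hS₀ : IsRegularDomain S₀) (hS₀Ω : S₀ ⊆ Ω) (hγ : 3 / 2 ≤ γ)
    (hm' : m₀ ≤ ∫ x, S₀.indicator ρ₀' x)
    (hY : ∀ n, IsFlowOf T Ω S₀ M m₀ K (S n) (ρ n) (u n) (ρ₀ n) (Y n)) :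
    ∃ Y' : ℝ → Aff, IsIsometryCurve Y' ∧ (∀ t ∈ Icc 0 T, S' t = act (Y' t) ⁻¹' S₀) ∧
      IsBddBody T Ω M m₀ ((swept S').indicator ρ') u' ∧
      ∀ η, IsTest T Ω η → ∫ z, (swept S').indicator (fun _ => (1 : ℝ)) z *
        fderiv ℝ η z (1, bodyVel T ((swept S').indicator ρ') u' z) ∂cyl T Ω = 0 := by
  have hΩt : volume Ω ≠ ⊤ := ((measure_mono hΩ).trans_lt measure_ball_lt_top).ne
  obtain ⟨k, Y', hk, hI', hpre, hlim, hσ, hb'⟩ :=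
    h.exists_subseq hT hΩm hΩt hS₀ hS₀Ω hγ hm' hY
  exact ⟨Y', hI', hpre, hb', fun η hη => (h.comp hk.tendsto_atTop).integral_fderiv_lim hΩm hR hΩ hm
    (fun n => (hY (k n)).bddBody) hb'
    (ae_eventually_mem_swept_iff hS₀ (fun n => (hY (k n)).eq_preimage) hI' hpre hlim) hσ hη⟩

/-- Strong convergence of the interpolations. -/
theorem IsApproximation.tendsto_eLpNorm_glue_sub
    (h : IsApproximation T Ω S₀ γ S ρ u ρ₀ S' ρ' u' ρ₀')
    (hT : 0 < T) (hΩm : MeasurableSet Ω) (hΩ : volume Ω ≠ ⊤) (hS₀ : IsRegularDomain S₀)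
    (hS₀Ω : S₀ ⊆ Ω) (hγ : 3 / 2 ≤ γ) (hm' : m₀ ≤ ∫ x, S₀.indicator ρ₀' x)
    (hY : ∀ n, IsFlowOf T Ω S₀ M m₀ K (S n) (ρ n) (u n) (ρ₀ n) (Y n))
    (hζ : ∀ n, IsCutoff S₀ c (ε n) (ζ n)) (hε : Tendsto ε atTop (𝓝 0))
    (hF : ContDiff ℝ ∞ φF) (hS : ContDiff ℝ ∞ φS) (hC : IsTestBound T Ω φF φS C)
    (hφ : φ =ᵐ[cyl T Ω] fun z =>
      φF z + (swept S').indicator (fun _ => (1 : ℝ)) z • (φS z - φF z)) {p : ℝ} (hp : 0 < p) :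
    Tendsto (fun n => eLpNorm (glue (S n) φF (interp (ζ n) (Y n) φF φS) - φ) (ENNReal.ofReal p)
      (cyl T Ω)) atTop (𝓝 0) := by
  -- The limit `φ` is prescribed, so a further subsequence of every subsequence suffices.
  refine tendsto_of_subseq_tendsto fun ns hns => ?_
  obtain ⟨k, -, -, hlim⟩ := (h.comp hns).exists_subseq_cutoff hT hΩm hΩ hS₀ hS₀Ω hγ hm'
    (fun n => hY (ns n)) (fun n => hζ (ns n)) (hε.comp hns)
  exact ⟨k, SlipBody.tendsto_eLpNorm_glue_sub hΩm hΩ (fun n => hY (ns (k n)))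
    (fun n => hζ (ns (k n))) hF hS hC h.body_lim.measurable hφ hlim hp⟩

/-- Weak convergence of the material derivatives of the interpolations. -/
theorem IsApproximation.weakTendstoL2Lp_interpDeriv
    (h : IsApproximation T Ω S₀ γ S ρ u ρ₀ S' ρ' u' ρ₀')
    (hT : 0 < T) (hΩm : MeasurableSet Ω) (hR : 0 < R) (hΩ : Ω ⊆ Metric.ball 0 R) (hm : 0 < m₀)
    (hS₀ : IsRegularDomain S₀) (hS₀Ω : S₀ ⊆ Ω) (hγ : 3 / 2 ≤ γ)
    (hm' : m₀ ≤ ∫ x, S₀.indicator ρ₀' x)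
    (hY : ∀ n, IsFlowOf T Ω S₀ M m₀ K (S n) (ρ n) (u n) (ρ₀ n) (Y n))
    (hb' : IsBddBody T Ω M m₀ ((swept S').indicator ρ') u')
    (hζ : ∀ n, IsCutoff S₀ c (ε n) (ζ n)) (hε : Tendsto ε atTop (𝓝 0))
    (hF : ContDiff ℝ ∞ φF) (hS : ContDiff ℝ ∞ φS) (hC : IsTestBound T Ω φF φS C)
    {p : ℝ} (hp : 1 ≤ p) :
    WeakTendstoL2Lp T Ω (ENNReal.ofReal p)
      (fun n z => blend (fun z => ζ n (act (Y n z.1) z.2)) φF φS z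
        (1, bodyVel T ((swept (S n)).indicator (ρ n)) (u n) z))
      (fun z => blend (fun z => 1 - (swept S').indicator (fun _ => (1 : ℝ)) z) φF φS z
        (1, bodyVel T ((swept S').indicator ρ') u' z)) := by
  have hΩt : volume Ω ≠ ⊤ := ((measure_mono hΩ).trans_lt measure_ball_lt_top).ne
  have hp0 : 0 < p := by linarith
  have hC0 : 0 ≤ 2 * C := by linarith [hC.nonneg]
  have hle : cyl T Ω ≤ cyl T univ :=
    Measure.restrict_mono (prod_mono Subset.rfl (subset_univ Ω)) le_rfl
  have hL : ∀ n, AEStronglyMeasurable (blend (fun z => ζ n (act (Y n z.1) z.2)) φF φS)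
      (cyl T Ω) := fun n => aestronglyMeasurable_blend ((hζ n).contDiff.continuous.comp
        (hY n).flow.isIsometryCurve.continuous_act').aestronglyMeasurable hF hS
  have hL' : AEStronglyMeasurable
      (blend (fun z => 1 - (swept S').indicator (fun _ => (1 : ℝ)) z) φF φS) (cyl T Ω) :=
    aestronglyMeasurable_blend (aestronglyMeasurable_const.sub
      (aestronglyMeasurable_const.indicator₀
        (h.body_lim.measurable.mono_ac hle.absolutelyContinuous))) hF hS
  have hLC : ∀ n, ∀ z : ℝ × E3, z.1 ∈ Ioo 0 T → z.2 ∈ Ω →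
      ‖blend (fun z => ζ n (act (Y n z.1) z.2)) φF φS z‖ ≤ 2 * C := fun n z h1 h2 =>
    norm_blend_le hC (fun z => (hζ n).mem_Icc _) h1 h2
  have hL'C : ∀ z : ℝ × E3, z.1 ∈ Ioo 0 T → z.2 ∈ Ω →
      ‖blend (fun z => 1 - (swept S').indicator (fun _ => (1 : ℝ)) z) φF φS z‖ ≤ 2 * C :=
    fun z h1 h2 => norm_blend_le hC (fun z => by
      by_cases hz : z ∈ swept S' <;> simp [hz]) h1 h2
  refine ⟨fun n => memL2Lp_clm (hY n).bddBody hΩm hR hΩ hm (hL n) hC0 (hLC n) hp0,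
    memL2Lp_clm hb' hΩm hR hΩ hm hL' hC0 hL'C hp0, fun g hg => ?_⟩
  refine tendsto_of_subseq_tendsto fun ns hns => ?_
  obtain ⟨k, hk, hσ, hlim⟩ := (h.comp hns).exists_subseq_cutoff hT hΩm hΩt hS₀ hS₀Ω hγ hm'
    (fun n => hY (ns n)) (fun n => hζ (ns n)) (hε.comp hns)
  obtain ⟨B, hB⟩ := h.velocity_bdd
  have hu := ((h.comp hns).comp hk.tendsto_atTop).velocity_tendsto
  -- The conjugate exponent is defined as `1` plus a nonnegative term.
  have hq : 1 ≤ ENNReal.conjExponent (ENNReal.ofReal p) := by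
    rw [ENNReal.conjExponent]
    exact le_self_add
  refine ⟨k, tendsto_integral_clm hΩm hR hΩ hm (fun n => (hY (ns (k n))).bddBody) hb' hσ hu
    (fun n => hB (ns (k n))) (fun n => hL (ns (k n))) hL' hC0 (fun n => ?_) ?_ hq hg⟩
  · filter_upwards [ae_mem_Ioo_cyl T Ω hΩm] with z hz using hLC _ z hz.1 hz.2
  · filter_upwards [ae_cyl_of_ae_cyl_univ hlim] with z hz
    exact tendsto_const_nhds.add (hz.smul_const _)

end

/-! ### Powers of the parameter -/

lemma ofReal_add_gradient_rate_le {a C c T δ Δ ϑ p : ℝ} (ha : 0 ≤ a) (hC : 0 ≤ C) (hT : 0 ≤ T)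
    (hc : 0 ≤ c) (hδ : 0 < δ) (hδΔ : δ ≤ Δ) (hϑ : 0 < ϑ) (hp : 1 ≤ p) :
    ENNReal.ofReal a
        + ENNReal.ofReal (C / δ ^ ϑ) * (ENNReal.ofReal T * ENNReal.ofReal (c * δ ^ ϑ)) ^ (1 / p)
      ≤ ENNReal.ofReal ((a * Δ ^ (ϑ * (1 - 1 / p)) + C * (T * c) ^ (1 / p)) *
        δ ^ (-(ϑ * (1 - 1 / p)))) := by
  have hp0 : 0 < p := by linarith
  have hs : 0 ≤ ϑ * (1 - 1 / p) := by
    have : 1 / p ≤ 1 := by rw [div_le_one hp0]; exact hp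
    exact mul_nonneg hϑ.le (by linarith)
  have hδϑ := Real.rpow_pos_of_pos hδ ϑ
  have hX : 0 ≤ (T * c) ^ (1 / p) := by positivity
  have hδp := Real.rpow_pos_of_pos hδ (ϑ / p)
  rw [ofReal_mul_rpow_layer hT hc hδ hp0, ← ENNReal.ofReal_add ha (by positivity)]
  refine ENNReal.ofReal_le_ofReal ?_
  have e1 : C / δ ^ ϑ * (T * c) ^ (1 / p) * δ ^ (ϑ / p)
      = C * (T * c) ^ (1 / p) * δ ^ (-(ϑ * (1 - 1 / p))) := by
    have : δ ^ (-(ϑ * (1 - 1 / p))) = δ ^ (ϑ / p) / δ ^ ϑ := by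
      rw [← Real.rpow_sub hδ]
      congr 1
      ring
    rw [this]
    field_simp
  -- The rate has a nonpositive exponent and `δ ≤ Δ`, so the bounded term is absorbed at the cost of
  -- a power of `Δ`.
  have e2 : 1 ≤ Δ ^ (ϑ * (1 - 1 / p)) * δ ^ (-(ϑ * (1 - 1 / p))) := by
    rw [Real.rpow_neg hδ.le, ← div_eq_mul_inv, one_le_div (Real.rpow_pos_of_pos hδ _)]
    exact Real.rpow_le_rpow hδ.le hδΔ hs
  rw [e1, add_mul, mul_assoc a]
  have := mul_le_mul_of_nonneg_left e2 ha
  linarith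

end SlipBody

end

theorem proposition5p1
    (Ω S₀ : Set E3) (hΩ : IsRegularDomain Ω) (hS₀ : IsRegularDomain S₀) (hS₀Ω : closure S₀ ⊆ Ω)
    (T : ℝ) (hT : 0 < T)
    (γ β θ r : ℝ) (hγ : 3 / 2 < γ) (hβ : max 8 γ ≤ β) (hθ : θ = 2 / 3 * γ - 1)
    (hr : r = max (β + 1) ((β + θ) / θ))
    (δ : ℕ → ℝ) (hδ : ∀ n, 0 < δ n) (hδ0 : Tendsto δ atTop (𝓝 0))
    (Sδ : ℕ → ℝ → Set E3) (ρδ : ℕ → ℝ × E3 → ℝ) (uδ : ℕ → ℝ × E3 → E3) (ρδ₀ : ℕ → E3 → ℝ)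
    (S : ℝ → Set E3) (ρ : ℝ × E3 → ℝ) (u : ℝ × E3 → E3) (ρ₀ : E3 → ℝ)
    (happrox : IsApproximation T Ω S₀ γ Sδ ρδ uδ ρδ₀ S ρ u ρ₀)
    (φ φF φS : ℝ × E3 → E3) (hφ : IsSlipTest T Ω S φ φF φS)
    (ϑ : ℝ) (hϑ : 0 < ϑ) :
    ∃ (φδ φSδ : ℕ → ℝ × E3 → E3) (Dφδ : ℕ → ℝ × E3 → (ℝ × E3 →L[ℝ] E3)) (dφ : ℝ × E3 → E3),
      -- the form of the approximations
      (∀ n, φδ n = glue (Sδ n) φF (φSδ n)) ∧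
      -- their regularity, without jump at the interface
      (∀ n, MemH1L2W1r T Ω (ENNReal.ofReal r) (φδ n) (Dφδ n)) ∧
      (∀ n, ∀ t ∈ Ioo 0 T, ContinuousOn (fun x => φδ n (t, x)) Ω) ∧
      -- `dφ = (∂_t + P_S u · ∇) φ`
      HasWeakMaterialDeriv T Ω (solidVelocity S ρ u) φ dφ ∧
      ∀ p : ℝ, 1 ≤ p →
        (∃ C : ℝ, ∀ n,
          eLpNorm ((swept (Sδ n)).indicator (φSδ n - φS)) (ENNReal.ofReal p) (cyl T Ω)
            ≤ ENNReal.ofReal (C * δ n ^ (ϑ / p))) ∧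
        Tendsto (fun n => eLpNorm (φδ n - φ) (ENNReal.ofReal p) (cyl T Ω)) atTop (𝓝 0) ∧
        (∃ C : ℝ, ∀ n,
          normLpW1p T Ω (ENNReal.ofReal p) (φδ n) (Dφδ n)
            ≤ ENNReal.ofReal (C * δ n ^ (-(ϑ * (1 - 1 / p))))) ∧
        (∃ C : ℝ, ∀ n,
          normL2Lp T Ω (ENNReal.ofReal p)
            ((swept (Sδ n)).indicator fun z =>
              (Dφδ n z - fderiv ℝ φS z) (1, solidVelocity (Sδ n) (ρδ n) (uδ n) z))
            ≤ ENNReal.ofReal (C * δ n ^ (ϑ / p))) ∧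
        WeakTendstoL2Lp T Ω (ENNReal.ofReal p)
          (fun n z => Dφδ n z (1, solidVelocity (Sδ n) (ρδ n) (uδ n) z)) dφ := by
  have hΩm := hΩ.1.measurableSet
  have hS₀Ω' : S₀ ⊆ Ω := subset_closure.trans hS₀Ω
  obtain ⟨R, M, m₀, K, Y, hR, hΩR, -, hm, hm', hY⟩ :=
    happrox.exists_flows hT hΩ hS₀ hS₀Ω' (by linarith)
  have hΩt : volume Ω ≠ ⊤ := ((measure_mono hΩR).trans_lt measure_ball_lt_top).ne
  obtain ⟨Y', hI', hpre, hb', hχ⟩ :=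
    happrox.exists_limit_flow hT hΩm hR hΩR hm hS₀ hS₀Ω' hγ.le hm' hY
  have hF := hφ.fluid.1
  have hS := hφ.solid.contDiff
  obtain ⟨C, hC⟩ := exists_isTestBound T hΩR hF hS
  have hC0 := hC.nonneg
  obtain ⟨c, hc, hcut⟩ := hS₀.exists_cutoff
  have hδϑ : ∀ n, 0 < δ n ^ ϑ := fun n => Real.rpow_pos_of_pos (hδ n) ϑ
  -- The layer has width proportional to `δ^ϑ`. The cut-offs are chosen before `p`, so the
  -- approximations do not depend on it.
  choose ζ h1 h2 h3 h4 h5 h6 using fun n => hcut (δ n ^ ϑ) (hδϑ n)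
  have hζ : ∀ n, IsCutoff S₀ c (δ n ^ ϑ) (ζ n) := fun n =>
    ⟨h1 n, h2 n, h3 n, h4 n, h5 n, h6 n⟩
  have hε : Tendsto (fun n => δ n ^ ϑ) atTop (𝓝 0) := by
    have := hδ0.rpow_const (p := ϑ) (Or.inr hϑ.le)
    rwa [Real.zero_rpow hϑ.ne'] at this
  obtain ⟨Δ, hΔ⟩ : ∃ Δ, ∀ n, δ n ≤ Δ := by
    obtain ⟨Δ, hΔ⟩ := hδ0.bddAbove_range
    exact ⟨Δ, fun n => hΔ ⟨n, rfl⟩⟩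
  have hvn : ∀ n (z : ℝ × E3), z.1 ∈ Ioo 0 T → solidVelocity (Sδ n) (ρδ n) (uδ n) z
      = bodyVel T ((swept (Sδ n)).indicator (ρδ n)) (uδ n) z := fun n z hz =>
    solidVelocity_eq (fun t ht => ((happrox.transported n).body.regular t ht).1) hz
  have hv : ∀ z : ℝ × E3, z.1 ∈ Ioo 0 T → solidVelocity S ρ u z
      = bodyVel T ((swept S).indicator ρ) u z := fun z hz =>
    solidVelocity_eq (fun t ht => (happrox.body_lim.regular t ht).1) hz
  have hmat : ∀ n (z : ℝ × E3), z.1 ∈ Ioo 0 T →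
      blend (fun z => ζ n (act (Y n z.1) z.2)) φF φS z
          (1, bodyVel T ((swept (Sδ n)).indicator (ρδ n)) (uδ n) z)
        = interpDeriv (ζ n) (Y n) (bodyVel T ((swept (Sδ n)).indicator (ρδ n)) (uδ n)) φF φS z
          (1, solidVelocity (Sδ n) (ρδ n) (uδ n) z) := fun n z hz => by
    rw [hvn n z hz, interpDeriv_apply_velocity']
  refine ⟨fun n => glue (Sδ n) φF (interp (ζ n) (Y n) φF φS), fun n => interp (ζ n) (Y n) φF φS,
    fun n => interpDeriv (ζ n) (Y n) (bodyVel T ((swept (Sδ n)).indicator (ρδ n)) (uδ n)) φF φS,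
    glueDeriv S (bodyVel T ((swept S).indicator ρ) u) φF φS, fun n => rfl,
    fun n => (hY n).memH1L2W1r hΩm hR hΩR hm (hδϑ n) (hζ n) hF hS hC _, fun n t ht => ?_,
    hφ.hasWeakMaterialDeriv hΩm hR hΩR hm hS₀ hI' hpre happrox.body_lim.measurable hb' hχ hv,
    fun p hp => ?_⟩
  · have hcont := continuous_interp (h1 n) (hY n).flow.isIsometryCurve hF hS
    -- The interpolation is continuous on all of space-time and coincides with the glued function at
    -- times in `[0, T]`.
    refine Continuous.continuousOn ((hcont.comp (Continuous.prodMk_right t)).congr fun x => ?_)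
    exact ((hY n).glue_eq_interp (hζ n) (Ioo_subset_Icc_self ht)).symm
  have hp0 : 0 < p := by linarith
  refine ⟨⟨C * (T * c) ^ (1 / p), fun n => ?_⟩, ?_, ?_, ?_, ?_⟩
  · rw [← ofReal_mul_rpow_layer hT.le hc (hδ n) hp0]
    exact (hY n).eLpNorm_diff_le hΩm hS₀.1 (hζ n) hC hp0
  · exact happrox.tendsto_eLpNorm_glue_sub hT hΩm hΩt hS₀ hS₀Ω' hγ.le hm' hY hζ hε hF hS hC
      (hφ.ae_eq hΩm hS₀ hI' hpre) hp0
  · have hcyl : cyl T Ω univ ^ (1 / p) ≠ ⊤ := by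
      rw [cyl, Measure.restrict_apply_univ]
      exact ENNReal.rpow_ne_top_of_nonneg (by positivity) (volume_cyl_lt_top T hΩt).ne
    refine ⟨4 * C * (cyl T Ω univ ^ (1 / p)).toReal * Δ ^ (ϑ * (1 - 1 / p))
      + C * (T * c) ^ (1 / p), fun n => ?_⟩
    refine ((hY n).normLpW1p_le hΩm hS₀.1 (hδϑ n) (hζ n) hC hp _).trans ?_
    rw [← ENNReal.ofReal_toReal hcyl, ← ENNReal.ofReal_mul (by positivity),
      ENNReal.toReal_ofReal ENNReal.toReal_nonneg]
    exact ofReal_add_gradient_rate_le (by positivity) hC0 hT.le hc (hδ n) (hΔ n) hϑ hp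
  · set W : ℝ≥0∞ := eLpNorm (fun _ : ℝ => (1 : ℝ)) 2 (volume.restrict (Ioo 0 T))
        + ((K + R.toNNReal * K : ℝ≥0) : ℝ≥0∞) with hW
    have hWt : W ≠ ⊤ := ENNReal.add_ne_top.2 ⟨(memLp_const (1 : ℝ)).2.ne, ENNReal.coe_ne_top⟩
    -- The layer is measured at fixed time here, so the rate lemma is used with `T = 1`; `W` bounds
    -- the `L²` norm in time of `1 + |V|` uniformly in `n`.
    refine ⟨C * (1 * c) ^ (1 / p) * W.toReal, fun n => ?_⟩
    have e1 : normL2Lp T Ω (ENNReal.ofReal p) ((swept (Sδ n)).indicator fun z =>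
          (interpDeriv (ζ n) (Y n) (bodyVel T ((swept (Sδ n)).indicator (ρδ n)) (uδ n)) φF φS z
            - fderiv ℝ φS z) (1, solidVelocity (Sδ n) (ρδ n) (uδ n) z))
        = normL2Lp T Ω (ENNReal.ofReal p) ((swept (Sδ n)).indicator fun z =>
          (interpDeriv (ζ n) (Y n) (bodyVel T ((swept (Sδ n)).indicator (ρδ n)) (uδ n)) φF φS z
            - fderiv ℝ φS z) (1, bodyVel T ((swept (Sδ n)).indicator (ρδ n)) (uδ n) z)) := by
      refine normL2Lp_congr fun z hz => ?_
      simp only [indicator, hvn n z hz]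
    refine e1.le.trans (((hY n).normL2Lp_layer_le hΩm hR hΩR hS₀.1 (hζ n) hC hp0).trans ?_)
    refine (mul_le_mul_right ((hY n).eLpNorm_one_add_velBound_le hR.le) _).trans (le_of_eq ?_)
    have e2 := ofReal_mul_rpow_layer (C := C) (ϑ := ϑ) zero_le_one hc (hδ n) hp0
    rw [ENNReal.ofReal_one, one_mul] at e2
    rw [e2, ← hW, ← ENNReal.ofReal_toReal hWt, ← ENNReal.ofReal_mul' ENNReal.toReal_nonneg,
      ENNReal.toReal_ofReal ENNReal.toReal_nonneg]
    congr 1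
    ring
  · obtain ⟨hw1, hw2, hw3⟩ := happrox.weakTendstoL2Lp_interpDeriv hT hΩm hR hΩR hm hS₀ hS₀Ω' hγ.le
      hm' hY hb' hζ hε hF hS hC hp
    simp only [← glueDeriv_eq] at hw2 hw3
    refine ⟨fun n => (hw1 n).congr hΩm (hmat n), hw2, fun g hg => (hw3 g hg).congr fun n => ?_⟩
    refine integral_congr_ae ?_
    filter_upwards [ae_mem_Ioo_cyl T Ω hΩm] with z hz
    rw [hmat n z hz.1]
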